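/- **Notation.** Let $N\ge 2$. Fix a real radial $\varphi\in\mathcal S(\mathbb R^N)$ supported in $\{3/4\le|\xi|\le 8/3\}$ with $\sum_{j\in\mathbb Z}\varphi(2^{-j}\xi)=1$ for $\xi\ne0$, and put $\dot\Delta_k=\varphi(2^{-k}D)$, $D=-i\nabla$. For a tempered distribution $f$ on $\mathbb R^N$ (with values in $\mathbb C^N$) and for $f=f(t)$, $t\in(0,T)$, put $$\|f\|_{\dot B^s_{2,1}}=\sum_{k\in\mathbb Z}2^{ks}\|\dot\Delta_kf\|_{L^2},\qquad \|f\|_{L^\rho_T(\dot B^s_{2,1})}=\big\|\,\|f(\cdot)\|_{\dot B^s_{2,1}}\big\|_{L^\rho(0,T)},\qquad \|f\|_{\tilde L^\infty_T(\dot B^s_{2,1})}=\sum_{k\in\mathbb Z}2^{ks}\|\dot\Delta_kf\|_{L^\infty(0,T;L^2)}.$$ These norms do not see polynomials: Besov spaces are spaces of classes in $\mathcal S'/\mathcal P$, $\mathcal P$ being the space of polynomials. So that products make sense, the representatives of ${\bf u}(t)$ and ${\bf d}(t)$ in $\mathcal S'$ are chosen, for almost every $t$, such that $\nabla{\bf u}=\sum_k\dot\Delta_k\nabla{\bf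 u}$ and $\nabla{\bf d}=\sum_k\dot\Delta_k\nabla{\bf d}$ in $\mathcal S'$ (this fixes them up to additive constants). The product ${\bf u}\cdot\nabla{\bf d}=\sum_j u_j\partial_j{\bf d}$ is the limit in $\mathcal S'$ of $(\psi_n*{\bf u})\cdot\nabla(\psi_n*{\bf d})$, where $\psi_n=2^{nN}\psi(2^n\cdot)$, for every $\psi\in\mathcal S(\mathbb R^N)$ with $\int\psi=1$. **Proposition 3.2.** Let $s\in(-\frac N2,1+\frac N2)$. There is a constant $C>0$ depending only on $N$ and $s$ (and on the fixed function $\varphi$) such that the following holds for all $\theta>0$ and $T\in(0,\infty]$. Let ${\bf u}$ be a real vector field in $L^1_T(\dot B^{N/2+1}_{2,1})\cap L^1_{\rm loc}([0,T);\mathcal S')$, let $\mathcal M\in L^1_T(\dot B^s_{2,1})$, and let ${\bf d}\in L^\infty_{\rm loc}([0,T);\dot B^s_{2,1})$ be a (weakly measurable) solution of $$\partial_t{\bf d}+{\bf u}\cdot\nabla{\bf d}-\theta\Delta{\bf d}=\mathcal M,\qquad {\bf d}|_{t=0}={\bf d}_0,$$ on $[0,T)$ in the sense of distributions with values in $\mathcal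 S'/\mathcal P$, that is, for every $\eta\in\mathcal S(\mathbb R^N)$ orthogonal to all polynomials and almost every $t\in(0,T)$, $$\langle{\bf d}(t),\eta\rangle+\int_0^t\langle{\bf u}\cdot\nabla{\bf d},\eta\rangle\,d\tau-\theta\int_0^t\langle\Delta{\bf d},\eta\rangle\,d\tau=\langle{\bf d}_0,\eta\rangle+\int_0^t\langle\mathcal M,\eta\rangle\,d\tau .$$ Then for every $t\in[0,T)$ $$\|{\bf d}\|_{\tilde L^\infty_t(\dot B^s_{2,1})}+\theta\|{\bf d}\|_{L^1_t(\dot B^{s+2}_{2,1})}\le C\exp\Big(C\|{\bf u}\|_{L^1_t(\dot B^{N/2+1}_{2,1})}\Big)\Big(\|{\bf d}_0\|_{\dot B^s_{2,1}}+\|\mathcal M\|_{L^1_t(\dot B^s_{2,1})}\Big).$$ -/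

import Mathlib

open MeasureTheory Filter Topology FourierTransform
open scoped ENNReal SchwartzMap LineDeriv Laplacian

noncomputable section

namespace LiquidCrystal

/-- The physical space `ℝ^N` with its Euclidean norm. -/
abbrev Space (N : ℕ) : Type := EuclideanSpace ℝ (Fin N)

/-- The target of the vector fields; real vector fields are those satisfying `IsReal` below. -/
abbrev Vec (N : ℕ) : Type := EuclideanSpace ℂ (Fin N)

/-- The `j`-th vector of the canonical basis of `ℝ^N`. -/
abbrev basisVec {N : ℕ} (j : Fin N) : Space N := EuclideanSpace.single j (1 : ℝ)

/-! ### Littlewood-Paley decomposition and Besov norms -/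

/-- `φ` is a radial Schwartz function supported in the annulus `3/4 ≤ |ξ| ≤ 8/3` whose dyadic
dilates sum to `1` away from the origin. -/
structure IsDyadicPartition {N : ℕ} (φ : 𝓢(Space N, ℝ)) : Prop where
  radial : ∀ ξ η : Space N, ‖ξ‖ = ‖η‖ → φ ξ = φ η
  supported : ∀ ξ : Space N, φ ξ ≠ 0 → 3 / 4 ≤ ‖ξ‖ ∧ ‖ξ‖ ≤ 8 / 3
  sum_eq_one : ∀ ξ : Space N, ξ ≠ 0 → HasSum (fun j : ℤ => φ ((2 : ℝ) ^ (-j) • ξ)) 1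

/-- The homogeneous dyadic block `φ(2^{-k} D)`, `D = -i∇`. The factor `2π` comes from Mathlib's
normalisation of the Fourier transform, in which `D` has symbol `2πξ`. -/
def dyadicBlock {N : ℕ} (φ : 𝓢(Space N, ℝ)) (k : ℤ) :
    𝓢'(Space N, Vec N) →L[ℂ] 𝓢'(Space N, Vec N) :=
  TemperedDistribution.fourierMultiplierCLM (Vec N)
    (fun ξ => ((φ ((2 * Real.pi * (2 : ℝ) ^ (-k)) • ξ) : ℝ) : ℂ))

/-- The `L^p` norm of a tempered distribution; it is `∞` if the distribution is not given by an
`L^p` function. -/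
def distLpNorm {N : ℕ} (p : ℝ≥0∞) [Fact (1 ≤ p)] (f : 𝓢'(Space N, Vec N)) : ℝ≥0∞ :=
  ⨅ (g : Lp (Vec N) p (volume : Measure (Space N)))
    (_ : Lp.toTemperedDistribution g = f), ‖g‖ₑ

/-- The homogeneous Besov norm `‖f‖_{Ḃ^s_{p,r}} = ‖ (2^{ks} ‖Δ_k f‖_{L^p})_k ‖_{ℓ^r(ℤ)}`. It does
not see polynomials, so it is a function on tempered distributions modulo polynomials. -/
def besovNorm {N : ℕ} (φ : 𝓢(Space N, ℝ)) (s : ℝ) (p : ℝ≥0∞) [Fact (1 ≤ p)] (r : ℝ≥0∞)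
    (f : 𝓢'(Space N, Vec N)) : ℝ≥0∞ :=
  eLpNorm (fun k : ℤ => ENNReal.ofReal ((2 : ℝ) ^ ((k : ℝ) * s)) *
    distLpNorm p (dyadicBlock φ k f)) r Measure.count

/-- The time interval `(0, T)`, `0 ≤ T ≤ ∞`. -/
def timeInterval (T : ℝ≥0∞) : Set ℝ := {τ | 0 < τ ∧ ENNReal.ofReal τ < T}

/-- The norm of `L^ρ_T(Ḃ^s_{p,r}) = L^ρ(0,T; Ḃ^s_{p,r})`. -/
def timeBesovNorm {N : ℕ} (φ : 𝓢(Space N, ℝ)) (T ρ : ℝ≥0∞) (s : ℝ) (p : ℝ≥0∞) [Fact (1 ≤ p)]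
    (r : ℝ≥0∞) (f : ℝ → 𝓢'(Space N, Vec N)) : ℝ≥0∞ :=
  eLpNorm (fun τ => besovNorm φ s p r (f τ)) ρ (volume.restrict (timeInterval T))

/-- The norm of the Chemin-Lerner space `L̃^ρ_T(Ḃ^s_{p,r})`: the time norm is taken inside the
dyadic summation. -/
def cheminLernerNorm {N : ℕ} (φ : 𝓢(Space N, ℝ)) (T ρ : ℝ≥0∞) (s : ℝ) (p : ℝ≥0∞) [Fact (1 ≤ p)]
    (r : ℝ≥0∞) (f : ℝ → 𝓢'(Space N, Vec N)) : ℝ≥0∞ :=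
  eLpNorm (fun k : ℤ => ENNReal.ofReal ((2 : ℝ) ^ ((k : ℝ) * s)) *
    eLpNorm (fun τ => distLpNorm p (dyadicBlock φ k (f τ))) ρ
      (volume.restrict (timeInterval T))) r Measure.count

/-! ### Distributions modulo polynomials -/

/-- Schwartz functions orthogonal to all polynomials: the predual of `𝓢'/𝒫`. Two tempered
distributions agree modulo polynomials iff they agree on these test functions. -/
def AnnihilatesPolynomials {N : ℕ} (η : 𝓢(Space N, ℂ)) : Prop :=
  ∀ P : MvPolynomial (Fin N) ℂ,
    ∫ x : Space N, MvPolynomial.eval (fun i => ((x i : ℝ) : ℂ)) P * η x = 0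

/-- The formal identity `f = ∑_k Δ_k f` holds in `𝓢'` (not only modulo polynomials). -/
def EqSumBlocks {N : ℕ} (φ : 𝓢(Space N, ℝ)) (f : 𝓢'(Space N, Vec N)) : Prop :=
  ∀ η : 𝓢(Space N, ℂ),
    Tendsto (fun n : ℕ => ∑ k ∈ Finset.Icc (-(n : ℤ)) n, dyadicBlock φ k f η) atTop (𝓝 (f η))

/-- The tempered distribution `f` is normalised modulo polynomials so that `∇f = ∑_k Δ_k ∇f` in
`𝓢'`; this determines `f` in its class modulo polynomials up to an additive constant. -/
def HasNormalizedGradient {N : ℕ} (φ : 𝓢(Space N, ℝ)) (f : 𝓢'(Space N, Vec N)) : Prop :=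
  ∀ j : Fin N, EqSumBlocks φ (∂_{basisVec j} f)

/-- `f` is a real vector-valued distribution. -/
def IsReal {N : ℕ} (f : 𝓢'(Space N, Vec N)) : Prop :=
  ∀ η : 𝓢(Space N, ℂ), (∀ x, (η x).im = 0) → ∀ j : Fin N, ((f η) j).im = 0

/-! ### The product `u · ∇d` -/

/-- The Schwartz function `y ↦ 2^{nN} ψ(2^n (x - y))`. -/
def mollifierKernel {N : ℕ} (ψ : 𝓢(Space N, ℂ)) (n : ℕ) (x : Space N) : 𝓢(Space N, ℂ) :=
  ((2 : ℂ) ^ (n * N)) •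
    (SchwartzMap.compCLMOfContinuousLinearEquiv ℂ
      (ContinuousLinearEquiv.smulLeft (M₁ := Space N) (R₁ := ℝ)
        (Units.mk0 (-(2 : ℝ) ^ n) (by simp))) ψ).compSubConstCLM ℂ x

theorem mollifierKernel_apply {N : ℕ} (ψ : 𝓢(Space N, ℂ)) (n : ℕ) (x y : Space N) :
    mollifierKernel ψ n x y = (2 : ℂ) ^ (n * N) * ψ ((2 : ℝ) ^ n • (x - y)) := by
  have h : (-(2 : ℝ) ^ n) • (y - x) = (2 : ℝ) ^ n • (x - y) := by
    rw [neg_smul, ← smul_neg, neg_sub]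
  rw [← h]
  rfl

/-- The regularisation `ψ_n * f`, `ψ_n = 2^{nN} ψ(2^n ·)`, of a tempered distribution; it is a
smooth function of polynomial growth. -/
def mollify {N : ℕ} (ψ : 𝓢(Space N, ℂ)) (n : ℕ) (f : 𝓢'(Space N, Vec N)) (x : Space N) : Vec N :=
  f (mollifierKernel ψ n x)

/-- The tempered distribution `g` is the product `u · ∇d = ∑_j u_j ∂_j d`, defined by
regularisation: `(ψ_n * u) · ∇(ψ_n * d) → g` in `𝓢'` for every mollifier `ψ`. -/
def IsAdvection {N : ℕ} (u d g : 𝓢'(Space N, Vec N)) : Prop :=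
  ∀ ψ : 𝓢(Space N, ℂ), ∫ x, ψ x = 1 → ∀ η : 𝓢(Space N, ℂ),
    Tendsto (fun n : ℕ => ∫ x, η x •
      ∑ j : Fin N, (mollify ψ n u x) j • mollify ψ n (∂_{basisVec j} d) x) atTop (𝓝 (g η))

/-! ### Weak solutions -/

/-- `d` is a solution on `[0, T)` of `∂_t d + u · ∇d - θ Δd = M`, `d|_{t=0} = d₀`, in the sense of
distributions with values in `𝓢'/𝒫`: the equation is tested against the predual of `𝓢'/𝒫` and is
written in the form integrated in time. -/
def IsSolution {N : ℕ} (θ : ℝ) (T : ℝ≥0∞) (u d M : ℝ → 𝓢'(Space N, Vec N))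
    (d₀ : 𝓢'(Space N, Vec N)) : Prop :=
  ∃ g : ℝ → 𝓢'(Space N, Vec N),
    (∀ᵐ τ ∂(volume.restrict (timeInterval T)), IsAdvection (u τ) (d τ) (g τ)) ∧
    ∀ η : 𝓢(Space N, ℂ), AnnihilatesPolynomials η →
      (∀ t : ℝ≥0∞, t < T →
        IntegrableOn (fun τ => g τ η) (timeInterval t) ∧
        IntegrableOn (fun τ => (Δ (d τ)) η) (timeInterval t) ∧
        IntegrableOn (fun τ => M τ η) (timeInterval t)) ∧
      ∀ᵐ t ∂(volume.restrict (timeInterval T)),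
        d t η + (∫ τ in (0 : ℝ)..t, g τ η) - (θ : ℂ) • (∫ τ in (0 : ℝ)..t, (Δ (d τ)) η)
          = d₀ η + (∫ τ in (0 : ℝ)..t, M τ η)

/-- `f : (0,T) → 𝓢'` is weakly measurable. -/
def WeaklyMeasurable {N : ℕ} (T : ℝ≥0∞) (f : ℝ → 𝓢'(Space N, Vec N)) : Prop :=
  ∀ η : 𝓢(Space N, ℂ), AEStronglyMeasurable (fun τ => f τ η) (volume.restrict (timeInterval T))

/-- `f ∈ L¹_loc([0,T); 𝓢')`. -/
def WeaklyLocallyIntegrable {N : ℕ} (T : ℝ≥0∞) (f : ℝ → 𝓢'(Space N, Vec N)) : Prop :=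
  ∀ η : 𝓢(Space N, ℂ), ∀ t : ℝ≥0∞, t < T → IntegrableOn (fun τ => f τ η) (timeInterval t)

end LiquidCrystal

end

/-!
The estimate is proved for one dyadic block at a time, by the energy method, and summed over the
blocks with a commutator estimate.

A block `Δ_k f` is the smooth function `x ↦ f (kernelAt (blockSym φ k) x)`, the action of the
distribution on a translate of the kernel of the multiplier. These kernels annihilate polynomials
(`annihilatesPolynomials_kernelAt_blockSym`), so the equation modulo polynomials can be tested
against them, and for every `x` it becomes an integral equation in time for `Δ_k d (x)`:
`∂_t Δ_k d + u · ∇Δ_k d - θ Δ Δ_k d = Δ_k M - R_k`, with the commutator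
`R_k = Δ_k (u · ∇d) - u · ∇Δ_k d`. That the norm of a block is the `L²` norm of this function
(`distLpNorm_dyadicBlock`) rests on the fact that a tempered distribution commutes with
superpositions of translates of a Schwartz function (`apply_kernelAt_symMul`).

The commutator satisfies `∑ 2^{ks} ‖R_k‖ ≤ C ‖u‖ ‖d‖`, with the norms of `Ḃ^{N/2+1}_{2,1}` and
`Ḃ^s_{2,1}` (`exists_advComm_bound`). For a block of `u` of index `j` and a block of `d` of index `l`
(`exists_comm_bound`) there are three regimes. If `j` is much smaller than `l`, only `k` close to `l`
matter, and the commutator with a Lipschitz function gains the derivative that falls on `d`. If `j`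
is much larger than `l`, only `k` close to `j` and to `l` matter, and `s < 1 + N/2` is used. If they
are comparable, all `k` up to `j` matter, and the sum is geometric with ratio `2^{s + N/2}`, so that
`s > -N/2` is used. The double sum converges to the commutator because the product `u · ∇d` is the
limit of the products of the low-frequency cut-offs `S_n u` and `S_n ∇d`, mollification by the kernel
of `S_0` at the scale `2^{-n}` being `S_n`. The normalisation of the gradients ensures that these
cut-offs are sums of blocks, up to constants, and that `u` is a Lipschitz function.

In the energy estimate for `Δ_k d` the velocity grows at most linearly, so the energy is localised
by a cut-off at the scale `R`. The transport term costs only the Lipschitz constant of `u`, and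
`O(1/R)` for its value at the origin (`integral_cutoff_mul_inner_blkRhs_le`); the Laplacian is
coercive on functions with spectrum in the annulus (`exists_coercive`). The resulting inequality for
the square of the norm is divided by the norm through `√(E + ε²)`, as `R → ∞` and `ε → 0`
(`ae_add_integral_le_of_energy`), which gives
`‖Δ_k d(t)‖ + cθ 4^k ∫₀ᵗ ‖Δ_k d‖ ≤ ‖Δ_k d₀‖ + ∫₀ᵗ (‖Δ_k M‖ + ‖R_k‖ + C ‖u‖ ‖Δ_k d‖)`.

Multiplied by `2^{ks}` and summed over `k`, this is a Grönwall inequality for `‖d(t)‖`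
(`add_integral_le_mul_exp`). Its outcome bounds the right-hand sides uniformly in time, before the
supremum in time is taken, hence also the Chemin-Lerner norm and the diffusion term
(`exists_besovSum_bound`).
-/

noncomputable section

namespace LiquidCrystal

/-! ### Translations of Schwartz functions -/

section Translation

variable {N : ℕ}

theorem lineDerivOp_comm_schwartz (b : 𝓢(Space N, ℂ)) (v w : Space N) :
    ∂_{v} (∂_{w} b) = ∂_{w} (∂_{v} b) := by
  ext x
  have h1 : ∀ v w : Space N, ∂_{v} (∂_{w} b) x = fderiv ℝ (fderiv ℝ b) x v w := by
    intro v w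
    rw [SchwartzMap.lineDerivOp_apply_eq_fderiv]
    have : (⇑(∂_{w} b : 𝓢(Space N, ℂ)) : Space N → ℂ) = fun z => fderiv ℝ b z w := by
      ext z; exact SchwartzMap.lineDerivOp_apply_eq_fderiv w b z
    rw [this, fderiv_clm_apply (((b.smooth 2).fderiv_right (m := 1) (by norm_num)).differentiable
      (by norm_num)).differentiableAt (by fun_prop)]
    simp
  rw [h1, h1]
  exact ((b.contDiffAt 2).isSymmSndFDerivAt (by simp)).eq v w

theorem iteratedLineDerivOp_lineDerivOp_comm (b : 𝓢(Space N, ℂ)) (v : Space N) {n : ℕ}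
    (m : Fin n → Space N) : ∂^{m} (∂_{v} b) = ∂_{v} (∂^{m} b) := by
  induction n with
  | zero => simp
  | succ n ih =>
    rw [LineDeriv.iteratedLineDerivOp_succ_left, ih, LineDeriv.iteratedLineDerivOp_succ_left,
      lineDerivOp_comm_schwartz]

theorem iteratedFDeriv_lineDerivOp (b : 𝓢(Space N, ℂ)) (v : Space N) (n : ℕ) (y : Space N) :
    iteratedFDeriv ℝ n (∂_{v} b : 𝓢(Space N, ℂ)) y = fderiv ℝ (iteratedFDeriv ℝ n b) y v := by
  have hd : DifferentiableAt ℝ (iteratedFDeriv ℝ n b) y :=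
    ((b.smooth ⊤).differentiable_iteratedFDeriv (m := n)
      (by exact_mod_cast ENat.natCast_lt_top n)).differentiableAt
  ext m
  rw [← SchwartzMap.iteratedLineDerivOp_eq_iteratedFDeriv, iteratedLineDerivOp_lineDerivOp_comm,
    SchwartzMap.lineDerivOp_apply_eq_fderiv]
  have : (⇑(∂^{m} b : 𝓢(Space N, ℂ)) : Space N → ℂ) = fun z => iteratedFDeriv ℝ n b z m := by
    ext z; exact SchwartzMap.iteratedLineDerivOp_eq_iteratedFDeriv
  rw [this, fderiv_continuousMultilinear_apply_const hd]
  rfl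

/-- The second order Taylor remainder of the translations of a Schwartz function. -/
theorem seminorm_translate_sub_le (b : 𝓢(Space N, ℂ)) (v : Space N) (k n : ℕ) :
    ∃ C : ℝ, 0 ≤ C ∧ ∀ h : ℝ, |h| ≤ 1 →
      SchwartzMap.seminorm ℂ k n
        (b.compSubConstCLM ℂ (h • v) - b + h • (∂_{v} b)) ≤ C * h ^ 2 := by
  set c : 𝓢(Space N, ℂ) := ∂_{v} (∂_{v} b) with hc
  refine ⟨2 ^ k * (SchwartzMap.seminorm ℂ k n c + ‖v‖ ^ k * SchwartzMap.seminorm ℂ 0 n c),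
    by positivity, fun h hh => SchwartzMap.seminorm_le_bound ℂ k n _ (by positivity) fun y => ?_⟩
  set A := 2 ^ k * (SchwartzMap.seminorm ℂ k n c + ‖v‖ ^ k * SchwartzMap.seminorm ℂ 0 n c)
  have hA : 0 ≤ A := by positivity
  have hdiff : ∀ (g : 𝓢(Space N, ℂ)) (z : Space N), HasFDerivAt (iteratedFDeriv ℝ n g)
      (fderiv ℝ (iteratedFDeriv ℝ n g) z) z := fun g z =>
    ((g.smooth ⊤).differentiable_iteratedFDeriv (m := n)
      (by exact_mod_cast ENat.natCast_lt_top n)).differentiableAt.hasFDerivAt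
  -- the derivatives of `t ↦ Dⁿ b (y - t v)`
  have hG : ∀ (g : 𝓢(Space N, ℂ)) (t : ℝ), HasDerivAt (fun t : ℝ => iteratedFDeriv ℝ n g (y - t • v))
      (-iteratedFDeriv ℝ n (∂_{v} g : 𝓢(Space N, ℂ)) (y - t • v)) t := by
    intro g t
    have h1 : HasDerivAt (fun t : ℝ => y - t • v) (-v) t := by
      simpa using ((hasDerivAt_id t).smul_const v).const_sub y
    have := (hdiff g (y - t • v)).comp_hasDerivAt t h1
    rw [map_neg, ← iteratedFDeriv_lineDerivOp] at this
    exact this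
  have hbound : ∀ t : ℝ, |t| ≤ 1 → ‖y‖ ^ k * ‖iteratedFDeriv ℝ n c (y - t • v)‖ ≤ A := by
    intro t ht
    have h1 : ‖y‖ ≤ ‖y - t • v‖ + ‖v‖ := by
      calc ‖y‖ = ‖(y - t • v) + t • v‖ := by simp
        _ ≤ ‖y - t • v‖ + ‖t • v‖ := norm_add_le _ _
        _ ≤ ‖y - t • v‖ + ‖v‖ := by
          gcongr; rw [norm_smul, Real.norm_eq_abs]
          exact mul_le_of_le_one_left (norm_nonneg _) ht
    have h2 : ‖y‖ ^ k ≤ 2 ^ k * (‖y - t • v‖ ^ k + ‖v‖ ^ k) := by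
      calc ‖y‖ ^ k ≤ (‖y - t • v‖ + ‖v‖) ^ k := by gcongr
        _ ≤ 2 ^ (k - 1) * (‖y - t • v‖ ^ k + ‖v‖ ^ k) :=
          add_pow_le (norm_nonneg _) (norm_nonneg _) k
        _ ≤ 2 ^ k * (‖y - t • v‖ ^ k + ‖v‖ ^ k) := by
          gcongr
          · norm_num
          · omega
    have h3 := SchwartzMap.le_seminorm ℂ k n c (y - t • v)
    have h4 := SchwartzMap.le_seminorm ℂ 0 n c (y - t • v)
    rw [pow_zero, one_mul] at h4
    calc ‖y‖ ^ k * ‖iteratedFDeriv ℝ n c (y - t • v)‖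
        ≤ (2 ^ k * (‖y - t • v‖ ^ k + ‖v‖ ^ k)) * ‖iteratedFDeriv ℝ n c (y - t • v)‖ := by gcongr
      _ = 2 ^ k * (‖y - t • v‖ ^ k * ‖iteratedFDeriv ℝ n c (y - t • v)‖ +
            ‖v‖ ^ k * ‖iteratedFDeriv ℝ n c (y - t • v)‖) := by ring
      _ ≤ A := by simp only [A]; gcongr
  -- derivative of the remainder
  set R : ℝ → (Space N [×n]→L[ℝ] ℂ) := fun t =>
    iteratedFDeriv ℝ n b (y - t • v) - iteratedFDeriv ℝ n b y +
      t • iteratedFDeriv ℝ n (∂_{v} b : 𝓢(Space N, ℂ)) y with hR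
  have hRd : ∀ t, HasDerivAt R (-iteratedFDeriv ℝ n (∂_{v} b : 𝓢(Space N, ℂ)) (y - t • v) +
      iteratedFDeriv ℝ n (∂_{v} b : 𝓢(Space N, ℂ)) y) t := by
    intro t
    exact (((hG b t).sub_const (iteratedFDeriv ℝ n b y)).fun_add
      ((hasDerivAt_id t).smul_const (iteratedFDeriv ℝ n (∂_{v} b : 𝓢(Space N, ℂ)) y))).congr_deriv
      (by simp)
  rcases (pow_nonneg (norm_nonneg y) k).eq_or_lt with hP | hP
  · rw [← hP, zero_mul]; positivity
  have hR'b : ∀ t, |t| ≤ 1 → ‖-iteratedFDeriv ℝ n (∂_{v} b : 𝓢(Space N, ℂ)) (y - t • v) +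
      iteratedFDeriv ℝ n (∂_{v} b : 𝓢(Space N, ℂ)) y‖ ≤ A / ‖y‖ ^ k * |t| := by
    intro t ht
    have := (convex_Icc (-1 : ℝ) 1).norm_image_sub_le_of_norm_hasDerivWithin_le
      (C := A / ‖y‖ ^ k) (x := t) (y := 0) (fun s _ => (hG (∂_{v} b) s).hasDerivWithinAt)
      (fun s hs => by
        rw [norm_neg, le_div_iff₀' hP]
        exact hbound s (abs_le.2 hs)) (abs_le.1 ht) (by constructor <;> norm_num)
    simpa [neg_add_eq_sub] using this
  have hmain := (convex_Icc (-|h|) |h|).norm_image_sub_le_of_norm_hasDerivWithin_le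
      (C := A / ‖y‖ ^ k * |h|) (x := 0) (y := h) (fun s _ => (hRd s).hasDerivWithinAt)
      (fun s hs => by
        have hs' := abs_le.2 hs
        exact (hR'b s (hs'.trans hh)).trans (by gcongr))
      (by constructor <;> simp) (abs_le.1 le_rfl)
  have hR0 : R 0 = 0 := by simp [hR]
  rw [hR0, sub_zero, sub_zero] at hmain
  have hfin : iteratedFDeriv ℝ n
      (b.compSubConstCLM ℂ (h • v) - b + h • (∂_{v} b) : 𝓢(Space N, ℂ)) y = R h := by
    have e : (⇑(b.compSubConstCLM ℂ (h • v) - b + h • (∂_{v} b) : 𝓢(Space N, ℂ)) : Space N → ℂ)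
        = ((fun z => b (z - h • v)) - ⇑b) + h • ⇑(∂_{v} b : 𝓢(Space N, ℂ)) := rfl
    have c1 : ContDiffAt ℝ n (fun z => b (z - h • v)) y :=
      ((b.smooth n).comp (contDiff_id.sub contDiff_const)).contDiffAt
    have c2 : ContDiffAt ℝ n b y := b.contDiffAt n
    have c3 : ContDiffAt ℝ n (∂_{v} b : 𝓢(Space N, ℂ)) y := (∂_{v} b : 𝓢(Space N, ℂ)).contDiffAt n
    have c4 : ContDiffAt ℝ n ((fun z => b (z - h • v)) - ⇑b) y := c1.sub c2
    have c5 : ContDiffAt ℝ n (h • ⇑(∂_{v} b : 𝓢(Space N, ℂ))) y := c3.const_smul h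
    rw [e, iteratedFDeriv_add_apply c4 c5, iteratedFDeriv_sub_apply c1 c2,
      iteratedFDeriv_const_smul_apply c3, iteratedFDeriv_comp_sub]
  rw [hfin]
  calc ‖y‖ ^ k * ‖R h‖ ≤ ‖y‖ ^ k * (A / ‖y‖ ^ k * |h| * ‖h‖) := by gcongr
    _ = A * h ^ 2 := by
      rw [Real.norm_eq_abs, mul_assoc, abs_mul_abs_self, ← sq, ← mul_assoc, mul_div_cancel₀ _ hP.ne']

/-- Translations act continuously on Schwartz functions, with a first order modulus. -/
theorem seminorm_translate_sub_self_le (b : 𝓢(Space N, ℂ)) (k n : ℕ) :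
    ∃ C : ℝ, 0 ≤ C ∧ ∀ w : Space N, ‖w‖ ≤ 1 →
      SchwartzMap.seminorm ℂ k n (b.compSubConstCLM ℂ w - b) ≤ C * ‖w‖ := by
  refine ⟨2 ^ k * (SchwartzMap.seminorm ℂ k (n + 1) b + SchwartzMap.seminorm ℂ 0 (n + 1) b),
    by positivity, fun w hw => SchwartzMap.seminorm_le_bound ℂ k n _ (by positivity) fun y => ?_⟩
  set A := 2 ^ k * (SchwartzMap.seminorm ℂ k (n + 1) b + SchwartzMap.seminorm ℂ 0 (n + 1) b)
  rcases (pow_nonneg (norm_nonneg y) k).eq_or_lt with hP | hP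
  · rw [← hP, zero_mul]; positivity
  have hbound : ∀ z ∈ segment ℝ y (y - w),
      ‖fderiv ℝ (iteratedFDeriv ℝ n b) z‖ ≤ A / ‖y‖ ^ k := by
    intro z hz
    have hzy : ‖z - y‖ ≤ 1 := by
      obtain ⟨s, hs, rfl⟩ := (segment_eq_image' ℝ y (y - w)) ▸ hz
      simp only [add_sub_cancel_left, norm_smul, Real.norm_eq_abs, sub_sub_cancel_left, norm_neg]
      rw [abs_of_nonneg hs.1]
      nlinarith [hs.1, hs.2, norm_nonneg w]
    have h1 : ‖y‖ ≤ ‖z‖ + 1 := by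
      calc ‖y‖ = ‖z - (z - y)‖ := by simp
        _ ≤ ‖z‖ + ‖z - y‖ := norm_sub_le _ _
        _ ≤ ‖z‖ + 1 := by gcongr
    have h2 : ‖y‖ ^ k ≤ 2 ^ k * (‖z‖ ^ k + 1) := by
      calc ‖y‖ ^ k ≤ (‖z‖ + 1) ^ k := by gcongr
        _ ≤ 2 ^ (k - 1) * (‖z‖ ^ k + 1 ^ k) := add_pow_le (norm_nonneg _) zero_le_one k
        _ ≤ 2 ^ k * (‖z‖ ^ k + 1) := by
          rw [one_pow]
          gcongr
          · norm_num
          · omega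
    have h3 := SchwartzMap.le_seminorm ℂ k (n + 1) b z
    have h4 := SchwartzMap.le_seminorm ℂ 0 (n + 1) b z
    rw [pow_zero, one_mul] at h4
    rw [norm_fderiv_iteratedFDeriv, le_div_iff₀' hP]
    calc ‖y‖ ^ k * ‖iteratedFDeriv ℝ (n + 1) b z‖
        ≤ (2 ^ k * (‖z‖ ^ k + 1)) * ‖iteratedFDeriv ℝ (n + 1) b z‖ := by gcongr
      _ = 2 ^ k * (‖z‖ ^ k * ‖iteratedFDeriv ℝ (n + 1) b z‖ +
            ‖iteratedFDeriv ℝ (n + 1) b z‖) := by ring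
      _ ≤ A := by simp only [A]; gcongr
  have hmain := (convex_segment y (y - w)).norm_image_sub_le_of_norm_hasFDerivWithin_le (𝕜 := ℝ)
    (f := iteratedFDeriv ℝ n b) (C := A / ‖y‖ ^ k) (x := y) (y := y - w)
    (fun z _ => (((b.smooth ⊤).differentiable_iteratedFDeriv (m := n)
      (by exact_mod_cast ENat.natCast_lt_top n)).differentiableAt.hasFDerivAt).hasFDerivWithinAt)
    hbound (left_mem_segment ℝ _ _) (right_mem_segment ℝ _ _)
  have e : (⇑(b.compSubConstCLM ℂ w - b : 𝓢(Space N, ℂ)) : Space N → ℂ)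
      = (fun z => b (z - w)) - ⇑b := rfl
  have c1 : ContDiffAt ℝ n (fun z => b (z - w)) y :=
    ((b.smooth n).comp (contDiff_id.sub contDiff_const)).contDiffAt
  rw [e, iteratedFDeriv_sub_apply c1 (b.contDiffAt n), iteratedFDeriv_comp_sub]
  rw [sub_sub_cancel_left, norm_neg] at hmain
  calc _ ≤ ‖y‖ ^ k * (A / ‖y‖ ^ k * ‖w‖) := by gcongr
    _ = A * ‖w‖ := by rw [← mul_assoc, mul_div_cancel₀ _ hP.ne']

variable {V : Type*} [NormedAddCommGroup V] [NormedSpace ℂ V]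

/-- A tempered distribution is controlled by finitely many Schwartz seminorms. -/
theorem exists_seminorm_bound (f : 𝓢'(Space N, V)) :
    ∃ (s : Finset (ℕ × ℕ)) (C : ℝ), 0 ≤ C ∧ ∀ η : 𝓢(Space N, ℂ),
      ‖f η‖ ≤ C * ∑ i ∈ s, SchwartzMap.seminorm ℂ i.1 i.2 η := by
  obtain ⟨s, C, -, hC⟩ := Seminorm.bound_of_continuous (schwartz_withSeminorms ℂ (Space N) ℂ)
    ((normSeminorm ℂ V).comp f.toLinearMap) (by
      exact continuous_norm.comp f.continuous)
  refine ⟨s, C, C.2, fun η => ?_⟩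
  have h1 := hC η
  have h2 := Seminorm.finset_sup_le_sum (schwartzSeminormFamily ℂ (Space N) ℂ) s η
  simp only [schwartzSeminormFamily, sum_apply] at h2
  refine le_trans h1 ?_
  change (C : ℝ) * _ ≤ _
  gcongr

/-- The Schwartz function `y ↦ a (x - y)`. -/
def reflAt (a : 𝓢(Space N, ℂ)) (x : Space N) : 𝓢(Space N, ℂ) :=
  (SchwartzMap.compCLMOfContinuousLinearEquiv ℂ
    (LinearIsometryEquiv.neg ℝ (E := Space N)).toContinuousLinearEquiv a).compSubConstCLM ℂ x

@[simp]
theorem reflAt_apply (a : 𝓢(Space N, ℂ)) (x y : Space N) : reflAt a x y = a (x - y) := by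
  simp [reflAt]

theorem reflAt_add (a : 𝓢(Space N, ℂ)) (x w : Space N) :
    reflAt a (x + w) = (reflAt a x).compSubConstCLM ℂ w := by
  simp [reflAt]

theorem reflAt_lineDerivOp (a : 𝓢(Space N, ℂ)) (v x : Space N) :
    reflAt (∂_{v} a) x = -∂_{v} (reflAt a x) := by
  ext y
  rw [reflAt_apply, neg_apply, SchwartzMap.lineDerivOp_apply_eq_fderiv,
    SchwartzMap.lineDerivOp_apply_eq_fderiv]
  have h1 : (⇑(reflAt a x) : Space N → ℂ) = fun z => a (x - z) := by ext z; simp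
  have h2 : HasFDerivAt (fun z : Space N => a (x - z))
      ((fderiv ℝ a (x - y)).comp (-ContinuousLinearMap.id ℝ (Space N))) y :=
    (a.hasFDerivAt (x - y)).comp y ((hasFDerivAt_id y).const_sub x)
  rw [h1, h2.fderiv]
  simp

theorem apply_reflAt_lineDerivOp (f : 𝓢'(Space N, V)) (a : 𝓢(Space N, ℂ)) (v x : Space N) :
    f (reflAt (∂_{v} a) x) = (∂_{v} f) (reflAt a x) := by
  rw [reflAt_lineDerivOp, TemperedDistribution.lineDerivOp_apply_apply]

/-- Regularisations of tempered distributions can be differentiated under the pairing. -/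
theorem hasLineDerivAt_apply_reflAt (f : 𝓢'(Space N, V)) (a : 𝓢(Space N, ℂ)) (x v : Space N) :
    HasLineDerivAt ℝ (fun z => f (reflAt a z)) ((∂_{v} f) (reflAt a x)) x v := by
  obtain ⟨s, C, hC, hf⟩ := exists_seminorm_bound f
  choose A hA hA' using fun i : ℕ × ℕ => seminorm_translate_sub_le (reflAt a x) v i.1 i.2
  rw [HasLineDerivAt, hasDerivAt_iff_isLittleO_nhds_zero]
  refine Asymptotics.IsBigO.trans_isLittleO (g := fun h : ℝ => h ^ 2) ?_
    (Asymptotics.isLittleO_pow_id one_lt_two)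
  refine Asymptotics.IsBigO.of_bound (C * ∑ i ∈ s, A i) ?_
  filter_upwards [Metric.ball_mem_nhds (0 : ℝ) one_pos] with h hh
  have hh' : |h| ≤ 1 := by simpa using (Metric.mem_ball.1 hh).le
  have key : f (reflAt a (x + (0 + h) • v)) - f (reflAt a (x + (0 : ℝ) • v)) -
      h • (∂_{v} f) (reflAt a x) =
      f ((reflAt a x).compSubConstCLM ℂ (h • v) - reflAt a x + h • ∂_{v} (reflAt a x)) := by
    rw [TemperedDistribution.lineDerivOp_apply_apply, zero_add, reflAt_add, zero_smul, add_zero,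
      map_add, map_sub, map_neg, smul_neg, sub_neg_eq_add]
    congr 1
    exact ((f : 𝓢(Space N, ℂ) →ₗ[ℂ] V).map_smul_of_tower h _).symm
  rw [key]
  refine (hf _).trans ?_
  rw [mul_assoc, Finset.sum_mul]
  gcongr with i
  simpa using hA' i h hh'

theorem continuous_apply_reflAt (f : 𝓢'(Space N, V)) (a : 𝓢(Space N, ℂ)) :
    Continuous fun x => f (reflAt a x) := by
  obtain ⟨s, C, hC, hf⟩ := exists_seminorm_bound f
  rw [continuous_iff_continuousAt]
  intro x
  choose A hA hA' using fun i : ℕ × ℕ => seminorm_translate_sub_self_le (reflAt a x) i.1 i.2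
  rw [ContinuousAt, tendsto_iff_norm_sub_tendsto_zero]
  have hlim : Tendsto (fun y : Space N => C * ∑ i ∈ s, A i * ‖y - x‖) (𝓝 x) (𝓝 0) := by
    have : Continuous fun y : Space N => C * ∑ i ∈ s, A i * ‖y - x‖ := by fun_prop
    simpa using this.tendsto x
  refine squeeze_zero' (Eventually.of_forall fun _ => norm_nonneg _) ?_ hlim
  filter_upwards [Metric.ball_mem_nhds x one_pos] with y hy
  have hy' : ‖y - x‖ ≤ 1 := by simpa [dist_eq_norm] using (Metric.mem_ball.1 hy).le
  rw [← map_sub]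
  refine (hf _).trans ?_
  gcongr with i
  have := hA' i (y - x) hy'
  rwa [← reflAt_add, add_sub_cancel] at this

end Translation

/-! ### Convolution kernels of Fourier multipliers -/

section Kernels

variable {N : ℕ} {V : Type*} [NormedAddCommGroup V] [NormedSpace ℂ V]

/-- The product of two symbols. -/
abbrev symMul (a b : 𝓢(Space N, ℂ)) : 𝓢(Space N, ℂ) := SchwartzMap.smulLeftCLM ℂ a b

theorem symMul_apply (a b : 𝓢(Space N, ℂ)) (ξ : Space N) : symMul a b ξ = a ξ * b ξ := by
  simp [symMul, SchwartzMap.smulLeftCLM_apply_apply a.hasTemperateGrowth]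

/-- The Schwartz function `y ↦ (𝓕⁻ m) (x - y)`: testing a tempered distribution `f` against it
gives the value at `x` of the smooth function `m(D) f`. -/
def kernelAt (m : 𝓢(Space N, ℂ)) (x : Space N) : 𝓢(Space N, ℂ) := reflAt (𝓕⁻ m) x

@[simp]
theorem kernelAt_apply (m : 𝓢(Space N, ℂ)) (x y : Space N) :
    kernelAt m x y = (𝓕⁻ m : 𝓢(Space N, ℂ)) (x - y) := by simp [kernelAt]

theorem kernelAt_add (m m' : 𝓢(Space N, ℂ)) (x : Space N) :
    kernelAt (m + m') x = kernelAt m x + kernelAt m' x := by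
  ext y; simp [FourierTransform.fourierInv_add]

theorem fourierInv_sub_schwartz (m m' : 𝓢(Space N, ℂ)) : 𝓕⁻ (m - m') = 𝓕⁻ m - 𝓕⁻ m' :=
  map_sub (FourierTransform.fourierInvCLM ℂ 𝓢(Space N, ℂ)) m m'

theorem kernelAt_sub (m m' : 𝓢(Space N, ℂ)) (x : Space N) :
    kernelAt (m - m') x = kernelAt m x - kernelAt m' x := by
  ext y; simp [fourierInv_sub_schwartz]

theorem kernelAt_smul (c : ℂ) (m : 𝓢(Space N, ℂ)) (x : Space N) :
    kernelAt (c • m) x = c • kernelAt m x := by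
  ext y; simp [FourierTransform.fourierInv_smul]

theorem kernelAt_zero (x : Space N) : kernelAt (0 : 𝓢(Space N, ℂ)) x = 0 := by
  have := kernelAt_smul (0 : ℂ) (0 : 𝓢(Space N, ℂ)) x
  simpa using this

theorem kernelAt_sum {ι : Type*} (s : Finset ι) (m : ι → 𝓢(Space N, ℂ)) (x : Space N) :
    kernelAt (∑ i ∈ s, m i) x = ∑ i ∈ s, kernelAt (m i) x := by
  classical
  induction s using Finset.induction_on with
  | empty => simp [kernelAt_zero]
  | insert a s ha ih => rw [Finset.sum_insert ha, Finset.sum_insert ha, kernelAt_add, ih]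

theorem fourierInv_reflAt (a : 𝓢(Space N, ℂ)) (x ξ : Space N) :
    (𝓕⁻ (reflAt a x) : 𝓢(Space N, ℂ)) ξ =
      (Real.fourierChar (inner ℝ x ξ) : ℂ) * (𝓕 a : 𝓢(Space N, ℂ)) ξ := by
  rw [SchwartzMap.fourierInv_coe, SchwartzMap.fourier_coe, Real.fourierInv_eq, Real.fourier_eq,
    ← integral_const_mul, ← integral_sub_left_eq_self _ volume x]
  refine integral_congr_ae (Eventually.of_forall fun z => ?_)
  simp only [reflAt_apply, sub_sub_cancel, Circle.smul_def, smul_eq_mul]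
  rw [inner_sub_left, sub_eq_add_neg, AddChar.map_add_eq_mul, Circle.coe_mul]
  ring

theorem fourierInv_kernelAt (m : 𝓢(Space N, ℂ)) (x ξ : Space N) :
    (𝓕⁻ (kernelAt m x) : 𝓢(Space N, ℂ)) ξ = (Real.fourierChar (inner ℝ x ξ) : ℂ) * m ξ := by
  rw [kernelAt, fourierInv_reflAt,
    FourierTransform.fourier_fourierInv_eq (F := 𝓢(Space N, ℂ)) m]

theorem fourier_smulLeft_fourierInv_kernelAt {σ : Space N → ℂ} (hσ : σ.HasTemperateGrowth)
    (m : 𝓢(Space N, ℂ)) (x : Space N) :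
    𝓕 (SchwartzMap.smulLeftCLM ℂ σ (𝓕⁻ (kernelAt m x))) =
      kernelAt (SchwartzMap.smulLeftCLM ℂ σ m) x := by
  rw [← FourierTransform.fourier_fourierInv_eq (F := 𝓢(Space N, ℂ)) (kernelAt (SchwartzMap.smulLeftCLM ℂ σ m) x)]
  congr 1
  ext ξ
  rw [SchwartzMap.smulLeftCLM_apply_apply hσ, fourierInv_kernelAt, fourierInv_kernelAt,
    SchwartzMap.smulLeftCLM_apply_apply hσ]
  simp only [smul_eq_mul]; ring

/-- Fourier multipliers act on kernels by multiplication of symbols. -/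
theorem fourierMultiplier_apply_kernelAt {σ : Space N → ℂ} (hσ : σ.HasTemperateGrowth)
    (f : 𝓢'(Space N, V)) (m : 𝓢(Space N, ℂ)) (x : Space N) :
    TemperedDistribution.fourierMultiplierCLM V σ f (kernelAt m x) =
      f (kernelAt (SchwartzMap.smulLeftCLM ℂ σ m) x) := by
  rw [TemperedDistribution.fourierMultiplierCLM_apply_apply,
    fourier_smulLeft_fourierInv_kernelAt hσ]

/-- The symbol of the composition of `m(D)` with the derivative in the direction `v`. -/
def derivSym (v : Space N) (m : 𝓢(Space N, ℂ)) : 𝓢(Space N, ℂ) :=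
  SchwartzMap.smulLeftCLM ℂ (fun ξ : Space N => (2 * Real.pi * Complex.I) * (inner ℝ ξ v : ℂ)) m

theorem derivSym_apply (v : Space N) (m : 𝓢(Space N, ℂ)) (ξ : Space N) :
    derivSym v m ξ = (2 * Real.pi * Complex.I) * (inner ℝ ξ v : ℂ) * m ξ := by
  rw [derivSym, SchwartzMap.smulLeftCLM_apply_apply (by fun_prop)]
  simp

theorem fourierInv_derivSym (v : Space N) (m : 𝓢(Space N, ℂ)) :
    (𝓕⁻ (derivSym v m) : 𝓢(Space N, ℂ)) = ∂_{v} (𝓕⁻ m) := by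
  rw [SchwartzMap.lineDerivOp_fourierInv_eq]
  congr 1
  ext ξ
  rw [derivSym_apply, smul_apply, SchwartzMap.smulLeftCLM_apply_apply (by fun_prop)]
  simp [mul_assoc]

theorem apply_kernelAt_derivSym (f : 𝓢'(Space N, V)) (v : Space N) (m : 𝓢(Space N, ℂ))
    (x : Space N) : f (kernelAt (derivSym v m) x) = (∂_{v} f) (kernelAt m x) := by
  rw [kernelAt, fourierInv_derivSym, apply_reflAt_lineDerivOp]; rfl

/-- The dilated symbol `ξ ↦ m (2^{-k} ξ)`. -/
def dil (k : ℤ) : 𝓢(Space N, ℂ) →L[ℂ] 𝓢(Space N, ℂ) :=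
  SchwartzMap.compCLMOfContinuousLinearEquiv ℂ
    (ContinuousLinearEquiv.smulLeft (M₁ := Space N) (R₁ := ℝ)
      (Units.mk0 ((2 : ℝ) ^ (-k)) (by positivity)))

theorem dil_apply (k : ℤ) (m : 𝓢(Space N, ℂ)) (ξ : Space N) :
    dil k m ξ = m ((2 : ℝ) ^ (-k) • ξ) := rfl

theorem dil_dil (k l : ℤ) (m : 𝓢(Space N, ℂ)) : dil k (dil l m) = dil (k + l) m := by
  ext ξ
  simp only [dil_apply, smul_smul]
  rw [← zpow_add₀ two_ne_zero]
  congr 3; ring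

theorem derivSym_dil (v : Space N) (k : ℤ) (m : 𝓢(Space N, ℂ)) :
    derivSym v (dil k m) = ((2 : ℂ) ^ k) • dil k (derivSym v m) := by
  ext ξ
  simp only [derivSym_apply, dil_apply, smul_apply, inner_smul_left, smul_eq_mul,
    conj_trivial, Complex.ofReal_mul, Complex.ofReal_zpow, Complex.ofReal_ofNat]
  have : (2 : ℂ) ^ k * (2 : ℂ) ^ (-k) = 1 := by
    rw [← zpow_add₀ two_ne_zero]; simp
  linear_combination (-(2 * Real.pi * Complex.I) * (inner ℝ ξ v : ℂ) *
    m ((2 : ℝ) ^ (-k) • ξ)) * this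

theorem fourierInv_dil (k : ℤ) (m : 𝓢(Space N, ℂ)) (z : Space N) :
    (𝓕⁻ (dil k m) : 𝓢(Space N, ℂ)) z =
      ((2 : ℂ) ^ k) ^ N * (𝓕⁻ m : 𝓢(Space N, ℂ)) ((2 : ℝ) ^ k • z) := by
  rw [SchwartzMap.fourierInv_coe, SchwartzMap.fourierInv_coe, Real.fourierInv_eq,
    Real.fourierInv_eq]
  have h := MeasureTheory.Measure.integral_comp_smul (volume : Measure (Space N))
    (fun v => Real.fourierChar (inner ℝ v ((2 : ℝ) ^ k • z)) • m v) ((2 : ℝ) ^ (-k))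
  have h2 : ∀ v : Space N, inner ℝ ((2 : ℝ) ^ (-k) • v) ((2 : ℝ) ^ k • z) = (inner ℝ v z : ℝ) := by
    intro v
    rw [inner_smul_left, inner_smul_right, ← mul_assoc, conj_trivial, ← zpow_add₀ two_ne_zero]
    simp
  simp only [h2] at h
  have h3 : |(((2 : ℝ) ^ (-k)) ^ Module.finrank ℝ (Space N))⁻¹| = ((2 : ℝ) ^ k) ^ N := by
    rw [abs_of_pos (by positivity), finrank_euclideanSpace_fin, zpow_neg, inv_pow, inv_inv]
  rw [h3] at h
  simp only [dil_apply]
  rw [h, Complex.real_smul]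
  push_cast
  rfl

end Kernels

/-! ### The Littlewood-Paley symbols -/

section Symbols

variable {N : ℕ}

/-- The symbol of `φ(2^{-k} D)`; recall that `D` has symbol `2πξ`. -/
def blockSym (φ : 𝓢(Space N, ℝ)) (k : ℤ) : 𝓢(Space N, ℂ) :=
  dil k (SchwartzMap.compCLMOfContinuousLinearEquiv ℂ
    (ContinuousLinearEquiv.smulLeft (M₁ := Space N) (R₁ := ℝ)
      (Units.mk0 (2 * Real.pi) (by positivity)))
    (φ.postcompCLM Complex.ofRealCLM))

theorem blockSym_apply (φ : 𝓢(Space N, ℝ)) (k : ℤ) (ξ : Space N) :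
    blockSym φ k ξ = ((φ ((2 * Real.pi * (2 : ℝ) ^ (-k)) • ξ) : ℝ) : ℂ) := by
  rw [blockSym, dil_apply, mul_smul]
  rfl

theorem dil_blockSym (φ : 𝓢(Space N, ℝ)) (k l : ℤ) :
    dil k (blockSym φ l) = blockSym φ (k + l) := by
  rw [blockSym, dil_dil, blockSym]

theorem dyadicBlock_eq (φ : 𝓢(Space N, ℝ)) (k : ℤ) (f : 𝓢'(Space N, Vec N)) :
    dyadicBlock φ k f = TemperedDistribution.fourierMultiplierCLM (Vec N) (blockSym φ k) f := by
  rw [dyadicBlock]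
  congr 2
  ext ξ
  rw [blockSym_apply]

theorem dyadicBlock_apply_kernelAt (φ : 𝓢(Space N, ℝ)) (k : ℤ) (f : 𝓢'(Space N, Vec N))
    (m : 𝓢(Space N, ℂ)) (x : Space N) :
    dyadicBlock φ k f (kernelAt m x) = f (kernelAt (symMul (blockSym φ k) m) x) := by
  rw [dyadicBlock_eq, fourierMultiplier_apply_kernelAt (SchwartzMap.hasTemperateGrowth _)]

/-- The profile `1 - ∑_{k ≥ 1} φ(2^{-k} ·)` of the low-frequency cut-off. On the support of the
bump function only the terms `k = 1, 2` do not vanish. -/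
def lowProfile (φ : 𝓢(Space N, ℝ)) (ξ : Space N) : ℝ :=
  (⟨3, 6, by norm_num, by norm_num⟩ : ContDiffBump (0 : Space N)) ξ *
    (1 - φ ((2 : ℝ)⁻¹ • ξ) - φ ((4 : ℝ)⁻¹ • ξ))

theorem contDiff_lowProfile (φ : 𝓢(Space N, ℝ)) : ContDiff ℝ (⊤ : ℕ∞) (lowProfile φ) := by
  have h := φ.smooth ⊤
  have h1 : ContDiff ℝ (⊤ : ℕ∞) fun ξ : Space N => φ ((2 : ℝ)⁻¹ • ξ) :=
    h.comp (contDiff_const_smul _)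
  have h2 : ContDiff ℝ (⊤ : ℕ∞) fun ξ : Space N => φ ((4 : ℝ)⁻¹ • ξ) :=
    h.comp (contDiff_const_smul _)
  exact (ContDiffBump.contDiff _).mul ((contDiff_const.sub h1).sub h2)

theorem hasCompactSupport_lowProfile (φ : 𝓢(Space N, ℝ)) : HasCompactSupport (lowProfile φ) :=
  (ContDiffBump.hasCompactSupport _).mul_right

variable {φ : 𝓢(Space N, ℝ)}

theorem IsDyadicPartition.eq_zero_of_lt (hφ : IsDyadicPartition φ) {ξ : Space N}
    (h : ‖ξ‖ < 3 / 4) : φ ξ = 0 := by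
  by_contra h'
  linarith [(hφ.supported ξ h').1]

theorem IsDyadicPartition.eq_zero_of_gt (hφ : IsDyadicPartition φ) {ξ : Space N}
    (h : 8 / 3 < ‖ξ‖) : φ ξ = 0 := by
  by_contra h'
  linarith [(hφ.supported ξ h').2]

/-- If only two consecutive dilates can be nonzero at `ξ`, they sum to one. -/
theorem IsDyadicPartition.sum_pair (hφ : IsDyadicPartition φ) {ξ : Space N} (j : ℤ)
    (h1 : 8 / 3 < (2 : ℝ) ^ (-(j - 1)) * ‖ξ‖) (h2 : (2 : ℝ) ^ (-(j + 2)) * ‖ξ‖ < 3 / 4) :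
    φ ((2 : ℝ) ^ (-j) • ξ) + φ ((2 : ℝ) ^ (-(j + 1)) • ξ) = 1 := by
  have hξ : ξ ≠ 0 := by
    rintro rfl; simp at h1; linarith
  have hs := hφ.sum_eq_one ξ hξ
  have hfin : HasSum (fun i : ℤ => φ ((2 : ℝ) ^ (-i) • ξ))
      (∑ i ∈ ({j, j + 1} : Finset ℤ), φ ((2 : ℝ) ^ (-i) • ξ)) := by
    refine hasSum_sum_of_ne_finset_zero fun i hi => ?_
    simp only [Finset.mem_insert, Finset.mem_singleton, not_or] at hi
    have hn : ‖(2 : ℝ) ^ (-i) • ξ‖ = (2 : ℝ) ^ (-i) * ‖ξ‖ := by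
      rw [norm_smul, Real.norm_of_nonneg (by positivity)]
    rcases lt_or_ge i j with h | h
    · refine hφ.eq_zero_of_gt (h1.trans_le ?_)
      rw [hn]
      gcongr
      · norm_num
      · omega
    · refine hφ.eq_zero_of_lt (lt_of_le_of_lt ?_ h2)
      rw [hn]
      gcongr
      · norm_num
      · omega
  rw [Finset.sum_pair (by omega)] at hfin
  exact hfin.unique hs

theorem lowProfile_eq_one (hφ : IsDyadicPartition φ) {ξ : Space N} (h : ‖ξ‖ < 3 / 2) :
    lowProfile φ ξ = 1 := by
  rw [lowProfile, ContDiffBump.one_of_mem_closedBall _ (by simp; linarith), hφ.eq_zero_of_lt,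
    hφ.eq_zero_of_lt]
  · norm_num
  · rw [norm_smul]; norm_num; linarith
  · rw [norm_smul]; norm_num; linarith

theorem lowProfile_eq_zero (hφ : IsDyadicPartition φ) {ξ : Space N} (h : 8 / 3 < ‖ξ‖) :
    lowProfile φ ξ = 0 := by
  rcases lt_or_ge ‖ξ‖ 6 with h6 | h6
  · have := hφ.sum_pair (ξ := ξ) 1 (by simpa using h) (by norm_num; linarith)
    norm_num at this
    rw [lowProfile]
    rw [show (1 : ℝ) - φ ((2 : ℝ)⁻¹ • ξ) - φ ((4 : ℝ)⁻¹ • ξ) = 0 by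
      rw [sub_sub]; norm_num; linarith, mul_zero]
  · rw [lowProfile, ContDiffBump.zero_of_le_dist _ (by simpa using h6), zero_mul]

theorem lowProfile_sub (hφ : IsDyadicPartition φ) (ξ : Space N) :
    lowProfile φ ξ - lowProfile φ ((2 : ℝ) • ξ) = φ ξ := by
  have hn : ‖(2 : ℝ) • ξ‖ = 2 * ‖ξ‖ := by rw [norm_smul]; norm_num
  rcases le_or_gt ‖ξ‖ (4 / 3) with h | h
  · rw [lowProfile_eq_one hφ (by linarith), lowProfile,
      ContDiffBump.one_of_mem_closedBall _ (by simp [norm_smul]; linarith), smul_smul, smul_smul,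
      hφ.eq_zero_of_lt (ξ := ((4 : ℝ)⁻¹ * 2) • ξ) (by rw [norm_smul]; norm_num; linarith)]
    norm_num
  · rw [lowProfile_eq_zero hφ (ξ := (2 : ℝ) • ξ) (by rw [hn]; linarith)]
    rcases le_or_gt ‖ξ‖ (8 / 3) with h' | h'
    · have := hφ.sum_pair (ξ := ξ) 0 (by norm_num; linarith) (by norm_num; linarith)
      norm_num at this
      rw [lowProfile, ContDiffBump.one_of_mem_closedBall _ (by simp; linarith),
        hφ.eq_zero_of_lt (ξ := (4 : ℝ)⁻¹ • ξ) (by rw [norm_smul]; norm_num; linarith)]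
      norm_num
      linarith
    · rw [lowProfile_eq_zero hφ h', hφ.eq_zero_of_gt h', sub_zero]

theorem lowProfile_neg (hφ : IsDyadicPartition φ) (ξ : Space N) :
    lowProfile φ (-ξ) = lowProfile φ ξ := by
  rw [lowProfile, lowProfile, ContDiffBump.neg, hφ.radial ((2 : ℝ)⁻¹ • -ξ) ((2 : ℝ)⁻¹ • ξ),
    hφ.radial ((4 : ℝ)⁻¹ • -ξ) ((4 : ℝ)⁻¹ • ξ)] <;> simp

/-- The symbol of the low-frequency cut-off `S_k = ∑_{j ≤ k} φ(2^{-j} D)`. -/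
def lowSym (φ : 𝓢(Space N, ℝ)) (k : ℤ) : 𝓢(Space N, ℂ) :=
  dil k (SchwartzMap.compCLMOfContinuousLinearEquiv ℂ
    (ContinuousLinearEquiv.smulLeft (M₁ := Space N) (R₁ := ℝ)
      (Units.mk0 (2 * Real.pi) (by positivity)))
    (((hasCompactSupport_lowProfile φ).toSchwartzMap (contDiff_lowProfile φ)).postcompCLM
      Complex.ofRealCLM))

theorem lowSym_apply (φ : 𝓢(Space N, ℝ)) (k : ℤ) (ξ : Space N) :
    lowSym φ k ξ = ((lowProfile φ ((2 * Real.pi * (2 : ℝ) ^ (-k)) • ξ) : ℝ) : ℂ) := by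
  rw [lowSym, dil_apply, mul_smul]
  rfl

theorem dil_lowSym (φ : 𝓢(Space N, ℝ)) (k l : ℤ) :
    dil k (lowSym φ l) = lowSym φ (k + l) := by
  rw [lowSym, dil_dil, lowSym]

theorem norm_two_pi_smul (k : ℤ) (ξ : Space N) :
    ‖(2 * Real.pi * (2 : ℝ) ^ (-k)) • ξ‖ = 2 * Real.pi * ‖ξ‖ / (2 : ℝ) ^ k := by
  rw [norm_smul, Real.norm_of_nonneg (by positivity), zpow_neg]
  field_simp

theorem blockSym_eq_sub (hφ : IsDyadicPartition φ) (k : ℤ) :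
    blockSym φ k = lowSym φ k - lowSym φ (k - 1) := by
  ext ξ
  rw [sub_apply, lowSym_apply, lowSym_apply, blockSym_apply, ← lowProfile_sub hφ, smul_smul]
  push_cast
  congr 4
  rw [neg_sub, sub_eq_add_neg, zpow_add₀ two_ne_zero, zpow_one]; ring

theorem blockSym_ne_zero (hφ : IsDyadicPartition φ) {k : ℤ} {ξ : Space N} (h : blockSym φ k ξ ≠ 0) :
    3 / 4 * (2 : ℝ) ^ k ≤ 2 * Real.pi * ‖ξ‖ ∧ 2 * Real.pi * ‖ξ‖ ≤ 8 / 3 * (2 : ℝ) ^ k := by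
  rw [blockSym_apply, Complex.ofReal_ne_zero] at h
  have := hφ.supported _ h
  rw [norm_two_pi_smul, le_div_iff₀ (by positivity), div_le_iff₀ (by positivity)] at this
  exact this

theorem lowSym_eq_one (hφ : IsDyadicPartition φ) {k : ℤ} {ξ : Space N}
    (h : 2 * Real.pi * ‖ξ‖ < 3 / 2 * (2 : ℝ) ^ k) : lowSym φ k ξ = 1 := by
  rw [lowSym_apply, lowProfile_eq_one hφ, Complex.ofReal_one]
  rwa [norm_two_pi_smul, div_lt_iff₀ (by positivity)]

theorem lowSym_eq_zero (hφ : IsDyadicPartition φ) {k : ℤ} {ξ : Space N}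
    (h : 8 / 3 * (2 : ℝ) ^ k < 2 * Real.pi * ‖ξ‖) : lowSym φ k ξ = 0 := by
  rw [lowSym_apply, lowProfile_eq_zero hφ, Complex.ofReal_zero]
  rwa [norm_two_pi_smul, lt_div_iff₀ (by positivity)]

theorem sum_blockSym (hφ : IsDyadicPartition φ) {a b : ℤ} (hab : a ≤ b) :
    ∑ k ∈ Finset.Ioc a b, blockSym φ k = lowSym φ b - lowSym φ a := by
  induction b, hab using Int.leInduction with
  | base => simp
  | succ b hb ih =>
    rw [← Finset.insert_Ioc_right_eq_Ioc_add_one hb, Finset.sum_insert (by simp), ih,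
      blockSym_eq_sub hφ]
    simp

theorem symMul_lowSym_lowSym (hφ : IsDyadicPartition φ) {k l : ℤ} (h : k < l) :
    symMul (lowSym φ l) (lowSym φ k) = lowSym φ k := by
  ext ξ
  rw [symMul_apply]
  by_cases h0 : 2 * Real.pi * ‖ξ‖ < 3 / 2 * (2 : ℝ) ^ l
  · rw [lowSym_eq_one hφ h0, one_mul]
  · rw [lowSym_eq_zero hφ (k := k), mul_zero]
    have : (2 : ℝ) ^ (k + 1) ≤ 2 ^ l := zpow_le_zpow_right₀ one_le_two (by omega)
    rw [zpow_add_one₀ two_ne_zero] at this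
    have hk : (0 : ℝ) < 2 ^ k := by positivity
    linarith

/-- A symbol equal to `1` on the support of `blockSym φ k`, supported in a slightly larger
annulus. -/
def fatSym (φ : 𝓢(Space N, ℝ)) (k : ℤ) : 𝓢(Space N, ℂ) := lowSym φ (k + 1) - lowSym φ (k - 2)

theorem dil_fatSym (φ : 𝓢(Space N, ℝ)) (k l : ℤ) :
    dil k (fatSym φ l) = fatSym φ (k + l) := by
  rw [fatSym, map_sub, dil_lowSym, dil_lowSym, fatSym, add_assoc, add_sub_assoc]

theorem fatSym_ne_zero (hφ : IsDyadicPartition φ) {k : ℤ} {ξ : Space N} (h : fatSym φ k ξ ≠ 0) :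
    3 / 8 * (2 : ℝ) ^ k ≤ 2 * Real.pi * ‖ξ‖ ∧ 2 * Real.pi * ‖ξ‖ ≤ 16 / 3 * (2 : ℝ) ^ k := by
  have e1 : (2 : ℝ) ^ (k + 1) = 2 ^ k * 2 := zpow_add_one₀ two_ne_zero k
  have e2 : (2 : ℝ) ^ (k - 2) = 2 ^ k / 4 := by
    rw [zpow_sub₀ two_ne_zero]; norm_num
  have hk : (0 : ℝ) < 2 ^ k := by positivity
  by_contra hcon
  apply h
  rw [fatSym, sub_apply]
  rcases not_and_or.1 hcon with h1 | h1
  · rw [lowSym_eq_one hφ, lowSym_eq_one hφ, sub_self]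
    · rw [e2]; linarith
    · rw [e1]; linarith
  · rw [lowSym_eq_zero hφ, lowSym_eq_zero hφ, sub_self]
    · rw [e2]; linarith
    · rw [e1]; linarith

theorem fatSym_mul_blockSym (hφ : IsDyadicPartition φ) (k : ℤ) :
    symMul (fatSym φ k) (blockSym φ k) = blockSym φ k := by
  ext ξ
  rw [symMul_apply]
  by_cases h0 : blockSym φ k ξ = 0
  · rw [h0, mul_zero]
  · obtain ⟨h1, h2⟩ := blockSym_ne_zero hφ h0
    have e1 : (2 : ℝ) ^ (k + 1) = 2 ^ k * 2 := zpow_add_one₀ two_ne_zero k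
    have e2 : (2 : ℝ) ^ (k - 2) = 2 ^ k / 4 := by
      rw [zpow_sub₀ two_ne_zero]; norm_num
    have hk : (0 : ℝ) < 2 ^ k := by positivity
    rw [fatSym, sub_apply, lowSym_eq_one hφ, lowSym_eq_zero hφ (k := k - 2), sub_zero, one_mul]
    · rw [e2]; linarith
    · rw [e1]; linarith

theorem symMul_comm (a b : 𝓢(Space N, ℂ)) : symMul a b = symMul b a := by
  ext ξ; rw [symMul_apply, symMul_apply, mul_comm]

end Symbols

/-! ### Young's inequality and scaling of kernels -/

section Young

variable {N : ℕ}

theorem lintegral_comp_smul (f : Space N → ℝ≥0∞) {r : ℝ} (hr : 0 < r) :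
    ∫⁻ x, f (r • x) = ENNReal.ofReal ((r ^ N)⁻¹) * ∫⁻ x, f x := by
  have h1 : ∫⁻ x, f x ∂(Measure.map (fun x : Space N => r • x) volume) = ∫⁻ x, f (r • x) :=
    (Homeomorph.smulOfNeZero r hr.ne').measurableEmbedding.lintegral_map f
  rw [← h1, Measure.map_addHaar_smul volume hr.ne', lintegral_smul_measure, smul_eq_mul,
    finrank_euclideanSpace_fin, abs_of_pos (by positivity)]

theorem lintegral_mul_sq_le {α : Type*} [MeasurableSpace α] (μ : Measure α) {f g : α → ℝ≥0∞}
    (hf : AEMeasurable f μ) (hg : AEMeasurable g μ) :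
    (∫⁻ a, f a * g a ∂μ) ^ (2 : ℝ) ≤ (∫⁻ a, f a ^ (2 : ℝ) ∂μ) * ∫⁻ a, g a ^ (2 : ℝ) ∂μ := by
  have := ENNReal.lintegral_mul_le_Lp_mul_Lq μ Real.HolderConjugate.two_two hf hg
  calc (∫⁻ a, f a * g a ∂μ) ^ (2 : ℝ)
      ≤ ((∫⁻ a, f a ^ (2 : ℝ) ∂μ) ^ (1 / (2 : ℝ)) * (∫⁻ a, g a ^ (2 : ℝ) ∂μ) ^ (1 / (2 : ℝ))) ^
          (2 : ℝ) := by
        gcongr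
        exact this
    _ = _ := by
        rw [ENNReal.mul_rpow_of_nonneg _ _ (by norm_num), ← ENNReal.rpow_mul, ← ENNReal.rpow_mul]
        norm_num

/-- The square of Young's inequality: by Cauchy-Schwarz for the measure `a (x - y) dy`, followed by
Tonelli. -/
theorem lintegral_conv_sq_le {a b : Space N → ℝ≥0∞} (ha : Measurable a) (hb : AEMeasurable b) :
    ∫⁻ x, (∫⁻ y, a (x - y) * b y) ^ (2 : ℝ) ≤ (∫⁻ z, a z) ^ (2 : ℝ) * ∫⁻ y, b y ^ (2 : ℝ) := by
  have hs : ∀ x : Space N, ∫⁻ y, a (x - y) = ∫⁻ z, a z := fun x =>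
    lintegral_sub_left_eq_self a x
  have hpt : ∀ x, (∫⁻ y, a (x - y) * b y) ^ (2 : ℝ) ≤
      (∫⁻ z, a z) * ∫⁻ y, a (x - y) * b y ^ (2 : ℝ) := by
    intro x
    have hm : Measurable fun y => a (x - y) := ha.comp (measurable_const.sub measurable_id)
    have := lintegral_mul_sq_le volume (f := fun y => a (x - y) ^ (1 / 2 : ℝ))
      (g := fun y => a (x - y) ^ (1 / 2 : ℝ) * b y) (hm.pow_const _).aemeasurable
      ((hm.pow_const _).aemeasurable.mul hb)
    have e : ∀ t : ℝ≥0∞, t ^ (1 / 2 : ℝ) * t ^ (1 / 2 : ℝ) = t := fun t => by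
      rw [← ENNReal.rpow_add_of_nonneg _ _ (by norm_num) (by norm_num)]; norm_num
    have e' : ∀ t : ℝ≥0∞, (t ^ (1 / 2 : ℝ)) ^ (2 : ℝ) = t := fun t => by
      rw [← ENNReal.rpow_mul]; norm_num
    simp only [← mul_assoc, e, ENNReal.mul_rpow_of_nonneg _ _ zero_le_two, e', hs] at this
    exact this
  calc ∫⁻ x, (∫⁻ y, a (x - y) * b y) ^ (2 : ℝ)
      ≤ ∫⁻ x, (∫⁻ z, a z) * ∫⁻ y, a (x - y) * b y ^ (2 : ℝ) := lintegral_mono hpt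
    _ ≤ (∫⁻ z, a z) * ∫⁻ x, ∫⁻ y, a (x - y) * b y ^ (2 : ℝ) := by
        rw [lintegral_const_mul'']
        have : AEMeasurable (fun p : Space N × Space N => a (p.1 - p.2) * b p.2 ^ (2 : ℝ))
            (volume.prod volume) :=
          (ha.comp (measurable_fst.sub measurable_snd)).aemeasurable.mul
            ((hb.comp_quasiMeasurePreserving Measure.quasiMeasurePreserving_snd).pow_const _)
        exact this.lintegral_prod_right'
    _ = (∫⁻ z, a z) * ∫⁻ y, ∫⁻ x, a (x - y) * b y ^ (2 : ℝ) := by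
        rw [lintegral_lintegral_swap]
        exact (ha.comp (measurable_fst.sub measurable_snd)).aemeasurable.mul
            ((hb.comp_quasiMeasurePreserving Measure.quasiMeasurePreserving_snd).pow_const _)
    _ = (∫⁻ z, a z) ^ (2 : ℝ) * ∫⁻ y, b y ^ (2 : ℝ) := by
        have : ∀ y, ∫⁻ x, a (x - y) * b y ^ (2 : ℝ) = (∫⁻ z, a z) * b y ^ (2 : ℝ) := by
          intro y
          have hm : Measurable fun x => a (x - y) := ha.comp (measurable_id.sub measurable_const)
          rw [lintegral_mul_const _ hm,
            lintegral_sub_right_eq_self a y]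
        simp_rw [this]
        rw [lintegral_const_mul'' _ (hb.pow_const _), ← mul_assoc]
        congr 1
        rw [show (2 : ℝ) = 1 + 1 by norm_num, ENNReal.rpow_add_of_nonneg _ _ zero_le_one zero_le_one,
          ENNReal.rpow_one]

variable {V W : Type*} [NormedAddCommGroup V] [NormedAddCommGroup W]

theorem eLpNorm_two_eq {α : Type*} [MeasurableSpace α] (μ : Measure α) (w : α → V) :
    eLpNorm w 2 μ = (∫⁻ y, ‖w y‖ₑ ^ (2 : ℝ) ∂μ) ^ (1 / (2 : ℝ)) := by
  rw [eLpNorm_eq_lintegral_rpow_enorm_toReal two_ne_zero ENNReal.ofNat_ne_top]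
  simp

/-- Young's inequality `L¹ * L² ⊆ L²`, for functions dominated by a convolution. -/
theorem eLpNorm_le_of_le_conv {a : Space N → ℝ≥0∞} (ha : Measurable a) {w : Space N → V}
    (hw : AEStronglyMeasurable w) {F : Space N → W}
    (hF : ∀ x, ‖F x‖ₑ ≤ ∫⁻ y, a (x - y) * ‖w y‖ₑ) :
    eLpNorm F 2 ≤ (∫⁻ z, a z) * eLpNorm w 2 := by
  rw [eLpNorm_two_eq, eLpNorm_two_eq]
  calc (∫⁻ x, ‖F x‖ₑ ^ (2 : ℝ)) ^ (1 / (2 : ℝ))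
      ≤ (∫⁻ x, (∫⁻ y, a (x - y) * ‖w y‖ₑ) ^ (2 : ℝ)) ^ (1 / (2 : ℝ)) := by
        gcongr with x; exact hF x
    _ ≤ ((∫⁻ z, a z) ^ (2 : ℝ) * ∫⁻ y, ‖w y‖ₑ ^ (2 : ℝ)) ^ (1 / (2 : ℝ)) := by
        gcongr; exact lintegral_conv_sq_le ha hw.enorm
    _ = _ := by
        rw [ENNReal.mul_rpow_of_nonneg _ _ (by norm_num), ← ENNReal.rpow_mul]
        norm_num

/-- Young's inequality `L² * L¹ ⊆ L²`, for functions dominated by a convolution. -/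
theorem eLpNorm_le_of_le_conv' {a : Space N → V} (ha : AEStronglyMeasurable a)
    {b : Space N → ℝ≥0∞} (hb : Measurable b) {F : Space N → W}
    (hF : ∀ x, ‖F x‖ₑ ≤ ∫⁻ y, ‖a (x - y)‖ₑ * b y) :
    eLpNorm F 2 ≤ eLpNorm a 2 * ∫⁻ z, b z := by
  rw [mul_comm]
  refine eLpNorm_le_of_le_conv hb ha fun x => (hF x).trans_eq ?_
  rw [← lintegral_sub_left_eq_self _ x]
  simp [mul_comm]

/-- The weight `2^a`. -/
def pw (a : ℝ) : ℝ≥0∞ := ENNReal.ofReal ((2 : ℝ) ^ a)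

theorem pw_add (a b : ℝ) : pw (a + b) = pw a * pw b := by
  rw [pw, pw, pw, Real.rpow_add two_pos, ENNReal.ofReal_mul (by positivity)]

@[simp] theorem pw_zero : pw 0 = 1 := by simp [pw]

theorem pw_ne_top (a : ℝ) : pw a ≠ ∞ := ENNReal.ofReal_ne_top

theorem pw_ne_zero (a : ℝ) : pw a ≠ 0 := by
  rw [pw, Ne, ENNReal.ofReal_eq_zero, not_le]; positivity

theorem pw_mono {a b : ℝ} (h : a ≤ b) : pw a ≤ pw b :=
  ENNReal.ofReal_le_ofReal (Real.rpow_le_rpow_of_exponent_le one_le_two h)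

theorem pw_intCast (k : ℤ) : pw k = ENNReal.ofReal ((2 : ℝ) ^ k) := by
  rw [pw, Real.rpow_intCast]

/-- The `L¹` norm of the kernel of `m(D)`. -/
def kerL1 (m : 𝓢(Space N, ℂ)) : ℝ≥0∞ := ∫⁻ z, ‖(𝓕⁻ m : 𝓢(Space N, ℂ)) z‖ₑ

/-- The `L²` norm of the kernel of `m(D)`. -/
def kerL2 (m : 𝓢(Space N, ℂ)) : ℝ≥0∞ := eLpNorm (𝓕⁻ m : 𝓢(Space N, ℂ)) 2

/-- The first moment of the kernel of `m(D)`. -/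
def kerM1 (m : 𝓢(Space N, ℂ)) : ℝ≥0∞ := ∫⁻ z, ‖z‖ₑ * ‖(𝓕⁻ m : 𝓢(Space N, ℂ)) z‖ₑ

theorem kerL1_ne_top (m : 𝓢(Space N, ℂ)) : kerL1 m ≠ ∞ := by
  have h : Integrable (𝓕⁻ m : 𝓢(Space N, ℂ)) volume := SchwartzMap.integrable _
  exact h.2.ne

theorem kerL2_ne_top (m : 𝓢(Space N, ℂ)) : kerL2 m ≠ ∞ :=
  (SchwartzMap.memLp (𝓕⁻ m : 𝓢(Space N, ℂ)) 2 volume).2.ne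

theorem kerM1_ne_top (m : 𝓢(Space N, ℂ)) : kerM1 m ≠ ∞ := by
  have h := ((𝓕⁻ m : 𝓢(Space N, ℂ)).integrable_pow_mul volume 1).2
  have e : ∀ z : Space N, ‖‖z‖ ^ 1 * ‖(𝓕⁻ m : 𝓢(Space N, ℂ)) z‖‖ₑ =
      ‖z‖ₑ * ‖(𝓕⁻ m : 𝓢(Space N, ℂ)) z‖ₑ := fun z => by
    rw [pow_one, enorm_mul, enorm_norm, enorm_norm]
  rw [HasFiniteIntegral] at h
  simp_rw [e] at h
  exact h.ne

theorem kerL1_smul (c : ℂ) (m : 𝓢(Space N, ℂ)) : kerL1 (c • m) = ‖c‖ₑ * kerL1 m := by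
  rw [kerL1, kerL1, ← lintegral_const_mul' _ _ enorm_ne_top, FourierTransform.fourierInv_smul]
  simp [enorm_mul]

theorem kerL2_smul (c : ℂ) (m : 𝓢(Space N, ℂ)) : kerL2 (c • m) = ‖c‖ₑ * kerL2 m := by
  rw [kerL2, kerL2, FourierTransform.fourierInv_smul]
  exact eLpNorm_const_smul c _ _ _

theorem enorm_two_zpow (k : ℤ) : ‖(2 : ℂ) ^ k‖ₑ = pw k := by
  rw [pw_intCast, ← ofReal_norm, norm_zpow]; norm_num

theorem enorm_two_zpow_pow (k : ℤ) : ‖((2 : ℂ) ^ k) ^ N‖ₑ = pw (k * N) := by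
  rw [enorm_pow, enorm_two_zpow, pw, pw, ← ENNReal.ofReal_pow (by positivity),
    Real.rpow_mul (by norm_num), Real.rpow_natCast]

theorem ofReal_zpow_pow_inv (k : ℤ) :
    ENNReal.ofReal ((((2 : ℝ) ^ k) ^ N)⁻¹) = pw (-(k * N)) := by
  rw [pw, Real.rpow_neg (by norm_num), Real.rpow_mul (by norm_num), Real.rpow_natCast,
    Real.rpow_intCast]

theorem kerL1_dil (k : ℤ) (m : 𝓢(Space N, ℂ)) : kerL1 (dil k m) = kerL1 m := by
  have := lintegral_comp_smul (fun z => ‖(𝓕⁻ m : 𝓢(Space N, ℂ)) z‖ₑ)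
    (r := (2 : ℝ) ^ k) (by positivity)
  simp only [kerL1, fourierInv_dil, enorm_mul]
  rw [lintegral_const_mul' _ _ enorm_ne_top, this, enorm_two_zpow_pow, ofReal_zpow_pow_inv,
    ← mul_assoc, ← pw_add]
  simp

theorem kerM1_dil (k : ℤ) (m : 𝓢(Space N, ℂ)) : kerM1 (dil k m) = pw (-k) * kerM1 m := by
  have := lintegral_comp_smul (fun z => ‖z‖ₑ * ‖(𝓕⁻ m : 𝓢(Space N, ℂ)) z‖ₑ)
    (r := (2 : ℝ) ^ k) (by positivity)
  have e : ∀ z : Space N, ‖z‖ₑ * (‖((2 : ℂ) ^ k) ^ N‖ₑ * ‖(𝓕⁻ m : 𝓢(Space N, ℂ)) ((2 : ℝ) ^ k • z)‖ₑ)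
      = (‖((2 : ℂ) ^ k) ^ N‖ₑ * pw (-k)) *
        (‖(2 : ℝ) ^ k • z‖ₑ * ‖(𝓕⁻ m : 𝓢(Space N, ℂ)) ((2 : ℝ) ^ k • z)‖ₑ) := by
    intro z
    have h2 : ‖(2 : ℝ) ^ k‖ₑ = pw k := by
      rw [pw_intCast, Real.enorm_of_nonneg (by positivity)]
    have h3 : pw (-k) * pw k = 1 := by rw [← pw_add]; simp
    rw [enorm_smul, h2]
    calc _ = (pw (-k) * pw k) * (‖z‖ₑ * (‖((2 : ℂ) ^ k) ^ N‖ₑ *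
        ‖(𝓕⁻ m : 𝓢(Space N, ℂ)) ((2 : ℝ) ^ k • z)‖ₑ)) := by rw [h3, one_mul]
      _ = _ := by ring
  simp only [kerM1, fourierInv_dil, enorm_mul, e]
  rw [lintegral_const_mul' _ _ (ENNReal.mul_ne_top enorm_ne_top (pw_ne_top _)), this,
    enorm_two_zpow_pow, ofReal_zpow_pow_inv, mul_comm (pw (k * N)), mul_assoc, ← mul_assoc (pw (k * N)),
    ← pw_add (k * N)]
  simp

theorem kerL2_dil (k : ℤ) (m : 𝓢(Space N, ℂ)) :
    kerL2 (dil k m) = pw (k * (N / 2)) * kerL2 m := by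
  have := lintegral_comp_smul (fun z => ‖(𝓕⁻ m : 𝓢(Space N, ℂ)) z‖ₑ ^ (2 : ℝ))
    (r := (2 : ℝ) ^ k) (by positivity)
  have e : ∀ z : Space N, ‖(𝓕⁻ (dil k m) : 𝓢(Space N, ℂ)) z‖ₑ ^ (2 : ℝ) =
      pw (k * N) ^ (2 : ℝ) * ‖(𝓕⁻ m : 𝓢(Space N, ℂ)) ((2 : ℝ) ^ k • z)‖ₑ ^ (2 : ℝ) := by
    intro z
    rw [fourierInv_dil, enorm_mul, enorm_two_zpow_pow, ENNReal.mul_rpow_of_nonneg _ _ zero_le_two]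
  rw [kerL2, eLpNorm_two_eq, kerL2, eLpNorm_two_eq]
  simp_rw [e]
  rw [lintegral_const_mul' _ _ (by simp [pw_ne_top]), this, ofReal_zpow_pow_inv, ← mul_assoc,
    ENNReal.mul_rpow_of_nonneg _ _ (by norm_num)]
  congr 1
  have h2 : pw (k * N) ^ (2 : ℝ) = pw (k * N * 2) := by
    rw [pw, pw, ENNReal.ofReal_rpow_of_pos (by positivity), ← Real.rpow_mul (by norm_num)]
  rw [h2, ← pw_add, pw, pw, ENNReal.ofReal_rpow_of_pos (by positivity), ← Real.rpow_mul (by norm_num)]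
  congr 2; ring

end Young

/-! ### Convolution with square integrable functions -/

section Convolution

set_option linter.unusedSectionVars false

variable {N : ℕ} {V : Type*} [NormedAddCommGroup V] [NormedSpace ℂ V]

/-- The function `m(D) w` for a square integrable function `w`. -/
def mconv (m : 𝓢(Space N, ℂ)) (w : Space N → V) (x : Space N) : V := ∫ y, kernelAt m x y • w y

theorem enorm_mconv_le (m : 𝓢(Space N, ℂ)) (w : Space N → V) (x : Space N) :
    ‖mconv m w x‖ₑ ≤ ∫⁻ y, ‖(𝓕⁻ m : 𝓢(Space N, ℂ)) (x - y)‖ₑ * ‖w y‖ₑ := by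
  refine (enorm_integral_le_lintegral_enorm _).trans_eq ?_
  simp [enorm_smul]

theorem lintegral_shift_mul_le (a : 𝓢(Space N, ℂ)) {w : Space N → V}
    (hw : AEStronglyMeasurable w) (x : Space N) :
    ∫⁻ y, ‖a (x - y)‖ₑ * ‖w y‖ₑ ≤ eLpNorm a 2 * eLpNorm w 2 := by
  have hm : AEMeasurable fun y => ‖a (x - y)‖ₑ :=
    ((a.continuous.comp (continuous_const.sub continuous_id)).measurable.enorm).aemeasurable
  refine (ENNReal.lintegral_mul_le_Lp_mul_Lq volume Real.HolderConjugate.two_two hm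
    hw.enorm).trans_eq ?_
  rw [eLpNorm_two_eq, eLpNorm_two_eq,
    lintegral_sub_left_eq_self (fun y => ‖a y‖ₑ ^ (2 : ℝ)) x]

/-- Bernstein's inequality, from `L²` to `L^∞`. -/
theorem enorm_mconv_le_L2 (m : 𝓢(Space N, ℂ)) {w : Space N → V} (hw : AEStronglyMeasurable w)
    (x : Space N) : ‖mconv m w x‖ₑ ≤ kerL2 m * eLpNorm w 2 :=
  (enorm_mconv_le m w x).trans (lintegral_shift_mul_le _ hw x)

theorem eLpNorm_mconv_le (m : 𝓢(Space N, ℂ)) {w : Space N → V} (hw : AEStronglyMeasurable w) :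
    eLpNorm (mconv m w) 2 ≤ kerL1 m * eLpNorm w 2 :=
  eLpNorm_le_of_le_conv (a := fun z => ‖(𝓕⁻ m : 𝓢(Space N, ℂ)) z‖ₑ)
    (SchwartzMap.continuous _).measurable.enorm hw (enorm_mconv_le m w)

/-- Bernstein's inequality, from `L¹` to `L²`. -/
theorem eLpNorm_mconv_le' (m : 𝓢(Space N, ℂ)) {w : Space N → V} (hw : StronglyMeasurable w) :
    eLpNorm (mconv m w) 2 ≤ kerL2 m * eLpNorm w 1 := by
  rw [eLpNorm_one_eq_lintegral_enorm]
  exact eLpNorm_le_of_le_conv' (SchwartzMap.continuous _).aestronglyMeasurable hw.enorm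
    (enorm_mconv_le m w)

theorem integrable_kernelAt_smul (m : 𝓢(Space N, ℂ)) {w : Space N → V} (hw : MemLp w 2)
    (x : Space N) : Integrable fun y => kernelAt m x y • w y := by
  refine ⟨(kernelAt m x).continuous.aestronglyMeasurable.smul hw.1, ?_⟩
  rw [HasFiniteIntegral]
  simp only [enorm_smul, kernelAt_apply]
  exact (lintegral_shift_mul_le _ hw.1 x).trans_lt
    (ENNReal.mul_lt_top (kerL2_ne_top m).lt_top hw.2)

theorem mconv_congr {w w' : Space N → V} (h : w =ᵐ[volume] w') (m : 𝓢(Space N, ℂ)) :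
    mconv m w = mconv m w' := by
  ext x
  exact integral_congr_ae (h.mono fun y hy => by simp only [hy])

variable [CompleteSpace V]

theorem mconv_eq_apply (m : 𝓢(Space N, ℂ)) {w : Space N → V} (hw : MemLp w 2) (x : Space N) :
    mconv m w x = Lp.toTemperedDistribution (hw.toLp w) (kernelAt m x) := by
  rw [Lp.toTemperedDistribution_apply]
  exact integral_congr_ae (hw.coeFn_toLp.mono fun y hy => by simp only [hy])

theorem continuous_mconv (m : 𝓢(Space N, ℂ)) {w : Space N → V} (hw : MemLp w 2) :
    Continuous (mconv m w) := by
  have : mconv m w = fun x => Lp.toTemperedDistribution (hw.toLp w) (kernelAt m x) := by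
    ext x; exact mconv_eq_apply m hw x
  rw [this]
  exact continuous_apply_reflAt _ _

theorem hasLineDerivAt_mconv (m : 𝓢(Space N, ℂ)) {w : Space N → V} (hw : MemLp w 2)
    (x v : Space N) : HasLineDerivAt ℝ (mconv m w) (mconv (derivSym v m) w x) x v := by
  have : mconv m w = fun x => Lp.toTemperedDistribution (hw.toLp w) (kernelAt m x) := by
    ext x; exact mconv_eq_apply m hw x
  rw [mconv_eq_apply _ hw, this, apply_kernelAt_derivSym]
  exact hasLineDerivAt_apply_reflAt _ _ x v

theorem memLp_schwartz (a : 𝓢(Space N, ℂ)) : MemLp a 2 volume := SchwartzMap.memLp a 2 volume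

theorem integrable_conv_kernel {p : Space N → ℂ} (hp : Integrable p) (a : 𝓢(Space N, ℂ))
    {w : Space N → V} (hw : MemLp w 2) :
    Integrable (Function.uncurry fun x z : Space N => p x • (a (x - z) • w z))
      (volume.prod volume) := by
  have h1 : ∫⁻ x, ‖p x‖ₑ < ∞ := hp.2
  have h2 : eLpNorm a 2 < ∞ := (memLp_schwartz a).2
  have h3 : eLpNorm w 2 < ∞ := hw.2
  refine ⟨?_, ?_⟩
  · exact (hp.1.comp_quasiMeasurePreserving Measure.quasiMeasurePreserving_fst).smul
      ((a.continuous.comp (continuous_fst.sub continuous_snd)).aestronglyMeasurable.smul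
        (hw.1.comp_quasiMeasurePreserving Measure.quasiMeasurePreserving_snd))
  · rw [HasFiniteIntegral]
    refine (lintegral_prod_le _).trans_lt ?_
    simp only [Function.uncurry, enorm_smul]
    calc ∫⁻ x, ∫⁻ z, ‖p x‖ₑ * (‖a (x - z)‖ₑ * ‖w z‖ₑ)
        ≤ ∫⁻ x, ‖p x‖ₑ * (eLpNorm a 2 * eLpNorm w 2) := by
          gcongr with x
          rw [lintegral_const_mul' _ _ enorm_ne_top]
          gcongr
          exact lintegral_shift_mul_le a hw.1 x
      _ = (∫⁻ x, ‖p x‖ₑ) * (eLpNorm a 2 * eLpNorm w 2) := by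
          rw [lintegral_mul_const' _ _ (ENNReal.mul_lt_top h2 h3).ne]
      _ < ∞ := by
          have h4 := ENNReal.mul_lt_top h2 h3
          exact ENNReal.mul_lt_top h1 h4

theorem integral_smul_conv {p : Space N → ℂ} (hp : Integrable p) (a : 𝓢(Space N, ℂ))
    {w : Space N → V} (hw : MemLp w 2) :
    ∫ x, p x • ∫ z, a (x - z) • w z = ∫ z, (∫ x, p x * a (x - z)) • w z := by
  simp_rw [← integral_smul]
  rw [integral_integral_swap (integrable_conv_kernel hp a hw)]
  refine integral_congr_ae (Eventually.of_forall fun z => ?_)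
  simp only [← smul_assoc, smul_eq_mul]
  exact integral_smul_const _ _

/-- Composition of two Fourier multipliers at the level of kernels. -/
theorem integral_kernelAt_mul_fourierInv (m m' : 𝓢(Space N, ℂ)) (x z : Space N) :
    ∫ y, kernelAt m x y * (𝓕⁻ m' : 𝓢(Space N, ℂ)) (y - z) =
      (𝓕⁻ (symMul m m') : 𝓢(Space N, ℂ)) (x - z) := by
  have h1 : (𝓕⁻ (symMul m m') : 𝓢(Space N, ℂ)) =
      SchwartzMap.convolution (ContinuousLinearMap.mul ℂ ℂ) (𝓕⁻ m) (𝓕⁻ m') := by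
    have : symMul m m' = 𝓕 (SchwartzMap.convolution (ContinuousLinearMap.mul ℂ ℂ)
        (𝓕⁻ m) (𝓕⁻ m') : 𝓢(Space N, ℂ)) := by
      rw [SchwartzMap.fourier_convolution]
      ext ξ
      rw [symMul_apply, SchwartzMap.pairing_apply_apply]
      simp
    rw [this, FourierTransform.fourierInv_fourier_eq]
  rw [h1, SchwartzMap.convolution_apply, convolution_eq_swap,
    ← integral_add_right_eq_self _ z]
  refine integral_congr_ae (Eventually.of_forall fun y => ?_)
  simp only [kernelAt_apply, add_sub_cancel_right, ContinuousLinearMap.mul_apply']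
  congr 2
  abel

theorem mconv_mconv (m m' : 𝓢(Space N, ℂ)) {w : Space N → V} (hw : MemLp w 2) (x : Space N) :
    mconv m (mconv m' w) x = mconv (symMul m m') w x := by
  rw [mconv, mconv]
  have := integral_smul_conv (kernelAt m x).integrable (𝓕⁻ m') hw
  simp only [integral_kernelAt_mul_fourierInv] at this
  simp only [mconv, kernelAt_apply] at this ⊢
  exact this

theorem fourier_shift (a : 𝓢(Space N, ℂ)) (z ξ : Space N) :
    (𝓕 (a.compSubConstCLM ℂ z) : 𝓢(Space N, ℂ)) ξ =
      (Real.fourierChar (-inner ℝ z ξ) : ℂ) * (𝓕 a : 𝓢(Space N, ℂ)) ξ := by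
  rw [SchwartzMap.fourier_coe, SchwartzMap.fourier_coe, Real.fourier_eq, Real.fourier_eq,
    ← integral_const_mul, ← integral_add_right_eq_self _ z]
  refine integral_congr_ae (Eventually.of_forall fun y => ?_)
  simp only [SchwartzMap.compSubConstCLM_apply, add_sub_cancel_right, Circle.smul_def,
    smul_eq_mul]
  rw [inner_add_left, neg_add, AddChar.map_add_eq_mul, Circle.coe_mul]
  ring

/-- Integrating a test function against the kernel of `m(D)` in its output variable gives the
transposed multiplier. -/
theorem integral_mul_kernel (η m : 𝓢(Space N, ℂ)) (z : Space N) :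
    ∫ x, η x * (𝓕⁻ m : 𝓢(Space N, ℂ)) (x - z) =
      (𝓕 (symMul m (𝓕⁻ η)) : 𝓢(Space N, ℂ)) z := by
  have h1 := SchwartzMap.integral_fourierInv_smul_eq η
    (𝓕 ((𝓕⁻ m : 𝓢(Space N, ℂ)).compSubConstCLM ℂ z))
  rw [FourierTransform.fourierInv_fourier_eq] at h1
  simp only [SchwartzMap.compSubConstCLM_apply, smul_eq_mul] at h1
  rw [← h1, SchwartzMap.fourier_coe (symMul m (𝓕⁻ η)), Real.fourier_eq]
  refine integral_congr_ae (Eventually.of_forall fun ξ => ?_)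
  simp only [fourier_shift, symMul_apply, Circle.smul_def, smul_eq_mul]
  rw [FourierTransform.fourier_fourierInv_eq (F := 𝓢(Space N, ℂ)) m, real_inner_comm]
  ring

theorem integral_smul_mconv (η m : 𝓢(Space N, ℂ)) {w : Space N → V} (hw : MemLp w 2) :
    ∫ x, η x • mconv m w x = ∫ z, (𝓕 (symMul m (𝓕⁻ η)) : 𝓢(Space N, ℂ)) z • w z := by
  have := integral_smul_conv η.integrable (𝓕⁻ m) hw
  simp only [integral_mul_kernel] at this
  simp only [mconv, kernelAt_apply]
  exact this

end Convolution

/-! ### Frequency localisation of products -/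

section Products

set_option linter.unusedSectionVars false

variable {N : ℕ} {V : Type*} [NormedAddCommGroup V] [NormedSpace ℂ V]

theorem fourierInv_shift_eq_zero (m : 𝓢(Space N, ℂ)) (z ξ : Space N) (h : m (-ξ) = 0) :
    (𝓕⁻ ((𝓕⁻ m : 𝓢(Space N, ℂ)).compSubConstCLM ℂ z) : 𝓢(Space N, ℂ)) ξ = 0 := by
  rw [SchwartzMap.fourierInv_apply_eq]
  simp only [SchwartzMap.compCLMOfContinuousLinearEquiv_apply, Function.comp_apply,
    LinearIsometryEquiv.coe_toContinuousLinearEquiv, LinearIsometryEquiv.coe_neg]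
  rw [fourier_shift, FourierTransform.fourier_fourierInv_eq (F := 𝓢(Space N, ℂ)) m, h, mul_zero]

/-- A product of functions with symbols `m₁` and `m₂` has its spectrum in the sum of their supports.
The functions are taken as translates of the kernels, superpositions of which give all others. -/
theorem integral_triple_kernel_eq_zero (m₀ m₁ m₂ : 𝓢(Space N, ℂ))
    (h : ∀ ξ ζ, m₁ ξ ≠ 0 → m₂ ζ ≠ 0 → m₀ (ξ + ζ) = 0) (x y z : Space N) :
    ∫ t, kernelAt m₀ x t * (𝓕⁻ m₁ : 𝓢(Space N, ℂ)) (t - y) * (𝓕⁻ m₂ : 𝓢(Space N, ℂ)) (t - z)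
      = 0 := by
  set A : 𝓢(Space N, ℂ) := (𝓕⁻ m₁ : 𝓢(Space N, ℂ)).compSubConstCLM ℂ y with hA
  set B : 𝓢(Space N, ℂ) := (𝓕⁻ m₂ : 𝓢(Space N, ℂ)).compSubConstCLM ℂ z with hB
  have hAB : symMul A B = 𝓕 (SchwartzMap.convolution (ContinuousLinearMap.mul ℂ ℂ)
      (𝓕⁻ A) (𝓕⁻ B) : 𝓢(Space N, ℂ)) := by
    rw [SchwartzMap.fourier_convolution]
    ext ξ
    rw [symMul_apply, SchwartzMap.pairing_apply_apply]
    simp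
  have h1 := SchwartzMap.integral_fourier_smul_eq (SchwartzMap.convolution
    (ContinuousLinearMap.mul ℂ ℂ) (𝓕⁻ A) (𝓕⁻ B) : 𝓢(Space N, ℂ)) (kernelAt m₀ x)
  rw [← hAB] at h1
  have h2 : ∀ t, kernelAt m₀ x t * (𝓕⁻ m₁ : 𝓢(Space N, ℂ)) (t - y) *
      (𝓕⁻ m₂ : 𝓢(Space N, ℂ)) (t - z) = symMul A B t • kernelAt m₀ x t := by
    intro t
    rw [symMul_apply, hA, hB, SchwartzMap.compSubConstCLM_apply, SchwartzMap.compSubConstCLM_apply,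
      smul_eq_mul]
    ring
  simp_rw [h2]
  rw [h1]
  refine integral_eq_zero_of_ae (Eventually.of_forall fun ξ => ?_)
  simp only [Pi.zero_apply, smul_eq_mul]
  by_cases h0 : m₀ (-ξ) = 0
  · have : (𝓕 (kernelAt m₀ x) : 𝓢(Space N, ℂ)) ξ = 0 := by
      have h3 : (𝓕 (kernelAt m₀ x) : 𝓢(Space N, ℂ)) ξ = (𝓕⁻ (kernelAt m₀ x) : 𝓢(Space N, ℂ)) (-ξ) := by
        rw [SchwartzMap.fourierInv_apply_eq]
        simp
      rw [h3, fourierInv_kernelAt, h0, mul_zero]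
    rw [this, mul_zero]
  · rw [SchwartzMap.convolution_apply]
    have : convolution (⇑(𝓕⁻ A : 𝓢(Space N, ℂ))) (⇑(𝓕⁻ B : 𝓢(Space N, ℂ)))
        (ContinuousLinearMap.mul ℂ ℂ) volume ξ = 0 := by
      refine integral_eq_zero_of_ae (Eventually.of_forall fun t => ?_)
      simp only [ContinuousLinearMap.mul_apply', Pi.zero_apply]
      by_cases h1 : m₁ (-t) = 0
      · rw [hA, fourierInv_shift_eq_zero _ _ _ h1, zero_mul]
      · by_cases h2 : m₂ (-(ξ - t)) = 0
        · rw [hB, fourierInv_shift_eq_zero _ _ _ h2, mul_zero]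
        · exact absurd (by have := h _ _ h1 h2; rwa [show -t + -(ξ - t) = -ξ by abel] at this) h0
    rw [this, zero_mul]

variable [CompleteSpace V]

/-- The product of two spectrally localised functions has no frequencies outside of the sum of
the two spectra. -/
theorem integral_kernelAt_mul_mconv_eq_zero (m₀ m₁ m₂ : 𝓢(Space N, ℂ))
    (h : ∀ ξ ζ, m₁ ξ ≠ 0 → m₂ ζ ≠ 0 → m₀ (ξ + ζ) = 0) {v : Space N → ℂ} (hv : MemLp v 2)
    {w : Space N → V} (hw : MemLp w 2) (x : Space N) :
    ∫ t, kernelAt m₀ x t • mconv m₁ v t • mconv m₂ w t = 0 := by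
  have hint : ∀ (a : 𝓢(Space N, ℂ)), Integrable fun t => kernelAt m₀ x t * a t := fun a => by
    have := (symMul (kernelAt m₀ x) a).integrable (μ := volume)
    exact this.congr (Eventually.of_forall fun t => symMul_apply _ _ t)
  have hp : Integrable fun t => kernelAt m₀ x t * mconv m₁ v t := by
    refine ((kernelAt m₀ x).integrable (μ := volume)).mul_bdd (c := (kerL2 m₁ * eLpNorm v 2).toReal)
      (continuous_mconv m₁ hv).aestronglyMeasurable (Eventually.of_forall fun t => ?_)
    rw [← toReal_enorm]
    exact ENNReal.toReal_mono (ENNReal.mul_ne_top (kerL2_ne_top _) hv.2.ne)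
      (enorm_mconv_le_L2 m₁ hv.1 t)
  have h1 := integral_smul_conv hp (𝓕⁻ m₂) hw
  have h2 : ∀ z, ∫ t, kernelAt m₀ x t * mconv m₁ v t * (𝓕⁻ m₂ : 𝓢(Space N, ℂ)) (t - z) = 0 := by
    intro z
    have h3 := integral_smul_conv (hint ((𝓕⁻ m₂ : 𝓢(Space N, ℂ)).compSubConstCLM ℂ z)) (𝓕⁻ m₁) hv
    simp only [SchwartzMap.compSubConstCLM_apply] at h3
    have h4 : ∀ y, ∫ t, kernelAt m₀ x t * (𝓕⁻ m₂ : 𝓢(Space N, ℂ)) (t - z) *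
        (𝓕⁻ m₁ : 𝓢(Space N, ℂ)) (t - y) = 0 := fun y =>
      integral_triple_kernel_eq_zero m₀ m₂ m₁
        (fun ξ ζ h1 h2 => by rw [add_comm]; exact h ζ ξ h2 h1) x z y
    simp only [h4, zero_smul, integral_zero] at h3
    rw [← h3]
    refine integral_congr_ae (Eventually.of_forall fun t => ?_)
    simp only [mconv, kernelAt_apply, smul_eq_mul]
    ring
  simp only [h2, zero_smul, integral_zero] at h1
  rw [← h1]
  refine integral_congr_ae (Eventually.of_forall fun t => ?_)
  simp only [mconv, kernelAt_apply, smul_smul]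

end Products

/-! ### Dyadic blocks as functions -/

section Blocks

variable {N : ℕ} {φ : 𝓢(Space N, ℝ)}

/-- The dyadic block `Δ_k f` as a smooth function. -/
def blk (φ : 𝓢(Space N, ℝ)) (k : ℤ) (f : 𝓢'(Space N, Vec N)) (x : Space N) : Vec N :=
  f (kernelAt (blockSym φ k) x)

theorem continuous_blk (k : ℤ) (f : 𝓢'(Space N, Vec N)) : Continuous (blk φ k f) :=
  continuous_apply_reflAt f _

theorem exists_lp_of_distLpNorm_ne_top {f : 𝓢'(Space N, Vec N)} (h : distLpNorm 2 f ≠ ∞) :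
    ∃ g : Lp (Vec N) 2 (volume : Measure (Space N)), Lp.toTemperedDistribution g = f := by
  by_contra! hne
  exact h (by simp [distLpNorm, hne])

theorem toTemperedDistribution_injective :
    Function.Injective (fun g : Lp (Vec N) 2 (volume : Measure (Space N)) =>
      Lp.toTemperedDistribution g) := by
  have h := Lp.ker_toTemperedDistributionCLM_eq_bot (F := Vec N) (p := 2)
    (μ := (volume : Measure (Space N)))
  exact LinearMap.ker_eq_bot.1 h

theorem distLpNorm_toTemperedDistribution (g : Lp (Vec N) 2 (volume : Measure (Space N))) :
    distLpNorm 2 (Lp.toTemperedDistribution g) = ‖g‖ₑ := by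
  refine le_antisymm ?_ (le_iInf₂ fun g' h => ?_)
  · rw [distLpNorm]
    exact iInf₂_le (f := fun (g' : Lp (Vec N) 2 (volume : Measure (Space N)))
      (_ : Lp.toTemperedDistribution g' = Lp.toTemperedDistribution g) => ‖g'‖ₑ) g rfl
  · rw [toTemperedDistribution_injective h]

/-- The reproducing formula for a dyadic block with finite `L²` norm. -/
theorem block_representation (hφ : IsDyadicPartition φ) {k : ℤ} {f : 𝓢'(Space N, Vec N)}
    (h : distLpNorm 2 (dyadicBlock φ k f) ≠ ∞) :
    MemLp (blk φ k f) 2 ∧ eLpNorm (blk φ k f) 2 = distLpNorm 2 (dyadicBlock φ k f) ∧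
      ∀ (m : 𝓢(Space N, ℂ)) (x : Space N),
        f (kernelAt (symMul (blockSym φ k) m) x) = mconv m (blk φ k f) x := by
  obtain ⟨g, hg⟩ := exists_lp_of_distLpNorm_ne_top h
  have ha : ∀ (m : 𝓢(Space N, ℂ)) (x : Space N),
      f (kernelAt (symMul (blockSym φ k) m) x) = mconv m g x := fun m x => by
    rw [← dyadicBlock_apply_kernelAt, ← hg, mconv_eq_apply m (Lp.memLp g), Lp.toLp_coeFn]
  have hb : blk φ k f = mconv (fatSym φ k) g := by
    ext1 x
    rw [← ha, symMul_comm, fatSym_mul_blockSym hφ, blk]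
  have hmem : MemLp (blk φ k f) 2 := by
    rw [hb]
    exact ⟨(continuous_mconv _ (Lp.memLp g)).aestronglyMeasurable,
      (eLpNorm_mconv_le _ (Lp.memLp g).1).trans_lt
        (ENNReal.mul_lt_top (kerL1_ne_top _).lt_top (Lp.memLp g).2)⟩
  have hc : hmem.toLp (blk φ k f) = g := by
    refine toTemperedDistribution_injective ?_
    ext1 η
    have h1 : Lp.toTemperedDistribution (hmem.toLp (blk φ k f)) η =
        ∫ x, η x • mconv (fatSym φ k) g x := by
      rw [Lp.toTemperedDistribution_apply, ← hb]
      exact integral_congr_ae (hmem.coeFn_toLp.mono fun y hy => by simp only [hy])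
    dsimp only
    rw [h1, integral_smul_mconv _ _ (Lp.memLp g), ← Lp.toTemperedDistribution_apply, hg,
      dyadicBlock_eq, TemperedDistribution.fourierMultiplierCLM_apply_apply,
      TemperedDistribution.fourierMultiplierCLM_apply_apply,
      FourierTransform.fourierInv_fourier_eq]
    congr 2
    ext ξ
    have := congrArg (fun a : 𝓢(Space N, ℂ) => a ξ) (fatSym_mul_blockSym hφ k)
    simp only [symMul_apply] at this ⊢
    rw [← mul_assoc, mul_comm (blockSym φ k ξ), this]
  have hae : (g : Space N → Vec N) =ᵐ[volume] blk φ k f := by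
    rw [← hc]; exact hmem.coeFn_toLp
  refine ⟨hmem, ?_, fun m x => ?_⟩
  · rw [← hg, distLpNorm_toTemperedDistribution, Lp.enorm_def]
    exact eLpNorm_congr_ae hae.symm
  · rw [ha, mconv_congr hae]

end Blocks

/-! ### Spectrally localised square integrable functions -/

section IsBlock

variable {N : ℕ} {φ : 𝓢(Space N, ℝ)} {V : Type*} [NormedAddCommGroup V] [NormedSpace ℂ V]

/-- The function `w` is square integrable with frequencies of size about `2^l`: it is reproduced
by the enlarged dyadic multiplier. -/
structure IsBlock (φ : 𝓢(Space N, ℝ)) (l : ℤ) (w : Space N → V) : Prop where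
  memLp : MemLp w 2
  eq_mconv : ∀ x, w x = mconv (fatSym φ l) w x

theorem IsBlock.blk (hφ : IsDyadicPartition φ) {k : ℤ} {f : 𝓢'(Space N, Vec N)}
    (h : distLpNorm 2 (dyadicBlock φ k f) ≠ ∞) : IsBlock φ k (blk φ k f) := by
  obtain ⟨h1, -, h2⟩ := block_representation hφ h
  refine ⟨h1, fun x => ?_⟩
  rw [← h2, symMul_comm, fatSym_mul_blockSym hφ]; rfl

theorem mconv_apply_coord (m : 𝓢(Space N, ℂ)) {w : Space N → Vec N} (hw : MemLp w 2) (x : Space N)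
    (i : Fin N) : (mconv m w x) i = mconv m (fun y => w y i) x := by
  have := (EuclideanSpace.proj i : Vec N →L[ℂ] ℂ).integral_comp_comm
    (integrable_kernelAt_smul m hw x)
  simpa [mconv] using this.symm

theorem MemLp.coord {w : Space N → Vec N} (hw : MemLp w 2) (i : Fin N) :
    MemLp (fun y => w y i) 2 :=
  (EuclideanSpace.proj i : Vec N →L[ℂ] ℂ).comp_memLp' hw

theorem IsBlock.coord {l : ℤ} {w : Space N → Vec N} (h : IsBlock φ l w) (i : Fin N) :
    IsBlock φ l (fun y => w y i) :=
  ⟨MemLp.coord h.memLp i, fun x => by rw [← mconv_apply_coord _ h.memLp, ← h.eq_mconv]⟩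

theorem eLpNorm_coord_le {w : Space N → Vec N} (i : Fin N) :
    eLpNorm (fun y => w y i) 2 ≤ eLpNorm w 2 := by
  refine eLpNorm_mono fun x => ?_
  exact PiLp.norm_apply_le (w x) i

theorem IsBlock.enorm_le {l : ℤ} {w : Space N → V} (h : IsBlock φ l w)
    (x : Space N) : ‖w x‖ₑ ≤ kerL2 (fatSym φ 0) * pw (l * (N / 2)) * eLpNorm w 2 := by
  rw [h.eq_mconv]
  refine (enorm_mconv_le_L2 _ h.memLp.1 x).trans_eq ?_
  have : fatSym φ l = dil l (fatSym φ 0) := by rw [dil_fatSym, add_zero]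
  rw [this, kerL2_dil]
  ring

/-- The derivative of a block. -/
def dblk (φ : 𝓢(Space N, ℝ)) (l : ℤ) (v : Space N) (w : Space N → V) : Space N → V :=
  mconv (derivSym v (fatSym φ l)) w

theorem derivSym_fatSym (v : Space N) (l : ℤ) :
    derivSym v (fatSym φ l) = (2 : ℂ) ^ l • dil l (derivSym v (fatSym φ 0)) := by
  rw [← derivSym_dil, dil_fatSym, add_zero]

theorem eLpNorm_dblk_le {l : ℤ} {w : Space N → V} (h : MemLp w 2) (v : Space N) :
    eLpNorm (dblk φ l v w) 2 ≤ kerL1 (derivSym v (fatSym φ 0)) * pw l * eLpNorm w 2 := by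
  refine (eLpNorm_mconv_le _ h.1).trans_eq ?_
  rw [derivSym_fatSym, kerL1_smul, kerL1_dil, enorm_two_zpow]
  ring

theorem enorm_dblk_le {l : ℤ} {w : Space N → V} (h : MemLp w 2) (v x : Space N) :
    ‖dblk φ l v w x‖ₑ ≤
      kerL2 (derivSym v (fatSym φ 0)) * pw (l * (1 + N / 2)) * eLpNorm w 2 := by
  refine (enorm_mconv_le_L2 _ h.1 x).trans_eq ?_
  rw [derivSym_fatSym, kerL2_smul, kerL2_dil, enorm_two_zpow, mul_add, pw_add, mul_one]
  ring

variable [CompleteSpace V]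

theorem IsBlock.continuous {l : ℤ} {w : Space N → V} (h : IsBlock φ l w) : Continuous w := by
  rw [funext h.eq_mconv]; exact continuous_mconv _ h.memLp

theorem IsBlock.hasLineDerivAt {l : ℤ} {w : Space N → V} (h : IsBlock φ l w) (x v : Space N) :
    HasLineDerivAt ℝ w (dblk φ l v w x) x v := by
  have := hasLineDerivAt_mconv (fatSym φ l) h.memLp x v
  rwa [← funext h.eq_mconv] at this

end IsBlock

/-! ### The commutator of a dyadic block with a transport operator -/

section Lipschitz

variable {N : ℕ} {V : Type*} [NormedAddCommGroup V] [NormedSpace ℝ V]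

theorem norm_sub_le_of_hasLineDerivAt {f f' : Space N → V} {x y : Space N} {C : ℝ}
    (h : ∀ z, HasLineDerivAt ℝ f (f' z) z (y - x)) (hC : ∀ z, ‖f' z‖ ≤ C) :
    ‖f y - f x‖ ≤ C := by
  have hd : ∀ t : ℝ, HasDerivAt (fun r : ℝ => f (x + r • (y - x))) (f' (x + t • (y - x))) t := by
    intro t
    have h1 : HasDerivAt (fun r : ℝ => f (x + t • (y - x) + r • (y - x)))
      (f' (x + t • (y - x))) (t - t) := by rw [sub_self]; exact h _
    have h2 := HasDerivAt.scomp (h := fun r : ℝ => r - t) t h1 ((hasDerivAt_id t).sub_const t)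
    rw [one_smul] at h2
    refine h2.congr_of_eventuallyEq (Eventually.of_forall fun r => ?_)
    simp only [Function.comp]
    congr 1
    rw [sub_smul]; abel
  have := norm_image_sub_le_of_norm_deriv_le_segment_01' (f := fun r : ℝ => f (x + r • (y - x)))
    (fun t _ => (hd t).hasDerivWithinAt) (fun t _ => hC (x + t • (y - x)))
  simpa using this

end Lipschitz

section Commutator

set_option linter.unusedSectionVars false

variable {N : ℕ} {φ : 𝓢(Space N, ℝ)} {V : Type*} [NormedAddCommGroup V] [NormedSpace ℂ V]

theorem derivSym_eq_sum (v : Space N) (m : 𝓢(Space N, ℂ)) :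
    derivSym v m = ∑ i, (v i : ℂ) • derivSym (basisVec i) m := by
  ext ξ
  rw [sum_apply]
  have h : ∀ i, inner ℝ ξ (basisVec i) = ξ i := fun i => by
    simp [basisVec, EuclideanSpace.inner_single_right]
  simp only [smul_apply, derivSym_apply, smul_eq_mul, h]
  simp only [PiLp.inner_apply, Complex.ofReal_sum, Finset.mul_sum, Finset.sum_mul]
  refine Finset.sum_congr rfl fun i _ => ?_
  simp
  ring

/-- The constant in Bernstein's inequality for gradients of blocks. -/
def gradConst (φ : 𝓢(Space N, ℝ)) : ℝ≥0∞ := ∑ i, kerL2 (derivSym (basisVec i) (fatSym φ 0))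

theorem gradConst_ne_top : gradConst φ ≠ ∞ :=
  (ENNReal.sum_lt_top.2 fun _ _ => (kerL2_ne_top _).lt_top).ne

theorem kerL2_derivSym_le (v : Space N) :
    kerL2 (derivSym v (fatSym φ 0)) ≤ ‖v‖ₑ * gradConst φ := by
  have h : (𝓕⁻ (derivSym v (fatSym φ 0)) : 𝓢(Space N, ℂ)) =
      ∑ i, (v i : ℂ) • (𝓕⁻ (derivSym (basisVec i) (fatSym φ 0)) : 𝓢(Space N, ℂ)) := by
    rw [derivSym_eq_sum]
    simp
  have h' : (⇑(𝓕⁻ (derivSym v (fatSym φ 0)) : 𝓢(Space N, ℂ)) : Space N → ℂ) =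
      ∑ i, (v i : ℂ) • ⇑(𝓕⁻ (derivSym (basisVec i) (fatSym φ 0)) : 𝓢(Space N, ℂ)) := by
    rw [h]; ext z; simp
  rw [kerL2, h', gradConst, Finset.mul_sum]
  refine (eLpNorm_sum_le (fun i _ => ((SchwartzMap.continuous _).aestronglyMeasurable).const_smul _)
    one_le_two).trans ?_
  gcongr with i
  rw [eLpNorm_const_smul]
  gcongr
  · rw [← ofReal_norm, ← ofReal_norm]
    refine ENNReal.ofReal_le_ofReal ?_
    rw [Complex.norm_real]
    exact PiLp.norm_apply_le v i
  · rfl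

theorem IsBlock.enorm_sub_le [CompleteSpace V] {l : ℤ} {w : Space N → V} (h : IsBlock φ l w)
    (x y : Space N) : ‖w y - w x‖ₑ ≤
      gradConst φ * pw (l * (1 + N / 2)) * eLpNorm w 2 * ‖y - x‖ₑ := by
  have h1 : ∀ z, ‖dblk φ l (y - x) w z‖ₑ ≤
      gradConst φ * pw (l * (1 + N / 2)) * eLpNorm w 2 * ‖y - x‖ₑ := fun z => by
    refine (enorm_dblk_le h.memLp (y - x) z).trans ?_
    calc _ ≤ (‖y - x‖ₑ * gradConst φ) * pw (l * (1 + N / 2)) * eLpNorm w 2 := by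
          gcongr; exact kerL2_derivSym_le _
      _ = _ := by ring
  have htop : gradConst φ * pw (l * (1 + N / 2)) * eLpNorm w 2 * ‖y - x‖ₑ ≠ ∞ :=
    ENNReal.mul_ne_top (ENNReal.mul_ne_top (ENNReal.mul_ne_top gradConst_ne_top (pw_ne_top _))
      h.memLp.2.ne) enorm_ne_top
  have := norm_sub_le_of_hasLineDerivAt (fun z => h.hasLineDerivAt z (y - x)) (fun z => by
    rw [← toReal_enorm]; exact ENNReal.toReal_mono htop (h1 z))
  rw [← ofReal_norm]
  exact ENNReal.ofReal_le_of_le_toReal this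

/-- The commutator `[h_k *, v] z`, `h_k` being the kernel of the dyadic block. -/
def comm (φ : 𝓢(Space N, ℝ)) (k : ℤ) (v : Space N → ℂ) (z : Space N → V) (x : Space N) : V :=
  ∫ y, kernelAt (blockSym φ k) x y • (v y - v x) • z y

theorem blockSym_eq_dil (φ : 𝓢(Space N, ℝ)) (k : ℤ) : blockSym φ k = dil k (blockSym φ 0) := by
  rw [dil_blockSym, add_zero]

/-- The commutator gains one derivative on Lipschitz functions. -/
theorem eLpNorm_comm_le_of_lipschitz (k : ℤ) {v : Space N → ℂ} {z : Space N → V}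
    (hz : AEStronglyMeasurable z) {L : ℝ≥0∞} (hL : L ≠ ∞) (hv : ∀ x y, ‖v y - v x‖ₑ ≤ L * ‖y - x‖ₑ) :
    eLpNorm (comm φ k v z) 2 ≤ L * pw (-k) * kerM1 (blockSym φ 0) * eLpNorm z 2 := by
  have h := eLpNorm_le_of_le_conv (F := comm φ k v z) (w := z)
    (a := fun t => L * (‖t‖ₑ * ‖(𝓕⁻ (blockSym φ k) : 𝓢(Space N, ℂ)) t‖ₑ))
    ((measurable_enorm.mul (SchwartzMap.continuous _).measurable.enorm).const_mul L) hz
    (fun x => by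
      refine (enorm_integral_le_lintegral_enorm _).trans ?_
      gcongr with y
      rw [enorm_smul, enorm_smul, kernelAt_apply]
      calc _ ≤ ‖(𝓕⁻ (blockSym φ k) : 𝓢(Space N, ℂ)) (x - y)‖ₑ * (L * ‖y - x‖ₑ * ‖z y‖ₑ) := by
            gcongr; exact hv x y
        _ = _ := by rw [← neg_sub x y, enorm_neg]; ring)
  rw [lintegral_const_mul' _ _ hL] at h
  refine h.trans_eq ?_
  change L * kerM1 (blockSym φ k) * _ = _
  rw [blockSym_eq_dil, kerM1_dil]
  ring

theorem comm_eq_sub (k : ℤ) {v : Space N → ℂ} (hv : AEStronglyMeasurable v) {B : ℝ}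
    (hB : ∀ x, ‖v x‖ ≤ B) {z : Space N → V} (hz : MemLp z 2) (x : Space N) :
    comm φ k v z x = mconv (blockSym φ k) (fun y => v y • z y) x - v x • mconv (blockSym φ k) z x := by
  have h1 := integrable_kernelAt_smul (blockSym φ k) hz x
  have h2 : Integrable fun y => v y • kernelAt (blockSym φ k) x y • z y :=
    h1.bdd_smul B hv (Eventually.of_forall hB)
  have h2' : Integrable fun y => kernelAt (blockSym φ k) x y • v y • z y :=
    h2.congr (Eventually.of_forall fun y => smul_comm _ _ _)
  have h3 : Integrable fun y => v x • kernelAt (blockSym φ k) x y • z y := h1.smul (v x)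
  rw [comm, mconv, mconv, ← integral_smul, ← integral_sub h2' h3]
  refine integral_congr_ae (Eventually.of_forall fun y => ?_)
  simp only [sub_smul, smul_sub]
  rw [smul_comm (v x)]

attribute [irreducible] pw kerL1 kerL2 kerM1 gradConst

/-- A product of blocks of indices `a` and `b`, `a` much smaller than `b`, has frequencies of size
`2 ^ b` only. -/
theorem blockSym_add_eq_zero_of_far (hφ : IsDyadicPartition φ) {k a b : ℤ} (hab : a + 5 ≤ b)
    (hk : b + 3 ≤ k ∨ k + 4 ≤ b) {ξ ζ : Space N} (hξ : fatSym φ a ξ ≠ 0) (hζ : fatSym φ b ζ ≠ 0) :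
    blockSym φ k (ξ + ζ) = 0 := by
  by_contra hne
  obtain ⟨h1, h2⟩ := blockSym_ne_zero hφ hne
  obtain ⟨h3, h4⟩ := fatSym_ne_zero hφ hξ
  obtain ⟨h5, h6⟩ := fatSym_ne_zero hφ hζ
  have hpi := Real.pi_pos
  have hb : (0 : ℝ) < 2 ^ b := by positivity
  have e1 : (2 : ℝ) ^ (a + 5) ≤ 2 ^ b := zpow_le_zpow_right₀ one_le_two hab
  rw [zpow_add₀ two_ne_zero] at e1
  norm_num at e1
  have t1 : 2 * Real.pi * ‖ξ + ζ‖ ≤ 2 * Real.pi * ‖ξ‖ + 2 * Real.pi * ‖ζ‖ := by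
    rw [← mul_add]; gcongr; exact norm_add_le _ _
  have t2 : 2 * Real.pi * ‖ζ‖ ≤ 2 * Real.pi * ‖ξ + ζ‖ + 2 * Real.pi * ‖ξ‖ := by
    rw [← mul_add]; gcongr
    calc ‖ζ‖ = ‖(ξ + ζ) - ξ‖ := by congr 1; abel
      _ ≤ _ := norm_sub_le _ _
  rcases hk with hk | hk
  · have e2 : (2 : ℝ) ^ (b + 3) ≤ 2 ^ k := zpow_le_zpow_right₀ one_le_two hk
    rw [zpow_add₀ two_ne_zero] at e2
    norm_num at e2
    linarith
  · have e2 : (2 : ℝ) ^ (k + 4) ≤ 2 ^ b := zpow_le_zpow_right₀ one_le_two hk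
    rw [zpow_add₀ two_ne_zero] at e2
    norm_num at e2
    linarith

theorem blockSym_add_eq_zero_of_lt (hφ : IsDyadicPartition φ) {k a b : ℤ} (hab : a ≤ b + 4)
    (hk : b + 7 ≤ k) {ξ ζ : Space N} (hξ : fatSym φ a ξ ≠ 0) (hζ : fatSym φ b ζ ≠ 0) :
    blockSym φ k (ξ + ζ) = 0 := by
  by_contra hne
  obtain ⟨h1, h2⟩ := blockSym_ne_zero hφ hne
  obtain ⟨h3, h4⟩ := fatSym_ne_zero hφ hξ
  obtain ⟨h5, h6⟩ := fatSym_ne_zero hφ hζ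
  have hpi := Real.pi_pos
  have hb : (0 : ℝ) < 2 ^ b := by positivity
  have e1 : (2 : ℝ) ^ a ≤ 2 ^ (b + 4) := zpow_le_zpow_right₀ one_le_two hab
  have e2 : (2 : ℝ) ^ (b + 7) ≤ 2 ^ k := zpow_le_zpow_right₀ one_le_two hk
  rw [zpow_add₀ two_ne_zero] at e1 e2
  norm_num at e1 e2
  have t1 : 2 * Real.pi * ‖ξ + ζ‖ ≤ 2 * Real.pi * ‖ξ‖ + 2 * Real.pi * ‖ζ‖ := by
    rw [← mul_add]; gcongr; exact norm_add_le _ _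
  linarith

theorem symMul_blockSym_derivSym_fatSym_eq_zero (hφ : IsDyadicPartition φ) {k l : ℤ}
    (hk : l + 3 ≤ k ∨ k + 3 ≤ l) (v : Space N) :
    symMul (blockSym φ k) (derivSym v (fatSym φ l)) = 0 := by
  ext ξ
  rw [symMul_apply, derivSym_apply]
  by_contra hne
  have hΦ : blockSym φ k ξ ≠ 0 := fun h => hne (by simp [h])
  have hF : fatSym φ l ξ ≠ 0 := fun h => hne (by simp [h])
  obtain ⟨h1, h2⟩ := blockSym_ne_zero hφ hΦ
  obtain ⟨h3, h4⟩ := fatSym_ne_zero hφ hF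
  have hk0 : (0 : ℝ) < 2 ^ k := by positivity
  have hl0 : (0 : ℝ) < 2 ^ l := by positivity
  rcases hk with hk | hk
  · have e2 : (2 : ℝ) ^ (l + 3) ≤ 2 ^ k := zpow_le_zpow_right₀ one_le_two hk
    rw [zpow_add₀ two_ne_zero] at e2
    norm_num at e2
    linarith
  · have e2 : (2 : ℝ) ^ (k + 3) ≤ 2 ^ l := zpow_le_zpow_right₀ one_le_two hk
    rw [zpow_add₀ two_ne_zero] at e2
    norm_num at e2
    linarith

theorem tsum_le_of_Icc {f : ℤ → ℝ≥0∞} {B : ℝ≥0∞} (a : ℤ) (n : ℕ)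
    (hB : ∀ k ∈ Finset.Icc (a - n) (a + n), f k ≤ B)
    (h0 : ∀ k ∉ Finset.Icc (a - n) (a + n), f k = 0) :
    ∑' k, f k ≤ (2 * n + 1 : ℕ) * B := by
  rw [tsum_eq_sum h0]
  refine (Finset.sum_le_card_nsmul _ _ _ hB).trans_eq ?_
  rw [Int.card_Icc, nsmul_eq_mul]
  congr 2
  omega

theorem tsum_geometric_ne_top {σ : ℝ} (hσ : 0 < σ) : ∑' n : ℕ, pw (-(n * σ)) ≠ ∞ := by
  have h1 : ∀ n : ℕ, pw (-(n * σ)) = (pw (-σ)) ^ n := fun n => by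
    rw [pw, pw, ← ENNReal.ofReal_pow (by positivity), ← Real.rpow_natCast, ← Real.rpow_mul (by norm_num)]
    congr 2; ring
  simp_rw [h1]
  rw [ENNReal.tsum_geometric]
  have : pw (-σ) < 1 := by
    rw [pw, ENNReal.ofReal_lt_one]
    exact Real.rpow_lt_one_of_one_lt_of_neg one_lt_two (by linarith)
  simpa [tsub_eq_zero_iff_le] using this

theorem tsum_le_geometric {f : ℤ → ℝ≥0∞} {B : ℝ≥0∞} {σ : ℝ} (a : ℤ)
    (hB : ∀ k, f k ≤ B * pw (k * σ)) (h0 : ∀ k, a < k → f k = 0) :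
    ∑' k, f k ≤ B * pw (a * σ) * ∑' n : ℕ, pw (-(n * σ)) := by
  have hinj : Function.Injective fun n : ℕ => a - (n : ℤ) := fun m n h => by
    simpa using h
  have hsupp : Function.support f ⊆ Set.range fun n : ℕ => a - (n : ℤ) := fun k hk => by
    refine ⟨(a - k).toNat, ?_⟩
    have : k ≤ a := not_lt.1 fun h => hk (h0 k h)
    dsimp only
    omega
  rw [← hinj.tsum_eq hsupp, ← ENNReal.tsum_mul_left]
  refine ENNReal.tsum_le_tsum fun n => (hB _).trans_eq ?_
  rw [mul_assoc, ← pw_add]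
  congr 2
  push_cast; ring

theorem eLpNorm_two_le_mul {W : Type*} [NormedAddCommGroup W] {f : Space N → V} {g : Space N → W}
    {c : ℝ≥0∞} (hc : c ≠ ∞) (h : ∀ x, ‖f x‖ₑ ≤ c * ‖g x‖ₑ) : eLpNorm f 2 ≤ c * eLpNorm g 2 := by
  rw [eLpNorm_two_eq, eLpNorm_two_eq]
  calc (∫⁻ x, ‖f x‖ₑ ^ (2 : ℝ)) ^ (1 / (2 : ℝ))
      ≤ (∫⁻ x, c ^ (2 : ℝ) * ‖g x‖ₑ ^ (2 : ℝ)) ^ (1 / (2 : ℝ)) := by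
        gcongr with x
        rw [← ENNReal.mul_rpow_of_nonneg _ _ zero_le_two]
        gcongr; exact h x
    _ = _ := by
        rw [lintegral_const_mul' _ _ (ENNReal.rpow_ne_top_of_nonneg zero_le_two hc),
          ENNReal.mul_rpow_of_nonneg _ _ (by norm_num), ← ENNReal.rpow_mul]
        norm_num

theorem eLpNorm_one_smul_le {v : Space N → ℂ} {z : Space N → V} (hv : AEStronglyMeasurable v)
    (hz : AEStronglyMeasurable z) :
    eLpNorm (fun y => v y • z y) 1 ≤ eLpNorm v 2 * eLpNorm z 2 := by
  rw [eLpNorm_one_eq_lintegral_enorm, eLpNorm_two_eq, eLpNorm_two_eq]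
  simp only [enorm_smul]
  exact ENNReal.lintegral_mul_le_Lp_mul_Lq volume Real.HolderConjugate.two_two hv.enorm hz.enorm

theorem pw_mul_le (s : ℝ) {k l : ℤ} {n : ℝ} (h : |(k : ℝ) - l| ≤ n) :
    pw (k * s) ≤ pw (n * |s|) * pw (l * s) := by
  rw [← pw_add]
  refine pw_mono ?_
  have h1 : ((k : ℝ) - l) * s ≤ n * |s| :=
    (le_abs_self _).trans (by rw [abs_mul]; gcongr)
  linarith

variable [CompleteSpace V]

theorem kerL2_basis_le (i : Fin N) : kerL2 (derivSym (basisVec i) (fatSym φ 0)) ≤ gradConst φ := by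
  rw [gradConst]
  exact   Finset.single_le_sum (f := fun i => kerL2 (derivSym (basisVec i) (fatSym φ 0)))
    (fun _ _ => zero_le) (Finset.mem_univ i)

/-- The `L²` constant in Bernstein's inequality for derivatives of blocks. -/
def gradConst' (φ : 𝓢(Space N, ℝ)) : ℝ≥0∞ := ∑ i, kerL1 (derivSym (basisVec i) (fatSym φ 0))

theorem gradConst'_ne_top : gradConst' φ ≠ ∞ :=
  (ENNReal.sum_lt_top.2 fun _ _ => (kerL1_ne_top _).lt_top).ne

theorem eLpNorm_dblk_basis_le {l : ℤ} {w : Space N → V} (h : MemLp w 2) (i : Fin N) :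
    eLpNorm (dblk φ l (basisVec i) w) 2 ≤ gradConst' φ * pw l * eLpNorm w 2 := by
  refine (eLpNorm_dblk_le h _).trans ?_
  gcongr
  exact Finset.single_le_sum (f := fun i => kerL1 (derivSym (basisVec i) (fatSym φ 0)))
    (fun _ _ => zero_le) (Finset.mem_univ i)

theorem enorm_dblk_basis_le {l : ℤ} {w : Space N → V} (h : MemLp w 2) (i : Fin N) (x : Space N) :
    ‖dblk φ l (basisVec i) w x‖ₑ ≤ gradConst φ * pw (l * (1 + N / 2)) * eLpNorm w 2 := by
  refine (enorm_dblk_le h _ x).trans ?_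
  gcongr
  exact kerL2_basis_le i

theorem memLp_dblk {l : ℤ} {w : Space N → V} (h : MemLp w 2) (v : Space N) :
    MemLp (dblk φ l v w) 2 :=
  ⟨(continuous_mconv _ h).aestronglyMeasurable, (eLpNorm_mconv_le _ h.1).trans_lt
    (ENNReal.mul_lt_top (kerL1_ne_top _).lt_top h.2)⟩

theorem eLpNorm_mconv_blockSym_le (k : ℤ) {w : Space N → V} (hw : AEStronglyMeasurable w) :
    eLpNorm (mconv (blockSym φ k) w) 2 ≤ kerL1 (blockSym φ 0) * eLpNorm w 2 := by
  have h : kerL1 (blockSym φ k) = kerL1 (blockSym φ 0) := by rw [blockSym_eq_dil, kerL1_dil]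
  exact h ▸ eLpNorm_mconv_le (blockSym φ k) hw

attribute [irreducible] gradConst'

variable {j l : ℤ} {v : Space N → ℂ} {w : Space N → V}

/-- The part `Δ_k(v ∂_i w)` of the commutator vanishes unless the frequencies can interact. -/
theorem mconv_blockSym_mul_eq_zero (k : ℤ) (hv : IsBlock φ j v) (hw : IsBlock φ l w) (i : Fin N)
    (h : ∀ ξ ζ, fatSym φ j ξ ≠ 0 → fatSym φ l ζ ≠ 0 → blockSym φ k (ξ + ζ) = 0) (x : Space N) :
    mconv (blockSym φ k) (fun y => v y • dblk φ l (basisVec i) w y) x = 0 := by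
  have h1 := integral_kernelAt_mul_mconv_eq_zero (blockSym φ k) (fatSym φ j)
    (derivSym (basisVec i) (fatSym φ l)) (fun ξ ζ hξ hζ => h ξ ζ hξ (fun h0 => hζ (by
      rw [derivSym_apply, h0, mul_zero]))) hv.memLp hw.memLp x
  rw [mconv]
  simp_rw [dblk]
  rw [← h1]
  refine integral_congr_ae (Eventually.of_forall fun t => ?_)
  simp only [← hv.eq_mconv]

theorem mconv_blockSym_dblk_eq_zero (hφ : IsDyadicPartition φ) {k : ℤ} (hw : IsBlock φ l w)
    (i : Fin N) (hk : l + 3 ≤ k ∨ k + 3 ≤ l) (x : Space N) :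
    mconv (blockSym φ k) (dblk φ l (basisVec i) w) x = 0 := by
  rw [dblk, mconv_mconv _ _ hw.memLp, symMul_blockSym_derivSym_fatSym_eq_zero hφ hk]
  simp [mconv, kernelAt_zero]

theorem IsBlock.norm_le (hv : IsBlock φ j w) (x : Space N) :
    ‖w x‖ ≤ (kerL2 (fatSym φ 0) * pw (j * (N / 2)) * eLpNorm w 2).toReal := by
  rw [← toReal_enorm]
  exact ENNReal.toReal_mono (ENNReal.mul_ne_top (ENNReal.mul_ne_top (kerL2_ne_top _) (pw_ne_top _))
    hv.memLp.2.ne) (hv.enorm_le x)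

/-- Low frequencies of the transporting field. -/
theorem tsum_comm_le_low (hφ : IsDyadicPartition φ) (s : ℝ) (hjl : j + 5 ≤ l)
    (hv : IsBlock φ j v) (hw : IsBlock φ l w) (i : Fin N) :
    ∑' k : ℤ, pw (k * s) * eLpNorm (comm φ k v (dblk φ l (basisVec i) w)) 2 ≤
      (7 * (pw (3 * |s|) * pw 3 * gradConst φ * kerM1 (blockSym φ 0) * gradConst' φ)) *
        (pw (j * (1 + N / 2)) * eLpNorm v 2) * (pw (l * s) * eLpNorm w 2) := by
  have hz := memLp_dblk (φ := φ) (l := l) hw.memLp (basisVec i)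
  have hL : gradConst φ * pw (j * (1 + N / 2)) * eLpNorm v 2 ≠ ∞ :=
    ENNReal.mul_ne_top (ENNReal.mul_ne_top gradConst_ne_top (pw_ne_top _)) hv.memLp.2.ne
  refine (tsum_le_of_Icc (B := pw (3 * |s|) * pw 3 * gradConst φ * kerM1 (blockSym φ 0) *
    gradConst' φ * (pw (j * (1 + N / 2)) * eLpNorm v 2) * (pw (l * s) * eLpNorm w 2)) l 3
    (fun k hk => ?_) (fun k hk => ?_)).trans_eq (by push_cast; ring)
  · rw [Finset.mem_Icc] at hk
    have hkl : |(k : ℝ) - l| ≤ 3 := by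
      rw [abs_le]
      have h1 : ((l - 3 : ℤ) : ℝ) ≤ k := by exact_mod_cast hk.1
      have h2 : (k : ℝ) ≤ ((l + 3 : ℤ) : ℝ) := by exact_mod_cast hk.2
      push_cast at h1 h2
      constructor <;> linarith
    have h3 : pw (-k) ≤ pw 3 * pw (-l) := by
      rw [← pw_add]
      refine pw_mono ?_
      linarith [(abs_le.1 hkl).1]
    have Z : pw (k * s) * eLpNorm (comm φ k v (dblk φ l (basisVec i) w)) 2
        ≤ (pw (3 * |s|) * pw (l * s)) * ((gradConst φ * pw (j * (1 + N / 2)) * eLpNorm v 2) *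
            (pw 3 * pw (-l)) * kerM1 (blockSym φ 0) * (gradConst' φ * pw l * eLpNorm w 2)) := by
          refine mul_le_mul' (pw_mul_le s hkl) ?_
          refine (eLpNorm_comm_le_of_lipschitz k hz.1 hL (fun x y => hv.enorm_sub_le x y)).trans ?_
          exact mul_le_mul' (mul_le_mul' (mul_le_mul' le_rfl h3) le_rfl)
            (eLpNorm_dblk_basis_le hw.memLp i)
    refine Z.trans (le_of_eq ?_)
    trans pw (3 * |s|) * pw 3 * gradConst φ * kerM1 (blockSym φ 0) *
            gradConst' φ * (pw (j * (1 + N / 2)) * eLpNorm v 2) * (pw (l * s) * eLpNorm w 2) *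
            (pw (-l) * pw l)
    · ring
    · have e : pw (-l) * pw l = 1 := by rw [← pw_add, neg_add_cancel, pw_zero]
      simp only [e, mul_one]
  · have hk' : l + 3 ≤ k - 1 ∨ k + 4 ≤ l := by
      rw [Finset.mem_Icc] at hk; push_cast at hk; omega
    have h0 : comm φ k v (dblk φ l (basisVec i) w) = 0 := by
      ext1 x
      rw [comm_eq_sub k hv.memLp.1 hv.norm_le hz,
        mconv_blockSym_mul_eq_zero k hv hw i (fun ξ ζ hξ hζ =>
          blockSym_add_eq_zero_of_far hφ hjl (by omega) hξ hζ),
        mconv_blockSym_dblk_eq_zero hφ hw i (by omega)]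
      simp
    rw [h0, eLpNorm_zero, mul_zero]

/-- The part `v Δ_k ∂_i w` of the commutator. -/
theorem tsum_mul_mconv_le (hφ : IsDyadicPartition φ) (s : ℝ) (hjl : l ≤ j + 4)
    (hv : IsBlock φ j v) (hw : IsBlock φ l w) (i : Fin N) :
    ∑' k : ℤ, pw (k * s) *
        eLpNorm (fun x => v x • mconv (blockSym φ k) (dblk φ l (basisVec i) w) x) 2 ≤
      (5 * (pw (2 * |s|) * pw 4 * kerL2 (fatSym φ 0) * kerL1 (blockSym φ 0) * gradConst' φ)) *
        (pw (j * (1 + N / 2)) * eLpNorm v 2) * (pw (l * s) * eLpNorm w 2) := by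
  have hz := memLp_dblk (φ := φ) (l := l) hw.memLp (basisVec i)
  have hB : kerL2 (fatSym φ 0) * pw (j * (N / 2)) * eLpNorm v 2 ≠ ∞ :=
    ENNReal.mul_ne_top (ENNReal.mul_ne_top (kerL2_ne_top _) (pw_ne_top _)) hv.memLp.2.ne
  refine (tsum_le_of_Icc (B := pw (2 * |s|) * pw 4 * kerL2 (fatSym φ 0) * kerL1 (blockSym φ 0) *
    gradConst' φ * (pw (j * (1 + N / 2)) * eLpNorm v 2) * (pw (l * s) * eLpNorm w 2)) l 2
    (fun k hk => ?_) (fun k hk => ?_)).trans_eq (by push_cast; ring)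
  · rw [Finset.mem_Icc] at hk
    have hkl : |(k : ℝ) - l| ≤ 2 := by
      rw [abs_le]
      have h1 : ((l - 2 : ℤ) : ℝ) ≤ k := by exact_mod_cast hk.1
      have h2 : (k : ℝ) ≤ ((l + 2 : ℤ) : ℝ) := by exact_mod_cast hk.2
      push_cast at h1 h2
      constructor <;> linarith
    have h3 : pw l ≤ pw 4 * pw j := by
      rw [← pw_add]
      refine pw_mono ?_
      have : (l : ℝ) ≤ ((j + 4 : ℤ) : ℝ) := by exact_mod_cast hjl
      push_cast at this
      linarith
    have Z : pw (k * s) * eLpNorm (fun x => v x • mconv (blockSym φ k) (dblk φ l (basisVec i) w) x) 2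
        ≤ (pw (2 * |s|) * pw (l * s)) * ((kerL2 (fatSym φ 0) * pw (j * (N / 2)) * eLpNorm v 2) *
            (kerL1 (blockSym φ 0) * (gradConst' φ * (pw 4 * pw j) * eLpNorm w 2))) := by
          refine mul_le_mul' (pw_mul_le s hkl) ?_
          refine (eLpNorm_two_le_mul (g := mconv (blockSym φ k) (dblk φ l (basisVec i) w)) hB
            (fun x => ?_)).trans (mul_le_mul' le_rfl ?_)
          · rw [enorm_smul]
            exact mul_le_mul' (hv.enorm_le x) le_rfl
          · refine (eLpNorm_mconv_blockSym_le k hz.1).trans (mul_le_mul' le_rfl ?_)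
            exact (eLpNorm_dblk_basis_le hw.memLp i).trans
              (mul_le_mul' (mul_le_mul' le_rfl h3) le_rfl)
    refine Z.trans (le_of_eq ?_)
    trans pw (2 * |s|) * pw 4 * kerL2 (fatSym φ 0) * kerL1 (blockSym φ 0) *
            gradConst' φ * ((pw j * pw (j * (N / 2))) * eLpNorm v 2) *
            (pw (l * s) * eLpNorm w 2)
    · ring
    · have e : pw j * pw (j * (N / 2)) = pw (j * (1 + N / 2)) := by
        rw [← pw_add, mul_add (j : ℝ), mul_one]
      simp only [e]
  · have h0 : (fun x => v x • mconv (blockSym φ k) (dblk φ l (basisVec i) w) x) = 0 := by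
      ext1 x
      rw [mconv_blockSym_dblk_eq_zero hφ hw i (by
        rw [Finset.mem_Icc] at hk; push_cast at hk; omega)]
      simp
    rw [h0, eLpNorm_zero, mul_zero]

/-- The part `Δ_k (v ∂_i w)` of the commutator, for high frequencies of `v`. This is where
`s ≤ 1 + N/2` is needed. -/
theorem tsum_mconv_mul_le_high (hφ : IsDyadicPartition φ) {s : ℝ} (hs' : s ≤ 1 + (N : ℝ) / 2)
    (hjl : l + 5 ≤ j) (hv : IsBlock φ j v) (hw : IsBlock φ l w) (i : Fin N) :
    ∑' k : ℤ, pw (k * s) *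
        eLpNorm (mconv (blockSym φ k) (fun y => v y • dblk φ l (basisVec i) w y)) 2 ≤
      (7 * (pw (3 * |s|) * kerL1 (blockSym φ 0) * gradConst φ)) *
        (pw (j * (1 + N / 2)) * eLpNorm v 2) * (pw (l * s) * eLpNorm w 2) := by
  have hz := memLp_dblk (φ := φ) (l := l) hw.memLp (basisVec i)
  have hB : gradConst φ * pw (l * (1 + N / 2)) * eLpNorm w 2 ≠ ∞ :=
    ENNReal.mul_ne_top (ENNReal.mul_ne_top gradConst_ne_top (pw_ne_top _)) hw.memLp.2.ne
  refine (tsum_le_of_Icc (B := pw (3 * |s|) * kerL1 (blockSym φ 0) * gradConst φ *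
    (pw (j * (1 + N / 2)) * eLpNorm v 2) * (pw (l * s) * eLpNorm w 2)) j 3
    (fun k hk => ?_) (fun k hk => ?_)).trans_eq (by push_cast; ring)
  · rw [Finset.mem_Icc] at hk
    have hkl : |(k : ℝ) - j| ≤ 3 := by
      rw [abs_le]
      have h1 : ((j - 3 : ℤ) : ℝ) ≤ k := by exact_mod_cast hk.1
      have h2 : (k : ℝ) ≤ ((j + 3 : ℤ) : ℝ) := by exact_mod_cast hk.2
      push_cast at h1 h2
      constructor <;> linarith
    have h3 : pw (j * s) * pw (l * (1 + N / 2)) ≤ pw (j * (1 + N / 2)) * pw (l * s) := by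
      rw [← pw_add, ← pw_add]
      refine pw_mono ?_
      have : ((l + 5 : ℤ) : ℝ) ≤ j := by exact_mod_cast hjl
      push_cast at this
      nlinarith
    have Z : pw (k * s) * eLpNorm (mconv (blockSym φ k) fun y => v y • dblk φ l (basisVec i) w y) 2
        ≤ (pw (3 * |s|) * pw (j * s)) * (kerL1 (blockSym φ 0) *
            ((gradConst φ * pw (l * (1 + N / 2)) * eLpNorm w 2) * eLpNorm v 2)) := by
          refine mul_le_mul' (pw_mul_le s hkl) ?_
          refine (eLpNorm_mconv_blockSym_le k (hv.memLp.1.smul hz.1)).trans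
            (mul_le_mul' le_rfl ?_)
          refine eLpNorm_two_le_mul hB (fun x => ?_)
          rw [Pi.smul_apply', enorm_smul, mul_comm]
          exact mul_le_mul' (enorm_dblk_basis_le hw.memLp i x) le_rfl
    refine Z.trans ?_
    convert mul_le_mul' (le_refl (pw (3 * |s|) * kerL1 (blockSym φ 0) * gradConst φ *
      eLpNorm v 2 * eLpNorm w 2)) h3 using 1 <;> ring
  · have h0 : mconv (blockSym φ k) (fun y => v y • dblk φ l (basisVec i) w y) = 0 := by
      ext1 x
      rw [mconv_blockSym_mul_eq_zero k hv hw i (fun ξ ζ hξ hζ => by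
        rw [add_comm]
        exact blockSym_add_eq_zero_of_far hφ hjl (by
          rw [Finset.mem_Icc] at hk; push_cast at hk; omega) hζ hξ)]
      rfl
    rw [h0, eLpNorm_zero, mul_zero]

/-- The part `Δ_k (v ∂_i w)` of the commutator, for comparable frequencies. All the low
frequencies are excited, and their sum converges because of `-N/2 < s`. -/
theorem tsum_mconv_mul_le_diag (hφ : IsDyadicPartition φ) (s : ℝ)
    (hjl : j ≤ l + 4) (hlj : l ≤ j + 4) (hv : IsBlock φ j v) (hw : IsBlock φ l w) (i : Fin N) :
    ∑' k : ℤ, pw (k * s) *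
        eLpNorm (mconv (blockSym φ k) (fun y => v y • dblk φ l (basisVec i) w y)) 2 ≤
      (kerL2 (blockSym φ 0) * gradConst' φ * pw (6 * (s + N / 2)) * pw (4 * (1 + N / 2)) *
        ∑' n : ℕ, pw (-(n * (s + N / 2)))) *
        (pw (j * (1 + N / 2)) * eLpNorm v 2) * (pw (l * s) * eLpNorm w 2) := by
  have hz := memLp_dblk (φ := φ) (l := l) hw.memLp (basisVec i)
  have hcont : Continuous fun y => v y • dblk φ l (basisVec i) w y :=
    hv.continuous.smul (continuous_mconv _ hw.memLp)
  refine (tsum_le_geometric (σ := s + N / 2) (B := kerL2 (blockSym φ 0) *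
    (eLpNorm v 2 * (gradConst' φ * pw l * eLpNorm w 2))) (l + 6) (fun k => ?_)
    (fun k hk => ?_)).trans ?_
  · have Z : pw (k * s) * eLpNorm (mconv (blockSym φ k) fun y => v y • dblk φ l (basisVec i) w y) 2
        ≤ pw (k * s) * ((pw (k * (N / 2)) * kerL2 (blockSym φ 0)) *
            (eLpNorm v 2 * (gradConst' φ * pw l * eLpNorm w 2))) := by
          refine mul_le_mul' le_rfl
            ((eLpNorm_mconv_le' _ hcont.stronglyMeasurable).trans (mul_le_mul' ?_ ?_))
          · rw [blockSym_eq_dil, kerL2_dil]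
          · exact (eLpNorm_one_smul_le hv.memLp.1 hz.1).trans
              (mul_le_mul' le_rfl (eLpNorm_dblk_basis_le hw.memLp i))
    refine Z.trans (le_of_eq ?_)
    trans kerL2 (blockSym φ 0) * (eLpNorm v 2 * (gradConst' φ * pw l * eLpNorm w 2)) *
          (pw (k * s) * pw (k * (N / 2)))
    · ring
    · have e : pw (k * s) * pw (k * (N / 2)) = pw (k * (s + N / 2)) := by
        rw [← pw_add, ← mul_add]
      simp only [e]
  · have h0 : mconv (blockSym φ k) (fun y => v y • dblk φ l (basisVec i) w y) = 0 := by
      ext1 x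
      rw [mconv_blockSym_mul_eq_zero k hv hw i (fun ξ ζ hξ hζ =>
        blockSym_add_eq_zero_of_lt hφ hjl (by omega) hξ hζ)]
      rfl
    rw [h0, eLpNorm_zero, mul_zero]
  · have h1 : pw l * pw (((l + 6 : ℤ) : ℝ) * (s + N / 2)) ≤
        pw (6 * (s + N / 2)) * pw (4 * (1 + N / 2)) * pw (j * (1 + N / 2)) * pw (l * s) := by
      simp only [← pw_add]
      refine pw_mono ?_
      have : (l : ℝ) ≤ ((j + 4 : ℤ) : ℝ) := by exact_mod_cast hlj
      push_cast at this ⊢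
      have hN : (0 : ℝ) ≤ 1 + N / 2 := by positivity
      nlinarith
    convert mul_le_mul' (mul_le_mul' (le_refl (kerL2 (blockSym φ 0) * gradConst' φ *
      eLpNorm v 2 * eLpNorm w 2)) h1) (le_refl (∑' n : ℕ, pw (-(n * (s + N / 2))))) using 1 <;>
      ring

/-- The commutator estimate for a block of the transporting field and a block of the transported
one. -/
theorem exists_comm_bound (hφ : IsDyadicPartition φ) {s : ℝ} (hs : -(N : ℝ) / 2 < s)
    (hs' : s < 1 + (N : ℝ) / 2) : ∃ C : ℝ≥0∞, C ≠ ∞ ∧ ∀ (j l : ℤ) (v : Space N → ℂ)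
      (w : Space N → V) (i : Fin N), IsBlock φ j v → IsBlock φ l w →
      ∑' k : ℤ, pw (k * s) * eLpNorm (comm φ k v (dblk φ l (basisVec i) w)) 2 ≤
        C * (pw (j * (1 + N / 2)) * eLpNorm v 2) * (pw (l * s) * eLpNorm w 2) := by
  set C₁ := 7 * (pw (3 * |s|) * pw 3 * gradConst φ * kerM1 (blockSym φ 0) * gradConst' φ) with hC₁
  set C₂ := 5 * (pw (2 * |s|) * pw 4 * kerL2 (fatSym φ 0) * kerL1 (blockSym φ 0) * gradConst' φ)
    with hC₂
  set C₃ := 7 * (pw (3 * |s|) * kerL1 (blockSym φ 0) * gradConst φ) with hC₃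
  set C₄ := kerL2 (blockSym φ 0) * gradConst' φ * pw (6 * (s + N / 2)) * pw (4 * (1 + N / 2)) *
        ∑' n : ℕ, pw (-(n * (s + N / 2))) with hC₄
  have hG : ∑' n : ℕ, pw (-(n * (s + N / 2))) ≠ ∞ := tsum_geometric_ne_top (by linarith)
  have t1 := gradConst_ne_top (φ := φ)
  have t2 := gradConst'_ne_top (φ := φ)
  have t3 := kerL1_ne_top (blockSym φ 0)
  have t4 := kerL2_ne_top (blockSym φ 0)
  have t5 := kerM1_ne_top (blockSym φ 0)
  have t6 := kerL2_ne_top (fatSym φ 0)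
  refine ⟨C₁ + (C₃ + C₄ + C₂), ?_, fun j l v w i hv hw => ?_⟩
  · simp only [hC₁, hC₂, hC₃, hC₄, ne_eq, ENNReal.add_eq_top, not_or]
    refine ⟨?_, ⟨?_, ?_⟩, ?_⟩ <;>
    repeat' first
      | assumption
      | exact pw_ne_top _
      | exact ENNReal.ofNat_ne_top
      | apply ENNReal.mul_ne_top
  -- The transporting block is of low frequency: the commutator gains a derivative from the
  -- Lipschitz bound of `v`. In the other regimes the commutator is split into its two terms, the
  -- derivative of `w` costing at most `2 ^ j`.
  by_cases hjl : j + 5 ≤ l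
  · refine (tsum_comm_le_low hφ s hjl hv hw i).trans ?_
    exact mul_le_mul' (mul_le_mul' le_self_add le_rfl) le_rfl
  · have hz := memLp_dblk (φ := φ) (l := l) hw.memLp (basisVec i)
    have hzc : Continuous (dblk φ l (basisVec i) w) := continuous_mconv _ hw.memLp
    have hvz : MemLp (fun y => v y • dblk φ l (basisVec i) w y) 2 := by
      refine ⟨hv.memLp.1.smul hz.1, ?_⟩
      have hB : kerL2 (fatSym φ 0) * pw (j * (N / 2)) * eLpNorm v 2 ≠ ∞ :=
        ENNReal.mul_ne_top (ENNReal.mul_ne_top t6 (pw_ne_top _)) hv.memLp.2.ne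
      refine (eLpNorm_two_le_mul (g := dblk φ l (basisVec i) w) hB fun x => ?_).trans_lt
        (ENNReal.mul_lt_top hB.lt_top hz.2)
      rw [enorm_smul]
      exact mul_le_mul' (hv.enorm_le x) le_rfl
    have hsplit : ∀ k : ℤ, eLpNorm (comm φ k v (dblk φ l (basisVec i) w)) 2 ≤
        eLpNorm (mconv (blockSym φ k) (fun y => v y • dblk φ l (basisVec i) w y)) 2 +
        eLpNorm (fun x => v x • mconv (blockSym φ k) (dblk φ l (basisVec i) w) x) 2 := fun k => by
      have : comm φ k v (dblk φ l (basisVec i) w) =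
          mconv (blockSym φ k) (fun y => v y • dblk φ l (basisVec i) w y) -
          (fun x => v x • mconv (blockSym φ k) (dblk φ l (basisVec i) w) x) :=
        funext fun x => comm_eq_sub k hv.memLp.1 hv.norm_le hz x
      rw [this]
      exact eLpNorm_sub_le (continuous_mconv _ hvz).aestronglyMeasurable
        (hv.continuous.smul (continuous_mconv _ hz)).aestronglyMeasurable one_le_two
    have h2 := tsum_mul_mconv_le hφ s (by omega : l ≤ j + 4) hv hw i
    have h1 : ∑' k : ℤ, pw (k * s) *
        eLpNorm (mconv (blockSym φ k) (fun y => v y • dblk φ l (basisVec i) w y)) 2 ≤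
        (C₃ + C₄) * (pw (j * (1 + N / 2)) * eLpNorm v 2) * (pw (l * s) * eLpNorm w 2) := by
      -- The product has frequencies of size `2 ^ j` if `l` is much smaller than `j`; for comparable
      -- `j` and `l` it reaches all lower frequencies.
      by_cases hlj : l + 5 ≤ j
      · refine (tsum_mconv_mul_le_high hφ hs'.le hlj hv hw i).trans ?_
        exact mul_le_mul' (mul_le_mul' le_self_add le_rfl) le_rfl
      · refine (tsum_mconv_mul_le_diag hφ s (by omega) (by omega) hv hw i).trans ?_
        exact mul_le_mul' (mul_le_mul' le_add_self le_rfl) le_rfl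
    calc _ ≤ ∑' k : ℤ, (pw (k * s) *
        eLpNorm (mconv (blockSym φ k) (fun y => v y • dblk φ l (basisVec i) w y)) 2 +
        pw (k * s) *
        eLpNorm (fun x => v x • mconv (blockSym φ k) (dblk φ l (basisVec i) w) x) 2) := by
          refine ENNReal.tsum_le_tsum fun k => ?_
          rw [← mul_add]
          exact mul_le_mul' le_rfl (hsplit k)
      _ ≤ (C₃ + C₄) * (pw (j * (1 + N / 2)) * eLpNorm v 2) * (pw (l * s) * eLpNorm w 2) +
          C₂ * (pw (j * (1 + N / 2)) * eLpNorm v 2) * (pw (l * s) * eLpNorm w 2) := by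
          rw [ENNReal.tsum_add]
          exact add_le_add h1 h2
      _ = (C₃ + C₄ + C₂) * (pw (j * (1 + N / 2)) * eLpNorm v 2) * (pw (l * s) * eLpNorm w 2) := by
          ring
      _ ≤ _ := by exact mul_le_mul' (mul_le_mul' le_add_self le_rfl) le_rfl

end Commutator

/-! ### Low-frequency cut-offs of normalised distributions -/

section LowFrequency

set_option linter.unusedSectionVars false

variable {N : ℕ} {φ : 𝓢(Space N, ℝ)}

/-- The low-frequency cut-off `S_n f`, a smooth function. -/
def lowCut (φ : 𝓢(Space N, ℝ)) (n : ℤ) (f : 𝓢'(Space N, Vec N)) (x : Space N) : Vec N :=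
  f (kernelAt (lowSym φ n) x)

theorem continuous_lowCut (n : ℤ) (f : 𝓢'(Space N, Vec N)) : Continuous (lowCut φ n f) :=
  continuous_apply_reflAt f _

theorem lowCut_sub_lowCut (hφ : IsDyadicPartition φ) (f : 𝓢'(Space N, Vec N)) {a b : ℤ}
    (hab : a ≤ b) (x : Space N) :
    lowCut φ b f x - lowCut φ a f x = ∑ k ∈ Finset.Ioc a b, blk φ k f x := by
  simp only [lowCut, blk]
  rw [← map_sub, ← kernelAt_sub, ← sum_blockSym hφ hab, kernelAt_sum, map_sum]

theorem hasLineDerivAt_lowCut (n : ℤ) (f : 𝓢'(Space N, Vec N)) (v x : Space N) :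
    HasLineDerivAt ℝ (lowCut φ n f) (lowCut φ n (∂_{v} f) x) x v :=
  hasLineDerivAt_apply_reflAt f _ x v

theorem lowCut_lineDeriv_eq_sum (n : ℤ) (f : 𝓢'(Space N, Vec N)) (v x : Space N) :
    lowCut φ n (∂_{v} f) x = ∑ i, (v i : ℂ) • lowCut φ n (∂_{basisVec i} f) x := by
  simp only [lowCut, ← apply_kernelAt_derivSym]
  rw [derivSym_eq_sum, kernelAt_sum, map_sum]
  simp only [kernelAt_smul, map_smul]

/-- All the dyadic blocks of `f` are square integrable. -/
def FiniteBlocks (φ : 𝓢(Space N, ℝ)) (f : 𝓢'(Space N, Vec N)) : Prop :=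
  ∀ k, distLpNorm 2 (dyadicBlock φ k f) ≠ ∞

theorem FiniteBlocks.isBlock (hφ : IsDyadicPartition φ) {f : 𝓢'(Space N, Vec N)}
    (hf : FiniteBlocks φ f) (k : ℤ) : IsBlock φ k (blk φ k f) :=
  IsBlock.blk hφ (hf k)

theorem symMul_derivSym (v : Space N) (a b : 𝓢(Space N, ℂ)) :
    symMul a (derivSym v b) = derivSym v (symMul a b) := by
  ext ξ
  simp only [symMul_apply, derivSym_apply]
  ring

/-- The blocks of the gradient are the gradients of the blocks. -/
theorem blk_lineDeriv (hφ : IsDyadicPartition φ) {f : 𝓢'(Space N, Vec N)}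
    (hf : FiniteBlocks φ f) (k : ℤ) (v x : Space N) :
    blk φ k (∂_{v} f) x = dblk φ k v (blk φ k f) x := by
  rw [blk, ← apply_kernelAt_derivSym, dblk, ← (block_representation hφ (hf k)).2.2,
    symMul_derivSym, symMul_comm, fatSym_mul_blockSym hφ]

theorem symMul_lowSym_sub (hφ : IsDyadicPartition φ) {a b c : ℤ} (hb : c < b) (ha : a < c) :
    symMul (lowSym φ b - lowSym φ a) (lowSym φ c) = lowSym φ c - lowSym φ a := by
  have h1 := congrArg DFunLike.coe (symMul_lowSym_lowSym hφ hb)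
  have h2 := congrArg DFunLike.coe (symMul_lowSym_lowSym hφ ha)
  ext ξ
  have h1' := congrFun h1 ξ
  have h2' := congrFun h2 ξ
  simp only [symMul_apply, sub_apply] at h1' h2' ⊢
  rw [sub_mul, h1', mul_comm (lowSym φ a ξ), h2']

/-- For a distribution which is the sum of its blocks the low-frequency part vanishes in the
limit. -/
theorem tendsto_lowCut_zero (hφ : IsDyadicPartition φ) {f : 𝓢'(Space N, Vec N)}
    (hf : EqSumBlocks φ f) (x : Space N) :
    Tendsto (fun n : ℕ => lowCut φ (-(n : ℤ) - 1) f x) atTop (𝓝 0) := by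
  have h := hf (kernelAt (lowSym φ 0) x)
  have h1 : ∀ n : ℕ, 1 ≤ n → ∑ k ∈ Finset.Icc (-(n : ℤ)) n,
      dyadicBlock φ k f (kernelAt (lowSym φ 0) x) =
      f (kernelAt (lowSym φ 0) x) - lowCut φ (-(n : ℤ) - 1) f x := by
    intro n hn
    have hIcc : Finset.Icc (-(n : ℤ)) n = Finset.Ioc (-(n : ℤ) - 1) n := by
      ext k; simp only [Finset.mem_Icc, Finset.mem_Ioc]; omega
    simp only [dyadicBlock_apply_kernelAt]
    have h2 : ∑ k ∈ Finset.Ioc (-(n : ℤ) - 1) n, symMul (blockSym φ k) (lowSym φ 0) =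
        symMul (lowSym φ n - lowSym φ (-(n : ℤ) - 1)) (lowSym φ 0) := by
      rw [← sum_blockSym hφ (by omega)]
      ext ξ
      simp only [sum_apply, symMul_apply, Finset.sum_mul]
    rw [hIcc, ← map_sum, ← kernelAt_sum, h2, symMul_lowSym_sub hφ (by omega) (by omega),
      kernelAt_sub, map_sub, lowCut]
  have h2 : Tendsto (fun n : ℕ => f (kernelAt (lowSym φ 0) x) -
      ∑ k ∈ Finset.Icc (-(n : ℤ)) n, dyadicBlock φ k f (kernelAt (lowSym φ 0) x)) atTop
      (𝓝 (f (kernelAt (lowSym φ 0) x) - f (kernelAt (lowSym φ 0) x))) :=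
    tendsto_const_nhds.sub h
  rw [sub_self] at h2
  refine h2.congr' ?_
  filter_upwards [eventually_ge_atTop 1] with n hn
  rw [h1 n hn, sub_sub_cancel]

theorem tendsto_sum_blk (hφ : IsDyadicPartition φ) {f : 𝓢'(Space N, Vec N)}
    (hf : EqSumBlocks φ f) (b : ℤ) (x : Space N) :
    Tendsto (fun n : ℕ => ∑ k ∈ Finset.Ioc (-(n : ℤ) - 1) b, blk φ k f x) atTop
      (𝓝 (lowCut φ b f x)) := by
  have h := (tendsto_const_nhds (x := lowCut φ b f x)).sub (tendsto_lowCut_zero hφ hf x)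
  rw [sub_zero] at h
  refine h.congr' ?_
  filter_upwards [eventually_ge_atTop (-b).toNat] with n hn
  exact lowCut_sub_lowCut hφ f (by omega) x

/-- The norm in `Ḃ^{N/2+1}_{2,1}` restricted to frequencies below `2^b`. -/
def lowLip (φ : 𝓢(Space N, ℝ)) (b : ℤ) (f : 𝓢'(Space N, Vec N)) : ℝ≥0∞ :=
  ∑' k : ℤ, if k ≤ b then pw (k * (1 + N / 2)) * eLpNorm (blk φ k f) 2 else 0

theorem enorm_sum_blk_lineDeriv_le (hφ : IsDyadicPartition φ) {f : 𝓢'(Space N, Vec N)}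
    (hf : FiniteBlocks φ f) (i : Fin N) (a b : ℤ) (x : Space N) :
    ‖∑ k ∈ Finset.Ioc a b, blk φ k (∂_{basisVec i} f) x‖ₑ ≤ gradConst φ * lowLip φ b f := by
  refine (enorm_sum_le _ _).trans ?_
  have h1 : ∀ k ∈ Finset.Ioc a b, ‖blk φ k (∂_{basisVec i} f) x‖ₑ ≤
      gradConst φ * (if k ≤ b then pw (k * (1 + N / 2)) * eLpNorm (blk φ k f) 2 else 0) := by
    intro k hk
    rw [if_pos (Finset.mem_Ioc.1 hk).2, blk_lineDeriv hφ hf, ← mul_assoc]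
    exact enorm_dblk_basis_le (hf.isBlock hφ k).memLp i x
  refine (Finset.sum_le_sum h1).trans ?_
  rw [← Finset.mul_sum]
  exact mul_le_mul' le_rfl (ENNReal.sum_le_tsum _)

theorem enorm_lowCut_lineDeriv_le (hφ : IsDyadicPartition φ) {f : 𝓢'(Space N, Vec N)}
    (hf : FiniteBlocks φ f) (hn : HasNormalizedGradient φ f) (i : Fin N) (b : ℤ) (x : Space N) :
    ‖lowCut φ b (∂_{basisVec i} f) x‖ₑ ≤ gradConst φ * lowLip φ b f :=
  le_of_tendsto' ((continuous_enorm.tendsto _).comp (tendsto_sum_blk hφ (hn i) b x))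
    fun _ => enorm_sum_blk_lineDeriv_le hφ hf i _ b x

/-- By the normalisation of the gradient, `∇ S_b f` is the sum of the blocks of `∇f`, each of which is
bounded by Bernstein's inequality. -/
theorem enorm_lowCut_sub_le (hφ : IsDyadicPartition φ) {f : 𝓢'(Space N, Vec N)}
    (hf : FiniteBlocks φ f) (hn : HasNormalizedGradient φ f) (b : ℤ) (hL : lowLip φ b f ≠ ∞)
    (x y : Space N) : ‖lowCut φ b f y - lowCut φ b f x‖ₑ ≤
      N * gradConst φ * lowLip φ b f * ‖y - x‖ₑ := by
  have h1 : ∀ z, ‖lowCut φ b (∂_{y - x} f) z‖ₑ ≤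
      N * gradConst φ * lowLip φ b f * ‖y - x‖ₑ := fun z => by
    rw [lowCut_lineDeriv_eq_sum]
    refine (enorm_sum_le _ _).trans ?_
    calc ∑ i, ‖((y - x) i : ℂ) • lowCut φ b (∂_{basisVec i} f) z‖ₑ
        ≤ ∑ i : Fin N, ‖y - x‖ₑ * (gradConst φ * lowLip φ b f) := by
          refine Finset.sum_le_sum fun i _ => ?_
          rw [enorm_smul]
          refine mul_le_mul' ?_ (enorm_lowCut_lineDeriv_le hφ hf hn i b z)
          rw [← ofReal_norm, ← ofReal_norm]
          refine ENNReal.ofReal_le_ofReal ?_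
          rw [Complex.norm_real]
          exact PiLp.norm_apply_le (y - x) i
      _ = N * gradConst φ * lowLip φ b f * ‖y - x‖ₑ := by
          rw [Finset.sum_const, Finset.card_univ, Fintype.card_fin, nsmul_eq_mul]
          ring
  have htop : N * gradConst φ * lowLip φ b f * ‖y - x‖ₑ ≠ ∞ :=
    ENNReal.mul_ne_top (ENNReal.mul_ne_top (ENNReal.mul_ne_top (ENNReal.natCast_ne_top N)
      gradConst_ne_top) hL) enorm_ne_top
  have := norm_sub_le_of_hasLineDerivAt (fun z => hasLineDerivAt_lowCut b f (y - x) z) (fun z => by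
    rw [← toReal_enorm]; exact ENNReal.toReal_mono htop (h1 z))
  rw [← ofReal_norm]
  exact ENNReal.ofReal_le_of_le_toReal this

/-- The norm in `Ḃ^{N/2+1}_{2,1}`, which controls the Lipschitz constant. -/
def lip (φ : 𝓢(Space N, ℝ)) (f : 𝓢'(Space N, Vec N)) : ℝ≥0∞ :=
  ∑' k : ℤ, pw (k * (1 + N / 2)) * eLpNorm (blk φ k f) 2

theorem lowLip_le_lip (b : ℤ) (f : 𝓢'(Space N, Vec N)) : lowLip φ b f ≤ lip φ f :=
  ENNReal.tsum_le_tsum fun k => by split_ifs <;> simp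

theorem tendsto_lowLip {f : 𝓢'(Space N, Vec N)} (h : lip φ f ≠ ∞) :
    Tendsto (fun n : ℕ => lowLip φ (-(n : ℤ) - 1) f) atTop (𝓝 0) := by
  have h1 : ∀ b, lowLip φ b f = ∫⁻ k, (if k ≤ b then pw (k * (1 + N / 2)) *
      eLpNorm (blk φ k f) 2 else 0) ∂(Measure.count : Measure ℤ) := fun b => by
    rw [lintegral_count, lowLip]
  simp_rw [h1]
  suffices hs : Tendsto (fun n : ℕ => ∫⁻ k, (if k ≤ -(n : ℤ) - 1 then pw (k * (1 + N / 2)) *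
      eLpNorm (blk φ k f) 2 else 0) ∂(Measure.count : Measure ℤ)) atTop
      (𝓝 (∫⁻ _, 0 ∂(Measure.count : Measure ℤ))) by rwa [lintegral_zero] at hs
  refine tendsto_lintegral_of_dominated_convergence
    (fun k => pw (k * (1 + N / 2)) * eLpNorm (blk φ k f) 2) (fun n => measurable_of_countable _)
    (fun n => Eventually.of_forall fun k => ?_) ?_ (Eventually.of_forall fun k => ?_)
  · dsimp only; split_ifs <;> simp
  · rw [lintegral_count]; exact h
  · refine tendsto_const_nhds.congr' ?_
    filter_upwards [eventually_ge_atTop (-k).toNat] with n hn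
    rw [if_neg (by omega)]

theorem tendsto_lowCut_sub (hφ : IsDyadicPartition φ) {f : 𝓢'(Space N, Vec N)}
    (hf : FiniteBlocks φ f) (hn : HasNormalizedGradient φ f) (h : lip φ f ≠ ∞) (x y : Space N) :
    Tendsto (fun n : ℕ => lowCut φ (-(n : ℤ) - 1) f y - lowCut φ (-(n : ℤ) - 1) f x) atTop
      (𝓝 0) := by
  rw [tendsto_zero_iff_enorm_tendsto_zero]
  have h1 : Tendsto (fun n : ℕ => N * gradConst φ * lowLip φ (-(n : ℤ) - 1) f * ‖y - x‖ₑ) atTop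
      (𝓝 (N * gradConst φ * 0 * ‖y - x‖ₑ)) :=
    ENNReal.Tendsto.mul_const (ENNReal.Tendsto.const_mul (tendsto_lowLip h)
      (Or.inr (ENNReal.mul_ne_top (ENNReal.natCast_ne_top N) gradConst_ne_top)))
      (Or.inr enorm_ne_top)
  rw [mul_zero, zero_mul] at h1
  exact tendsto_of_tendsto_of_tendsto_of_le_of_le tendsto_const_nhds h1 (fun _ => zero_le)
    fun n => enorm_lowCut_sub_le hφ hf hn _
      (ne_top_of_le_ne_top h (lowLip_le_lip _ f)) x y

/-- The increments of the cut-off `S_b f` are the sums of the increments of the blocks of `f`: the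
normalisation of the gradient excludes an additional polynomial. -/
theorem tendsto_sum_blk_sub (hφ : IsDyadicPartition φ) {f : 𝓢'(Space N, Vec N)}
    (hf : FiniteBlocks φ f) (hn : HasNormalizedGradient φ f) (h : lip φ f ≠ ∞) (b : ℤ)
    (x y : Space N) :
    Tendsto (fun n : ℕ => ∑ k ∈ Finset.Ioc (-(n : ℤ) - 1) b, (blk φ k f y - blk φ k f x)) atTop
      (𝓝 (lowCut φ b f y - lowCut φ b f x)) := by
  have h1 := (tendsto_const_nhds (x := lowCut φ b f y - lowCut φ b f x)).sub
    (tendsto_lowCut_sub hφ hf hn h x y)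
  rw [sub_zero] at h1
  refine h1.congr' ?_
  filter_upwards [eventually_ge_atTop (-b).toNat] with n hn
  rw [Finset.sum_sub_distrib, ← lowCut_sub_lowCut hφ f (by omega), ← lowCut_sub_lowCut hφ f (by omega)]
  abel

theorem enorm_sum_blk_sub_le (hφ : IsDyadicPartition φ) {f : 𝓢'(Space N, Vec N)}
    (hf : FiniteBlocks φ f) (s : Finset ℤ) (x y : Space N) :
    ‖∑ k ∈ s, (blk φ k f y - blk φ k f x)‖ₑ ≤ gradConst φ * lip φ f * ‖y - x‖ₑ := by
  refine (enorm_sum_le _ _).trans ?_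
  calc ∑ k ∈ s, ‖blk φ k f y - blk φ k f x‖ₑ
      ≤ ∑ k ∈ s, gradConst φ * (pw (k * (1 + N / 2)) * eLpNorm (blk φ k f) 2) * ‖y - x‖ₑ := by
        refine Finset.sum_le_sum fun k _ => ?_
        rw [← mul_assoc]
        exact (hf.isBlock hφ k).enorm_sub_le x y
    _ = gradConst φ * (∑ k ∈ s, pw (k * (1 + N / 2)) * eLpNorm (blk φ k f) 2) * ‖y - x‖ₑ := by
        rw [Finset.mul_sum, Finset.sum_mul]
    _ ≤ _ := by
        exact mul_le_mul' (mul_le_mul' le_rfl (ENNReal.sum_le_tsum _)) le_rfl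

theorem enorm_lowCut_sub_le_lip (hφ : IsDyadicPartition φ) {f : 𝓢'(Space N, Vec N)}
    (hf : FiniteBlocks φ f) (hn : HasNormalizedGradient φ f) (h : lip φ f ≠ ∞) (b : ℤ)
    (x y : Space N) :
    ‖lowCut φ b f y - lowCut φ b f x‖ₑ ≤ gradConst φ * lip φ f * ‖y - x‖ₑ :=
  le_of_tendsto' ((continuous_enorm.tendsto _).comp (tendsto_sum_blk_sub hφ hf hn h b x y))
    fun _ => enorm_sum_blk_sub_le hφ hf _ x y

/-- The high frequencies of a field in `Ḃ^{N/2+1}_{2,1}` are bounded. -/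
theorem sum_enorm_blk_le (hφ : IsDyadicPartition φ) {f : 𝓢'(Space N, Vec N)}
    (hf : FiniteBlocks φ f) (s : Finset ℤ) (hs : ∀ k ∈ s, 0 ≤ k) (x : Space N) :
    ∑ k ∈ s, ‖blk φ k f x‖ₑ ≤ kerL2 (fatSym φ 0) * lip φ f := by
  calc ∑ k ∈ s, ‖blk φ k f x‖ₑ
      ≤ ∑ k ∈ s, kerL2 (fatSym φ 0) * (pw (k * (1 + N / 2)) * eLpNorm (blk φ k f) 2) := by
        refine Finset.sum_le_sum fun k hk => ?_
        refine ((hf.isBlock hφ k).enorm_le x).trans ?_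
        rw [mul_assoc]
        refine mul_le_mul' le_rfl (mul_le_mul' (pw_mono ?_) le_rfl)
        have : (0 : ℝ) ≤ k := by exact_mod_cast hs k hk
        nlinarith
    _ ≤ _ := by
        rw [← Finset.mul_sum]
        exact mul_le_mul' le_rfl (ENNReal.sum_le_tsum _)

/-- The low-frequency cut-offs of a distribution in `Ḃ^{N/2+1}_{2,1}` converge pointwise. -/
theorem exists_tendsto_lowCut (hφ : IsDyadicPartition φ) {f : 𝓢'(Space N, Vec N)}
    (hf : FiniteBlocks φ f) (h : lip φ f ≠ ∞) :
    ∃ U : Space N → Vec N, ∀ x, Tendsto (fun n : ℕ => lowCut φ n f x) atTop (𝓝 (U x)) := by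
  have h1 : ∀ x, CauchySeq fun n : ℕ => lowCut φ n f x := by
    intro x
    refine cauchySeq_of_summable_dist ?_
    have h2 : ∀ n : ℕ, dist (lowCut φ n f x) (lowCut φ (n.succ : ℕ) f x) =
        ‖blk φ (n + 1 : ℤ) f x‖ := fun n => by
      rw [dist_comm, dist_eq_norm, lowCut_sub_lowCut hφ f (by push_cast; omega)]
      have : Finset.Ioc (n : ℤ) (n.succ : ℕ) = {(n + 1 : ℤ)} := by
        ext k; simp only [Finset.mem_Ioc, Finset.mem_singleton]; push_cast; omega
      rw [this, Finset.sum_singleton]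
    simp_rw [h2]
    have hne : kerL2 (fatSym φ 0) * lip φ f ≠ ∞ := ENNReal.mul_ne_top (kerL2_ne_top _) h
    refine summable_of_sum_le (c := (kerL2 (fatSym φ 0) * lip φ f).toReal)
      (fun n => norm_nonneg _) fun s => ?_
    have h3 := sum_enorm_blk_le hφ hf (s.image fun n : ℕ => (n + 1 : ℤ)) (fun k hk => by
      obtain ⟨n, -, rfl⟩ := Finset.mem_image.1 hk
      positivity) x
    rw [Finset.sum_image fun a _ b _ hab => by simpa using hab] at h3
    have h4 := ENNReal.toReal_mono hne h3
    rw [ENNReal.toReal_sum (fun _ _ => enorm_ne_top)] at h4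
    simpa using h4
  exact ⟨fun x => (cauchySeq_tendsto_of_complete (h1 x)).choose,
    fun x => (cauchySeq_tendsto_of_complete (h1 x)).choose_spec⟩

theorem enorm_lowCut_sub_lowCut_zero_le (hφ : IsDyadicPartition φ) {f : 𝓢'(Space N, Vec N)}
    (hf : FiniteBlocks φ f) (n : ℕ) (x : Space N) :
    ‖lowCut φ n f x - lowCut φ 0 f x‖ₑ ≤ kerL2 (fatSym φ 0) * lip φ f := by
  rw [lowCut_sub_lowCut hφ f (by omega)]
  exact (enorm_sum_le _ _).trans (sum_enorm_blk_le hφ hf _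
    (fun k hk => (Finset.mem_Ioc.1 hk).1.le) x)

end LowFrequency

/-! ### The commutator estimate -/

section CommutatorEstimate

set_option linter.unusedSectionVars false

variable {N : ℕ} {φ : 𝓢(Space N, ℝ)} {V : Type*} [NormedAddCommGroup V] [NormedSpace ℂ V]

/-- The Besov norm `∑_k 2^{ks} ‖Δ_k f‖_{L²}` in terms of the functions `blk φ k f`. -/
def besovSum (φ : 𝓢(Space N, ℝ)) (s : ℝ) (f : 𝓢'(Space N, Vec N)) : ℝ≥0∞ :=
  ∑' k : ℤ, pw (k * s) * eLpNorm (blk φ k f) 2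

theorem lowLip_le_besovSum {s : ℝ} (hs' : s ≤ 1 + (N : ℝ) / 2) (b : ℤ) (f : 𝓢'(Space N, Vec N)) :
    lowLip φ b f ≤ pw (b * (1 + N / 2 - s)) * besovSum φ s f := by
  rw [besovSum, ← ENNReal.tsum_mul_left]
  refine ENNReal.tsum_le_tsum fun k => ?_
  split_ifs with hk
  · rw [← mul_assoc, ← pw_add]
    refine mul_le_mul' (pw_mono ?_) le_rfl
    have : (k : ℝ) ≤ b := by exact_mod_cast hk
    nlinarith
  · exact zero_le

/-- Fatou's lemma for the norms of the sequence spaces over `L²`. -/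
theorem tsum_eLpNorm_le_of_tendsto {s : ℝ} {F : ℕ → ℤ → Space N → V} {G : ℤ → Space N → V}
    {B : ℝ≥0∞} (hF : ∀ n k, AEStronglyMeasurable (F n k))
    (hlim : ∀ k x, Tendsto (fun n => F n k x) atTop (𝓝 (G k x)))
    (hB : ∀ n, ∑' k : ℤ, pw (k * s) * eLpNorm (F n k) 2 ≤ B) :
    ∑' k : ℤ, pw (k * s) * eLpNorm (G k) 2 ≤ B := by
  have e : ∀ f : ℤ → ℝ≥0∞, ∑' k, f k = ∫⁻ k, f k ∂Measure.count := fun f =>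
    (lintegral_count f).symm
  rw [e]
  have hm : ∀ n : ℕ, Measurable fun k : ℤ => pw (k * s) * eLpNorm (F n k) 2 := fun n =>
    measurable_of_countable _
  have h0 := lintegral_liminf_le (μ := (Measure.count : Measure ℤ)) (u := atTop) hm
  refine le_trans ?_ (h0.trans ?_)
  · refine lintegral_mono fun k => ?_
    dsimp only
    rw [ENNReal.liminf_const_mul_of_ne_top (pw_ne_top _)]
    have h := Lp.eLpNorm_lim_le_liminf_eLpNorm (p := 2) (f := fun n => F n k) (fun n => hF n k)
      (G k) (Eventually.of_forall fun x => hlim k x)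
    exact mul_le_mul' le_rfl h
  · refine liminf_le_of_frequently_le' (Eventually.of_forall fun n => ?_).frequently
    rw [← e]
    exact hB n

/-- The majorant used for commutators of Lipschitz functions with bounded ones. -/
theorem integrable_kernel_majorant (m : 𝓢(Space N, ℂ)) (x : Space N) (L B : ℝ) :
    Integrable fun y => ‖kernelAt m x y‖ * (L * ‖y - x‖ * B) := by
  have h := ((𝓕⁻ m : 𝓢(Space N, ℂ)).integrable_pow_mul (volume : Measure (Space N)) 1).comp_sub_left x
  refine (h.const_mul (L * B)).congr (Eventually.of_forall fun y => ?_)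
  simp only [kernelAt_apply, pow_one]
  rw [norm_sub_rev y x]
  ring

theorem norm_le_toReal {E : Type*} [NormedAddCommGroup E] {a : E} {b : ℝ≥0∞} (hb : b ≠ ∞)
    (h : ‖a‖ₑ ≤ b) : ‖a‖ ≤ b.toReal := by
  rw [← toReal_enorm]; exact ENNReal.toReal_mono hb h

theorem norm_comm_integrand_le {m : 𝓢(Space N, ℂ)} {v : Space N → ℂ} {z : Space N → V}
    {L B : ℝ≥0∞} (hL : L ≠ ∞) (hB : B ≠ ∞) {x y : Space N} (hv : ‖v y - v x‖ₑ ≤ L * ‖y - x‖ₑ)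
    (hz : ‖z y‖ₑ ≤ B) :
    ‖kernelAt m x y • (v y - v x) • z y‖ ≤
      ‖kernelAt m x y‖ * (L.toReal * ‖y - x‖ * B.toReal) := by
  rw [norm_smul, norm_smul]
  have h1 := norm_le_toReal (ENNReal.mul_ne_top hL enorm_ne_top) hv
  rw [ENNReal.toReal_mul, toReal_enorm] at h1
  have h2 := norm_le_toReal hB hz
  gcongr

theorem integrable_comm {m : 𝓢(Space N, ℂ)} {v : Space N → ℂ} {z : Space N → V} {L B : ℝ≥0∞}
    (hL : L ≠ ∞) (hB : B ≠ ∞) (hvc : Continuous v) (hzc : Continuous z) {x : Space N}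
    (hv : ∀ y, ‖v y - v x‖ₑ ≤ L * ‖y - x‖ₑ) (hz : ∀ y, ‖z y‖ₑ ≤ B) :
    Integrable fun y => kernelAt m x y • (v y - v x) • z y :=
  (integrable_kernel_majorant m x L.toReal B.toReal).mono'
    ((SchwartzMap.continuous _).smul ((hvc.sub continuous_const).smul hzc)).aestronglyMeasurable
    (Eventually.of_forall fun y => norm_comm_integrand_le hL hB (hv y) (hz y))

/-- The commutator `∑_i [h_k *, v_i] z_i`. -/
def commSum (φ : 𝓢(Space N, ℝ)) (k : ℤ) (v : Space N → Vec N) (z : Fin N → Space N → V)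
    (x : Space N) : V :=
  ∑ i, comm φ k (fun y => v y i) (z i) x

theorem enorm_coord_le (a : Vec N) (i : Fin N) : ‖a i‖ₑ ≤ ‖a‖ₑ := by
  rw [← ofReal_norm, ← ofReal_norm]
  exact ENNReal.ofReal_le_ofReal (PiLp.norm_apply_le a i)

/-- Dominated convergence for commutators. -/
theorem tendsto_commSum {k : ℤ} {L B : ℝ≥0∞} (hL : L ≠ ∞) (hB : B ≠ ∞) {x : Space N}
    {v : ℕ → Space N → Vec N} {v₀ : Space N → Vec N} {z : ℕ → Fin N → Space N → V}
    {z₀ : Fin N → Space N → V} (hvc : ∀ n, Continuous (v n)) (hzc : ∀ n i, Continuous (z n i))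
    (hv : ∀ n y, ‖v n y - v n x‖ₑ ≤ L * ‖y - x‖ₑ) (hz : ∀ n i y, ‖z n i y‖ₑ ≤ B)
    (hv₀ : ∀ y, Tendsto (fun n => v n y - v n x) atTop (𝓝 (v₀ y - v₀ x)))
    (hz₀ : ∀ i y, Tendsto (fun n => z n i y) atTop (𝓝 (z₀ i y))) :
    Tendsto (fun n => commSum φ k (v n) (z n) x) atTop (𝓝 (commSum φ k v₀ z₀ x)) := by
  refine tendsto_finsetSum _ fun i _ => ?_
  refine tendsto_integral_of_dominated_convergence _ (fun n => ?_)
    (integrable_kernel_majorant (blockSym φ k) x L.toReal B.toReal) (fun n => ?_) ?_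
  · have h1 : Continuous fun y => v n y i := (EuclideanSpace.proj i).continuous.comp (hvc n)
    exact ((SchwartzMap.continuous _).smul
      ((h1.sub continuous_const).smul (hzc n i))).aestronglyMeasurable
  · exact Eventually.of_forall fun y => norm_comm_integrand_le
      (v := fun y => v n y i) hL hB
      ((enorm_coord_le (v n y - v n x) i).trans (hv n y)) (hz n i y)
  · refine Eventually.of_forall fun y => ?_
    have h1 : Tendsto (fun n => (v n y - v n x) i) atTop (𝓝 ((v₀ y - v₀ x) i)) :=
      ((EuclideanSpace.proj i : Vec N →L[ℂ] ℂ).continuous.tendsto _).comp (hv₀ y)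
    exact tendsto_const_nhds.smul (h1.smul (hz₀ i y))

variable [CompleteSpace V]

theorem comm_sum_sum {k : ℤ} {ι κ : Type*} (J : Finset ι) (K : Finset κ) {v : ι → Space N → ℂ}
    {z : κ → Space N → V} {x : Space N}
    (h : ∀ j ∈ J, ∀ l ∈ K, Integrable fun y => kernelAt (blockSym φ k) x y • (v j y - v j x) • z l y) :
    comm φ k (fun y => ∑ j ∈ J, v j y) (fun y => ∑ l ∈ K, z l y) x =
      ∑ j ∈ J, ∑ l ∈ K, comm φ k (v j) (z l) x := by
  have h1 : ∀ y, kernelAt (blockSym φ k) x y • (∑ j ∈ J, v j y - ∑ j ∈ J, v j x) •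
      ∑ l ∈ K, z l y =
      ∑ j ∈ J, ∑ l ∈ K, kernelAt (blockSym φ k) x y • (v j y - v j x) • z l y := fun y => by
    rw [← Finset.sum_sub_distrib, Finset.sum_smul, Finset.smul_sum]
    simp only [Finset.smul_sum]
  simp only [comm, h1]
  rw [integral_finsetSum J fun j hj => (integrable_finsetSum K fun l hl => h j hj l hl)]
  exact Finset.sum_congr rfl fun j hj => integral_finsetSum K fun l hl => h j hj l hl

theorem IsBlock.continuous_comm {j l k : ℤ} {v : Space N → ℂ} {w : Space N → V}
    (hv : IsBlock φ j v) (hw : IsBlock φ l w) (i : Fin N) :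
    Continuous (comm φ k v (dblk φ l (basisVec i) w)) := by
  have hz := memLp_dblk (φ := φ) (l := l) hw.memLp (basisVec i)
  have hvz : MemLp (fun y => v y • dblk φ l (basisVec i) w y) 2 := by
    have hB : kerL2 (fatSym φ 0) * pw (j * (N / 2)) * eLpNorm v 2 ≠ ∞ :=
      ENNReal.mul_ne_top (ENNReal.mul_ne_top (kerL2_ne_top _) (pw_ne_top _)) hv.memLp.2.ne
    refine ⟨hv.memLp.1.smul hz.1, (eLpNorm_two_le_mul (g := dblk φ l (basisVec i) w) hB
      fun x => ?_).trans_lt (ENNReal.mul_lt_top hB.lt_top hz.2)⟩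
    rw [enorm_smul]
    exact mul_le_mul' (hv.enorm_le x) le_rfl
  have h := funext fun x => comm_eq_sub (φ := φ) k hv.memLp.1 hv.norm_le hz x
  rw [h]
  exact (continuous_mconv _ hvz).sub (hv.continuous.smul (continuous_mconv _ hz))

theorem comm_blk_blk_integrable (hφ : IsDyadicPartition φ) {u d : 𝓢'(Space N, Vec N)}
    (hu : FiniteBlocks φ u) (hd : FiniteBlocks φ d) (i : Fin N) (j k l : ℤ) (x : Space N) :
    Integrable fun y => kernelAt (blockSym φ k) x y • (blk φ j u y i - blk φ j u x i) •
      blk φ l (∂_{basisVec i} d) y := by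
  have hj := hu.isBlock hφ j
  have hl := hd.isBlock hφ l
  have hL : gradConst φ * pw (j * (1 + N / 2)) * eLpNorm (blk φ j u) 2 ≠ ∞ :=
    ENNReal.mul_ne_top (ENNReal.mul_ne_top gradConst_ne_top (pw_ne_top _)) hj.memLp.2.ne
  have hB : gradConst φ * pw (l * (1 + N / 2)) * eLpNorm (blk φ l d) 2 ≠ ∞ :=
    ENNReal.mul_ne_top (ENNReal.mul_ne_top gradConst_ne_top (pw_ne_top _)) hl.memLp.2.ne
  refine integrable_comm (v := fun y => blk φ j u y i) hL hB
    ((EuclideanSpace.proj i : Vec N →L[ℂ] ℂ).continuous.comp (continuous_blk _ _))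
    (continuous_blk _ _) (fun y => ?_) (fun y => ?_)
  · exact (enorm_coord_le (blk φ j u y - blk φ j u x) i).trans (hj.enorm_sub_le x y)
  · rw [blk_lineDeriv hφ hd]
    exact enorm_dblk_basis_le hl.memLp i y

theorem commSum_blk_eq (hφ : IsDyadicPartition φ) {u d : 𝓢'(Space N, Vec N)}
    (hu : FiniteBlocks φ u) (hd : FiniteBlocks φ d) (J : Finset ℤ) (k : ℤ) :
    commSum φ k (fun y => ∑ j ∈ J, blk φ j u y)
      (fun i y => ∑ l ∈ J, blk φ l (∂_{basisVec i} d) y) =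
      fun x => ∑ i, ∑ j ∈ J, ∑ l ∈ J,
        comm φ k (fun y => blk φ j u y i) (dblk φ l (basisVec i) (blk φ l d)) x := by
  ext1 x
  refine Finset.sum_congr rfl fun i _ => ?_
  have h := comm_sum_sum J J (v := fun j y => blk φ j u y i)
    (z := fun l y => blk φ l (∂_{basisVec i} d) y)
    fun j _ l _ => comm_blk_blk_integrable hφ hu hd i j k l x
  have h1 : (fun y => (∑ j ∈ J, blk φ j u y) i) = fun y => ∑ j ∈ J, blk φ j u y i := by
    ext y; simp
  have h2 : ∀ l, blk φ l (∂_{basisVec i} d) = dblk φ l (basisVec i) (blk φ l d) := fun l =>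
    funext fun y => blk_lineDeriv hφ hd l _ y
  rw [h1, h]
  simp only [h2]

theorem continuous_commSum_blk (hφ : IsDyadicPartition φ) {u d : 𝓢'(Space N, Vec N)}
    (hu : FiniteBlocks φ u) (hd : FiniteBlocks φ d) (J : Finset ℤ) (k : ℤ) :
    Continuous (commSum φ k (fun y => ∑ j ∈ J, blk φ j u y)
      (fun i y => ∑ l ∈ J, blk φ l (∂_{basisVec i} d) y)) := by
  rw [commSum_blk_eq hφ hu hd]
  exact continuous_finsetSum _ fun i _ => continuous_finsetSum _ fun j _ =>
    continuous_finsetSum _ fun l _ =>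
      ((hu.isBlock hφ j).coord i).continuous_comm (hd.isBlock hφ l) i

theorem tsum_finset_le {ι : Type*} (J : Finset ι) {s : ℝ} {F : ι → ℤ → ℝ≥0∞} {B : ι → ℝ≥0∞}
    (h : ∀ j ∈ J, ∑' k : ℤ, pw (k * s) * F j k ≤ B j) :
    ∑' k : ℤ, pw (k * s) * ∑ j ∈ J, F j k ≤ ∑ j ∈ J, B j := by
  simp_rw [Finset.mul_sum]
  rw [Summable.tsum_finsetSum fun _ _ => ENNReal.summable]
  exact Finset.sum_le_sum h

/-- The commutator estimate for truncated Littlewood-Paley sums. -/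
theorem exists_commSum_blk_bound (hφ : IsDyadicPartition φ) {s : ℝ} (hs : -(N : ℝ) / 2 < s)
    (hs' : s < 1 + (N : ℝ) / 2) : ∃ C : ℝ≥0∞, C ≠ ∞ ∧ ∀ (u d : 𝓢'(Space N, Vec N)),
      FiniteBlocks φ u → FiniteBlocks φ d → ∀ J : Finset ℤ,
      ∑' k : ℤ, pw (k * s) * eLpNorm (commSum φ k (fun y => ∑ j ∈ J, blk φ j u y)
        (fun i y => ∑ l ∈ J, blk φ l (∂_{basisVec i} d) y)) 2 ≤ C * lip φ u * besovSum φ s d := by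
  obtain ⟨C, hC, h⟩ := exists_comm_bound (V := Vec N) hφ hs hs'
  refine ⟨N * C, ENNReal.mul_ne_top (ENNReal.natCast_ne_top N) hC, fun u d hu hd J => ?_⟩
  have hmeas : ∀ (k : ℤ) (i : Fin N) (j l : ℤ), AEStronglyMeasurable
      (comm φ k (fun y => blk φ j u y i) (dblk φ l (basisVec i) (blk φ l d))) := fun k i j l =>
    (((hu.isBlock hφ j).coord i).continuous_comm (hd.isBlock hφ l) i).aestronglyMeasurable
  have h1 : ∀ k, eLpNorm (commSum φ k (fun y => ∑ j ∈ J, blk φ j u y)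
        (fun i y => ∑ l ∈ J, blk φ l (∂_{basisVec i} d) y)) 2 ≤
      ∑ i, ∑ j ∈ J, ∑ l ∈ J,
        eLpNorm (comm φ k (fun y => blk φ j u y i) (dblk φ l (basisVec i) (blk φ l d))) 2 := by
    intro k
    have h2 : commSum φ k (fun y => ∑ j ∈ J, blk φ j u y)
        (fun i y => ∑ l ∈ J, blk φ l (∂_{basisVec i} d) y) = ∑ i, ∑ j ∈ J, ∑ l ∈ J,
        comm φ k (fun y => blk φ j u y i) (dblk φ l (basisVec i) (blk φ l d)) := by
      rw [commSum_blk_eq hφ hu hd]; ext1 x; simp only [Finset.sum_apply]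
    rw [h2]
    refine (eLpNorm_sum_le (fun i _ => Finset.aestronglyMeasurable_sum _ fun j _ =>
      Finset.aestronglyMeasurable_sum _ fun l _ => hmeas k i j l) one_le_two).trans ?_
    refine Finset.sum_le_sum fun i _ => ?_
    refine (eLpNorm_sum_le (fun j _ =>
      Finset.aestronglyMeasurable_sum _ fun l _ => hmeas k i j l) one_le_two).trans ?_
    exact Finset.sum_le_sum fun j _ => eLpNorm_sum_le (fun l _ => hmeas k i j l) one_le_two
  refine (ENNReal.tsum_le_tsum fun k => mul_le_mul' le_rfl (h1 k)).trans ?_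
  have h3 : ∀ (i : Fin N) (j l : ℤ), ∑' k : ℤ, pw (k * s) * eLpNorm
      (comm φ k (fun y => blk φ j u y i) (dblk φ l (basisVec i) (blk φ l d))) 2 ≤
      C * (pw (j * (1 + N / 2)) * eLpNorm (blk φ j u) 2) * (pw (l * s) * eLpNorm (blk φ l d) 2) :=
    fun i j l => (h j l _ _ i ((hu.isBlock hφ j).coord i) (hd.isBlock hφ l)).trans
      (mul_le_mul' (mul_le_mul' le_rfl (mul_le_mul' le_rfl (eLpNorm_coord_le i))) le_rfl)
  refine (tsum_finset_le _ fun i _ => tsum_finset_le _ fun j _ =>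
    tsum_finset_le _ fun l _ => h3 i j l).trans ?_
  simp only [← Finset.mul_sum, ← Finset.sum_mul, Finset.sum_const, Finset.card_univ,
    Fintype.card_fin, nsmul_eq_mul]
  have h4 : ∑ j ∈ J, pw (j * (1 + N / 2)) * eLpNorm (blk φ j u) 2 ≤ lip φ u :=
    ENNReal.sum_le_tsum _
  have h5 : ∑ l ∈ J, pw (l * s) * eLpNorm (blk φ l d) 2 ≤ besovSum φ s d :=
    ENNReal.sum_le_tsum _
  convert mul_le_mul' (mul_le_mul' (le_refl (N * C)) h4) h5 using 1
  ring

/-- The commutator estimate for low-frequency cut-offs. -/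
theorem exists_commSum_lowCut_bound (hφ : IsDyadicPartition φ) {s : ℝ} (hs : -(N : ℝ) / 2 < s)
    (hs' : s < 1 + (N : ℝ) / 2) : ∃ C : ℝ≥0∞, C ≠ ∞ ∧ ∀ (u d : 𝓢'(Space N, Vec N)),
      FiniteBlocks φ u → FiniteBlocks φ d → HasNormalizedGradient φ u →
      HasNormalizedGradient φ d → lip φ u ≠ ∞ → besovSum φ s d ≠ ∞ → ∀ b : ℤ,
      (∀ k, AEStronglyMeasurable (commSum φ k (lowCut φ b u)
        fun i => lowCut φ b (∂_{basisVec i} d))) ∧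
      ∑' k : ℤ, pw (k * s) * eLpNorm (commSum φ k (lowCut φ b u)
        fun i => lowCut φ b (∂_{basisVec i} d)) 2 ≤ C * lip φ u * besovSum φ s d := by
  obtain ⟨C, hC, h⟩ := exists_commSum_blk_bound hφ hs hs'
  refine ⟨C, hC, fun u d hu hd hnu hnd hlu hbd b => ?_⟩
  have hlow : lowLip φ b d ≠ ∞ := ne_top_of_le_ne_top (ENNReal.mul_ne_top (pw_ne_top _) hbd)
    (lowLip_le_besovSum hs'.le b d)
  have hmeas : ∀ (n : ℕ) k, AEStronglyMeasurable (commSum φ k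
      (fun y => ∑ j ∈ Finset.Ioc (-(n : ℤ) - 1) b, blk φ j u y)
      (fun i y => ∑ l ∈ Finset.Ioc (-(n : ℤ) - 1) b, blk φ l (∂_{basisVec i} d) y)) :=
    fun n k => (continuous_commSum_blk hφ hu hd _ k).aestronglyMeasurable
  have hlim : ∀ k x, Tendsto (fun n : ℕ => commSum φ k
      (fun y => ∑ j ∈ Finset.Ioc (-(n : ℤ) - 1) b, blk φ j u y)
      (fun i y => ∑ l ∈ Finset.Ioc (-(n : ℤ) - 1) b, blk φ l (∂_{basisVec i} d) y) x) atTop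
      (𝓝 (commSum φ k (lowCut φ b u) (fun i => lowCut φ b (∂_{basisVec i} d)) x)) := by
    intro k x
    refine tendsto_commSum (L := gradConst φ * lip φ u) (B := gradConst φ * lowLip φ b d)
      (ENNReal.mul_ne_top gradConst_ne_top hlu) (ENNReal.mul_ne_top gradConst_ne_top hlow)
      (fun n => continuous_finsetSum _ fun j _ => continuous_blk _ _)
      (fun n i => continuous_finsetSum _ fun j _ => continuous_blk _ _)
      (fun n y => ?_) (fun n i y => enorm_sum_blk_lineDeriv_le hφ hd i _ b y)
      (fun y => ?_) (fun i y => tendsto_sum_blk hφ (hnd i) b y)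
    · rw [← Finset.sum_sub_distrib]
      exact enorm_sum_blk_sub_le hφ hu _ x y
    · simp only [← Finset.sum_sub_distrib]
      exact tendsto_sum_blk_sub hφ hu hnu hlu b x y
  exact ⟨fun k => aestronglyMeasurable_of_tendsto_ae _ (fun n => hmeas n k)
    (Eventually.of_forall fun x => hlim k x),
    tsum_eLpNorm_le_of_tendsto hmeas hlim fun n => h u d hu hd _⟩

end CommutatorEstimate

/-! ### The product and its commutator with a dyadic block -/

section Advection

set_option linter.unusedSectionVars false

variable {N : ℕ} {φ : 𝓢(Space N, ℝ)}

theorem mollifierKernel_eq_kernelAt (φ : 𝓢(Space N, ℝ)) (n : ℕ) (x : Space N) :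
    mollifierKernel (𝓕⁻ (lowSym φ 0)) n x = kernelAt (lowSym φ n) x := by
  ext y
  have h : lowSym φ n = dil n (lowSym φ 0) := by rw [dil_lowSym, add_zero]
  rw [mollifierKernel_apply, kernelAt_apply, h, fourierInv_dil]
  simp [pow_mul]

theorem mollify_eq_lowCut (φ : 𝓢(Space N, ℝ)) (n : ℕ) (f : 𝓢'(Space N, Vec N)) :
    mollify (𝓕⁻ (lowSym φ 0)) n f = lowCut φ n f := by
  ext1 x
  rw [mollify, mollifierKernel_eq_kernelAt, lowCut]

theorem integral_fourierInv_lowSym (hφ : IsDyadicPartition φ) :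
    ∫ x, (𝓕⁻ (lowSym φ 0) : 𝓢(Space N, ℂ)) x = 1 := by
  have h1 : (𝓕 (𝓕⁻ (lowSym φ 0)) : 𝓢(Space N, ℂ)) 0 = 1 := by
    rw [FourierTransform.fourier_fourierInv_eq (F := 𝓢(Space N, ℂ)), lowSym_eq_one hφ (by simp)]
  rw [SchwartzMap.fourier_coe, Real.fourier_eq] at h1
  simpa using h1

theorem integrable_kernelAt_smul_of_bound {V : Type*} [NormedAddCommGroup V] [NormedSpace ℂ V]
    (m : 𝓢(Space N, ℂ)) (x : Space N) {z : Space N → V}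
    (hz : Continuous z) {B : ℝ≥0∞} (hB : B ≠ ∞) (h : ∀ y, ‖z y‖ₑ ≤ B) :
    Integrable fun y => kernelAt m x y • z y :=
  ((kernelAt m x).integrable (μ := volume)).smul_bdd B.toReal hz.aestronglyMeasurable
    (Eventually.of_forall fun y => norm_le_toReal hB (h y))

/-- `Δ_k S_n = Δ_k` for `n ≥ k + 3`, on gradients of normalised distributions. -/
theorem integral_kernelAt_lowCut (hφ : IsDyadicPartition φ) {d : 𝓢'(Space N, Vec N)}
    (hd : FiniteBlocks φ d) (hnd : HasNormalizedGradient φ d) {b : ℤ} (hlow : lowLip φ b d ≠ ∞)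
    (i : Fin N) {k : ℤ} (hk : k + 3 ≤ b) (x : Space N) :
    ∫ y, kernelAt (blockSym φ k) x y • lowCut φ b (∂_{basisVec i} d) y =
      blk φ k (∂_{basisVec i} d) x := by
  have hB : gradConst φ * lowLip φ b d ≠ ∞ := ENNReal.mul_ne_top gradConst_ne_top hlow
  have hlim : Tendsto (fun n : ℕ => ∫ y, kernelAt (blockSym φ k) x y •
      ∑ l ∈ Finset.Ioc (-(n : ℤ) - 1) b, blk φ l (∂_{basisVec i} d) y) atTop
      (𝓝 (∫ y, kernelAt (blockSym φ k) x y • lowCut φ b (∂_{basisVec i} d) y)) := by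
    refine tendsto_integral_of_dominated_convergence
      (fun y => ‖kernelAt (blockSym φ k) x y‖ * (gradConst φ * lowLip φ b d).toReal)
      (fun n => ?_) ?_ (fun n => Eventually.of_forall fun y => ?_)
      (Eventually.of_forall fun y => tendsto_const_nhds.smul (tendsto_sum_blk hφ (hnd i) b y))
    · exact ((kernelAt (blockSym φ k) x).continuous.smul
        (continuous_finsetSum _ fun l _ => continuous_blk _ _)).aestronglyMeasurable
    · exact ((kernelAt (blockSym φ k) x).integrable (μ := volume)).norm.mul_const _
    · rw [norm_smul]
      gcongr
      exact norm_le_toReal hB (enorm_sum_blk_lineDeriv_le hφ hd i _ b y)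
  refine tendsto_nhds_unique hlim (tendsto_const_nhds.congr' ?_)
  filter_upwards [eventually_ge_atTop (k.natAbs + b.natAbs + 3)] with n hn
  have hdl : ∀ l, blk φ l (∂_{basisVec i} d) = dblk φ l (basisVec i) (blk φ l d) := fun l =>
    funext fun y => blk_lineDeriv hφ hd l _ y
  have h1 : ∀ l, Integrable fun y => kernelAt (blockSym φ k) x y • blk φ l (∂_{basisVec i} d) y :=
    fun l => by
      rw [hdl]
      exact integrable_kernelAt_smul _ (memLp_dblk (hd.isBlock hφ l).memLp _) x
  have h2 : ∀ l, ∫ y, kernelAt (blockSym φ k) x y • blk φ l (∂_{basisVec i} d) y =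
      (∂_{basisVec i} d) (kernelAt (symMul (blockSym φ l) (blockSym φ k)) x) := fun l => by
    rw [hdl]
    change mconv (blockSym φ k) (dblk φ l (basisVec i) (blk φ l d)) x = _
    rw [dblk, mconv_mconv _ _ (hd.isBlock hφ l).memLp, ← (block_representation hφ (hd l)).2.2,
      ← apply_kernelAt_derivSym]
    congr 2
    have h := congrArg DFunLike.coe (fatSym_mul_blockSym hφ l)
    ext ξ
    have h' := congrFun h ξ
    simp only [symMul_apply, derivSym_apply] at h' ⊢
    calc _ = 2 * Real.pi * Complex.I * (inner ℝ ξ (basisVec i) : ℂ) *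
          ((fatSym φ l ξ * blockSym φ l ξ) * blockSym φ k ξ) := by ring
      _ = _ := by rw [h']
  simp only [Finset.smul_sum]
  rw [integral_finsetSum _ fun l _ => h1 l]
  simp only [h2]
  rw [← map_sum, ← kernelAt_sum, blk]
  congr 2
  have h3 : ∑ l ∈ Finset.Ioc (-(n : ℤ) - 1) b, symMul (blockSym φ l) (blockSym φ k) =
      symMul (lowSym φ b - lowSym φ (-(n : ℤ) - 1)) (blockSym φ k) := by
    rw [← sum_blockSym hφ (by omega)]
    ext ξ
    simp only [sum_apply, symMul_apply, Finset.sum_mul]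
  rw [h3]
  have h4 := congrArg DFunLike.coe (symMul_lowSym_sub hφ (a := -(n : ℤ) - 1) (b := b) (c := k)
    (by omega) (by omega))
  have h5 := congrArg DFunLike.coe (symMul_lowSym_sub hφ (a := -(n : ℤ) - 1) (b := b) (c := k - 1)
    (by omega) (by omega))
  ext ξ
  have h4' := congrFun h4 ξ
  have h5' := congrFun h5 ξ
  rw [blockSym_eq_sub hφ]
  simp only [symMul_apply, sub_apply] at h4' h5' ⊢
  rw [mul_sub, h4', h5']
  ring

/-- The commutator of the product with a dyadic block at a fixed regularisation. -/
theorem commSum_lowCut_eq (hφ : IsDyadicPartition φ) {u d : 𝓢'(Space N, Vec N)}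
    (hu : FiniteBlocks φ u) (hd : FiniteBlocks φ d) (hnu : HasNormalizedGradient φ u)
    (hnd : HasNormalizedGradient φ d) (hlu : lip φ u ≠ ∞) {b : ℤ} (hlow : lowLip φ b d ≠ ∞)
    {k : ℤ} (hk : k + 3 ≤ b) (x : Space N) :
    commSum φ k (lowCut φ b u) (fun i => lowCut φ b (∂_{basisVec i} d)) x =
      (∫ y, kernelAt (blockSym φ k) x y • ∑ i, lowCut φ b u y i •
        lowCut φ b (∂_{basisVec i} d) y) -
      ∑ i, lowCut φ b u x i • blk φ k (∂_{basisVec i} d) x := by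
  have hB : gradConst φ * lowLip φ b d ≠ ∞ := ENNReal.mul_ne_top gradConst_ne_top hlow
  have hz : ∀ i y, ‖lowCut φ b (∂_{basisVec i} d) y‖ₑ ≤ gradConst φ * lowLip φ b d :=
    fun i y => enorm_lowCut_lineDeriv_le hφ hd hnd i b y
  have hc : ∀ i, Continuous fun y => lowCut φ b u y i := fun i =>
    (EuclideanSpace.proj i : Vec N →L[ℂ] ℂ).continuous.comp (continuous_lowCut _ _)
  have h1 : ∀ i, Integrable fun y => kernelAt (blockSym φ k) x y •
      (lowCut φ b u y i - lowCut φ b u x i) • lowCut φ b (∂_{basisVec i} d) y := fun i =>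
    integrable_comm (v := fun y => lowCut φ b u y i) (L := gradConst φ * lip φ u)
      (ENNReal.mul_ne_top gradConst_ne_top hlu) hB (hc i) (continuous_lowCut _ _)
      (fun y => (enorm_coord_le (lowCut φ b u y - lowCut φ b u x) i).trans
        (enorm_lowCut_sub_le_lip hφ hu hnu hlu b x y)) (hz i)
  have h2 : ∀ i, Integrable fun y => lowCut φ b u x i • kernelAt (blockSym φ k) x y •
      lowCut φ b (∂_{basisVec i} d) y := fun i =>
    (integrable_kernelAt_smul_of_bound (blockSym φ k) x (continuous_lowCut _ _) hB (hz i)).smul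
      (lowCut φ b u x i)
  have h3 : ∀ i y, kernelAt (blockSym φ k) x y • lowCut φ b u y i •
      lowCut φ b (∂_{basisVec i} d) y = kernelAt (blockSym φ k) x y •
      (lowCut φ b u y i - lowCut φ b u x i) • lowCut φ b (∂_{basisVec i} d) y +
      lowCut φ b u x i • kernelAt (blockSym φ k) x y • lowCut φ b (∂_{basisVec i} d) y := by
    intro i y
    rw [smul_comm (lowCut φ b u x i), ← smul_add, ← add_smul, sub_add_cancel]
  have h4 : ∀ i, Integrable fun y => kernelAt (blockSym φ k) x y •
      (lowCut φ b u y i - lowCut φ b u x i) • lowCut φ b (∂_{basisVec i} d) y +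
      lowCut φ b u x i • kernelAt (blockSym φ k) x y • lowCut φ b (∂_{basisVec i} d) y :=
    fun i => (h1 i).add (h2 i)
  simp only [Finset.smul_sum, h3]
  rw [integral_finsetSum _ fun i _ => h4 i, ← Finset.sum_sub_distrib]
  refine Finset.sum_congr rfl fun i _ => ?_
  rw [integral_add (h1 i) (h2 i), integral_smul, integral_kernelAt_lowCut hφ hd hnd hlow i hk,
    add_sub_cancel_right]
  rfl

/-- The commutator `Δ_k(u · ∇d) - u · ∇Δ_k d`, where `g` is the product `u · ∇d` and `U` is the
function given by `u`. -/
def advComm (φ : 𝓢(Space N, ℝ)) (U : Space N → Vec N) (d g : 𝓢'(Space N, Vec N)) (k : ℤ)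
    (x : Space N) : Vec N :=
  blk φ k g x - ∑ i, U x i • blk φ k (∂_{basisVec i} d) x

/-- The commutator estimate for the product `u · ∇d`. -/
theorem exists_advComm_bound (hφ : IsDyadicPartition φ) {s : ℝ} (hs : -(N : ℝ) / 2 < s)
    (hs' : s < 1 + (N : ℝ) / 2) : ∃ C : ℝ≥0∞, C ≠ ∞ ∧ ∀ (u d g : 𝓢'(Space N, Vec N))
      (U : Space N → Vec N), FiniteBlocks φ u → FiniteBlocks φ d → HasNormalizedGradient φ u →
      HasNormalizedGradient φ d → lip φ u ≠ ∞ → besovSum φ s d ≠ ∞ → IsAdvection u d g →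
      (∀ x, Tendsto (fun n : ℕ => lowCut φ n u x) atTop (𝓝 (U x))) →
      ∑' k : ℤ, pw (k * s) * eLpNorm (advComm φ U d g k) 2 ≤ C * lip φ u * besovSum φ s d := by
  obtain ⟨C, hC, h⟩ := exists_commSum_lowCut_bound hφ hs hs'
  refine ⟨C, hC, fun u d g U hu hd hnu hnd hlu hbd hg hU => ?_⟩
  have hlow : ∀ b, lowLip φ b d ≠ ∞ := fun b =>
    ne_top_of_le_ne_top (ENNReal.mul_ne_top (pw_ne_top _) hbd) (lowLip_le_besovSum hs'.le b d)
  refine tsum_eLpNorm_le_of_tendsto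
    (fun (n : ℕ) k => (h u d hu hd hnu hnd hlu hbd n).1 k) (fun k x => ?_)
    fun n => (h u d hu hd hnu hnd hlu hbd n).2
  -- mollification with the kernel of `S_0` at the scale `2 ^ (-n)` is the cut-off `S_n`
  have h1 := hg (𝓕⁻ (lowSym φ 0)) (integral_fourierInv_lowSym hφ) (kernelAt (blockSym φ k) x)
  simp only [mollify_eq_lowCut] at h1
  have h2 : Tendsto (fun n : ℕ => ∑ i, lowCut φ n u x i • blk φ k (∂_{basisVec i} d) x) atTop
      (𝓝 (∑ i, U x i • blk φ k (∂_{basisVec i} d) x)) :=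
    tendsto_finsetSum _ fun i _ => Tendsto.smul_const
      (((EuclideanSpace.proj i : Vec N →L[ℂ] ℂ).continuous.tendsto _).comp (hU x)) _
  refine (h1.sub h2).congr' ?_
  filter_upwards [eventually_ge_atTop (k.natAbs + 3)] with n hn
  rw [commSum_lowCut_eq hφ hu hd hnu hnd hlu (hlow n) (by omega)]

end Advection

/-! ### Energy identities for a block at a fixed time -/

section Energy

set_option linter.unusedSectionVars false

variable {N : ℕ} {φ : 𝓢(Space N, ℝ)}

/-- The radial cut-off equal to `1` on the ball of radius `R` and to `0` outside the ball of
radius `2R`. -/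
def cutoff (R : ℝ) (x : Space N) : ℝ := max 0 (min 1 (2 - ‖x‖ / R))

theorem cutoff_nonneg (R : ℝ) (x : Space N) : 0 ≤ cutoff R x := le_max_left _ _

theorem cutoff_le_one (R : ℝ) (x : Space N) : cutoff R x ≤ 1 :=
  max_le zero_le_one (min_le_left _ _)

theorem continuous_cutoff (R : ℝ) : Continuous (cutoff (N := N) R) := by
  unfold cutoff; fun_prop

theorem cutoff_eq_zero {R : ℝ} (hR : 0 < R) {x : Space N} (h : 2 * R ≤ ‖x‖) : cutoff R x = 0 := by
  rw [cutoff, max_eq_left]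
  refine (min_le_right _ _).trans ?_
  rw [sub_nonpos, le_div_iff₀ hR]
  exact h

theorem hasCompactSupport_cutoff {R : ℝ} (hR : 0 < R) : HasCompactSupport (cutoff (N := N) R) := by
  refine HasCompactSupport.intro (isCompact_closedBall (0 : Space N) (2 * R)) fun x hx => ?_
  refine cutoff_eq_zero hR ?_
  rw [mem_closedBall_zero_iff, not_le] at hx
  exact hx.le

theorem abs_cutoff_sub_le {R : ℝ} (hR : 0 < R) (x y : Space N) :
    |cutoff R x - cutoff R y| ≤ ‖x - y‖ / R := by
  have h1 : |cutoff R x - cutoff R y| ≤ |(2 - ‖x‖ / R) - (2 - ‖y‖ / R)| := by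
    rw [cutoff, cutoff, max_comm 0, max_comm 0, min_comm 1, min_comm 1]
    refine (abs_max_sub_max_le_abs _ _ _).trans ((abs_min_sub_min_le_max _ _ _ _).trans ?_)
    rw [sub_self, abs_zero, max_eq_left (abs_nonneg _)]
  refine h1.trans ?_
  have : (2 - ‖x‖ / R) - (2 - ‖y‖ / R) = -((‖x‖ - ‖y‖) / R) := by ring
  rw [this, abs_neg, abs_div, abs_of_pos hR]
  gcongr
  exact abs_norm_sub_norm_le x y

theorem tendsto_cutoff (x : Space N) : Tendsto (fun n : ℕ => cutoff ((n : ℝ) + 1) x) atTop (𝓝 1) := by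
  refine tendsto_const_nhds.congr' ?_
  filter_upwards [eventually_ge_atTop ⌈‖x‖⌉₊] with n hn
  have h : ‖x‖ ≤ (n : ℝ) + 1 := (Nat.ceil_le.1 hn).trans (by linarith)
  have h' : ‖x‖ / ((n : ℝ) + 1) ≤ 1 := (div_le_one (by positivity)).2 h
  rw [cutoff, min_eq_left (by linarith), max_eq_right zero_le_one]

/-- A Lipschitz function times a cut-off is Lipschitz. -/
theorem abs_cutoff_mul_sub_le {R : ℝ} (hR : 0 < R) {v : Space N → ℝ} {L : ℝ}
    (hv : ∀ x y, |v x - v y| ≤ L * ‖x - y‖) (x y : Space N) :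
    |cutoff R x * v x - cutoff R y * v y| ≤ (3 * L + |v 0| / R) * ‖x - y‖ := by
  wlog hxy : ‖y‖ ≤ ‖x‖ generalizing x y
  · rw [abs_sub_comm, norm_sub_rev]; exact this y x (not_le.1 hxy).le
  have hL : 0 ≤ L * ‖x - y‖ := (abs_nonneg _).trans (hv x y)
  rcases le_or_gt (2 * R) ‖y‖ with h | h
  · rw [cutoff_eq_zero hR h, cutoff_eq_zero hR (h.trans hxy)]
    have : 0 ≤ |v 0| / R * ‖x - y‖ := by positivity
    simp only [zero_mul, sub_self, abs_zero]
    linarith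
  have h0 := hv y 0
  rw [sub_zero] at h0
  rcases eq_or_ne x y with rfl | hne
  · simp
  have hL' : 0 ≤ L := nonneg_of_mul_nonneg_left hL (norm_sub_pos_iff.2 hne)
  have h2 : |v y| ≤ |v 0| + 2 * R * L := by
    have h3 : |v y| ≤ |v y - v 0| + |v 0| := by simpa using abs_add_le (v y - v 0) (v 0)
    nlinarith
  have e : cutoff R x * v x - cutoff R y * v y =
      cutoff R x * (v x - v y) + (cutoff R x - cutoff R y) * v y := by ring
  rw [e]
  refine (abs_add_le _ _).trans ?_
  rw [abs_mul, abs_mul, abs_of_nonneg (cutoff_nonneg _ _)]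
  have h4 : cutoff R x * |v x - v y| ≤ 1 * (L * ‖x - y‖) :=
    mul_le_mul (cutoff_le_one _ _) (hv x y) (abs_nonneg _) zero_le_one
  have h5 : |cutoff R x - cutoff R y| * |v y| ≤ ‖x - y‖ / R * (|v 0| + 2 * R * L) :=
    mul_le_mul (abs_cutoff_sub_le hR x y) h2 (abs_nonneg _) (by positivity)
  have h6 : ‖x - y‖ / R * (|v 0| + 2 * R * L) = (2 * L + |v 0| / R) * ‖x - y‖ := by
    field_simp; ring
  linarith

theorem integral_norm_sq_eq {w : Space N → Vec N} (hw : MemLp w 2) :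
    ∫ x, ‖w x‖ ^ 2 = (eLpNorm w 2).toReal ^ 2 := by
  have h := hw.eLpNorm_eq_integral_rpow_norm two_ne_zero ENNReal.ofNat_ne_top
  rw [h, ENNReal.toReal_ofReal (by positivity), ← Real.rpow_natCast, ← Real.rpow_mul]
  · simp
  · exact integral_nonneg fun x => by positivity

theorem integrable_norm_sq {w : Space N → Vec N} (hw : MemLp w 2) :
    Integrable fun x => ‖w x‖ ^ 2 := hw.integrable_norm_pow two_ne_zero

theorem integrable_inner_of_memLp {w z : Space N → Vec N} (hw : MemLp w 2) (hz : MemLp z 2) :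
    Integrable fun x => inner ℝ (w x) (z x) := by
  refine (hw.norm.integrable_mul hz.norm).mono' (hw.1.inner hz.1) (Eventually.of_forall fun x => ?_)
  exact abs_real_inner_le_norm _ _

theorem IsBlock.hasLineDerivAt_norm_sq {l : ℤ} {w : Space N → Vec N} (h : IsBlock φ l w)
    (x v : Space N) :
    HasLineDerivAt ℝ (fun x => ‖w x‖ ^ 2) (2 * inner ℝ (w x) (dblk φ l v w x)) x v := by
  have h1 := (h.hasLineDerivAt x v)
  have h2 : HasDerivAt (fun t : ℝ => w (x + t • v)) (dblk φ l v w x) 0 := h1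
  have h3 := h2.norm_sq
  rw [zero_smul, add_zero] at h3
  exact h3

theorem IsBlock.exists_lipschitzWith_norm_sq {l : ℤ} {w : Space N → Vec N} (h : IsBlock φ l w) :
    ∃ K, LipschitzWith K (fun x => ‖w x‖ ^ 2) := by
  obtain ⟨B, hB⟩ : ∃ B, ∀ x, ‖w x‖ ≤ B := ⟨_, h.norm_le⟩
  set D : ℝ≥0∞ := gradConst φ * pw (l * (1 + N / 2)) * eLpNorm w 2 with hD
  have hD' : D ≠ ∞ := ENNReal.mul_ne_top (ENNReal.mul_ne_top gradConst_ne_top (pw_ne_top _))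
    h.memLp.2.ne
  have h1 : ∀ x y, ‖w x - w y‖ ≤ D.toReal * ‖x - y‖ := fun x y => by
    have := ENNReal.toReal_mono (ENNReal.mul_ne_top hD' enorm_ne_top) (h.enorm_sub_le y x)
    rwa [ENNReal.toReal_mul, toReal_enorm, toReal_enorm] at this
  have hB0 : 0 ≤ B := (norm_nonneg _).trans (hB 0)
  refine ⟨(2 * B * D.toReal).toNNReal, LipschitzWith.of_dist_le_mul fun x y => ?_⟩
  rw [Real.coe_toNNReal _ (by positivity), Real.dist_eq, dist_eq_norm]
  have e : ‖w x‖ ^ 2 - ‖w y‖ ^ 2 = (‖w x‖ + ‖w y‖) * (‖w x‖ - ‖w y‖) := by ring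
  rw [e, abs_mul, abs_of_nonneg (by positivity)]
  refine (mul_le_mul (add_le_add (hB x) (hB y)) ((abs_norm_sub_norm_le _ _).trans (h1 x y))
    (abs_nonneg _) (by positivity)).trans_eq ?_
  ring

/-- The transport term `∫ χ v ∂_i |w|²`, after an integration by parts against the Lipschitz
function `χ v`. -/
theorem IsBlock.abs_integral_cutoff_le {l : ℤ} {w : Space N → Vec N} (h : IsBlock φ l w)
    {R : ℝ} (hR : 0 < R) {v : Space N → ℝ} {L : ℝ}
    (hL : 0 ≤ L) (hv : ∀ x y, |v x - v y| ≤ L * ‖x - y‖) (i : Fin N) :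
    |∫ x, cutoff R x * (v x * (2 * inner ℝ (w x) (dblk φ l (basisVec i) w x)))| ≤
      (3 * L + |v 0| / R) * (eLpNorm w 2).toReal ^ 2 := by
  obtain ⟨K, hK⟩ := h.exists_lipschitzWith_norm_sq
  set D : ℝ := 3 * L + |v 0| / R with hD
  have hD0 : 0 ≤ D := by positivity
  have hg : LipschitzWith D.toNNReal fun x => cutoff R x * v x :=
    LipschitzWith.of_dist_le_mul fun x y => by
      rw [Real.coe_toNNReal _ hD0, Real.dist_eq, dist_eq_norm]
      exact abs_cutoff_mul_sub_le hR hv x y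
  have h1 := LipschitzWith.integral_lineDeriv_mul_eq (μ := volume) hK hg
    ((hasCompactSupport_cutoff hR).mul_right) (basisVec i)
  have e : ∀ x, cutoff R x * (v x * (2 * inner ℝ (w x) (dblk φ l (basisVec i) w x))) =
      lineDeriv ℝ (fun x => ‖w x‖ ^ 2) x (basisVec i) * (cutoff R x * v x) := fun x => by
    rw [(h.hasLineDerivAt_norm_sq x _).lineDeriv]; ring
  simp only [e]
  rw [h1, ← integral_norm_sq_eq h.memLp, ← integral_const_mul, ← Real.norm_eq_abs]
  refine norm_integral_le_of_norm_le ((integrable_norm_sq h.memLp).const_mul D)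
    (Eventually.of_forall fun x => ?_)
  rw [norm_mul, Real.norm_of_nonneg (sq_nonneg ‖w x‖)]
  refine mul_le_mul_of_nonneg_right ?_ (sq_nonneg _)
  refine (norm_lineDeriv_le_of_lipschitz ℝ (f := fun x => cutoff R x * v x) hg).trans_eq ?_
  rw [Real.coe_toNNReal _ hD0, norm_neg]
  simp

/-- The Laplacian of a block. -/
def lapBlk (φ : 𝓢(Space N, ℝ)) (l : ℤ) (w : Space N → Vec N) (x : Space N) : Vec N :=
  ∑ i, mconv (derivSym (basisVec i) (derivSym (basisVec i) (fatSym φ l))) w x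

theorem memLp_mconv (m : 𝓢(Space N, ℂ)) {w : Space N → Vec N} (h : MemLp w 2) :
    MemLp (mconv m w) 2 :=
  ⟨(continuous_mconv _ h).aestronglyMeasurable, (eLpNorm_mconv_le _ h.1).trans_lt
    (ENNReal.mul_lt_top (kerL1_ne_top _).lt_top h.2)⟩

theorem IsBlock.integral_inner_lapBlk {l : ℤ} {w : Space N → Vec N} (h : IsBlock φ l w) :
    ∫ x, inner ℝ (lapBlk φ l w x) (w x) =
      - ∑ i, (eLpNorm (dblk φ l (basisVec i) w) 2).toReal ^ 2 := by
  have hm : ∀ i, MemLp (mconv (derivSym (basisVec i) (derivSym (basisVec i) (fatSym φ l))) w) 2 :=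
    fun i => memLp_mconv _ h.memLp
  simp only [lapBlk, sum_inner]
  rw [integral_finsetSum _ fun i _ => integrable_inner_of_memLp (hm i) h.memLp,
    ← Finset.sum_neg_distrib]
  refine Finset.sum_congr rfl fun i _ => ?_
  have hd : MemLp (dblk φ l (basisVec i) w) 2 := memLp_dblk h.memLp _
  have h1 : ∫ x, inner ℝ (w x)
      (mconv (derivSym (basisVec i) (derivSym (basisVec i) (fatSym φ l))) w x) =
      -∫ x, inner ℝ (dblk φ l (basisVec i) w x) (dblk φ l (basisVec i) w x) :=
    integral_bilinear_hasLineDerivAt_right_eq_neg_left_of_integrable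
      (μ := (volume : Measure (Space N))) (v := basisVec i) (B := innerSL ℝ (E := Vec N))
      (integrable_inner_of_memLp hd hd) (integrable_inner_of_memLp h.memLp (hm i))
      (integrable_inner_of_memLp h.memLp hd)
      (fun x _ => h.hasLineDerivAt x _) (fun x _ => hasLineDerivAt_mconv _ h.memLp x _)
  simp only [real_inner_self_eq_norm_sq] at h1
  rw [integral_norm_sq_eq hd] at h1
  rw [← h1]
  exact integral_congr_ae (Eventually.of_forall fun x => real_inner_comm _ _)

theorem blk_laplacian (hφ : IsDyadicPartition φ) {f : 𝓢'(Space N, Vec N)}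
    (hf : FiniteBlocks φ f) (k : ℤ) (x : Space N) :
    blk φ k (Δ f) x = lapBlk φ k (blk φ k f) x := by
  have h1 : Δ f = ∑ i : Fin N, ∂_{basisVec i} (∂_{basisVec i} f) := by
    rw [TemperedDistribution.laplacian_eq_sum (EuclideanSpace.basisFun (Fin N) ℝ)]
    simp [basisVec]
  have h2 : ∀ i, (∂_{basisVec i} (∂_{basisVec i} f)) (kernelAt (blockSym φ k) x) =
      mconv (derivSym (basisVec i) (derivSym (basisVec i) (fatSym φ k))) (blk φ k f) x := fun i => by
    rw [← (block_representation hφ (hf k)).2.2, ← apply_kernelAt_derivSym,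
      ← apply_kernelAt_derivSym]
    congr 2
    ext ξ
    have h := congrFun (congrArg DFunLike.coe (fatSym_mul_blockSym hφ k)) ξ
    simp only [symMul_apply, derivSym_apply] at h ⊢
    linear_combination (-(2 * Real.pi * Complex.I * (inner ℝ ξ (basisVec i) : ℂ)) ^ 2) * h
  rw [blk, lapBlk, h1]
  simp only [← h2]
  exact sum_apply _ _ _

theorem exists_eLpNorm_lapBlk_le (φ : 𝓢(Space N, ℝ)) (l : ℤ) : ∃ C : ℝ≥0∞, C ≠ ∞ ∧
    ∀ w : Space N → Vec N, MemLp w 2 → MemLp (lapBlk φ l w) 2 ∧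
      eLpNorm (lapBlk φ l w) 2 ≤ C * eLpNorm w 2 := by
  refine ⟨∑ i, kerL1 (derivSym (basisVec i) (derivSym (basisVec i) (fatSym φ l))),
    (ENNReal.sum_lt_top.2 fun _ _ => (kerL1_ne_top _).lt_top).ne, fun w hw => ?_⟩
  have e : lapBlk φ l w =
      ∑ i, mconv (derivSym (basisVec i) (derivSym (basisVec i) (fatSym φ l))) w := by
    ext1 x; rw [lapBlk, Finset.sum_apply]
  rw [e]
  refine ⟨memLp_finsetSum' _ fun i _ => memLp_mconv _ hw, ?_⟩
  refine (eLpNorm_sum_le (fun i _ => (memLp_mconv _ hw).1) one_le_two).trans ?_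
  rw [Finset.sum_mul]
  exact Finset.sum_le_sum fun i _ => eLpNorm_mconv_le _ hw.1

/-- A symbol that agrees with the one of `Δ⁻¹` on the frequencies of the block of index `0`. It is the
product of `fatSym φ 0` with `-|2πξ|⁻²`, smooth because `fatSym φ 0` vanishes near the origin. -/
theorem exists_inverse_laplacian_symbol (hφ : IsDyadicPartition φ) : ∃ ρ : 𝓢(Space N, ℂ),
    ∑ i, derivSym (basisVec i) (derivSym (basisVec i) ρ) = fatSym φ 0 := by
  let f : Space N → ℂ := fun ξ =>
    fatSym φ 0 ξ * (((-(2 * Real.pi) ^ 2 * ‖ξ‖ ^ 2)⁻¹ : ℝ) : ℂ)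
  have hsupp : HasCompactSupport f := by
    refine HasCompactSupport.intro (isCompact_closedBall (0 : Space N) 1) fun ξ hξ => ?_
    by_contra h0
    have h1 := (fatSym_ne_zero hφ (left_ne_zero_of_mul h0)).2
    rw [mem_closedBall_zero_iff, not_le] at hξ
    rw [zpow_zero, mul_one] at h1
    nlinarith [Real.pi_gt_three]
  have hsm : ContDiff ℝ (⊤ : ℕ∞) f := by
    rw [contDiff_iff_contDiffAt]
    intro ξ
    rcases eq_or_ne ξ 0 with rfl | hξ
    · refine (contDiffAt_const (c := (0 : ℂ))).congr_of_eventuallyEq ?_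
      have h1 : ∀ᶠ ξ : Space N in 𝓝 0, 2 * Real.pi * ‖ξ‖ < 3 / 8 := by
        have h2 : Continuous fun ξ : Space N => 2 * Real.pi * ‖ξ‖ := by fun_prop
        refine (h2.tendsto 0).eventually_lt_const ?_
        rw [norm_zero, mul_zero]; norm_num
      filter_upwards [h1] with ξ h
      have h3 : fatSym φ 0 ξ = 0 := by
        by_contra h0
        have := (fatSym_ne_zero hφ h0).1
        rw [zpow_zero] at this
        linarith
      change fatSym φ 0 ξ * _ = 0
      rw [h3, zero_mul]
    · refine ((fatSym φ 0).smooth ⊤).contDiffAt.mul ?_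
      refine Complex.ofRealCLM.contDiff.contDiffAt.comp ξ ?_
      refine ContDiffAt.inv (contDiffAt_const.mul (contDiff_norm_sq ℝ).contDiffAt) ?_
      have : 0 < ‖ξ‖ := norm_pos_iff.2 hξ
      have : (2 * Real.pi) ^ 2 * ‖ξ‖ ^ 2 ≠ 0 := by positivity
      simpa using this
  refine ⟨hsupp.toSchwartzMap hsm, ?_⟩
  ext ξ
  simp only [sum_apply, derivSym_apply]
  change ∑ i, _ * (_ * f ξ) = _
  have h1 : ∑ i : Fin N, 2 * Real.pi * Complex.I * (inner ℝ ξ (basisVec i) : ℂ) *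
      (2 * Real.pi * Complex.I * (inner ℝ ξ (basisVec i) : ℂ) * f ξ) =
      ((-(2 * Real.pi) ^ 2 * ‖ξ‖ ^ 2 : ℝ) : ℂ) * f ξ := by
    have h2 : ‖ξ‖ ^ 2 = ∑ i, (inner ℝ ξ (basisVec i)) ^ 2 := by
      rw [EuclideanSpace.norm_sq_eq]
      refine Finset.sum_congr rfl fun i _ => ?_
      simp [basisVec, EuclideanSpace.inner_single_right]
    rw [h2, Finset.mul_sum]
    push_cast
    rw [Finset.sum_mul]
    refine Finset.sum_congr rfl fun i _ => ?_
    linear_combination (4 * (Real.pi : ℂ) ^ 2 * (inner ℝ ξ (basisVec i) : ℂ) ^ 2 * f ξ) *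
      Complex.I_sq
  rw [h1]
  by_cases h0 : fatSym φ 0 ξ = 0
  · simp only [f, h0, zero_mul, mul_zero]
  · have h3 := (fatSym_ne_zero hφ h0).1
    have h4 : 0 < ‖ξ‖ := by
      rw [zpow_zero] at h3
      by_contra h5
      have : ‖ξ‖ = 0 := le_antisymm (not_lt.1 h5) (norm_nonneg _)
      rw [this] at h3
      linarith
    have h5 : (-(2 * Real.pi) ^ 2 * ‖ξ‖ ^ 2 : ℝ) ≠ 0 := by
      have : (2 * Real.pi) ^ 2 * ‖ξ‖ ^ 2 ≠ 0 := by positivity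
      simpa using this
    simp only [f]
    rw [mul_left_comm, ← Complex.ofReal_mul, mul_inv_cancel₀ h5, Complex.ofReal_one, mul_one]

/-- The reverse Bernstein inequality `2^l ‖w‖ ≤ C ∑ ‖∂_i w‖` for a block. -/
theorem exists_pw_mul_eLpNorm_le (hφ : IsDyadicPartition φ) : ∃ K : ℝ≥0∞, K ≠ ∞ ∧
    ∀ (l : ℤ) (w : Space N → Vec N), IsBlock φ l w →
      pw l * eLpNorm w 2 ≤ K * ∑ i, eLpNorm (dblk φ l (basisVec i) w) 2 := by
  obtain ⟨ρ, hρ⟩ := exists_inverse_laplacian_symbol hφ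
  refine ⟨∑ i : Fin N, kerL1 (derivSym (basisVec i) ρ),
    (ENNReal.sum_lt_top.2 fun _ _ => (kerL1_ne_top _).lt_top).ne, fun l w hw => ?_⟩
  -- `2^l w` is the sum of the multipliers `∂_i ρ (2^{-l} D)` applied to `∂_i w`
  have h1 : ∀ x, ((2 : ℂ) ^ l) • w x =
      ∑ i, mconv (dil l (derivSym (basisVec i) ρ)) (dblk φ l (basisVec i) w) x := by
    intro x
    have h2 : ∀ i, mconv (dil l (derivSym (basisVec i) ρ)) (dblk φ l (basisVec i) w) x =
        Lp.toTemperedDistribution (hw.memLp.toLp w)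
          (kernelAt (symMul (dil l (derivSym (basisVec i) ρ))
            (derivSym (basisVec i) (fatSym φ l))) x) := fun i => by
      rw [dblk, mconv_mconv _ _ hw.memLp, mconv_eq_apply _ hw.memLp]
    simp only [h2]
    rw [← map_sum, ← kernelAt_sum]
    have h3 : ∑ i, symMul (dil l (derivSym (basisVec i) ρ)) (derivSym (basisVec i) (fatSym φ l)) =
        (2 : ℂ) ^ l • symMul (fatSym φ l) (fatSym φ l) := by
      have e : fatSym φ l = dil l (fatSym φ 0) := by rw [dil_fatSym, add_zero]
      ext ξ
      have h4 : ∑ i, derivSym (basisVec i) (derivSym (basisVec i) ρ) ((2 : ℝ) ^ (-l) • ξ) =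
          fatSym φ 0 ((2 : ℝ) ^ (-l) • ξ) := by
        rw [← hρ, sum_apply]
      have h5 : ∀ i, derivSym (basisVec i) (derivSym (basisVec i) ρ) ((2 : ℝ) ^ (-l) • ξ) =
          (2 * Real.pi * Complex.I) * ((2 : ℝ) ^ (-l) * inner ℝ ξ (basisVec i) : ℂ) *
            derivSym (basisVec i) ρ ((2 : ℝ) ^ (-l) • ξ) := fun i => by
        rw [derivSym_apply, inner_smul_left]
        simp
      simp only [sum_apply, symMul_apply, smul_apply, smul_eq_mul]
      have h6 : fatSym φ l ξ = fatSym φ 0 ((2 : ℝ) ^ (-l) • ξ) := by rw [e, dil_apply]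
      have h8 : (2 : ℂ) ^ l * (2 : ℂ) ^ (-l) = 1 := by
        rw [← zpow_add₀ two_ne_zero, add_neg_cancel, zpow_zero]
      have h9 : fatSym φ l ξ * fatSym φ l ξ =
          (∑ i, derivSym (basisVec i) (derivSym (basisVec i) ρ) ((2 : ℝ) ^ (-l) • ξ)) *
            fatSym φ l ξ := by rw [h4, ← h6]
      rw [h9, Finset.sum_mul, Finset.mul_sum]
      refine Finset.sum_congr rfl fun i _ => ?_
      rw [h5, dil_apply, derivSym_apply (basisVec i) (fatSym φ l)]
      linear_combination (-(2 * Real.pi * Complex.I) * (inner ℝ ξ (basisVec i) : ℂ) *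
        derivSym (basisVec i) ρ ((2 : ℝ) ^ (-l) • ξ) * fatSym φ l ξ) * h8
    rw [h3, kernelAt_smul, map_smul, ← mconv_eq_apply _ hw.memLp, ← mconv_mconv _ _ hw.memLp,
      ← funext hw.eq_mconv, ← hw.eq_mconv]
  have h7 : pw l * eLpNorm w 2 = eLpNorm (fun x => ((2 : ℂ) ^ l) • w x) 2 := by
    rw [← enorm_two_zpow]
    exact (eLpNorm_const_smul _ _ _ _).symm
  have e : (fun x => ((2 : ℂ) ^ l) • w x) =
      ∑ i, mconv (dil l (derivSym (basisVec i) ρ)) (dblk φ l (basisVec i) w) := by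
    ext1 x; rw [h1, Finset.sum_apply]
  have hd : ∀ i, MemLp (dblk φ l (basisVec i) w) 2 := fun i => memLp_dblk hw.memLp _
  rw [h7, e]
  refine (eLpNorm_sum_le (fun i _ => (memLp_mconv _ (hd i)).1) one_le_two).trans ?_
  rw [Finset.mul_sum]
  refine Finset.sum_le_sum fun i _ => ?_
  refine (eLpNorm_mconv_le _ (hd i).1).trans (mul_le_mul' ?_ le_rfl)
  rw [kerL1_dil]
  exact Finset.single_le_sum (f := fun i => kerL1 (derivSym (basisVec i) ρ))
    (fun _ _ => zero_le) (Finset.mem_univ i)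

theorem sq_le_sum_sq_of_le_sum {ι : Type*} [Fintype ι] {a K : ℝ} {b : ι → ℝ} (ha : 0 ≤ a)
    (h : a ≤ K * ∑ i, b i) :
    1 / ((K ^ 2 + 1) * (Fintype.card ι + 1)) * a ^ 2 ≤ ∑ i, b i ^ 2 := by
  have h2 : (∑ i, b i) ^ 2 ≤ Fintype.card ι * ∑ i, b i ^ 2 :=
    sq_sum_le_card_mul_sum_sq (s := (Finset.univ : Finset ι))
  have h3 := pow_le_pow_left₀ ha h 2
  rw [mul_pow] at h3
  set S := ∑ i, b i ^ 2
  have hS : 0 ≤ S := Finset.sum_nonneg fun _ _ => sq_nonneg _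
  rw [one_div, inv_mul_le_iff₀ (by positivity)]
  refine h3.trans ((mul_le_mul_of_nonneg_left h2 (sq_nonneg _)).trans ?_)
  have : (0 : ℝ) ≤ Fintype.card ι := Nat.cast_nonneg _
  nlinarith [mul_nonneg (sq_nonneg K) hS, mul_nonneg this hS]

/-- Coercivity of the Laplacian on a block. -/
theorem exists_coercive (hφ : IsDyadicPartition φ) : ∃ c : ℝ, 0 < c ∧
    ∀ (l : ℤ) (w : Space N → Vec N), IsBlock φ l w →
      ∫ x, inner ℝ (lapBlk φ l w x) (w x) ≤
        -(c * ((2 : ℝ) ^ l * (eLpNorm w 2).toReal) ^ 2) := by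
  obtain ⟨K, hK, h⟩ := exists_pw_mul_eLpNorm_le hφ
  refine ⟨1 / ((K.toReal ^ 2 + 1) * (Fintype.card (Fin N) + 1)), by positivity,
    fun l w hw => ?_⟩
  have hd : ∀ i, eLpNorm (dblk φ l (basisVec i) w) 2 ≠ ∞ := fun i => (memLp_dblk hw.memLp _).2.ne
  have h1 := ENNReal.toReal_mono (ENNReal.mul_ne_top hK
    (ENNReal.sum_lt_top.2 fun i _ => (hd i).lt_top).ne) (h l w hw)
  rw [ENNReal.toReal_mul, ENNReal.toReal_mul, ENNReal.toReal_sum fun i _ => hd i, pw_intCast,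
    ENNReal.toReal_ofReal (by positivity)] at h1
  rw [hw.integral_inner_lapBlk, neg_le_neg_iff]
  exact sq_le_sum_sq_of_le_sum (by positivity) h1

theorem IsReal.im_lowCut {u : 𝓢'(Space N, Vec N)} (hu : IsReal u) (hφ : IsDyadicPartition φ)
    (n : ℤ) (x : Space N) (i : Fin N) : (lowCut φ n u x i).im = 0 := by
  refine hu _ (fun y => ?_) i
  rw [kernelAt_apply, ← Complex.conj_eq_iff_im, SchwartzMap.fourierInv_coe, Real.fourierInv_eq,
    ← integral_conj, ← integral_neg_eq_self]
  refine integral_congr_ae (Eventually.of_forall fun ξ => ?_)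
  simp only [Circle.smul_def, smul_eq_mul, map_mul, lowSym_apply, Complex.conj_ofReal, smul_neg,
    lowProfile_neg hφ, inner_neg_left]
  congr 1
  rw [AddChar.map_neg_eq_inv, Circle.coe_inv_eq_conj, Complex.conj_conj]

end Energy

/-! ### Energy estimates in time -/

section Time

set_option linter.unusedSectionVars false

variable {V : Type*} [NormedAddCommGroup V]

/-- A function of `(τ, x)` measurable in `τ` and continuous in `x` for almost every `τ` has a jointly
measurable modification. The values on a countable dense set of `x` single out the exceptional
times, at which the function is replaced by zero. -/
theorem exists_measurable_modification {S : Type*} [TopologicalSpace S]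
    [TopologicalSpace.MetrizableSpace S] [SecondCountableTopology S] [MeasurableSpace S]
    [BorelSpace S] [Nonempty S] {μ : Measure ℝ} {f : ℝ → S → V}
    (hm : ∀ x, AEStronglyMeasurable (fun τ => f τ x) μ) (hc : ∀ᵐ τ ∂μ, Continuous (f τ)) :
    ∃ f' : ℝ → S → V, StronglyMeasurable (Function.uncurry f') ∧ ∀ᵐ τ ∂μ, f' τ = f τ := by
  let D : ℕ → S := TopologicalSpace.denseSeq S
  have hD : DenseRange D := TopologicalSpace.denseRange_denseSeq S
  have h1 : ∀ᵐ τ ∂μ, (∀ n, f τ (D n) = (hm (D n)).mk _ τ) ∧ Continuous (f τ) :=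
    (ae_all_iff.2 fun n => (hm (D n)).ae_eq_mk).and hc
  let Z : Set ℝ := toMeasurable μ {τ | ¬ ((∀ n, f τ (D n) = (hm (D n)).mk _ τ) ∧ Continuous (f τ))}
  have hZ : MeasurableSet Z := measurableSet_toMeasurable _ _
  have hZ0 : μ Z = 0 := by rw [measure_toMeasurable]; exact h1
  have hZ' : ∀ τ ∉ Z, (∀ n, f τ (D n) = (hm (D n)).mk _ τ) ∧ Continuous (f τ) := fun τ hτ => by
    by_contra h
    exact hτ (subset_toMeasurable _ _ h)
  classical
  let f' : ℝ → S → V := fun τ => if τ ∈ Z then 0 else f τ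
  have hc' : ∀ τ, Continuous (f' τ) := fun τ => by
    by_cases h : τ ∈ Z
    · simp only [f', if_pos h]; exact continuous_zero
    · simp only [f', if_neg h]; exact (hZ' τ h).2
  have hm1 : ∀ n, StronglyMeasurable fun τ => f' τ (D n) := fun n => by
    have : (fun τ => f' τ (D n)) = Zᶜ.indicator ((hm (D n)).mk _) := by
      ext1 τ
      by_cases h : τ ∈ Z
      · simp [f', h]
      · rw [Set.indicator_of_mem (by exact h)]
        simp only [f', if_neg h]
        exact (hZ' τ h).1 n
    rw [this]
    exact (hm (D n)).stronglyMeasurable_mk.indicator hZ.compl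
  have hm2 : ∀ x, StronglyMeasurable fun τ => f' τ x := fun x => by
    let := TopologicalSpace.metrizableSpaceMetric S
    obtain ⟨y, hy, hlim⟩ := mem_closure_iff_seq_limit.1 (hD x)
    choose n hn using hy
    refine stronglyMeasurable_of_tendsto atTop (f := fun j τ => f' τ (y j)) (fun j => ?_) ?_
    · have := hm1 (n j)
      rwa [hn j] at this
    · exact tendsto_pi_nhds.2 fun τ => ((hc' τ).tendsto x).comp hlim
  refine ⟨f', ?_, ?_⟩
  · exact (stronglyMeasurable_uncurry_of_continuous_of_stronglyMeasurable (u := fun x τ => f' τ x)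
      hc' hm2).comp_measurable measurable_swap
  · have : ∀ᵐ τ ∂μ, τ ∉ Z := measure_eq_zero_iff_ae_notMem.1 hZ0
    filter_upwards [this] with τ hτ
    simp only [f', if_neg hτ]

theorem absolutelyContinuousOnInterval_of_dist_le {X Y : Type*} [PseudoMetricSpace X]
    [PseudoMetricSpace Y] {f : ℝ → X} {g : ℝ → Y} {a b K : ℝ}
    (hf : AbsolutelyContinuousOnInterval f a b)
    (h : ∀ x ∈ Set.uIcc a b, ∀ y ∈ Set.uIcc a b, dist (g x) (g y) ≤ K * dist (f x) (f y)) :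
    AbsolutelyContinuousOnInterval g a b := by
  rw [absolutelyContinuousOnInterval_iff] at hf ⊢
  intro ε hε
  obtain ⟨δ, hδ, hf⟩ := hf (ε / (|K| + 1)) (by positivity)
  refine ⟨δ, hδ, fun E hE hs => ?_⟩
  have h1 := hf E hE hs
  rw [lt_div_iff₀ (by positivity)] at h1
  refine lt_of_le_of_lt ?_ h1
  rw [Finset.sum_mul]
  refine Finset.sum_le_sum fun i hi => ?_
  have h2 := hE.1 i hi
  refine (h _ h2.1 _ h2.2).trans ?_
  have := le_abs_self K
  nlinarith [dist_nonneg (x := f (E.2 i).1) (y := f (E.2 i).2)]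

variable [NormedSpace ℝ V]

theorem absolutelyContinuousOnInterval_integral [CompleteSpace V] {f : ℝ → V} {a b : ℝ}
    (h : IntervalIntegrable f volume a b) :
    AbsolutelyContinuousOnInterval (fun x => ∫ v in a..x, f v) a b := by
  refine absolutelyContinuousOnInterval_of_dist_le (K := 1)
    (h.norm.absolutelyContinuousOnInterval_intervalIntegral (c := a) Set.left_mem_uIcc)
    fun x hx y hy => ?_
  have hx' : IntervalIntegrable f volume a x :=
    h.mono_set (Set.uIcc_subset_uIcc Set.left_mem_uIcc hx)
  have hy' : IntervalIntegrable f volume a y :=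
    h.mono_set (Set.uIcc_subset_uIcc Set.left_mem_uIcc hy)
  rw [dist_eq_norm, Real.dist_eq, intervalIntegral.integral_interval_sub_left hx' hy',
    intervalIntegral.integral_interval_sub_left hx'.norm hy'.norm, one_mul]
  exact intervalIntegral.norm_integral_le_abs_integral_norm

theorem integral_eq_sub_of_ae_hasDerivAt {g g' : ℝ → ℝ} {a b : ℝ}
    (hg : AbsolutelyContinuousOnInterval g a b)
    (h : ∀ᵐ x, x ∈ Set.uIcc a b → HasDerivAt g (g' x) x) : ∫ x in a..b, g' x = g b - g a := by
  rw [← hg.integral_deriv_eq_sub]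
  refine intervalIntegral.integral_congr_ae ?_
  filter_upwards [h] with x hx hx'
  exact (hx (Set.uIoc_subset_uIcc hx')).deriv.symm

theorem absolutelyContinuousOnInterval_const_add {f : ℝ → V} {a b : ℝ}
    (hf : AbsolutelyContinuousOnInterval f a b) (z : V) :
    AbsolutelyContinuousOnInterval (fun x => z + f x) a b :=
  absolutelyContinuousOnInterval_of_dist_le (K := 1) hf fun x _ y _ => by simp

/-- The chain rule for `√(E + ε²)`, `E` being absolutely continuous and nonnegative. -/
theorem sqrt_add_sq_eq {e : ℝ → ℝ} {E₀ b ε : ℝ} (hb : 0 ≤ b) (hε : 0 < ε)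
    (he : IntervalIntegrable e volume 0 b) (hE : ∀ t ∈ Set.Icc 0 b, 0 ≤ E₀ + ∫ τ in 0..t, e τ) :
    √((E₀ + ∫ τ in 0..b, e τ) + ε ^ 2) = √(E₀ + ε ^ 2) +
      ∫ t in 0..b, e t / (2 * √((E₀ + ∫ τ in 0..t, e τ) + ε ^ 2)) := by
  set E : ℝ → ℝ := fun t => E₀ + ∫ τ in 0..t, e τ with hEdef
  have hAC : AbsolutelyContinuousOnInterval E 0 b :=
    absolutelyContinuousOnInterval_const_add (absolutelyContinuousOnInterval_integral he) E₀
  rw [← Set.uIcc_of_le hb] at hE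
  have hlow : ∀ t ∈ Set.uIcc 0 b, ε ≤ √(E t + ε ^ 2) := fun t ht => by
    refine Real.le_sqrt_of_sq_le ?_
    linarith [hE t ht]
  have hAC' : AbsolutelyContinuousOnInterval (fun t => √(E t + ε ^ 2)) 0 b := by
    refine absolutelyContinuousOnInterval_of_dist_le (K := ε⁻¹) hAC fun x hx y hy => ?_
    rw [Real.dist_eq, Real.dist_eq]
    have h1 := hlow x hx
    have h2 := hlow y hy
    have h3 : (√(E x + ε ^ 2) - √(E y + ε ^ 2)) * (√(E x + ε ^ 2) + √(E y + ε ^ 2)) =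
        E x - E y := by
      have e1 := Real.sq_sqrt (x := E x + ε ^ 2) (by linarith [hE x hx, sq_nonneg ε])
      have e2 := Real.sq_sqrt (x := E y + ε ^ 2) (by linarith [hE y hy, sq_nonneg ε])
      linear_combination e1 - e2
    rw [← h3, abs_mul, abs_of_nonneg (by linarith : 0 ≤ √(E x + ε ^ 2) + √(E y + ε ^ 2)),
      inv_mul_eq_div, le_div_iff₀ hε]
    exact mul_le_mul_of_nonneg_left (by linarith) (abs_nonneg _)
  have h4 := integral_eq_sub_of_ae_hasDerivAt
    (g' := fun t => e t / (2 * √(E t + ε ^ 2))) hAC' ?_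
  · rw [h4]
    simp [hEdef]
  · filter_upwards [he.ae_hasDerivAt_integral] with t ht hmem
    have h5 : HasDerivAt E (e t) t := (ht hmem 0 Set.left_mem_uIcc).const_add E₀
    refine (h5.add_const (ε ^ 2)).sqrt ?_
    have := hE t hmem
    positivity

theorem tendsto_sq_div_sqrt {x : ℝ} (hx : 0 ≤ x) :
    Tendsto (fun m : ℕ => x ^ 2 / √(x ^ 2 + (1 / ((m : ℝ) + 1)) ^ 2)) atTop (𝓝 x) := by
  rcases hx.eq_or_lt with rfl | h
  · simp
  · have h1 : Tendsto (fun m : ℕ => √(x ^ 2 + (1 / ((m : ℝ) + 1)) ^ 2)) atTop (𝓝 √(x ^ 2 + 0 ^ 2)) :=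
      ((tendsto_const_nhds.add (tendsto_one_div_add_atTop_nhds_zero_nat.pow 2))).sqrt
    rw [zero_pow two_ne_zero, add_zero, Real.sqrt_sq hx] at h1
    have h2 := (tendsto_const_nhds (x := x ^ 2)).div h1 h.ne'
    have e : x ^ 2 / x = x := by rw [sq, mul_div_cancel_right₀ _ h.ne']
    rw [e] at h2
    exact h2

theorem sq_div_sqrt_le {x : ℝ} (hx : 0 ≤ x) (ε : ℝ) : x ^ 2 / √(x ^ 2 + ε ^ 2) ≤ x := by
  have h1 : x ≤ √(x ^ 2 + ε ^ 2) := Real.le_sqrt_of_sq_le (by linarith [sq_nonneg ε])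
  refine div_le_of_le_mul₀ (Real.sqrt_nonneg _) hx ?_
  rw [sq x] at h1 ⊢
  exact mul_le_mul_of_nonneg_left h1 hx

/-- The differential inequality `(X²)' ≤ 2fX - 2κX²`, known only for the approximations `E n` of
`X²`, is integrated through the derivative of `√(E n + ε²)`; then `n → ∞` and `ε → 0`. -/
theorem ae_add_integral_le_of_energy {b κ B X₀ : ℝ} {X f a H h : ℝ → ℝ} {g E e : ℕ → ℝ → ℝ}
    (hX₀ : 0 ≤ X₀)
    (hXm : AEStronglyMeasurable X (volume.restrict (Set.Ioc 0 b)))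
    (hX : ∀ t, 0 ≤ X t) (hXB : ∀ᵐ t ∂volume.restrict (Set.Ioc 0 b), X t ≤ B)
    (hf : IntegrableOn f (Set.Ioc 0 b)) (hf0 : ∀ t, 0 ≤ f t)
    (ha : IntegrableOn a (Set.Ioc 0 b)) (ha0 : ∀ t, 0 ≤ a t)
    (hH : IntegrableOn H (Set.Ioc 0 b))
    (hgm : ∀ n, AEStronglyMeasurable (g n) (volume.restrict (Set.Ioc 0 b)))
    (hgH : ∀ n, ∀ᵐ t ∂volume.restrict (Set.Ioc 0 b), |g n t| ≤ H t)
    (hgh : ∀ᵐ t ∂volume.restrict (Set.Ioc 0 b), Tendsto (fun n => g n t) atTop (𝓝 (h t)))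
    (hh : ∀ᵐ t ∂volume.restrict (Set.Ioc 0 b), h t ≤ -(κ * X t ^ 2))
    (he : ∀ n, IntegrableOn (e n) (Set.Ioc 0 b))
    (hE0 : ∀ n, ∀ t ∈ Set.Icc 0 b, 0 ≤ E n t)
    (hE : ∀ n, ∀ t ∈ Set.Icc 0 b, E n t = E n 0 + ∫ τ in 0..t, e n τ)
    (hle : ∀ n : ℕ, ∀ᵐ t ∂volume.restrict (Set.Ioc 0 b),
      e n t ≤ 2 * (f t * X t) + a t * X t ^ 2 / (n + 1) + 2 * g n t)
    (hlim0 : Tendsto (fun n => E n 0) atTop (𝓝 (X₀ ^ 2)))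
    (hlim : ∀ᵐ t ∂volume.restrict (Set.Ioc 0 b), Tendsto (fun n => E n t) atTop (𝓝 (X t ^ 2))) :
    ∀ᵐ t ∂volume.restrict (Set.Ioc 0 b),
      X t + κ * ∫ τ in 0..t, X τ ≤ X₀ + ∫ τ in 0..t, f τ := by
  have hmono : ∀ {t : ℝ}, t ∈ Set.Ioc 0 b → volume.restrict (Set.Ioc 0 t) ≤
      volume.restrict (Set.Ioc 0 b) := fun {t} ht =>
    Measure.restrict_mono (Set.Ioc_subset_Ioc_right ht.2) le_rfl
  have hXint : IntegrableOn X (Set.Ioc 0 b) :=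
    Integrable.of_bound hXm B (hXB.mono fun t ht => by rwa [Real.norm_of_nonneg (hX t)])
  -- the estimate at a fixed `ε`, where `n → ∞` by dominated convergence: the denominators are at
  -- least `ε`
  have key : ∀ ε : ℝ, 0 < ε → ∀ᵐ t ∂volume.restrict (Set.Ioc 0 b),
      X t + κ * ∫ τ in 0..t, X τ ^ 2 / √(X τ ^ 2 + ε ^ 2) ≤ X₀ + ε + ∫ τ in 0..t, f τ := by
    intro ε hε
    have hEcont : ∀ n, AEStronglyMeasurable (E n) (volume.restrict (Set.Ioc 0 b)) := by
      intro n
      rcases le_or_gt b 0 with hb | hb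
      · rw [Set.Ioc_eq_empty (not_lt.2 hb), Measure.restrict_empty]
        exact aestronglyMeasurable_zero_measure _
      have h1 : ContinuousOn (fun t => E n 0 + ∫ τ in 0..t, e n τ) (Set.uIcc 0 b) :=
        (absolutelyContinuousOnInterval_const_add (absolutelyContinuousOnInterval_integral
          ((intervalIntegrable_iff_integrableOn_Ioc_of_le hb.le).2 (he n))) _).continuousOn
      rw [Set.uIcc_of_le hb.le] at h1
      have h2 : ContinuousOn (E n) (Set.Ioc 0 b) :=
        (h1.congr (hE n)).mono Set.Ioc_subset_Icc_self
      exact h2.aestronglyMeasurable measurableSet_Ioc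
    have hlow : ∀ n, ∀ t ∈ Set.Icc 0 b, ε ≤ √(E n t + ε ^ 2) := fun n t ht =>
      Real.le_sqrt_of_sq_le (by linarith [hE0 n t ht])
    let I : ℕ → ℝ → ℝ := fun n t =>
      (2 * (f t * X t) + a t * X t ^ 2 / (n + 1) + 2 * g n t) / (2 * √(E n t + ε ^ 2))
    let J : ℝ → ℝ := fun t => (f t * X t + h t) / √(X t ^ 2 + ε ^ 2)
    let bd : ℝ → ℝ := fun t => (f t * B + a t * B ^ 2 + H t) / ε
    have hbd : IntegrableOn bd (Set.Ioc 0 b) :=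
      (((hf.mul_const B).add (ha.mul_const (B ^ 2))).add hH).div_const ε
    have hIm : ∀ n, AEStronglyMeasurable (I n) (volume.restrict (Set.Ioc 0 b)) := fun n => by
      have h1 : AEMeasurable X (volume.restrict (Set.Ioc 0 b)) := hXm.aemeasurable
      have h2 := hf.1.aemeasurable
      have h3 := ha.1.aemeasurable
      have h4 := (hgm n).aemeasurable
      have h5 := (hEcont n).aemeasurable
      refine AEMeasurable.aestronglyMeasurable ?_
      exact ((((h2.mul h1).const_mul 2).add ((h3.mul (h1.pow_const 2)).div_const _)).add
        (h4.const_mul 2)).div (((h5.add_const _).sqrt).const_mul 2)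
    have hIbd : ∀ n, ∀ᵐ t ∂volume.restrict (Set.Ioc 0 b), ‖I n t‖ ≤ bd t := fun n => by
      filter_upwards [hXB, hgH n, ae_restrict_mem measurableSet_Ioc] with t h1 h2 h3
      have h4 := hlow n t (Set.Ioc_subset_Icc_self h3)
      have h5 : 0 < √(E n t + ε ^ 2) := hε.trans_le h4
      have h6 : f t * X t ≤ f t * B := mul_le_mul_of_nonneg_left h1 (hf0 t)
      have h7 : a t * X t ^ 2 ≤ a t * B ^ 2 :=
        mul_le_mul_of_nonneg_left (pow_le_pow_left₀ (hX t) h1 2) (ha0 t)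
      have h8 : a t * X t ^ 2 / (n + 1) ≤ a t * X t ^ 2 :=
        div_le_self (mul_nonneg (ha0 t) (sq_nonneg _)) (by linarith [n.cast_nonneg (α := ℝ)])
      have h9 : 0 ≤ a t * X t ^ 2 / (n + 1) :=
        div_nonneg (mul_nonneg (ha0 t) (sq_nonneg _)) (by positivity)
      have h10 : 0 ≤ f t * X t := mul_nonneg (hf0 t) (hX t)
      have h11 := abs_le.1 h2
      have h12 : |2 * (f t * X t) + a t * X t ^ 2 / (n + 1) + 2 * g n t| ≤
          2 * (f t * B + a t * B ^ 2 + H t) := by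
        rw [abs_le]; constructor <;> linarith
      simp only [I, bd]
      rw [norm_div, Real.norm_eq_abs, Real.norm_eq_abs, abs_of_pos (a := 2 * √(E n t + ε ^ 2))
        (by positivity), div_le_div_iff₀ (by positivity) hε]
      refine (mul_le_mul h12 h4 hε.le ((abs_nonneg _).trans h12)).trans_eq (by ring)
    have hIint : ∀ n, IntegrableOn (I n) (Set.Ioc 0 b) := fun n => hbd.mono' (hIm n) (hIbd n)
    have hIlim : ∀ᵐ t ∂volume.restrict (Set.Ioc 0 b),
        Tendsto (fun n => I n t) atTop (𝓝 (J t)) := by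
      filter_upwards [hlim, hgh] with t h1 h2
      have h3 : Tendsto (fun n : ℕ => a t * X t ^ 2 / ((n : ℝ) + 1)) atTop (𝓝 0) := by
        have := (tendsto_one_div_add_atTop_nhds_zero_nat (𝕜 := ℝ)).const_mul (a t * X t ^ 2)
        simpa [div_eq_mul_inv] using this
      have h4 := (((tendsto_const_nhds (x := 2 * (f t * X t))).add h3).add (h2.const_mul 2)).div
        (((h1.add_const (ε ^ 2)).sqrt).const_mul 2) (by positivity)
      have h5 : (2 * (f t * X t) + 0 + 2 * h t) / (2 * √(X t ^ 2 + ε ^ 2)) = J t := by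
        simp only [J]
        rw [add_zero, ← mul_add, mul_div_mul_left _ _ two_ne_zero]
      rw [h5] at h4
      exact h4
    have hineq : ∀ᵐ t ∂volume.restrict (Set.Ioc 0 b),
        √(X t ^ 2 + ε ^ 2) ≤ √(X₀ ^ 2 + ε ^ 2) + ∫ τ in 0..t, J τ := by
      filter_upwards [hlim, ae_restrict_mem measurableSet_Ioc] with t h1 ht
      have h2 : ∀ n, √(E n t + ε ^ 2) ≤ √(E n 0 + ε ^ 2) + ∫ τ in 0..t, I n τ := fun n => by
        have het : IntegrableOn (e n) (Set.Ioc 0 t) :=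
          (he n).mono_set (Set.Ioc_subset_Ioc_right ht.2)
        have heq : ∀ τ ∈ Set.Icc 0 t, E n τ = E n 0 + ∫ σ in 0..τ, e n σ := fun τ hτ =>
          hE n τ ⟨hτ.1, hτ.2.trans ht.2⟩
        have h3 := sqrt_add_sq_eq ht.1.le hε
          ((intervalIntegrable_iff_integrableOn_Ioc_of_le ht.1.le).2 het)
          (fun τ hτ => (hE0 n τ ⟨hτ.1, hτ.2.trans ht.2⟩).trans_eq (heq τ hτ))
        rw [← heq t ⟨ht.1.le, le_rfl⟩] at h3
        rw [h3, add_le_add_iff_left]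
        rw [intervalIntegral.integral_of_le ht.1.le, intervalIntegral.integral_of_le ht.1.le]
        have h4 : ∀ᵐ τ ∂volume.restrict (Set.Ioc 0 t),
            e n τ / (2 * √((E n 0 + ∫ σ in 0..τ, e n σ) + ε ^ 2)) =
              e n τ / (2 * √(E n τ + ε ^ 2)) := by
          filter_upwards [ae_restrict_mem measurableSet_Ioc] with τ hτ
          rw [heq τ ⟨hτ.1.le, hτ.2⟩]
        rw [integral_congr_ae h4]
        refine integral_mono_ae ?_ ((hIint n).mono_set (Set.Ioc_subset_Ioc_right ht.2)) ?_
        · refine (het.norm.div_const ε).mono' ?_ ?_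
          · have h5 := het.1.aemeasurable
            have h6 := ((hEcont n).mono_measure (hmono ht)).aemeasurable
            exact (h5.div (((h6.add_const _).sqrt).const_mul 2)).aestronglyMeasurable
          · filter_upwards [ae_restrict_mem measurableSet_Ioc] with τ hτ
            have h7 := hlow n τ ⟨hτ.1.le, hτ.2.trans ht.2⟩
            rw [norm_div]
            refine div_le_div_of_nonneg_left (norm_nonneg _) hε ?_
            rw [Real.norm_of_nonneg (by positivity)]
            linarith
        · filter_upwards [(hle n).filter_mono (ae_mono (hmono ht)),
            ae_restrict_mem measurableSet_Ioc] with τ h5 hτ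
          exact div_le_div_of_nonneg_right h5 (by positivity)
      have h3 : Tendsto (fun n => ∫ τ in 0..t, I n τ) atTop (𝓝 (∫ τ in 0..t, J τ)) := by
        simp only [intervalIntegral.integral_of_le ht.1.le]
        exact tendsto_integral_of_dominated_convergence bd
          (fun n => (hIm n).mono_measure (hmono ht))
          (hbd.mono_set (Set.Ioc_subset_Ioc_right ht.2))
          (fun n => (hIbd n).filter_mono (ae_mono (hmono ht)))
          (hIlim.filter_mono (ae_mono (hmono ht)))
      exact le_of_tendsto_of_tendsto' ((h1.add_const _).sqrt) (((hlim0.add_const _).sqrt).add h3) h2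
    have hJint : IntegrableOn J (Set.Ioc 0 b) := by
      refine hbd.mono' (aestronglyMeasurable_of_tendsto_ae atTop hIm hIlim) ?_
      filter_upwards [ae_all_iff.2 hIbd, hIlim] with t h1 h2
      exact le_of_tendsto' h2.norm h1
    have hQint : IntegrableOn (fun t => X t ^ 2 / √(X t ^ 2 + ε ^ 2)) (Set.Ioc 0 b) := by
      refine hXint.mono' ?_ (Eventually.of_forall fun t => ?_)
      · have h1 := hXm.aemeasurable
        exact ((h1.pow_const 2).div (((h1.pow_const 2).add_const _).sqrt)).aestronglyMeasurable
      · rw [Real.norm_of_nonneg (by positivity)]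
        exact sq_div_sqrt_le (hX t) ε
    filter_upwards [hineq, ae_restrict_mem measurableSet_Ioc] with t h1 ht
    have h2 : ∫ τ in 0..t, J τ ≤ ∫ τ in 0..t, (f τ - κ * (X τ ^ 2 / √(X τ ^ 2 + ε ^ 2))) := by
      rw [intervalIntegral.integral_of_le ht.1.le, intervalIntegral.integral_of_le ht.1.le]
      refine integral_mono_ae (hJint.mono_set (Set.Ioc_subset_Ioc_right ht.2))
        ((hf.mono_set (Set.Ioc_subset_Ioc_right ht.2)).sub
          ((hQint.mono_set (Set.Ioc_subset_Ioc_right ht.2)).const_mul κ)) ?_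
      filter_upwards [hh.filter_mono (ae_mono (hmono ht))] with τ h3
      have h4 : X τ ≤ √(X τ ^ 2 + ε ^ 2) := Real.le_sqrt_of_sq_le (by linarith [sq_nonneg ε])
      have h5 : 0 < √(X τ ^ 2 + ε ^ 2) := Real.sqrt_pos.2 (by positivity)
      have h6 : f τ - κ * (X τ ^ 2 / √(X τ ^ 2 + ε ^ 2)) =
          (f τ * √(X τ ^ 2 + ε ^ 2) - κ * X τ ^ 2) / √(X τ ^ 2 + ε ^ 2) := by
        field_simp
      simp only [J]
      rw [h6]
      refine div_le_div_of_nonneg_right ?_ h5.le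
      have := mul_le_mul_of_nonneg_left h4 (hf0 τ)
      linarith
    have hft : IntervalIntegrable f volume 0 t :=
      (intervalIntegrable_iff_integrableOn_Ioc_of_le ht.1.le).2
        (hf.mono_set (Set.Ioc_subset_Ioc_right ht.2))
    have hQt : IntervalIntegrable (fun t => X t ^ 2 / √(X t ^ 2 + ε ^ 2)) volume 0 t :=
      (intervalIntegrable_iff_integrableOn_Ioc_of_le ht.1.le).2
        (hQint.mono_set (Set.Ioc_subset_Ioc_right ht.2))
    rw [intervalIntegral.integral_sub hft (hQt.const_mul κ),
      intervalIntegral.integral_const_mul] at h2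
    have h7 : X t ≤ √(X t ^ 2 + ε ^ 2) := Real.le_sqrt_of_sq_le (by linarith [sq_nonneg ε])
    have h8 : √(X₀ ^ 2 + ε ^ 2) ≤ X₀ + ε := by
      rw [Real.sqrt_le_left (by positivity)]
      nlinarith [mul_nonneg hX₀ hε.le]
    linarith
  have key' := ae_all_iff.2 fun m : ℕ => key (1 / ((m : ℝ) + 1)) (by positivity)
  filter_upwards [key', ae_restrict_mem measurableSet_Ioc] with t h1 ht
  have h2 : Tendsto (fun m : ℕ => ∫ τ in 0..t, X τ ^ 2 / √(X τ ^ 2 + (1 / ((m : ℝ) + 1)) ^ 2))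
      atTop (𝓝 (∫ τ in 0..t, X τ)) := by
    simp only [intervalIntegral.integral_of_le ht.1.le]
    refine tendsto_integral_of_dominated_convergence X (fun m => ?_)
      (hXint.mono_set (Set.Ioc_subset_Ioc_right ht.2)) (fun m => Eventually.of_forall fun τ => ?_)
      (Eventually.of_forall fun τ => tendsto_sq_div_sqrt (hX τ))
    · have h1 := (hXm.mono_measure (hmono ht)).aemeasurable
      exact ((h1.pow_const 2).div (((h1.pow_const 2).add_const _).sqrt)).aestronglyMeasurable
    · rw [Real.norm_of_nonneg (by positivity)]
      exact sq_div_sqrt_le (hX τ) _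
  have h3 : Tendsto (fun m : ℕ => X₀ + 1 / ((m : ℝ) + 1) + ∫ τ in 0..t, f τ) atTop
      (𝓝 (X₀ + 0 + ∫ τ in 0..t, f τ)) :=
    (tendsto_const_nhds.add tendsto_one_div_add_atTop_nhds_zero_nat).add_const _
  rw [add_zero] at h3
  exact le_of_tendsto_of_tendsto' (tendsto_const_nhds.add (h2.const_mul κ)) h3 h1

end Time

section EnergyIdentity

set_option linter.unusedSectionVars false

variable {V : Type*} [NormedAddCommGroup V] [InnerProductSpace ℝ V] [CompleteSpace V]

/-- The chain rule for the square of the norm of an absolutely continuous curve. -/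
theorem norm_sq_const_add_integral {F : ℝ → V} {b : ℝ} (z : V)
    (hF : IntervalIntegrable F volume 0 b) :
    ‖z + ∫ τ in 0..b, F τ‖ ^ 2 =
      ‖z‖ ^ 2 + ∫ t in 0..b, 2 * inner ℝ (z + ∫ τ in 0..t, F τ) (F t) := by
  set D : ℝ → V := fun t => z + ∫ τ in 0..t, F τ with hD
  have hAC : AbsolutelyContinuousOnInterval D 0 b :=
    absolutelyContinuousOnInterval_const_add (absolutelyContinuousOnInterval_integral hF) z
  obtain ⟨B, hB⟩ := hAC.exists_bound
  have hAC' : AbsolutelyContinuousOnInterval (fun t => ‖D t‖ ^ 2) 0 b := by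
    refine absolutelyContinuousOnInterval_of_dist_le (K := B + B) hAC fun x hx y hy => ?_
    rw [Real.dist_eq, dist_eq_norm]
    have e : ‖D x‖ ^ 2 - ‖D y‖ ^ 2 = (‖D x‖ + ‖D y‖) * (‖D x‖ - ‖D y‖) := by ring
    rw [e, abs_mul, abs_of_nonneg (by positivity)]
    exact mul_le_mul (add_le_add (hB x hx) (hB y hy)) (abs_norm_sub_norm_le _ _) (abs_nonneg _)
      (by linarith [(norm_nonneg _).trans (hB x hx)])
  have h := integral_eq_sub_of_ae_hasDerivAt (g' := fun t => 2 * inner ℝ (D t) (F t)) hAC' ?_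
  · rw [h]
    simp [hD]
  · filter_upwards [hF.ae_hasDerivAt_integral] with t ht hmem
    have h5 : HasDerivAt D (F t) t := (ht hmem 0 Set.left_mem_uIcc).const_add z
    exact h5.norm_sq

variable {S : Type*} [MeasurableSpace S] {ν : Measure S} [SFinite ν] {b : ℝ} {F w : ℝ → S → V}
  {w₀ : S → V} {χ : S → ℝ}

theorem stronglyMeasurable_const_add_integral (hF : StronglyMeasurable (Function.uncurry F))
    (hw₀ : StronglyMeasurable w₀) :
    StronglyMeasurable fun p : ℝ × S => w₀ p.2 + ∫ τ in Set.Ioc 0 p.1, F τ p.2 := by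
  refine (hw₀.comp_measurable measurable_snd).add ?_
  have h1 : ∀ p : ℝ × S, ∫ τ in Set.Ioc 0 p.1, F τ p.2 =
      ∫ τ, {q : (ℝ × S) × ℝ | 0 < q.2 ∧ q.2 ≤ q.1.1}.indicator
        (fun q : (ℝ × S) × ℝ => F q.2 q.1.2) (p, τ) := fun p => by
    rw [← integral_indicator measurableSet_Ioc]
    rfl
  simp only [h1]
  refine StronglyMeasurable.integral_prod_right (f := _) ?_
  refine StronglyMeasurable.indicator ?_ ?_
  · exact hF.comp_measurable (measurable_snd.prodMk (measurable_snd.comp measurable_fst))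
  · exact (measurableSet_lt measurable_const measurable_snd).inter
      (measurableSet_le measurable_snd (measurable_fst.comp measurable_fst))

/-- The localised energy of `w = w₀ + ∫ F` is the integral of its formal derivative. -/
theorem energy_eq
    (hFi : ∀ x, IntegrableOn (fun τ => F τ x) (Set.Ioc 0 b))
    (hD : ∀ x, ∀ᵐ t ∂volume.restrict (Set.Ioc 0 b), w t x = w₀ x + ∫ τ in 0..t, F τ x)
    (h0 : Integrable (fun x => χ x * ‖w₀ x‖ ^ 2) ν)
    (hint : Integrable (fun p : ℝ × S => χ p.2 * (2 * inner ℝ (w p.1 p.2) (F p.1 p.2)))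
      ((volume.restrict (Set.Ioc 0 b)).prod ν)) {t : ℝ} (ht : t ∈ Set.Icc 0 b) :
    ∫ x, χ x * ‖w₀ x + ∫ τ in 0..t, F τ x‖ ^ 2 ∂ν = ∫ x, χ x * ‖w₀ x‖ ^ 2 ∂ν +
      ∫ τ in 0..t, ∫ x, χ x * (2 * inner ℝ (w τ x) (F τ x)) ∂ν := by
  have hle : volume.restrict (Set.Ioc 0 t) ≤ volume.restrict (Set.Ioc 0 b) :=
    Measure.restrict_mono (Set.Ioc_subset_Ioc_right ht.2) le_rfl
  have hint' : Integrable (fun p : ℝ × S => χ p.2 * (2 * inner ℝ (w p.1 p.2) (F p.1 p.2)))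
      ((volume.restrict (Set.Ioc 0 t)).prod ν) := 
    hint.mono_measure (Measure.prod_mono hle le_rfl)
  have h1 : ∀ x, χ x * ‖w₀ x + ∫ τ in 0..t, F τ x‖ ^ 2 = χ x * ‖w₀ x‖ ^ 2 +
      ∫ τ in Set.Ioc 0 t, χ x * (2 * inner ℝ (w τ x) (F τ x)) := fun x => by
    rw [norm_sq_const_add_integral (w₀ x) ((intervalIntegrable_iff_integrableOn_Ioc_of_le ht.1).2
      ((hFi x).mono_set (Set.Ioc_subset_Ioc_right ht.2))), mul_add, integral_const_mul,
      intervalIntegral.integral_of_le ht.1]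
    congr 2
    refine integral_congr_ae ?_
    filter_upwards [(hD x).filter_mono (ae_mono hle)] with τ hτ
    rw [hτ]
  simp only [h1]
  rw [integral_add h0 hint'.integral_prod_right, intervalIntegral.integral_of_le ht.1,
    integral_integral_swap (f := fun τ x => χ x * (2 * inner ℝ (w τ x) (F τ x))) hint']

theorem ae_eq_const_add_integral (hF : StronglyMeasurable (Function.uncurry F))
    (hw : StronglyMeasurable (Function.uncurry w)) (hw₀ : StronglyMeasurable w₀)
    (hD : ∀ x, ∀ᵐ t ∂volume.restrict (Set.Ioc 0 b), w t x = w₀ x + ∫ τ in 0..t, F τ x) :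
    ∀ᵐ t ∂volume.restrict (Set.Ioc 0 b), ∀ᵐ x ∂ν, w t x = w₀ x + ∫ τ in 0..t, F τ x := by
  have h1 : ∀ x, ∀ᵐ t ∂volume.restrict (Set.Ioc 0 b),
      w t x = w₀ x + ∫ τ in Set.Ioc 0 t, F τ x := fun x => by
    filter_upwards [hD x, ae_restrict_mem measurableSet_Ioc] with t h ht
    rw [h, intervalIntegral.integral_of_le ht.1.le]
  have h2 := (Measure.ae_ae_comm (μ := volume.restrict (Set.Ioc 0 b)) (ν := ν)
    (p := fun t x => w t x = w₀ x + ∫ τ in Set.Ioc 0 t, F τ x)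
    (hw.measurableSet_eq_fun (stronglyMeasurable_const_add_integral hF hw₀))).2
    (Eventually.of_forall h1)
  filter_upwards [h2, ae_restrict_mem measurableSet_Ioc] with t h ht
  simpa only [intervalIntegral.integral_of_le ht.1.le] using h

variable {N : ℕ}

theorem tendsto_integral_cutoff_mul {f : Space N → ℝ} (hf : Integrable f) :
    Tendsto (fun n : ℕ => ∫ x, cutoff ((n : ℝ) + 1) x * f x) atTop (𝓝 (∫ x, f x)) := by
  refine tendsto_integral_of_dominated_convergence (fun x => ‖f x‖)
    (fun n => (continuous_cutoff _).aestronglyMeasurable.mul hf.1) hf.norm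
    (fun n => Eventually.of_forall fun x => ?_) (Eventually.of_forall fun x => ?_)
  · rw [norm_mul, Real.norm_of_nonneg (cutoff_nonneg _ _)]
    exact mul_le_of_le_one_left (norm_nonneg _) (cutoff_le_one _ _)
  · simpa using (tendsto_cutoff x).mul_const (f x)

theorem integrable_cutoff_mul {f : Space N → ℝ} (hf : Integrable f) (R : ℝ) :
    Integrable fun x => cutoff R x * f x :=
  hf.norm.mono' ((continuous_cutoff _).aestronglyMeasurable.mul hf.1)
    (Eventually.of_forall fun x => by
      rw [norm_mul, Real.norm_of_nonneg (cutoff_nonneg _ _)]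
      exact mul_le_of_le_one_left (norm_nonneg _) (cutoff_le_one _ _))

/-- The `L²` estimate for `w = w₀ + ∫ F`, from a bound of `∫ χ 2⟨w, F⟩` for the cut-offs `χ`. -/
theorem ae_eLpNorm_add_integral_le {b κ B : ℝ} {F w : ℝ → Space N → Vec N}
    {w₀ : Space N → Vec N} {f a H h : ℝ → ℝ} {g : ℕ → ℝ → ℝ}
    (hF : StronglyMeasurable (Function.uncurry F)) (hw : StronglyMeasurable (Function.uncurry w))
    (hw₀ : Continuous w₀) (hw₀2 : MemLp w₀ 2)
    (hFi : ∀ x, IntegrableOn (fun τ => F τ x) (Set.Ioc 0 b))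
    (hD : ∀ x, ∀ᵐ t ∂volume.restrict (Set.Ioc 0 b), w t x = w₀ x + ∫ τ in 0..t, F τ x)
    (hw2 : ∀ᵐ t ∂volume.restrict (Set.Ioc 0 b), MemLp (w t) 2)
    (hB : ∀ᵐ t ∂volume.restrict (Set.Ioc 0 b), (eLpNorm (w t) 2).toReal ≤ B)
    (hint : ∀ n : ℕ, Integrable
      (fun p : ℝ × Space N => cutoff ((n : ℝ) + 1) p.2 * (2 * inner ℝ (w p.1 p.2) (F p.1 p.2)))
      ((volume.restrict (Set.Ioc 0 b)).prod volume))
    (hf : IntegrableOn f (Set.Ioc 0 b)) (hf0 : ∀ t, 0 ≤ f t)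
    (ha : IntegrableOn a (Set.Ioc 0 b)) (ha0 : ∀ t, 0 ≤ a t)
    (hH : IntegrableOn H (Set.Ioc 0 b))
    (hgm : ∀ n, AEStronglyMeasurable (g n) (volume.restrict (Set.Ioc 0 b)))
    (hgH : ∀ n, ∀ᵐ t ∂volume.restrict (Set.Ioc 0 b), |g n t| ≤ H t)
    (hgh : ∀ᵐ t ∂volume.restrict (Set.Ioc 0 b), Tendsto (fun n => g n t) atTop (𝓝 (h t)))
    (hh : ∀ᵐ t ∂volume.restrict (Set.Ioc 0 b), h t ≤ -(κ * (eLpNorm (w t) 2).toReal ^ 2))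
    (hle : ∀ n : ℕ, ∀ᵐ t ∂volume.restrict (Set.Ioc 0 b),
      ∫ x, cutoff ((n : ℝ) + 1) x * (2 * inner ℝ (w t x) (F t x)) ≤
        2 * (f t * (eLpNorm (w t) 2).toReal) + a t * (eLpNorm (w t) 2).toReal ^ 2 / (n + 1) +
          2 * g n t) :
    ∀ᵐ t ∂volume.restrict (Set.Ioc 0 b),
      (eLpNorm (w t) 2).toReal + κ * ∫ τ in 0..t, (eLpNorm (w τ) 2).toReal ≤
        (eLpNorm w₀ 2).toReal + ∫ τ in 0..t, f τ := by
  have hXm : Measurable fun t => (eLpNorm (w t) 2).toReal := by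
    simp only [eLpNorm_two_eq]
    exact ((Measurable.lintegral_prod_right' (f := fun p : ℝ × Space N => ‖w p.1 p.2‖ₑ ^ (2 : ℝ))
      (hw.enorm.pow_const _)).pow_const _).ennreal_toReal
  let E : ℕ → ℝ → ℝ := fun n t => ∫ x, cutoff ((n : ℝ) + 1) x * ‖w₀ x + ∫ τ in 0..t, F τ x‖ ^ 2
  have hE0 : ∀ n, E n 0 = ∫ x, cutoff ((n : ℝ) + 1) x * ‖w₀ x‖ ^ 2 := fun n => by
    simp only [E, intervalIntegral.integral_same, add_zero]
  refine ae_add_integral_le_of_energy (E := E)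
    (e := fun n t => ∫ x, cutoff ((n : ℝ) + 1) x * (2 * inner ℝ (w t x) (F t x)))
    ENNReal.toReal_nonneg hXm.aestronglyMeasurable (fun _ => ENNReal.toReal_nonneg) hB hf hf0 ha ha0
    hH hgm hgH hgh hh (fun n => (hint n).integral_prod_left) (fun n t _ => ?_) (fun n t ht => ?_)
    hle ?_ ?_
  · exact integral_nonneg fun x => mul_nonneg (cutoff_nonneg _ _) (sq_nonneg _)
  · rw [hE0]
    exact energy_eq hFi hD (integrable_cutoff_mul (integrable_norm_sq hw₀2) _) (hint n) ht
  · simp only [hE0]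
    rw [← integral_norm_sq_eq hw₀2]
    exact tendsto_integral_cutoff_mul (integrable_norm_sq hw₀2)
  · filter_upwards [ae_eq_const_add_integral (ν := volume) hF hw hw₀.stronglyMeasurable hD, hw2]
      with t h1 h2
    rw [← integral_norm_sq_eq h2]
    refine (tendsto_integral_cutoff_mul (integrable_norm_sq h2)).congr fun n => ?_
    refine integral_congr_ae ?_
    filter_upwards [h1] with x hx
    rw [hx]

end EnergyIdentity

/-! ### The energy estimate of a block at a fixed time -/

section FixedTime

set_option linter.unusedSectionVars false

variable {N : ℕ} {φ : 𝓢(Space N, ℝ)}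

/-- The function given by a distribution `u` with `lip φ u < ∞`: the limit of its low-frequency
cut-offs. -/
def fieldOf (φ : 𝓢(Space N, ℝ)) (u : 𝓢'(Space N, Vec N)) (x : Space N) : Vec N :=
  limUnder atTop fun n : ℕ => lowCut φ n u x

/-- A velocity field with the regularity of the theorem, at a fixed time. -/
structure IsVelocity (φ : 𝓢(Space N, ℝ)) (u : 𝓢'(Space N, Vec N)) : Prop where
  real : IsReal u
  normalized : HasNormalizedGradient φ u
  finite : FiniteBlocks φ u
  lip_ne_top : lip φ u ≠ ∞

/-- A Lipschitz constant of the function given by `u`. -/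
def lipConst (φ : 𝓢(Space N, ℝ)) (u : 𝓢'(Space N, Vec N)) : ℝ := (gradConst φ * lip φ u).toReal

theorem lipConst_nonneg (u : 𝓢'(Space N, Vec N)) : 0 ≤ lipConst φ u := ENNReal.toReal_nonneg

/-- A bound of `|u(0)|`: the low frequencies of `u` at the origin plus its high frequencies, which are
uniformly bounded. -/
def originBound (φ : 𝓢(Space N, ℝ)) (u : 𝓢'(Space N, Vec N)) : ℝ :=
  ‖lowCut φ 0 u 0‖ + (kerL2 (fatSym φ 0) * lip φ u).toReal

theorem originBound_nonneg (u : 𝓢'(Space N, Vec N)) : 0 ≤ originBound φ u := by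
  unfold originBound; positivity

variable {u : 𝓢'(Space N, Vec N)}

theorem IsVelocity.tendsto (hu : IsVelocity φ u) (hφ : IsDyadicPartition φ) (x : Space N) :
    Tendsto (fun n : ℕ => lowCut φ n u x) atTop (𝓝 (fieldOf φ u x)) := by
  obtain ⟨U, hU⟩ := exists_tendsto_lowCut hφ hu.finite hu.lip_ne_top
  rw [fieldOf, (hU x).limUnder_eq]
  exact hU x

theorem IsVelocity.norm_sub_le (hu : IsVelocity φ u) (hφ : IsDyadicPartition φ) (x y : Space N) :
    ‖fieldOf φ u x - fieldOf φ u y‖ ≤ lipConst φ u * ‖x - y‖ := by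
  refine le_of_tendsto' ((hu.tendsto hφ x).sub (hu.tendsto hφ y)).norm fun n => ?_
  have h := ENNReal.toReal_mono (ENNReal.mul_ne_top
    (ENNReal.mul_ne_top gradConst_ne_top hu.lip_ne_top) enorm_ne_top)
    (enorm_lowCut_sub_le_lip hφ hu.finite hu.normalized hu.lip_ne_top n y x)
  rwa [ENNReal.toReal_mul, toReal_enorm, toReal_enorm] at h

theorem IsVelocity.norm_zero_le (hu : IsVelocity φ u) (hφ : IsDyadicPartition φ) :
    ‖fieldOf φ u 0‖ ≤ originBound φ u := by
  refine le_of_tendsto' (hu.tendsto hφ 0).norm fun n => ?_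
  have h := ENNReal.toReal_mono (ENNReal.mul_ne_top (kerL2_ne_top _) hu.lip_ne_top)
    (enorm_lowCut_sub_lowCut_zero_le hφ hu.finite n (0 : Space N))
  rw [toReal_enorm] at h
  have h2 := norm_add_le (lowCut φ n u 0 - lowCut φ 0 u 0) (lowCut φ 0 u 0)
  rw [sub_add_cancel] at h2
  unfold originBound
  linarith

theorem IsVelocity.continuous (hu : IsVelocity φ u) (hφ : IsDyadicPartition φ) :
    Continuous (fieldOf φ u) := by
  refine (LipschitzWith.of_dist_le_mul (K := (lipConst φ u).toNNReal) fun x y => ?_).continuous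
  rw [Real.coe_toNNReal _ (lipConst_nonneg u), dist_eq_norm, dist_eq_norm]
  exact hu.norm_sub_le hφ x y

theorem IsVelocity.coord_eq (hu : IsVelocity φ u) (hφ : IsDyadicPartition φ) (x : Space N)
    (i : Fin N) : fieldOf φ u x i = ((fieldOf φ u x i).re : ℂ) := by
  have h1 : Tendsto (fun n : ℕ => (lowCut φ n u x i).im) atTop (𝓝 (fieldOf φ u x i).im) :=
    (Complex.continuous_im.tendsto _).comp
      (((EuclideanSpace.proj i : Vec N →L[ℂ] ℂ).continuous.tendsto _).comp (hu.tendsto hφ x))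
  simp only [hu.real.im_lowCut hφ] at h1
  have h2 := tendsto_nhds_unique h1 tendsto_const_nhds
  exact Complex.ext (by simp) (by simp [h2])

theorem abs_re_coord_le (a : Vec N) (i : Fin N) : |(a i).re| ≤ ‖a‖ :=
  (Complex.abs_re_le_norm _).trans (PiLp.norm_apply_le a i)

theorem abs_integral_cutoff_inner_le {R : ℝ} {w z : Space N → Vec N} (hw : MemLp w 2)
    (hz : MemLp z 2) : ∫ x, |cutoff R x * inner ℝ (w x) (z x)| ≤
      (eLpNorm w 2).toReal * (eLpNorm z 2).toReal := by
  have h1 : ∫ x, |cutoff R x * inner ℝ (w x) (z x)| ≤ ∫ x, ‖w x‖ * ‖z x‖ := by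
    refine integral_mono_of_nonneg (Eventually.of_forall fun x => abs_nonneg _)
      (hw.norm.integrable_mul hz.norm) (Eventually.of_forall fun x => ?_)
    change |cutoff R x * inner ℝ (w x) (z x)| ≤ ‖w x‖ * ‖z x‖
    rw [abs_mul, abs_of_nonneg (cutoff_nonneg _ _)]
    exact (mul_le_of_le_one_left (abs_nonneg _) (cutoff_le_one _ _)).trans
      (abs_real_inner_le_norm _ _)
  refine h1.trans ?_
  have h2 := integral_mul_le_Lp_mul_Lq_of_nonneg (μ := (volume : Measure (Space N)))
    (p := 2) (q := 2) Real.HolderConjugate.two_two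
    (f := fun x => ‖w x‖) (g := fun x => ‖z x‖)
    (Eventually.of_forall fun x => norm_nonneg _) (Eventually.of_forall fun x => norm_nonneg _)
    (by simpa using hw.norm) (by simpa using hz.norm)
  refine h2.trans_eq ?_
  have h3 : ∀ {w : Space N → Vec N}, MemLp w 2 →
      (∫ x, ‖w x‖ ^ (2 : ℝ)) ^ (1 / (2 : ℝ)) = (eLpNorm w 2).toReal := fun {w} hw => by
    simp only [Real.rpow_two]
    rw [integral_norm_sq_eq hw, ← Real.sqrt_eq_rpow, Real.sqrt_sq ENNReal.toReal_nonneg]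
  rw [h3 hw, h3 hz]

/-- The time derivative of a block of a solution. -/
def blkRhs (φ : 𝓢(Space N, ℝ)) (θ : ℝ) (k : ℤ) (d M g : 𝓢'(Space N, Vec N)) (x : Space N) :
    Vec N :=
  blk φ k M x - blk φ k g x + (θ : ℂ) • blk φ k (Δ d) x

theorem continuous_blkRhs (θ : ℝ) (k : ℤ) (d M g : 𝓢'(Space N, Vec N)) :
    Continuous (blkRhs φ θ k d M g) := by
  have h : Continuous fun x => (θ : ℂ) • blk φ k (Δ d) x :=
    (continuous_blk k (Δ d)).const_smul (θ : ℂ)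
  exact ((continuous_blk k M).sub (continuous_blk k g)).add h

variable {d M g : 𝓢'(Space N, Vec N)} {k : ℤ} {θ : ℝ}

theorem inner_blkRhs (hφ : IsDyadicPartition φ) (hu : IsVelocity φ u) (hd : FiniteBlocks φ d)
    (x : Space N) : inner ℝ (blk φ k d x) (blkRhs φ θ k d M g x) =
      inner ℝ (blk φ k d x) (blk φ k M x) -
      inner ℝ (blk φ k d x) (advComm φ (fieldOf φ u) d g k x) -
      ∑ i, (fieldOf φ u x i).re * inner ℝ (blk φ k d x) (dblk φ k (basisVec i) (blk φ k d) x) +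
      θ * inner ℝ (blk φ k d x) (lapBlk φ k (blk φ k d) x) := by
  have hs : ∀ (r : ℝ) (a b : Vec N), inner ℝ a ((r : ℂ) • b) = r * inner ℝ a b := fun r a b => by
    rw [← inner_smul_right]
    rfl
  have h1 : blk φ k g x = advComm φ (fieldOf φ u) d g k x +
      ∑ i, ((fieldOf φ u x i).re : ℂ) • dblk φ k (basisVec i) (blk φ k d) x := by
    rw [advComm]
    simp only [← hu.coord_eq hφ, ← blk_lineDeriv hφ hd]
    rw [sub_add_cancel]
  rw [blkRhs, h1, blk_laplacian hφ hd, inner_add_right, inner_sub_right, inner_add_right, inner_sum,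
    hs]
  simp only [hs]
  ring

theorem IsVelocity.abs_cutoff_mul_le (hu : IsVelocity φ u) (hφ : IsDyadicPartition φ) {R : ℝ}
    (hR : 0 < R) (x : Space N) (i : Fin N) :
    |cutoff R x * (fieldOf φ u x i).re| ≤ originBound φ u + 2 * R * lipConst φ u := by
  have hL := lipConst_nonneg (φ := φ) u
  have h0 := originBound_nonneg (φ := φ) u
  rcases le_or_gt (2 * R) ‖x‖ with h | h
  · rw [cutoff_eq_zero hR h, zero_mul, abs_zero]
    positivity
  rw [abs_mul, abs_of_nonneg (cutoff_nonneg _ _)]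
  refine (mul_le_of_le_one_left (abs_nonneg _) (cutoff_le_one _ _)).trans
    ((abs_re_coord_le _ _).trans ?_)
  have h1 := hu.norm_sub_le hφ x 0
  rw [sub_zero] at h1
  have h2 := norm_add_le (fieldOf φ u x - fieldOf φ u 0) (fieldOf φ u 0)
  rw [sub_add_cancel] at h2
  have h3 := hu.norm_zero_le hφ
  nlinarith

theorem IsVelocity.integrable_transport (hu : IsVelocity φ u) (hφ : IsDyadicPartition φ) {R : ℝ}
    (hR : 0 < R) {w z : Space N → Vec N} (hw : MemLp w 2) (hz : MemLp z 2) (i : Fin N) :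
    Integrable fun x => cutoff R x * ((fieldOf φ u x i).re * inner ℝ (w x) (z x)) := by
  refine ((integrable_inner_of_memLp hw hz).norm.const_mul
    (originBound φ u + 2 * R * lipConst φ u)).mono' ?_ (Eventually.of_forall fun x => ?_)
  · refine (continuous_cutoff R).aestronglyMeasurable.mul
      (Continuous.aestronglyMeasurable ?_ |>.mul (hw.1.inner hz.1))
    exact Complex.continuous_re.comp
      ((EuclideanSpace.proj i : Vec N →L[ℂ] ℂ).continuous.comp (hu.continuous hφ))
  · rw [← mul_assoc, norm_mul]
    exact mul_le_mul_of_nonneg_right (hu.abs_cutoff_mul_le hφ hR x i) (norm_nonneg _)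

theorem IsVelocity.integral_abs_transport_le (hu : IsVelocity φ u) (hφ : IsDyadicPartition φ)
    {R : ℝ} (hR : 0 < R) {w z : Space N → Vec N} (hw : MemLp w 2) (hz : MemLp z 2) (i : Fin N) :
    ∫ x, |cutoff R x * ((fieldOf φ u x i).re * inner ℝ (w x) (z x))| ≤
      (originBound φ u + 2 * R * lipConst φ u) * ((eLpNorm w 2).toReal * (eLpNorm z 2).toReal) := by
  have hA : 0 ≤ originBound φ u + 2 * R * lipConst φ u := by
    have hL := lipConst_nonneg (φ := φ) u
    have h0 := originBound_nonneg (φ := φ) u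
    positivity
  -- on the support of `cutoff R` the cut-off of radius `2R` equals `1`
  have h1 : ∀ x, |cutoff R x * ((fieldOf φ u x i).re * inner ℝ (w x) (z x))| ≤
      (originBound φ u + 2 * R * lipConst φ u) * |cutoff (2 * R) x * inner ℝ (w x) (z x)| := by
    intro x
    rcases le_or_gt (2 * R) ‖x‖ with h | h
    · rw [cutoff_eq_zero hR h, zero_mul, abs_zero]
      positivity
    · have h2 : cutoff (2 * R) x = 1 := by
        have : ‖x‖ / (2 * R) ≤ 1 := (div_le_one (by positivity)).2 h.le
        rw [cutoff, min_eq_left (by linarith), max_eq_right zero_le_one]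
      rw [h2, one_mul, ← mul_assoc, abs_mul]
      exact mul_le_mul_of_nonneg_right (hu.abs_cutoff_mul_le hφ hR x i) (abs_nonneg _)
  refine (integral_mono (hu.integrable_transport hφ hR hw hz i).abs
    ((integrable_cutoff_mul (integrable_inner_of_memLp hw hz) _).abs.const_mul _) h1).trans ?_
  rw [integral_const_mul]
  exact mul_le_mul_of_nonneg_left (abs_integral_cutoff_inner_le hw hz) hA

theorem cutoff_mul_inner_blkRhs (hφ : IsDyadicPartition φ) (hu : IsVelocity φ u)
    (hd : FiniteBlocks φ d) (R : ℝ) (x : Space N) :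
    cutoff R x * (2 * inner ℝ (blk φ k d x) (blkRhs φ θ k d M g x)) =
      2 * (cutoff R x * inner ℝ (blk φ k d x) (blk φ k M x)) -
      2 * (cutoff R x * inner ℝ (blk φ k d x) (advComm φ (fieldOf φ u) d g k x)) -
      (∑ i, 2 * (cutoff R x * ((fieldOf φ u x i).re *
        inner ℝ (blk φ k d x) (dblk φ k (basisVec i) (blk φ k d) x)))) +
      2 * (θ * (cutoff R x * inner ℝ (blk φ k d x) (lapBlk φ k (blk φ k d) x))) := by
  rw [inner_blkRhs hφ hu hd, ← Finset.mul_sum, ← Finset.mul_sum]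
  ring

theorem integrable_cutoff_mul_inner_blkRhs (hφ : IsDyadicPartition φ) (hu : IsVelocity φ u)
    (hd : FiniteBlocks φ d) (hM : FiniteBlocks φ M)
    (hadv : MemLp (advComm φ (fieldOf φ u) d g k) 2) {R : ℝ} (hR : 0 < R) :
    Integrable fun x => cutoff R x * (2 * inner ℝ (blk φ k d x) (blkRhs φ θ k d M g x)) := by
  have hw := (hd.isBlock hφ k).memLp
  obtain ⟨C, -, hC⟩ := exists_eLpNorm_lapBlk_le φ k
  simp only [cutoff_mul_inner_blkRhs hφ hu hd]
  exact ((((integrable_cutoff_mul (integrable_inner_of_memLp hw (hM.isBlock hφ k).memLp) R).const_mul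
    2).sub ((integrable_cutoff_mul (integrable_inner_of_memLp hw hadv) R).const_mul 2)).sub
    (integrable_finsetSum _ fun i _ => (hu.integrable_transport hφ hR hw (memLp_dblk hw _)
      i).const_mul 2)).add
    (((integrable_cutoff_mul (integrable_inner_of_memLp hw (hC _ hw).1) R).const_mul θ).const_mul 2)

/-- The localised energy has an integrable derivative. The bound grows with the radius `R`, because
the velocity is of linear growth. -/
theorem integral_abs_cutoff_mul_inner_blkRhs_le (hφ : IsDyadicPartition φ) (hu : IsVelocity φ u)
    (hd : FiniteBlocks φ d) (hM : FiniteBlocks φ M)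
    (hadv : MemLp (advComm φ (fieldOf φ u) d g k) 2) {R : ℝ} (hR : 0 < R) (hθ : 0 < θ)
    {C : ℝ≥0∞} (hC' : C ≠ ∞) (hC : ∀ w : Space N → Vec N, MemLp w 2 → MemLp (lapBlk φ k w) 2 ∧
      eLpNorm (lapBlk φ k w) 2 ≤ C * eLpNorm w 2) :
    ∫ x, |cutoff R x * (2 * inner ℝ (blk φ k d x) (blkRhs φ θ k d M g x))| ≤
      2 * (((eLpNorm (blk φ k M) 2).toReal + (eLpNorm (advComm φ (fieldOf φ u) d g k) 2).toReal +
        N * ((originBound φ u + 2 * R * lipConst φ u) *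
          ((gradConst' φ * pw k).toReal * (eLpNorm (blk φ k d) 2).toReal)) +
        θ * (C.toReal * (eLpNorm (blk φ k d) 2).toReal)) * (eLpNorm (blk φ k d) 2).toReal) := by
  have hw := (hd.isBlock hφ k).memLp
  have hm := (hM.isBlock hφ k).memLp
  have hz : ∀ i, MemLp (dblk φ k (basisVec i) (blk φ k d)) 2 := fun i => memLp_dblk hw _
  have i1 := (integrable_cutoff_mul (integrable_inner_of_memLp hw hm) R).abs
  have i2 := (integrable_cutoff_mul (integrable_inner_of_memLp hw hadv) R).abs
  have i3 := fun i => (hu.integrable_transport hφ hR hw (hz i) i).abs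
  have i4 := (integrable_cutoff_mul (integrable_inner_of_memLp hw (hC _ hw).1) R).abs
  have h1 : ∀ x, |cutoff R x * (2 * inner ℝ (blk φ k d x) (blkRhs φ θ k d M g x))| ≤
      2 * |cutoff R x * inner ℝ (blk φ k d x) (blk φ k M x)| +
      2 * |cutoff R x * inner ℝ (blk φ k d x) (advComm φ (fieldOf φ u) d g k x)| +
      (∑ i, 2 * |cutoff R x * ((fieldOf φ u x i).re *
        inner ℝ (blk φ k d x) (dblk φ k (basisVec i) (blk φ k d) x))|) +
      2 * (θ * |cutoff R x * inner ℝ (blk φ k d x) (lapBlk φ k (blk φ k d) x)|) := fun x => by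
    rw [cutoff_mul_inner_blkRhs hφ hu hd]
    refine (abs_add_le _ _).trans (add_le_add ((abs_sub _ _).trans
      (add_le_add ((abs_sub _ _).trans (add_le_add ?_ ?_)) ?_)) ?_)
    · rw [abs_mul, abs_two]
    · rw [abs_mul, abs_two]
    · refine (Finset.abs_sum_le_sum_abs _ _).trans (Finset.sum_le_sum fun i _ => ?_)
      rw [abs_mul, abs_two]
    · rw [abs_mul, abs_two, abs_mul, abs_of_pos hθ]
  have i3' : Integrable fun x => ∑ i, 2 * |cutoff R x * ((fieldOf φ u x i).re *
        inner ℝ (blk φ k d x) (dblk φ k (basisVec i) (blk φ k d) x))| :=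
    integrable_finsetSum _ fun i _ => (i3 i).const_mul 2
  have i12 : Integrable fun x => 2 * |cutoff R x * inner ℝ (blk φ k d x) (blk φ k M x)| +
      2 * |cutoff R x * inner ℝ (blk φ k d x) (advComm φ (fieldOf φ u) d g k x)| :=
    (i1.const_mul 2).add (i2.const_mul 2)
  have i123 : Integrable fun x => 2 * |cutoff R x * inner ℝ (blk φ k d x) (blk φ k M x)| +
      2 * |cutoff R x * inner ℝ (blk φ k d x) (advComm φ (fieldOf φ u) d g k x)| +
      (∑ i, 2 * |cutoff R x * ((fieldOf φ u x i).re *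
        inner ℝ (blk φ k d x) (dblk φ k (basisVec i) (blk φ k d) x))|) := i12.add i3'
  have i4' : Integrable fun x =>
      2 * (θ * |cutoff R x * inner ℝ (blk φ k d x) (lapBlk φ k (blk φ k d) x)|) :=
    (i4.const_mul θ).const_mul 2
  refine (integral_mono (integrable_cutoff_mul_inner_blkRhs hφ hu hd hM hadv hR).abs
    (i123.add i4') h1).trans ?_
  simp only [Pi.add_apply]
  rw [integral_add i123 i4', integral_add i12 i3', integral_add (i1.const_mul 2) (i2.const_mul 2),
    integral_finsetSum _ fun i _ => (i3 i).const_mul 2]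
  simp only [integral_const_mul]
  set X := (eLpNorm (blk φ k d) 2).toReal
  have hX : 0 ≤ X := ENNReal.toReal_nonneg
  have hA : 0 ≤ originBound φ u + 2 * R * lipConst φ u := by
    have hL := lipConst_nonneg (φ := φ) u
    have h0 := originBound_nonneg (φ := φ) u
    positivity
  have b1 := abs_integral_cutoff_inner_le (R := R) hw hm
  have b2 := abs_integral_cutoff_inner_le (R := R) hw hadv
  have b4 : ∫ x, |cutoff R x * inner ℝ (blk φ k d x) (lapBlk φ k (blk φ k d) x)| ≤
      X * (C.toReal * X) := by
    refine (abs_integral_cutoff_inner_le hw (hC _ hw).1).trans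
      (mul_le_mul_of_nonneg_left ?_ hX)
    have := ENNReal.toReal_mono (ENNReal.mul_ne_top hC' hw.2.ne) (hC _ hw).2
    rwa [ENNReal.toReal_mul] at this
  have b3 : ∑ i, 2 * ∫ x, |cutoff R x * ((fieldOf φ u x i).re *
      inner ℝ (blk φ k d x) (dblk φ k (basisVec i) (blk φ k d) x))| ≤
      2 * (N * ((originBound φ u + 2 * R * lipConst φ u) *
        (X * ((gradConst' φ * pw k).toReal * X)))) := by
    refine (Finset.sum_le_card_nsmul _ _ (2 * ((originBound φ u + 2 * R * lipConst φ u) *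
        (X * ((gradConst' φ * pw k).toReal * X)))) fun i _ => ?_).trans_eq ?_
    · refine mul_le_mul_of_nonneg_left ((hu.integral_abs_transport_le hφ hR hw (hz i) i).trans
        (mul_le_mul_of_nonneg_left (mul_le_mul_of_nonneg_left ?_ hX) hA)) zero_le_two
      have := ENNReal.toReal_mono (ENNReal.mul_ne_top (ENNReal.mul_ne_top gradConst'_ne_top
        (pw_ne_top _)) hw.2.ne) (eLpNorm_dblk_basis_le (φ := φ) (l := k) hw i)
      rwa [ENNReal.toReal_mul] at this
    · rw [Finset.card_univ, Fintype.card_fin, nsmul_eq_mul]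
      ring
  have b4' := mul_le_mul_of_nonneg_left b4 hθ.le
  refine (add_le_add (add_le_add (add_le_add (mul_le_mul_of_nonneg_left b1 zero_le_two)
    (mul_le_mul_of_nonneg_left b2 zero_le_two)) b3)
    (mul_le_mul_of_nonneg_left b4' zero_le_two)).trans_eq ?_
  ring

/-- The energy inequality of a block at a fixed time: the transport term costs only the Lipschitz
constant of the velocity. -/
theorem integral_cutoff_mul_inner_blkRhs_le (hφ : IsDyadicPartition φ) (hu : IsVelocity φ u)
    (hd : FiniteBlocks φ d) (hM : FiniteBlocks φ M)
    (hadv : MemLp (advComm φ (fieldOf φ u) d g k) 2) {R : ℝ} (hR : 0 < R) :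
    ∫ x, cutoff R x * (2 * inner ℝ (blk φ k d x) (blkRhs φ θ k d M g x)) ≤
      2 * (((eLpNorm (blk φ k M) 2).toReal + (eLpNorm (advComm φ (fieldOf φ u) d g k) 2).toReal +
        2 * N * lipConst φ u * (eLpNorm (blk φ k d) 2).toReal) * (eLpNorm (blk φ k d) 2).toReal) +
      N * originBound φ u * (eLpNorm (blk φ k d) 2).toReal ^ 2 / R +
      2 * (θ * ∫ x, cutoff R x * inner ℝ (blk φ k d x) (lapBlk φ k (blk φ k d) x)) := by
  have hb := hd.isBlock hφ k
  have hw := hb.memLp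
  have hm := (hM.isBlock hφ k).memLp
  obtain ⟨C, -, hC⟩ := exists_eLpNorm_lapBlk_le φ k
  have hz : ∀ i, MemLp (dblk φ k (basisVec i) (blk φ k d)) 2 := fun i => memLp_dblk hw _
  have i1 := integrable_cutoff_mul (integrable_inner_of_memLp hw hm) R
  have i2 := integrable_cutoff_mul (integrable_inner_of_memLp hw hadv) R
  have i3 := fun i => hu.integrable_transport hφ hR hw (hz i) i
  have i4 := integrable_cutoff_mul (integrable_inner_of_memLp hw (hC _ hw).1) R
  have i3' : Integrable fun x => ∑ i, 2 * (cutoff R x * ((fieldOf φ u x i).re *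
        inner ℝ (blk φ k d x) (dblk φ k (basisVec i) (blk φ k d) x))) :=
    integrable_finsetSum _ fun i _ => (i3 i).const_mul 2
  have i12 : Integrable fun x => 2 * (cutoff R x * inner ℝ (blk φ k d x) (blk φ k M x)) -
      2 * (cutoff R x * inner ℝ (blk φ k d x) (advComm φ (fieldOf φ u) d g k x)) :=
    (i1.const_mul 2).sub (i2.const_mul 2)
  have i123 : Integrable fun x => 2 * (cutoff R x * inner ℝ (blk φ k d x) (blk φ k M x)) -
      2 * (cutoff R x * inner ℝ (blk φ k d x) (advComm φ (fieldOf φ u) d g k x)) -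
      (∑ i, 2 * (cutoff R x * ((fieldOf φ u x i).re *
        inner ℝ (blk φ k d x) (dblk φ k (basisVec i) (blk φ k d) x)))) := i12.sub i3'
  simp only [cutoff_mul_inner_blkRhs hφ hu hd]
  rw [integral_add i123 ((i4.const_mul θ).const_mul 2), integral_sub i12 i3',
    integral_sub (i1.const_mul 2) (i2.const_mul 2),
    integral_finsetSum _ fun i _ => (i3 i).const_mul 2]
  simp only [integral_const_mul]
  set X := (eLpNorm (blk φ k d) 2).toReal
  have hX : 0 ≤ X := ENNReal.toReal_nonneg
  have b1 := (le_abs_self _).trans ((abs_integral_le_integral_abs (μ := volume)).trans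
    (abs_integral_cutoff_inner_le (R := R) hw hm))
  have b2 := (neg_le_abs _).trans ((abs_integral_le_integral_abs (μ := volume)).trans
    (abs_integral_cutoff_inner_le (R := R) hw hadv))
  have b3 : -∑ i, 2 * ∫ x, cutoff R x * ((fieldOf φ u x i).re *
      inner ℝ (blk φ k d x) (dblk φ k (basisVec i) (blk φ k d) x)) ≤
      N * ((3 * lipConst φ u + originBound φ u / R) * X ^ 2) := by
    rw [← Finset.sum_neg_distrib]
    refine (Finset.sum_le_card_nsmul _ _ ((3 * lipConst φ u + originBound φ u / R) * X ^ 2)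
      fun i _ => ?_).trans_eq ?_
    · have h1 := hb.abs_integral_cutoff_le hR (v := fun x => (fieldOf φ u x i).re)
        (lipConst_nonneg u) (fun x y => by
          have := abs_re_coord_le (fieldOf φ u x - fieldOf φ u y) i
          rw [PiLp.sub_apply, Complex.sub_re] at this
          exact this.trans (hu.norm_sub_le hφ x y)) i
      have e : ∀ x, cutoff R x * ((fieldOf φ u x i).re *
          (2 * inner ℝ (blk φ k d x) (dblk φ k (basisVec i) (blk φ k d) x))) =
          2 * (cutoff R x * ((fieldOf φ u x i).re *
          inner ℝ (blk φ k d x) (dblk φ k (basisVec i) (blk φ k d) x))) := fun x => by ring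
      simp only [e, integral_const_mul] at h1
      refine (neg_le_abs _).trans (h1.trans (mul_le_mul_of_nonneg_right ?_ (sq_nonneg _)))
      have := (abs_re_coord_le (fieldOf φ u 0) i).trans (hu.norm_zero_le hφ)
      gcongr
    · rw [Finset.card_univ, Fintype.card_fin, nsmul_eq_mul]
  have hLX : 0 ≤ N * lipConst φ u * X ^ 2 := by
    have hL := lipConst_nonneg (φ := φ) u
    positivity
  have e1 : N * originBound φ u * X ^ 2 / R = N * (originBound φ u / R * X ^ 2) := by ring
  rw [e1]
  linarith

end FixedTime

/-! ### Superposition of translates under a tempered distribution -/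

section Superposition
set_option linter.unusedSectionVars false

variable {N : ℕ}

open scoped BoundedContinuousFunction

theorem exists_seminorm_reflAt_le (a : 𝓢(Space N, ℂ)) (k n : ℕ) :
    ∃ A : ℝ, 0 ≤ A ∧ ∀ y : Space N,
      SchwartzMap.seminorm ℂ k n (reflAt a y) ≤ A * (1 + ‖y‖ ^ k) := by
  set b := reflAt a 0 with hb
  refine ⟨2 ^ k * (SchwartzMap.seminorm ℂ k n b + SchwartzMap.seminorm ℂ 0 n b), by positivity,
    fun y => SchwartzMap.seminorm_le_bound ℂ k n _ (by positivity) fun z => ?_⟩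
  have e : (⇑(reflAt a y) : Space N → ℂ) = fun z => b (z - y) := by
    rw [← zero_add y, reflAt_add, ← hb, zero_add]; rfl
  have h1 := SchwartzMap.le_seminorm ℂ k n b (z - y)
  have h2 := SchwartzMap.le_seminorm ℂ 0 n b (z - y)
  rw [pow_zero, one_mul] at h2
  have h3 : ‖z‖ ^ k ≤ 2 ^ k * (‖z - y‖ ^ k + ‖y‖ ^ k) := by
    have : ‖z‖ ≤ ‖z - y‖ + ‖y‖ := by simpa using norm_add_le (z - y) y
    refine (pow_le_pow_left₀ (norm_nonneg _) this k).trans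
      ((add_pow_le (norm_nonneg _) (norm_nonneg _) k).trans ?_)
    gcongr
    · norm_num
    · omega
  rw [e, iteratedFDeriv_comp_sub]
  set q := ‖iteratedFDeriv ℝ n (⇑b) (z - y)‖ with hq
  have hq0 : 0 ≤ q := norm_nonneg _
  have hy0 : 0 ≤ ‖y‖ ^ k := by positivity
  have hsk : 0 ≤ SchwartzMap.seminorm ℂ k n b := apply_nonneg _ _
  calc ‖z‖ ^ k * q ≤ 2 ^ k * (‖z - y‖ ^ k + ‖y‖ ^ k) * q := by gcongr
    _ = 2 ^ k * (‖z - y‖ ^ k * q + ‖y‖ ^ k * q) := by ring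
    _ ≤ 2 ^ k * (SchwartzMap.seminorm ℂ k n b + ‖y‖ ^ k * SchwartzMap.seminorm ℂ 0 n b) := by
        gcongr
    _ ≤ 2 ^ k * (SchwartzMap.seminorm ℂ k n b + SchwartzMap.seminorm ℂ 0 n b) * (1 + ‖y‖ ^ k) := by
        have : 0 ≤ SchwartzMap.seminorm ℂ 0 n b := apply_nonneg _ _
        rw [mul_assoc]
        refine mul_le_mul_of_nonneg_left ?_ (by positivity)
        nlinarith [mul_nonneg hy0 hsk]

/-- The space of `l`-th derivatives of complex functions on `ℝ^N`. It is a definition of its own so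
that its norm and module structure are found at once. -/
def Jet (N l : ℕ) : Type := Space N [×l]→L[ℝ] ℂ

instance (l : ℕ) : NormedAddCommGroup (Jet N l) :=
  inferInstanceAs (NormedAddCommGroup (Space N [×l]→L[ℝ] ℂ))

instance (l : ℕ) : NormedSpace ℂ (Jet N l) :=
  inferInstanceAs (NormedSpace ℂ (Space N [×l]→L[ℝ] ℂ))

instance (l : ℕ) : CompleteSpace (Jet N l) :=
  inferInstanceAs (CompleteSpace (Space N [×l]→L[ℝ] ℂ))

/-- The `l`-th derivative of a Schwartz function. -/
def jet (l : ℕ) (η : 𝓢(Space N, ℂ)) (x : Space N) : Jet N l := iteratedFDeriv ℝ l η x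

theorem continuous_jet (l : ℕ) (η : 𝓢(Space N, ℂ)) : Continuous (jet l η) :=
  (η.smooth l).continuous_iteratedFDeriv le_rfl

theorem jet_add (l : ℕ) (η ζ : 𝓢(Space N, ℂ)) (x : Space N) :
    jet l (η + ζ) x = jet l η x + jet l ζ x :=
  iteratedFDeriv_add_apply (η.contDiffAt _) (ζ.contDiffAt _)

theorem jet_smul (l : ℕ) (c : ℂ) (η : 𝓢(Space N, ℂ)) (x : Space N) :
    jet l (c • η) x = c • jet l η x :=
  iteratedFDeriv_const_smul_apply (η.contDiffAt _)

/-- Evaluation of an `l`-th derivative in the directions `v`. -/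
def jetEval {l : ℕ} (v : Fin l → Space N) : Jet N l →L[ℂ] ℂ :=
  LinearMap.mkContinuous
    { toFun := fun p => (show Space N [×l]→L[ℝ] ℂ from p) v
      map_add' := fun _ _ => rfl
      map_smul' := fun _ _ => rfl } (∏ i, ‖v i‖) fun p => by
    rw [mul_comm]
    exact ContinuousMultilinearMap.le_opNorm (show Space N [×l]→L[ℝ] ℂ from p) v

theorem jetEval_jet {l : ℕ} (v : Fin l → Space N) (η : 𝓢(Space N, ℂ)) (x : Space N) :
    jetEval v (jet l η x) = (∂^{v} η : 𝓢(Space N, ℂ)) x := by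
  rw [SchwartzMap.iteratedLineDerivOp_eq_iteratedFDeriv]; rfl

theorem jet_ext {l : ℕ} {p q : Jet N l} (h : ∀ v, jetEval v p = jetEval v q) : p = q :=
  ContinuousMultilinearMap.ext (f := (show Space N [×l]→L[ℝ] ℂ from p)) h

/-- The weighted derivative `x ↦ ‖x‖^k ∂^l η x` as a bounded continuous function; its uniform norm
is the Schwartz seminorm with indices `(k, l)`. -/
def weightedDeriv (i : ℕ × ℕ) :
    𝓢(Space N, ℂ) →ₗ[ℂ] (Space N →ᵇ Jet N i.2) where
  toFun η := BoundedContinuousFunction.ofNormedAddCommGroup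
    (fun x => ((‖x‖ ^ i.1 : ℝ) : ℂ) • jet i.2 η x)
    ((Complex.continuous_ofReal.comp (continuous_norm.pow _)).smul (continuous_jet i.2 η))
    (SchwartzMap.seminorm ℂ i.1 i.2 η) fun x => by
      rw [norm_smul, Complex.norm_real, norm_pow, norm_norm]
      exact SchwartzMap.le_seminorm ℂ i.1 i.2 η x
  map_add' η ζ := by
    ext1 x
    change ((‖x‖ ^ i.1 : ℝ) : ℂ) • jet i.2 (η + ζ) x = _
    rw [jet_add, smul_add]
    rfl
  map_smul' c η := by
    ext1 x
    change ((‖x‖ ^ i.1 : ℝ) : ℂ) • jet i.2 (c • η) x = _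
    rw [jet_smul, smul_comm]
    rfl

theorem weightedDeriv_apply (i : ℕ × ℕ) (η : 𝓢(Space N, ℂ)) (x : Space N) :
    weightedDeriv i η x = ((‖x‖ ^ i.1 : ℝ) : ℂ) • jet i.2 η x := rfl

theorem norm_weightedDeriv (i : ℕ × ℕ) (η : 𝓢(Space N, ℂ)) :
    ‖weightedDeriv i η‖ = SchwartzMap.seminorm ℂ i.1 i.2 η := by
  refine le_antisymm ((BoundedContinuousFunction.norm_le (apply_nonneg _ _)).2 fun x => ?_)
    (SchwartzMap.seminorm_le_bound ℂ _ _ _ (norm_nonneg _) fun x => ?_)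
  · rw [weightedDeriv_apply, norm_smul, Complex.norm_real, norm_pow, norm_norm]
    exact SchwartzMap.le_seminorm ℂ i.1 i.2 η x
  have := (weightedDeriv i η).norm_coe_le_norm x
  rwa [weightedDeriv_apply, norm_smul, Complex.norm_real, norm_pow, norm_norm] at this

theorem lineDerivOp_kernelAt (v : Space N) (m : 𝓢(Space N, ℂ)) (y : Space N) :
    ∂_{v} (kernelAt m y) = kernelAt (-derivSym v m) y := by
  have h := reflAt_lineDerivOp (𝓕⁻ m) v y
  rw [← fourierInv_derivSym] at h
  have h2 : kernelAt (-derivSym v m) y = -kernelAt (derivSym v m) y := by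
    have := kernelAt_smul (-1) (derivSym v m) y
    simpa using this
  rw [h2, kernelAt, kernelAt, h, neg_neg]

theorem symMul_neg_derivSym (v : Space N) (m m' : 𝓢(Space N, ℂ)) :
    symMul m (-derivSym v m') = -derivSym v (symMul m m') := by
  ext ξ
  simp only [symMul_apply, neg_apply, derivSym_apply]
  ring

/-- Iterated derivatives of kernels are kernels, compatibly with products of symbols. -/
theorem exists_iteratedLineDerivOp_kernelAt {l : ℕ} (v : Fin l → Space N) (m' : 𝓢(Space N, ℂ)) :
    ∃ m'' : 𝓢(Space N, ℂ), (∀ y, ∂^{v} (kernelAt m' y) = kernelAt m'' y) ∧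
      ∀ m x, ∂^{v} (kernelAt (symMul m m') x) = kernelAt (symMul m m'') x := by
  induction l with
  | zero => exact ⟨m', fun y => by simp, fun m x => by simp⟩
  | succ l ih =>
    obtain ⟨m'', h1, h2⟩ := ih (Fin.tail v)
    refine ⟨-derivSym (v 0) m'', fun y => ?_, fun m x => ?_⟩
    · rw [LineDeriv.iteratedLineDerivOp_succ_left, h1, lineDerivOp_kernelAt]
    · rw [LineDeriv.iteratedLineDerivOp_succ_left, h2, lineDerivOp_kernelAt, symMul_neg_derivSym]

theorem continuous_weightedDeriv_kernelAt (i : ℕ × ℕ) (m : 𝓢(Space N, ℂ)) :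
    Continuous fun y => weightedDeriv i (kernelAt m y) := by
  rw [continuous_iff_continuousAt]
  intro x
  obtain ⟨A, hA, hA'⟩ := seminorm_translate_sub_self_le (kernelAt m x) i.1 i.2
  rw [ContinuousAt, tendsto_iff_norm_sub_tendsto_zero]
  have hlim : Tendsto (fun y : Space N => A * ‖y - x‖) (𝓝 x) (𝓝 0) := by
    have : Continuous fun y : Space N => A * ‖y - x‖ := by fun_prop
    simpa using this.tendsto x
  refine squeeze_zero' (Eventually.of_forall fun _ => norm_nonneg _) ?_ hlim
  filter_upwards [Metric.ball_mem_nhds x one_pos] with y hy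
  rw [← map_sub, norm_weightedDeriv]
  have h := hA' (y - x) (by rw [← dist_eq_norm]; exact (Metric.mem_ball.1 hy).le)
  rw [kernelAt, ← reflAt_add, add_sub_cancel] at h
  exact h

theorem integrable_kernelAt_smul_weightedDeriv (i : ℕ × ℕ) (m m' : 𝓢(Space N, ℂ)) (x : Space N) :
    Integrable fun y => kernelAt m x y • weightedDeriv i (kernelAt m' y) := by
  obtain ⟨A, hA, hA'⟩ := exists_seminorm_reflAt_le (𝓕⁻ m') i.1 i.2
  have h1 := ((kernelAt m x).integrable (μ := volume)).norm
  have h2 := (kernelAt m x).integrable_pow_mul (volume : Measure (Space N)) i.1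
  refine Integrable.mono' ((h1.add h2).const_mul A)
    (((kernelAt m x).continuous.smul
      (continuous_weightedDeriv_kernelAt i m')).aestronglyMeasurable)
    (Eventually.of_forall fun y => ?_)
  rw [norm_smul, norm_weightedDeriv]
  have h3 := mul_le_mul_of_nonneg_left (hA' y) (norm_nonneg (kernelAt m x y))
  refine h3.trans (le_of_eq ?_)
  rw [Pi.add_apply]
  ring

/-- The superposition of the translates of a kernel, weighted by another kernel, is a kernel: this is
the associativity of the convolution, in the norms that define the Schwartz topology. -/
theorem integral_kernelAt_smul_weightedDeriv (i : ℕ × ℕ) (m m' : 𝓢(Space N, ℂ)) (x : Space N) :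
    ∫ y, kernelAt m x y • weightedDeriv i (kernelAt m' y) =
      weightedDeriv i (kernelAt (symMul m m') x) := by
  have hint := integrable_kernelAt_smul_weightedDeriv i m m' x
  ext1 z
  refine jet_ext fun v => ?_
  obtain ⟨m'', h1, h2⟩ := exists_iteratedLineDerivOp_kernelAt v m'
  let L : (Space N →ᵇ Jet N i.2) →L[ℂ] ℂ :=
    (jetEval v).comp (BoundedContinuousFunction.evalCLM ℂ z)
  have hL : ∀ p, L p = jetEval v (p z) := fun p => rfl
  have hval : ∀ (η : 𝓢(Space N, ℂ)),
      L (weightedDeriv i η) = ((‖z‖ ^ i.1 : ℝ) : ℂ) * (∂^{v} η : 𝓢(Space N, ℂ)) z := by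
    intro η
    rw [hL, weightedDeriv_apply, map_smul, jetEval_jet, smul_eq_mul]
  rw [← hL, ← hL, ← L.integral_comp_comm hint, hval, h2, kernelAt_apply,
    ← integral_kernelAt_mul_fourierInv m m'' x z, ← integral_const_mul]
  refine integral_congr_ae (Eventually.of_forall fun y => ?_)
  have e : L (kernelAt m x y • weightedDeriv i (kernelAt m' y))
      = kernelAt m x y * L (weightedDeriv i (kernelAt m' y)) := map_smul L _ _
  dsimp only
  rw [e, hval, h1, kernelAt_apply m'']
  ring

/-- A tempered distribution commutes with superpositions of translates of a Schwartz function. By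
the Hahn-Banach theorem it factors through a Banach space of bounded continuous functions, in which
the superposition is a Bochner integral. -/
theorem apply_kernelAt_symMul (f : 𝓢'(Space N, Vec N)) (m m' : 𝓢(Space N, ℂ)) (x : Space N) :
    f (kernelAt (symMul m m') x) = ∫ y, kernelAt m x y • f (kernelAt m' y) := by
  obtain ⟨s, C, hC, hf⟩ := exists_seminorm_bound f
  let Y := ∀ i : s, (Space N →ᵇ Jet N (i : ℕ × ℕ).2)
  let T : 𝓢(Space N, ℂ) →ₗ[ℂ] Y := LinearMap.pi fun i => weightedDeriv (i : ℕ × ℕ)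
  have hfT : ∀ η, ‖f η‖ ≤ C * s.card * ‖T η‖ := by
    intro η
    refine (hf η).trans ?_
    rw [mul_assoc]
    refine mul_le_mul_of_nonneg_left ?_ hC
    have : ∀ i ∈ s, SchwartzMap.seminorm ℂ i.1 i.2 η ≤ ‖T η‖ := by
      intro i hi
      rw [← norm_weightedDeriv]
      exact norm_le_pi_norm (T η) ⟨i, hi⟩
    simpa using Finset.sum_le_card_nsmul _ _ _ this
  have hint : Integrable fun y => kernelAt m x y • T (kernelAt m' y) :=
    Integrable.of_eval fun i : s => integrable_kernelAt_smul_weightedDeriv (i : ℕ × ℕ) m m' x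
  have hTi : ∫ y, kernelAt m x y • T (kernelAt m' y) = T (kernelAt (symMul m m') x) := by
    ext1 i
    rw [eval_integral fun i => hint.eval i]
    exact integral_kernelAt_smul_weightedDeriv (i : ℕ × ℕ) m m' x
  have hcoord : ∀ j : Fin N, ∃ G : Y →L[ℂ] ℂ, ∀ η, G (T η) = f η j := by
    intro j
    let g₀ : 𝓢(Space N, ℂ) →ₗ[ℂ] ℂ := (EuclideanSpace.proj (𝕜 := ℂ) j).toLinearMap ∘ₗ f.toLinearMap
    have hg₀ : ∀ η, g₀ η = f η j := fun η => rfl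
    have hker : LinearMap.ker T ≤ LinearMap.ker g₀ := by
      intro η hη
      rw [LinearMap.mem_ker] at hη ⊢
      have h := hfT η
      rw [hη, norm_zero, mul_zero] at h
      have h0 : f η = 0 := norm_le_zero_iff.1 h
      rw [hg₀, h0]; rfl
    obtain ⟨h₀, hh₀⟩ : ∃ h₀ : LinearMap.range T →ₗ[ℂ] ℂ,
        ∀ η, h₀ ⟨T η, LinearMap.mem_range_self T η⟩ = g₀ η := by
      refine ⟨((LinearMap.ker T).liftQ g₀ hker) ∘ₗ T.quotKerEquivRange.symm.toLinearMap,
        fun η => ?_⟩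
      have : T.quotKerEquivRange.symm ⟨T η, LinearMap.mem_range_self T η⟩
          = Submodule.Quotient.mk η := by
        rw [LinearEquiv.symm_apply_eq]; rfl
      simp [this]
    let h₁ : StrongDual ℂ (LinearMap.range T) := h₀.mkContinuous (C * s.card) (by
      rintro ⟨_, η, rfl⟩
      rw [hh₀]
      exact (PiLp.norm_apply_le (f η) j).trans (hfT η))
    obtain ⟨G, hG, -⟩ := exists_extension_norm_eq (LinearMap.range T) h₁
    exact ⟨G, fun η => (hG ⟨T η, LinearMap.mem_range_self T η⟩).trans (hh₀ η)⟩
  choose G hG using hcoord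
  let Φ : Y →L[ℂ] Vec N :=
    ((PiLp.continuousLinearEquiv 2 ℂ fun _ : Fin N => ℂ).symm : (Fin N → ℂ) →L[ℂ] Vec N).comp
      (ContinuousLinearMap.pi G)
  have hΦ : ∀ η, Φ (T η) = f η := fun η => by
    ext j
    exact hG j η
  rw [← hΦ, ← hTi, ← Φ.integral_comp_comm hint]
  simp only [map_smul, hΦ]

/-- The distribution `Δ_k f` is square integrable as soon as the function `Δ_k f` is. -/
theorem distLpNorm_dyadicBlock {φ : 𝓢(Space N, ℝ)} (hφ : IsDyadicPartition φ) (k : ℤ)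
    (f : 𝓢'(Space N, Vec N)) : distLpNorm 2 (dyadicBlock φ k f) = eLpNorm (blk φ k f) 2 := by
  by_cases h : eLpNorm (blk φ k f) 2 = ∞
  · rw [h]
    by_contra hne
    exact hne ((block_representation hφ hne).2.1.symm.trans h)
  · have hmem : MemLp (blk φ k f) 2 :=
      ⟨(continuous_blk k f).aestronglyMeasurable, lt_top_iff_ne_top.2 h⟩
    have hrep : dyadicBlock φ k f = Lp.toTemperedDistribution (hmem.toLp (blk φ k f)) := by
      ext1 η
      have hη : η = kernelAt (𝓕 (reflAt η 0)) 0 := by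
        ext y
        rw [kernelAt_apply, FourierTransform.fourierInv_fourier_eq, reflAt_apply]
        simp
      rw [hη, dyadicBlock_apply_kernelAt, ← mconv_eq_apply _ hmem, symMul_comm,
        apply_kernelAt_symMul]
      rfl
    rw [hrep, distLpNorm_toTemperedDistribution, Lp.enorm_def]
    exact eLpNorm_congr_ae hmem.coeFn_toLp

end Superposition

/-! ### Test functions with spectrum away from the origin -/

section Annihilation

variable {N : ℕ}

/-- A Schwartz function whose Fourier transform vanishes near the origin is orthogonal to all
polynomials: multiplication by a coordinate becomes a derivative in frequency, so the products with
polynomials have the same property, and the integral is the Fourier transform at the origin. -/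
theorem annihilatesPolynomials_of_fourier_eventuallyEq {η : 𝓢(Space N, ℂ)}
    (h : (⇑(𝓕 η : 𝓢(Space N, ℂ)) : Space N → ℂ) =ᶠ[𝓝 0] 0) : AnnihilatesPolynomials η := by
  intro P
  suffices H : ∃ ζ : 𝓢(Space N, ℂ),
      (∀ x : Space N, ζ x = MvPolynomial.eval (fun i => ((x i : ℝ) : ℂ)) P * η x) ∧
        (⇑(𝓕 ζ : 𝓢(Space N, ℂ)) : Space N → ℂ) =ᶠ[𝓝 0] 0 by
    obtain ⟨ζ, hζ, hζ0⟩ := H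
    have h0 : (𝓕 ζ : 𝓢(Space N, ℂ)) 0 = 0 := hζ0.eq_of_nhds
    rw [SchwartzMap.fourier_coe, Real.fourier_eq] at h0
    simp only [inner_zero_right, neg_zero, AddChar.map_zero_eq_one, one_smul] at h0
    simpa only [hζ] using h0
  induction P using MvPolynomial.induction_on with
  | C a =>
    refine ⟨a • η, fun x => by simp, ?_⟩
    rw [FourierTransform.fourier_smul]
    filter_upwards [h] with ξ hξ
    rw [smul_apply, hξ]
    simp
  | add p q hp hq =>
    obtain ⟨ζ, h1, h2⟩ := hp
    obtain ⟨ζ', h3, h4⟩ := hq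
    refine ⟨ζ + ζ', fun x => by rw [add_apply, h1, h3, map_add, add_mul], ?_⟩
    rw [FourierTransform.fourier_add]
    filter_upwards [h2, h4] with ξ h5 h6
    rw [add_apply, h5, h6]
    simp
  | mul_X p i hp =>
    obtain ⟨ζ, h1, h2⟩ := hp
    refine ⟨(2 * Real.pi * Complex.I)⁻¹ • derivSym (basisVec i) ζ, fun x => ?_, ?_⟩
    · have hpi : (2 * Real.pi * Complex.I : ℂ) ≠ 0 := Complex.two_pi_I_ne_zero
      rw [smul_apply, derivSym_apply, h1, map_mul, MvPolynomial.eval_X, smul_eq_mul]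
      have hin : inner ℝ x (basisVec i) = x i := by
        rw [EuclideanSpace.inner_single_right]; simp
      rw [hin]
      field_simp
    · have h3 : (𝓕 (derivSym (basisVec i) ζ) : 𝓢(Space N, ℂ)) = -∂_{basisVec i} (𝓕 ζ) := by
        rw [SchwartzMap.lineDerivOp_fourier_eq, ← FourierTransform.fourier_neg]
        congr 1
        ext ξ
        rw [derivSym_apply, neg_apply, smul_apply,
          SchwartzMap.smulLeftCLM_apply_apply (by fun_prop)]
        simp [mul_assoc]
      rw [FourierTransform.fourier_smul, h3]
      have h4 := h2.fderiv (𝕜 := ℝ)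
      filter_upwards [h4] with ξ h5
      rw [smul_apply, neg_apply, SchwartzMap.lineDerivOp_apply_eq_fderiv, h5]
      simp

/-- The kernels of the dyadic blocks have vanishing moments, because their spectra avoid the origin.
Hence the equation modulo polynomials determines an equation for the blocks. -/
theorem annihilatesPolynomials_kernelAt_blockSym {φ : 𝓢(Space N, ℝ)} (hφ : IsDyadicPartition φ)
    (k : ℤ) (x : Space N) : AnnihilatesPolynomials (kernelAt (blockSym φ k) x) := by
  refine annihilatesPolynomials_of_fourier_eventuallyEq ?_
  filter_upwards [Metric.ball_mem_nhds (0 : Space N)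
    (show 0 < 3 / 4 * (2 : ℝ) ^ k / (2 * Real.pi) by positivity)] with ξ hξ
  have h3 : (𝓕 (kernelAt (blockSym φ k) x) : 𝓢(Space N, ℂ)) ξ =
      (𝓕⁻ (kernelAt (blockSym φ k) x) : 𝓢(Space N, ℂ)) (-ξ) := by
    rw [SchwartzMap.fourierInv_apply_eq]
    simp
  rw [h3, fourierInv_kernelAt]
  have h4 : blockSym φ k (-ξ) = 0 := by
    by_contra hne
    have h5 := (blockSym_ne_zero hφ hne).1
    rw [mem_ball_zero_iff, lt_div_iff₀ (by positivity)] at hξ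
    rw [norm_neg] at h5
    linarith
  rw [h4, mul_zero, Pi.zero_apply]

end Annihilation

/-! ### Measurability in time -/

section Measurability

variable {N : ℕ} {φ : 𝓢(Space N, ℝ)} {μ : Measure ℝ}

theorem aemeasurable_eLpNorm_two {w : ℝ → Space N → Vec N}
    (hm : ∀ x, AEStronglyMeasurable (fun τ => w τ x) μ) (hc : ∀ᵐ τ ∂μ, Continuous (w τ)) :
    AEMeasurable (fun τ => eLpNorm (w τ) 2) μ := by
  obtain ⟨w', h1, h2⟩ := exists_measurable_modification hm hc
  refine ⟨fun τ => eLpNorm (w' τ) 2, ?_, h2.mono fun τ h => by dsimp only; rw [h]⟩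
  simp only [eLpNorm_two_eq]
  exact (Measurable.lintegral_prod_right' (f := fun p : ℝ × Space N => ‖w' p.1 p.2‖ₑ ^ (2 : ℝ))
    (h1.enorm.pow_const _)).pow_const _

variable {f : ℝ → 𝓢'(Space N, Vec N)}

theorem aemeasurable_eLpNorm_blk (hf : ∀ η, AEStronglyMeasurable (fun τ => f τ η) μ) (k : ℤ) :
    AEMeasurable (fun τ => eLpNorm (blk φ k (f τ)) 2) μ :=
  aemeasurable_eLpNorm_two (fun _ => hf _) (Eventually.of_forall fun _ => continuous_blk _ _)

theorem aemeasurable_besovSum (hf : ∀ η, AEStronglyMeasurable (fun τ => f τ η) μ) (s : ℝ) :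
    AEMeasurable (fun τ => besovSum φ s (f τ)) μ :=
  AEMeasurable.tsum fun k => (aemeasurable_eLpNorm_blk hf k).const_mul _

theorem finiteBlocks_of_besovSum_ne_top (hφ : IsDyadicPartition φ) {s : ℝ}
    {f : 𝓢'(Space N, Vec N)} (h : besovSum φ s f ≠ ∞) : FiniteBlocks φ f := by
  intro k hk
  rw [distLpNorm_dyadicBlock hφ] at hk
  refine h (ENNReal.tsum_eq_top_of_eq_top ⟨k, ?_⟩)
  rw [hk, ENNReal.mul_top (pw_ne_zero _)]

theorem eLpNorm_blk_le_besovSum (s : ℝ) (k : ℤ) (f : 𝓢'(Space N, Vec N)) :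
    eLpNorm (blk φ k f) 2 ≤ pw (-(k * s)) * besovSum φ s f := by
  have h1 : pw (k * s) * eLpNorm (blk φ k f) 2 ≤ besovSum φ s f := ENNReal.le_tsum k
  have h2 := mul_le_mul' (le_refl (pw (-(k * s)))) h1
  have h3 : pw (-(k * s)) * pw (k * s) = 1 := by rw [← pw_add, neg_add_cancel, pw_zero]
  rwa [← mul_assoc, h3, one_mul] at h2

theorem aestronglyMeasurable_fieldOf (hφ : IsDyadicPartition φ)
    (hf : ∀ η, AEStronglyMeasurable (fun τ => f τ η) μ) (hv : ∀ᵐ τ ∂μ, IsVelocity φ (f τ))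
    (x : Space N) : AEStronglyMeasurable (fun τ => fieldOf φ (f τ) x) μ :=
  aestronglyMeasurable_of_tendsto_ae atTop (fun n : ℕ => hf (kernelAt (lowSym φ n) x))
    (hv.mono fun _ h => h.tendsto hφ x)

end Measurability

/-! ### The energy inequality for a dyadic block -/

section BlockInequality

variable {N : ℕ} {φ : 𝓢(Space N, ℝ)}

/-- A solution `d` of `∂_t d + u · ∇d - θ Δd = M` on `(0, b]` in the class of the theorem, with the
product `g = u · ∇d`. -/
structure IsTransportSolution (φ : 𝓢(Space N, ℝ)) (s θ b : ℝ) (u d M g : ℝ → 𝓢'(Space N, Vec N))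
    (d₀ : 𝓢'(Space N, Vec N)) : Prop where
  velocity : ∀ᵐ τ ∂volume.restrict (Set.Ioc 0 b), IsVelocity φ (u τ)
  velocity_integrable : ∀ η, IntegrableOn (fun τ => u τ η) (Set.Ioc 0 b)
  velocity_norm : ∫⁻ τ in Set.Ioc 0 b, lip φ (u τ) ≠ ∞
  source_measurable : ∀ η, AEStronglyMeasurable (fun τ => M τ η) (volume.restrict (Set.Ioc 0 b))
  source_norm : ∫⁻ τ in Set.Ioc 0 b, besovSum φ s (M τ) ≠ ∞
  measurable : ∀ η, AEStronglyMeasurable (fun τ => d τ η) (volume.restrict (Set.Ioc 0 b))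
  normalized : ∀ᵐ τ ∂volume.restrict (Set.Ioc 0 b), HasNormalizedGradient φ (d τ)
  bounded : ∃ B : ℝ≥0∞, B ≠ ∞ ∧ ∀ᵐ τ ∂volume.restrict (Set.Ioc 0 b), besovSum φ s (d τ) ≤ B
  initial : FiniteBlocks φ d₀
  advection : ∀ᵐ τ ∂volume.restrict (Set.Ioc 0 b), IsAdvection (u τ) (d τ) (g τ)
  advection_integrable : ∀ η, AnnihilatesPolynomials η →
    IntegrableOn (fun τ => g τ η) (Set.Ioc 0 b)
  laplacian_integrable : ∀ η, AnnihilatesPolynomials η →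
    IntegrableOn (fun τ => (Δ (d τ)) η) (Set.Ioc 0 b)
  source_integrable : ∀ η, AnnihilatesPolynomials η →
    IntegrableOn (fun τ => M τ η) (Set.Ioc 0 b)
  equation : ∀ η, AnnihilatesPolynomials η → ∀ᵐ t ∂volume.restrict (Set.Ioc 0 b),
    d t η + (∫ τ in (0 : ℝ)..t, g τ η) - (θ : ℂ) • (∫ τ in (0 : ℝ)..t, (Δ (d τ)) η)
      = d₀ η + (∫ τ in (0 : ℝ)..t, M τ η)

theorem continuous_advComm {U : Space N → Vec N} (hU : Continuous U) (d g : 𝓢'(Space N, Vec N))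
    (k : ℤ) : Continuous (advComm φ U d g k) := by
  refine (continuous_blk k g).sub (continuous_finsetSum _ fun i _ => ?_)
  exact ((EuclideanSpace.proj i : Vec N →L[ℂ] ℂ).continuous.comp hU).smul (continuous_blk k _)

theorem intervalIntegral_congr_of_ae {V : Type*} [NormedAddCommGroup V] [NormedSpace ℝ V]
    {F G : ℝ → V} {b t : ℝ} (ht : t ∈ Set.Ioc 0 b)
    (h : ∀ᵐ τ ∂volume.restrict (Set.Ioc 0 b), F τ = G τ) :
    ∫ τ in 0..t, F τ = ∫ τ in 0..t, G τ := by
  rw [intervalIntegral.integral_of_le ht.1.le, intervalIntegral.integral_of_le ht.1.le]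
  exact integral_congr_ae (h.filter_mono (ae_mono (Measure.restrict_mono
    (Set.Ioc_subset_Ioc_right ht.2) le_rfl)))

namespace IsTransportSolution

variable {s θ b : ℝ} {u d M g : ℝ → 𝓢'(Space N, Vec N)} {d₀ : 𝓢'(Space N, Vec N)}

theorem velocity_measurable (h : IsTransportSolution φ s θ b u d M g d₀) (η : 𝓢(Space N, ℂ)) :
    AEStronglyMeasurable (fun τ => u τ η) (volume.restrict (Set.Ioc 0 b)) :=
  (h.velocity_integrable η).1

theorem finiteBlocks_source (h : IsTransportSolution φ s θ b u d M g d₀)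
    (hφ : IsDyadicPartition φ) :
    ∀ᵐ τ ∂volume.restrict (Set.Ioc 0 b), FiniteBlocks φ (M τ) :=
  (ae_lt_top' (aemeasurable_besovSum h.source_measurable s) h.source_norm).mono fun _ hτ =>
    finiteBlocks_of_besovSum_ne_top hφ hτ.ne

theorem besovSum_ne_top (h : IsTransportSolution φ s θ b u d M g d₀) :
    ∀ᵐ τ ∂volume.restrict (Set.Ioc 0 b), besovSum φ s (d τ) ≠ ∞ := by
  obtain ⟨B, hB, h⟩ := h.bounded
  exact h.mono fun _ hτ => ne_top_of_le_ne_top hB hτ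

theorem finiteBlocks (h : IsTransportSolution φ s θ b u d M g d₀) (hφ : IsDyadicPartition φ) :
    ∀ᵐ τ ∂volume.restrict (Set.Ioc 0 b), FiniteBlocks φ (d τ) :=
  h.besovSum_ne_top.mono fun _ hτ => finiteBlocks_of_besovSum_ne_top hφ hτ

theorem aestronglyMeasurable_advComm (h : IsTransportSolution φ s θ b u d M g d₀)
    (hφ : IsDyadicPartition φ) (k : ℤ) (x : Space N) : AEStronglyMeasurable
      (fun τ => advComm φ (fieldOf φ (u τ)) (d τ) (g τ) k x) (volume.restrict (Set.Ioc 0 b)) := by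
  refine (h.advection_integrable _ (annihilatesPolynomials_kernelAt_blockSym hφ k x)).1.sub ?_
  have : ∀ i : Fin N, AEStronglyMeasurable
      (fun τ => fieldOf φ (u τ) x i • blk φ k (∂_{basisVec i} (d τ)) x)
      (volume.restrict (Set.Ioc 0 b)) := fun i => by
    have h1 : AEStronglyMeasurable (fun τ => fieldOf φ (u τ) x i)
        (volume.restrict (Set.Ioc 0 b)) :=
      (EuclideanSpace.proj i : Vec N →L[ℂ] ℂ).continuous.comp_aestronglyMeasurable
        (aestronglyMeasurable_fieldOf hφ h.velocity_measurable h.velocity x)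
    have h2 : AEStronglyMeasurable (fun τ => blk φ k (∂_{basisVec i} (d τ)) x)
        (volume.restrict (Set.Ioc 0 b)) := by
      simp only [blk, ← apply_kernelAt_derivSym]
      exact h.measurable _
    exact h1.smul h2
  exact Finset.aestronglyMeasurable_fun_sum _ fun i _ => this i

theorem aemeasurable_eLpNorm_advComm (h : IsTransportSolution φ s θ b u d M g d₀)
    (hφ : IsDyadicPartition φ) (k : ℤ) : AEMeasurable
      (fun τ => eLpNorm (advComm φ (fieldOf φ (u τ)) (d τ) (g τ) k) 2)
      (volume.restrict (Set.Ioc 0 b)) :=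
  aemeasurable_eLpNorm_two (h.aestronglyMeasurable_advComm hφ k)
    (h.velocity.mono fun _ hu => continuous_advComm (hu.continuous hφ) _ _ _)

theorem aemeasurable_lip (h : IsTransportSolution φ s θ b u d M g d₀) :
    AEMeasurable (fun τ => lip φ (u τ)) (volume.restrict (Set.Ioc 0 b)) :=
  aemeasurable_besovSum h.velocity_measurable (1 + N / 2)

theorem integrable_lip_mul (h : IsTransportSolution φ s θ b u d M g d₀) {K : ℝ≥0∞} (hK : K ≠ ∞) :
    IntegrableOn (fun τ => (K * lip φ (u τ)).toReal) (Set.Ioc 0 b) := by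
  refine integrable_toReal_of_lintegral_ne_top (h.aemeasurable_lip.const_mul K) ?_
  rw [lintegral_const_mul'' _ h.aemeasurable_lip]
  exact ENNReal.mul_ne_top hK h.velocity_norm

theorem integrable_originBound (h : IsTransportSolution φ s θ b u d M g d₀) :
    IntegrableOn (fun τ => originBound φ (u τ)) (Set.Ioc 0 b) :=
  (h.velocity_integrable _).norm.add (h.integrable_lip_mul (kerL2_ne_top _))

/-- The commutator estimate along a solution. -/
theorem ae_tsum_advComm_le (h : IsTransportSolution φ s θ b u d M g d₀)
    (hφ : IsDyadicPartition φ) {C : ℝ≥0∞}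
    (hC : ∀ (u d g : 𝓢'(Space N, Vec N)) (U : Space N → Vec N), FiniteBlocks φ u →
      FiniteBlocks φ d → HasNormalizedGradient φ u → HasNormalizedGradient φ d → lip φ u ≠ ∞ →
      besovSum φ s d ≠ ∞ → IsAdvection u d g →
      (∀ x, Tendsto (fun n : ℕ => lowCut φ n u x) atTop (𝓝 (U x))) →
      ∑' k : ℤ, pw (k * s) * eLpNorm (advComm φ U d g k) 2 ≤ C * lip φ u * besovSum φ s d) :
    ∀ᵐ τ ∂volume.restrict (Set.Ioc 0 b),
      ∑' k : ℤ, pw (k * s) * eLpNorm (advComm φ (fieldOf φ (u τ)) (d τ) (g τ) k) 2 ≤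
        C * lip φ (u τ) * besovSum φ s (d τ) := by
  filter_upwards [h.velocity, h.normalized, h.besovSum_ne_top, h.finiteBlocks hφ, h.advection]
    with τ hu hnd hbd hd hadv
  exact hC _ _ _ _ hu.finite hd hu.normalized hnd hu.lip_ne_top hbd hadv (hu.tendsto hφ)

theorem integrableOn_blkRhs (h : IsTransportSolution φ s θ b u d M g d₀)
    (hφ : IsDyadicPartition φ) (k : ℤ) (x : Space N) :
    IntegrableOn (fun τ => blkRhs φ θ k (d τ) (M τ) (g τ) x) (Set.Ioc 0 b) := by
  have ha := annihilatesPolynomials_kernelAt_blockSym hφ k x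
  exact ((h.source_integrable _ ha).sub (h.advection_integrable _ ha)).add
    ((h.laplacian_integrable _ ha).smul (θ : ℂ))

/-- The equation of a block, pointwise in `x`. -/
theorem blk_eq_add_integral (h : IsTransportSolution φ s θ b u d M g d₀)
    (hφ : IsDyadicPartition φ) (k : ℤ) (x : Space N) :
    ∀ᵐ t ∂volume.restrict (Set.Ioc 0 b),
      blk φ k (d t) x = blk φ k d₀ x + ∫ τ in 0..t, blkRhs φ θ k (d τ) (M τ) (g τ) x := by
  have ha := annihilatesPolynomials_kernelAt_blockSym hφ k x
  filter_upwards [h.equation _ ha, ae_restrict_mem measurableSet_Ioc] with t ht htb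
  have hi : ∀ {F : ℝ → Vec N}, IntegrableOn F (Set.Ioc 0 b) → IntervalIntegrable F volume 0 t :=
    fun hF => (intervalIntegrable_iff_integrableOn_Ioc_of_le htb.1.le).2
      (hF.mono_set (Set.Ioc_subset_Ioc_right htb.2))
  have i1 := hi (h.source_integrable _ ha)
  have i2 := hi (h.advection_integrable _ ha)
  have i3 := hi (h.laplacian_integrable _ ha)
  have i4 : IntervalIntegrable (fun τ => (θ : ℂ) • (Δ (d τ)) (kernelAt (blockSym φ k) x))
      volume 0 t := i3.smul (θ : ℂ)
  have e : ∫ τ in 0..t, blkRhs φ θ k (d τ) (M τ) (g τ) x =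
      (∫ τ in 0..t, M τ (kernelAt (blockSym φ k) x)) -
        (∫ τ in 0..t, g τ (kernelAt (blockSym φ k) x)) +
        (θ : ℂ) • ∫ τ in 0..t, (Δ (d τ)) (kernelAt (blockSym φ k) x) := by
    rw [← intervalIntegral.integral_sub i1 i2, ← intervalIntegral.integral_smul,
      ← intervalIntegral.integral_add (i1.sub i2) i4]
    rfl
  rw [e, blk, blk]
  rw [eq_sub_of_add_eq (eq_add_of_sub_eq ht)]
  abel

theorem memLp_advComm (h : IsTransportSolution φ s θ b u d M g d₀)
    (hφ : IsDyadicPartition φ) {C : ℝ≥0∞} (hC : C ≠ ∞)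
    (hadv : ∀ᵐ τ ∂volume.restrict (Set.Ioc 0 b),
      ∑' k : ℤ, pw (k * s) * eLpNorm (advComm φ (fieldOf φ (u τ)) (d τ) (g τ) k) 2 ≤
        C * lip φ (u τ) * besovSum φ s (d τ)) (k : ℤ) :
    ∀ᵐ τ ∂volume.restrict (Set.Ioc 0 b),
      MemLp (advComm φ (fieldOf φ (u τ)) (d τ) (g τ) k) 2 := by
  filter_upwards [h.velocity, h.besovSum_ne_top, hadv] with τ hu hd hτ
  refine ⟨(continuous_advComm (hu.continuous hφ) _ _ _).aestronglyMeasurable,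
    lt_top_iff_ne_top.2 fun htop => ?_⟩
  have h1 := (ENNReal.le_tsum k).trans hτ
  rw [htop, ENNReal.mul_top (pw_ne_zero _)] at h1
  exact ENNReal.mul_ne_top (ENNReal.mul_ne_top hC hu.lip_ne_top) hd (top_le_iff.1 h1)

theorem integrableOn_eLpNorm_advComm (h : IsTransportSolution φ s θ b u d M g d₀)
    (hφ : IsDyadicPartition φ) {C : ℝ≥0∞} (hC : C ≠ ∞)
    (hadv : ∀ᵐ τ ∂volume.restrict (Set.Ioc 0 b),
      ∑' k : ℤ, pw (k * s) * eLpNorm (advComm φ (fieldOf φ (u τ)) (d τ) (g τ) k) 2 ≤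
        C * lip φ (u τ) * besovSum φ s (d τ)) (k : ℤ) :
    IntegrableOn (fun τ => (eLpNorm (advComm φ (fieldOf φ (u τ)) (d τ) (g τ) k) 2).toReal)
      (Set.Ioc 0 b) := by
  refine integrable_toReal_of_lintegral_ne_top (h.aemeasurable_eLpNorm_advComm hφ k) ?_
  obtain ⟨B, hB, hdB⟩ := h.bounded
  refine ne_top_of_le_ne_top (b := ∫⁻ τ in Set.Ioc 0 b, pw (-(k * s)) * C * B * lip φ (u τ)) ?_
    (lintegral_mono_ae ?_)
  · rw [lintegral_const_mul'' _ h.aemeasurable_lip]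
    exact ENNReal.mul_ne_top (ENNReal.mul_ne_top (ENNReal.mul_ne_top (pw_ne_top _) hC) hB)
      h.velocity_norm
  · filter_upwards [hadv, hdB] with τ hτ hd
    have h1 := (ENNReal.le_tsum k).trans (hτ.trans (mul_le_mul' le_rfl hd))
    have h2 := mul_le_mul' (le_refl (pw (-(k * s)))) h1
    have h3 : pw (-(k * s)) * pw (k * s) = 1 := by rw [← pw_add, neg_add_cancel, pw_zero]
    rw [← mul_assoc, h3, one_mul] at h2
    refine h2.trans (le_of_eq ?_)
    ring

theorem integrableOn_eLpNorm_source (h : IsTransportSolution φ s θ b u d M g d₀) (k : ℤ) :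
    IntegrableOn (fun τ => (eLpNorm (blk φ k (M τ)) 2).toReal) (Set.Ioc 0 b) := by
  refine integrable_toReal_of_lintegral_ne_top (aemeasurable_eLpNorm_blk h.source_measurable k) ?_
  refine ne_top_of_le_ne_top (b := ∫⁻ τ in Set.Ioc 0 b, pw (-(k * s)) * besovSum φ s (M τ)) ?_
    (lintegral_mono fun τ => eLpNorm_blk_le_besovSum s k (M τ))
  rw [lintegral_const_mul'' _ (aemeasurable_besovSum h.source_measurable s)]
  exact ENNReal.mul_ne_top (pw_ne_top _) h.source_norm

theorem exists_bound_eLpNorm_blk (h : IsTransportSolution φ s θ b u d M g d₀) (k : ℤ) :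
    ∃ B : ℝ, ∀ᵐ t ∂volume.restrict (Set.Ioc 0 b), (eLpNorm (blk φ k (d t)) 2).toReal ≤ B := by
  obtain ⟨B, hB, hdB⟩ := h.bounded
  refine ⟨(pw (-(k * s)) * B).toReal, hdB.mono fun t ht => ?_⟩
  exact ENNReal.toReal_mono (ENNReal.mul_ne_top (pw_ne_top _) hB)
    ((eLpNorm_blk_le_besovSum s k (d t)).trans (mul_le_mul' le_rfl ht))

theorem integrableOn_mul_eLpNorm (h : IsTransportSolution φ s θ b u d M g d₀) (k : ℤ) {f : ℝ → ℝ}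
    (hf : IntegrableOn f (Set.Ioc 0 b)) :
    IntegrableOn (fun τ => f τ * (eLpNorm (blk φ k (d τ)) 2).toReal) (Set.Ioc 0 b) := by
  obtain ⟨B, hB⟩ := h.exists_bound_eLpNorm_blk k
  refine hf.mul_bdd (c := B) (aemeasurable_eLpNorm_blk h.measurable k).ennreal_toReal.aestronglyMeasurable
    (hB.mono fun t ht => ?_)
  rwa [Real.norm_of_nonneg ENNReal.toReal_nonneg]

theorem integrableOn_eLpNorm_blk (h : IsTransportSolution φ s θ b u d M g d₀) (k : ℤ) :
    IntegrableOn (fun τ => (eLpNorm (blk φ k (d τ)) 2).toReal) (Set.Ioc 0 b) := by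
  have := h.integrableOn_mul_eLpNorm k (f := fun _ => 1) (integrable_const 1)
  simpa only [one_mul] using this

/-- The energy inequality for the dyadic block `Δ_k d`. -/
theorem ae_eLpNorm_blk_add_integral_le (h : IsTransportSolution φ s θ b u d M g d₀)
    (hφ : IsDyadicPartition φ) (hθ : 0 < θ) {c : ℝ}
    (hc : ∀ (l : ℤ) (w : Space N → Vec N), IsBlock φ l w →
      ∫ x, inner ℝ (lapBlk φ l w x) (w x) ≤ -(c * ((2 : ℝ) ^ l * (eLpNorm w 2).toReal) ^ 2))
    {C : ℝ≥0∞} (hC : C ≠ ∞) (hadv : ∀ᵐ τ ∂volume.restrict (Set.Ioc 0 b),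
      ∑' k : ℤ, pw (k * s) * eLpNorm (advComm φ (fieldOf φ (u τ)) (d τ) (g τ) k) 2 ≤
        C * lip φ (u τ) * besovSum φ s (d τ)) (k : ℤ) :
    ∀ᵐ t ∂volume.restrict (Set.Ioc 0 b),
      (eLpNorm (blk φ k (d t)) 2).toReal +
          θ * (c * ((2 : ℝ) ^ k) ^ 2) * ∫ τ in 0..t, (eLpNorm (blk φ k (d τ)) 2).toReal ≤
        (eLpNorm (blk φ k d₀) 2).toReal + ∫ τ in 0..t, ((eLpNorm (blk φ k (M τ)) 2).toReal +
          (eLpNorm (advComm φ (fieldOf φ (u τ)) (d τ) (g τ) k) 2).toReal +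
          2 * N * lipConst φ (u τ) * (eLpNorm (blk φ k (d τ)) 2).toReal) := by
  have hadv2 := h.memLp_advComm hφ hC hadv k
  have hr := h.integrableOn_eLpNorm_advComm hφ hC hadv k
  have hm := h.integrableOn_eLpNorm_source k
  have hX := h.integrableOn_eLpNorm_blk k
  have hL : IntegrableOn (fun τ => lipConst φ (u τ)) (Set.Ioc 0 b) :=
    h.integrable_lip_mul gradConst_ne_top
  obtain ⟨B, hB⟩ := h.exists_bound_eLpNorm_blk k
  obtain ⟨K, hK, hlap⟩ := exists_eLpNorm_lapBlk_le φ k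
  have hdcont : ∀ᵐ τ ∂volume.restrict (Set.Ioc 0 b), Continuous (blk φ k (d τ)) :=
    Eventually.of_forall fun τ => continuous_blk k _
  obtain ⟨w, hw, hwd⟩ := exists_measurable_modification (f := fun τ => blk φ k (d τ))
    (μ := volume.restrict (Set.Ioc 0 b)) (fun x => h.measurable _) hdcont
  obtain ⟨F, hF, hFd⟩ := exists_measurable_modification
    (f := fun τ => blkRhs φ θ k (d τ) (M τ) (g τ)) (μ := volume.restrict (Set.Ioc 0 b))
    (fun x => (h.integrableOn_blkRhs hφ k x).1)
    (Eventually.of_forall fun τ => continuous_blkRhs θ k _ _ _)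
  have hlapm : ∀ x, AEStronglyMeasurable (fun τ => lapBlk φ k (blk φ k (d τ)) x)
      (volume.restrict (Set.Ioc 0 b)) := fun x =>
    (h.laplacian_integrable _ (annihilatesPolynomials_kernelAt_blockSym hφ k x)).1.congr
      ((h.finiteBlocks hφ).mono fun τ hd => blk_laplacian hφ hd k x)
  have hlapc : ∀ᵐ τ ∂volume.restrict (Set.Ioc 0 b), Continuous (lapBlk φ k (blk φ k (d τ))) :=
    (h.finiteBlocks hφ).mono fun τ hd =>
      continuous_finsetSum _ fun i _ => continuous_mconv _ (hd.isBlock hφ k).memLp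
  obtain ⟨w₂, hw₂, hw₂d⟩ := exists_measurable_modification hlapm hlapc
  have hint : ∀ n : ℕ, Integrable
      (fun p : ℝ × Space N => cutoff ((n : ℝ) + 1) p.2 * (2 * inner ℝ (w p.1 p.2) (F p.1 p.2)))
      ((volume.restrict (Set.Ioc 0 b)).prod volume) := by
    intro n
    have hn : (0 : ℝ) < n + 1 := by positivity
    have hmeas : StronglyMeasurable fun p : ℝ × Space N =>
        cutoff ((n : ℝ) + 1) p.2 * (2 * inner ℝ (w p.1 p.2) (F p.1 p.2)) :=
      ((continuous_cutoff _).comp continuous_snd).stronglyMeasurable.mul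
        ((hw.inner hF).const_mul 2)
    rw [integrable_prod_iff hmeas.aestronglyMeasurable]
    constructor
    · filter_upwards [hwd, hFd, h.velocity, h.finiteBlocks hφ, h.finiteBlocks_source hφ, hadv2]
        with τ h1 h2 hu hd hM ha
      simp only [h1, h2]
      exact integrable_cutoff_mul_inner_blkRhs hφ hu hd hM ha hn
    · refine Integrable.mono' (g := fun τ => 2 * (((eLpNorm (blk φ k (M τ)) 2).toReal +
          (eLpNorm (advComm φ (fieldOf φ (u τ)) (d τ) (g τ) k) 2).toReal +
          N * ((originBound φ (u τ) + 2 * ((n : ℝ) + 1) * lipConst φ (u τ)) *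
            ((gradConst' φ * pw k).toReal * (eLpNorm (blk φ k (d τ)) 2).toReal)) +
          θ * (K.toReal * (eLpNorm (blk φ k (d τ)) 2).toReal)) *
          (eLpNorm (blk φ k (d τ)) 2).toReal)) ?_
        hmeas.norm.integral_prod_right'.aestronglyMeasurable ?_
      · refine (h.integrableOn_mul_eLpNorm k (((hm.add hr).add (Integrable.const_mul ?_ _)).add
          ((hX.const_mul _).const_mul _))).const_mul 2
        have h1 := h.integrableOn_mul_eLpNorm k
          ((h.integrable_originBound.add (hL.const_mul (2 * ((n : ℝ) + 1)))).const_mul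
            (gradConst' φ * pw k).toReal)
        refine h1.congr (Eventually.of_forall fun τ => ?_)
        simp only [Pi.add_apply]
        ring
      · filter_upwards [hwd, hFd, h.velocity, h.finiteBlocks hφ, h.finiteBlocks_source hφ, hadv2]
          with τ h1 h2 hu hd hM ha
        simp only [h1, h2]
        rw [Real.norm_of_nonneg (integral_nonneg fun _ => norm_nonneg _)]
        exact integral_abs_cutoff_mul_inner_blkRhs_le hφ hu hd hM ha hn hθ hK hlap
  have hgm : ∀ n : ℕ, AEStronglyMeasurable (fun τ => θ * ∫ x, cutoff ((n : ℝ) + 1) x *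
      inner ℝ (blk φ k (d τ) x) (lapBlk φ k (blk φ k (d τ)) x))
      (volume.restrict (Set.Ioc 0 b)) := by
    intro n
    have hmeas : StronglyMeasurable fun p : ℝ × Space N =>
        cutoff ((n : ℝ) + 1) p.2 * inner ℝ (w p.1 p.2) (w₂ p.1 p.2) :=
      ((continuous_cutoff _).comp continuous_snd).stronglyMeasurable.mul (hw.inner hw₂)
    refine ((hmeas.integral_prod_right' (ν := (volume : Measure (Space N)))).const_mul θ).aestronglyMeasurable.congr ?_
    filter_upwards [hwd, hw₂d] with τ h1 h2
    rw [h1, h2]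
  have key := ae_eLpNorm_add_integral_le (b := b) (κ := θ * (c * ((2 : ℝ) ^ k) ^ 2)) (B := B)
    (F := F) (w := w) (w₀ := blk φ k d₀)
    (f := fun τ => (eLpNorm (blk φ k (M τ)) 2).toReal +
          (eLpNorm (advComm φ (fieldOf φ (u τ)) (d τ) (g τ) k) 2).toReal +
          2 * N * lipConst φ (u τ) * (eLpNorm (blk φ k (d τ)) 2).toReal)
    (a := fun τ => N * originBound φ (u τ))
    (H := fun τ => θ * (B * (K.toReal * (eLpNorm (blk φ k (d τ)) 2).toReal)))
    (h := fun τ => θ * ∫ x, inner ℝ (blk φ k (d τ) x) (lapBlk φ k (blk φ k (d τ)) x))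
    (g := fun n τ => θ * ∫ x, cutoff ((n : ℝ) + 1) x *
      inner ℝ (blk φ k (d τ) x) (lapBlk φ k (blk φ k (d τ)) x))
    hF hw (continuous_blk k d₀) (h.initial.isBlock hφ k).memLp ?_ ?_ ?_ ?_ hint ?_ ?_ ?_ ?_ ?_ hgm
    ?_ ?_ ?_ ?_
  · filter_upwards [key, hwd, ae_restrict_mem measurableSet_Ioc] with t ht hwt htb
    rw [hwt] at ht
    have e := intervalIntegral_congr_of_ae htb
      (hwd.mono fun τ hτ => congrArg (fun v => (eLpNorm v 2 volume).toReal) hτ)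
    rw [e] at ht
    exact ht
  · exact fun x => (h.integrableOn_blkRhs hφ k x).congr
      (hFd.mono fun τ hτ => (congrFun hτ x).symm)
  · intro x
    filter_upwards [h.blk_eq_add_integral hφ k x, hwd, ae_restrict_mem measurableSet_Ioc]
      with t ht hwt htb
    rw [intervalIntegral_congr_of_ae htb (hFd.mono fun τ hτ => congrFun hτ x), hwt]
    exact ht
  · filter_upwards [hwd, h.finiteBlocks hφ] with t ht hd
    rw [ht]
    exact (hd.isBlock hφ k).memLp
  · filter_upwards [hwd, hB] with t ht hd
    rw [ht]
    exact hd
  · exact (hm.add hr).add (h.integrableOn_mul_eLpNorm k (hL.const_mul (2 * (N : ℝ))))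
  · intro t
    have := lipConst_nonneg (φ := φ) (u t)
    positivity
  · exact h.integrable_originBound.const_mul _
  · exact fun t => mul_nonneg (Nat.cast_nonneg _) (originBound_nonneg _)
  · exact ((hX.const_mul _).const_mul _).const_mul _
  · intro n
    filter_upwards [hB, h.finiteBlocks hφ] with τ hτ hd
    have hw2 := (hd.isBlock hφ k).memLp
    have h1 := abs_integral_cutoff_inner_le (R := (n : ℝ) + 1) hw2 (hlap _ hw2).1
    have h2 := ENNReal.toReal_mono (ENNReal.mul_ne_top hK hw2.2.ne) (hlap _ hw2).2
    rw [ENNReal.toReal_mul] at h2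
    rw [abs_mul, abs_of_pos hθ]
    refine mul_le_mul_of_nonneg_left ?_ hθ.le
    refine (abs_integral_le_integral_abs.trans h1).trans ?_
    exact mul_le_mul hτ h2 ENNReal.toReal_nonneg (ENNReal.toReal_nonneg.trans hτ)
  · filter_upwards [h.finiteBlocks hφ] with τ hd
    have hw2 := (hd.isBlock hφ k).memLp
    exact (tendsto_integral_cutoff_mul (integrable_inner_of_memLp hw2 (hlap _ hw2).1)).const_mul θ
  · filter_upwards [hwd, h.finiteBlocks hφ] with τ ht hd
    rw [ht]
    have h1 := hc k _ (hd.isBlock hφ k)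
    simp only [real_inner_comm] at h1 ⊢
    have h2 := mul_le_mul_of_nonneg_left h1 hθ.le
    refine h2.trans (le_of_eq ?_)
    ring
  · intro n
    filter_upwards [hwd, hFd, h.velocity, h.finiteBlocks hφ, h.finiteBlocks_source hφ, hadv2]
      with τ h1 h2 hu hd hM ha
    simp only [h1, h2]
    exact integral_cutoff_mul_inner_blkRhs_le hφ hu hd hM ha (by positivity)

end IsTransportSolution

end BlockInequality

/-! ### Grönwall's inequality -/

section Gronwall

theorem abs_exp_neg_sub_le {a b : ℝ} (ha : 0 ≤ a) (hb : 0 ≤ b) :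
    |Real.exp (-a) - Real.exp (-b)| ≤ |a - b| := by
  have h := (convex_Ici (0 : ℝ)).norm_image_sub_le_of_norm_hasDerivWithin_le
    (f := fun x => Real.exp (-x)) (f' := fun x => Real.exp (-x) * -1) (C := 1) (x := b) (y := a)
    (fun x _ => ((hasDerivAt_neg x).exp).hasDerivWithinAt)
    (fun x hx => by
      rw [norm_mul, norm_neg, norm_one, mul_one, Real.norm_of_nonneg (Real.exp_pos _).le]
      exact Real.exp_le_one_iff.2 (neg_nonpos.2 hx)) hb ha
  simpa using h

/-- Grönwall's inequality for integrable coefficients: the derivative of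
`exp (-∫ ℓ) (A + ∫ ℓ y)` is nonpositive. -/
theorem add_integral_le_mul_exp {ℓ y : ℝ → ℝ} {A b : ℝ} (hb : 0 ≤ b)
    (hℓ : IntegrableOn ℓ (Set.Ioc 0 b)) (hℓ0 : ∀ t, 0 ≤ ℓ t)
    (hℓy : IntegrableOn (fun t => ℓ t * y t) (Set.Ioc 0 b))
    (h : ∀ᵐ t ∂volume.restrict (Set.Ioc 0 b), y t ≤ A + ∫ τ in 0..t, ℓ τ * y τ) :
    A + ∫ τ in 0..b, ℓ τ * y τ ≤ A * Real.exp (∫ τ in 0..b, ℓ τ) := by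
  have i1 : IntervalIntegrable ℓ volume 0 b :=
    (intervalIntegrable_iff_integrableOn_Ioc_of_le hb).2 hℓ
  have i2 : IntervalIntegrable (fun t => ℓ t * y t) volume 0 b :=
    (intervalIntegrable_iff_integrableOn_Ioc_of_le hb).2 hℓy
  let L : ℝ → ℝ := fun t => ∫ τ in 0..t, ℓ τ
  let P : ℝ → ℝ := fun t => A + ∫ τ in 0..t, ℓ τ * y τ
  have hL0 : ∀ t ∈ Set.uIcc 0 b, 0 ≤ L t := fun t ht => by
    rw [Set.uIcc_of_le hb] at ht
    exact intervalIntegral.integral_nonneg ht.1 fun τ _ => hℓ0 τ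
  have hLac : AbsolutelyContinuousOnInterval L 0 b := absolutelyContinuousOnInterval_integral i1
  have hEac : AbsolutelyContinuousOnInterval (fun t => Real.exp (-L t)) 0 b :=
    absolutelyContinuousOnInterval_of_dist_le (K := 1) hLac fun s hs t ht => by
      rw [one_mul, Real.dist_eq, Real.dist_eq]
      exact abs_exp_neg_sub_le (hL0 s hs) (hL0 t ht)
  have hPac : AbsolutelyContinuousOnInterval P 0 b :=
    absolutelyContinuousOnInterval_const_add (absolutelyContinuousOnInterval_integral i2) A
  have hd : ∀ᵐ t, t ∈ Set.uIcc 0 b → HasDerivAt (fun t => Real.exp (-L t) * P t)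
      (Real.exp (-L t) * (ℓ t * (y t - P t))) t := by
    filter_upwards [i1.ae_hasDerivAt_integral, i2.ae_hasDerivAt_integral] with t h1 h2 ht
    have h3 := ((h1 ht 0 Set.left_mem_uIcc).fun_neg.exp).fun_mul
      ((h2 ht 0 Set.left_mem_uIcc).const_add A)
    refine h3.congr_deriv ?_
    simp only [L, P]
    ring
  have hfin := integral_eq_sub_of_ae_hasDerivAt (hEac.mul hPac) hd
  have hneg : ∫ t in 0..b, Real.exp (-L t) * (ℓ t * (y t - P t)) ≤ 0 := by
    rw [intervalIntegral.integral_of_le hb]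
    refine integral_nonpos_of_ae ?_
    filter_upwards [h] with t ht
    exact mul_nonpos_of_nonneg_of_nonpos (Real.exp_pos _).le
      (mul_nonpos_of_nonneg_of_nonpos (hℓ0 t) (sub_nonpos.2 ht))
  have h0 : Real.exp (-L 0) * P 0 = A := by simp [L, P]
  simp only [Pi.mul_apply] at hfin
  rw [hfin, h0, sub_nonpos, Real.exp_neg, inv_mul_le_iff₀ (Real.exp_pos _), mul_comm] at hneg
  exact hneg

/-- A property that holds for almost all times holds at times arbitrarily close to the end. -/
theorem frequently_of_ae_restrict_Ioc {b : ℝ} (hb : 0 < b) {p : ℝ → Prop}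
    (h : ∀ᵐ t ∂volume.restrict (Set.Ioc 0 b), p t) : ∃ᶠ t in 𝓝[<] b, p t := by
  intro hn
  obtain ⟨a, ha, hs⟩ := (mem_nhdsLT_iff_exists_Ioo_subset' hb).1 hn
  have hsub : Set.Ioo (max 0 a) b ⊆ Set.Ioc 0 b := fun t ht =>
    ⟨(le_max_left _ _).trans_lt ht.1, ht.2.le⟩
  have h1 : ∀ᵐ t ∂volume.restrict (Set.Ioo (max 0 a) b), p t :=
    h.filter_mono (ae_mono (Measure.restrict_mono hsub le_rfl))
  have h2 : ∀ᵐ t ∂volume.restrict (Set.Ioo (max 0 a) b), False := by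
    filter_upwards [h1, ae_restrict_mem measurableSet_Ioo] with t ht hm
    exact hs (show t ∈ Set.Ioo a b from ⟨(le_max_right _ _).trans_lt hm.1, hm.2⟩) ht
  rw [eventually_false_iff_eq_bot, ae_eq_bot, Measure.restrict_eq_zero, Real.volume_Ioo,
    ENNReal.ofReal_eq_zero, sub_nonpos] at h2
  exact (max_lt hb ha).not_ge h2

end Gronwall

/-! ### Summation over the dyadic blocks -/

section Summation

variable {N : ℕ} {φ : 𝓢(Space N, ℝ)}

theorem ofReal_intervalIntegral_toReal {X : ℝ → ℝ≥0∞} {b t : ℝ} (ht : t ∈ Set.Icc 0 b)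
    (hi : IntegrableOn (fun τ => (X τ).toReal) (Set.Ioc 0 b))
    (hX : ∀ᵐ τ ∂volume.restrict (Set.Ioc 0 b), X τ ≠ ∞) :
    ENNReal.ofReal (∫ τ in 0..t, (X τ).toReal) = ∫⁻ τ in Set.Ioc 0 t, X τ := by
  have hsub : Set.Ioc 0 t ⊆ Set.Ioc 0 b := Set.Ioc_subset_Ioc_right ht.2
  rw [intervalIntegral.integral_of_le ht.1, ofReal_integral_eq_lintegral_ofReal (hi.mono_set hsub)
    (Eventually.of_forall fun _ => ENNReal.toReal_nonneg)]
  exact lintegral_congr_ae ((hX.filter_mono (ae_mono (Measure.restrict_mono hsub le_rfl))).mono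
    fun τ hτ => ENNReal.ofReal_toReal hτ)

/-- The right-hand side of the energy inequality for a dyadic block. -/
def blkSource (φ : 𝓢(Space N, ℝ)) (u d M g : 𝓢'(Space N, Vec N)) (k : ℤ) : ℝ≥0∞ :=
  eLpNorm (blk φ k M) 2 + eLpNorm (advComm φ (fieldOf φ u) d g k) 2 +
    2 * N * (gradConst φ * lip φ u) * eLpNorm (blk φ k d) 2

namespace IsTransportSolution

variable {s θ b : ℝ} {u d M g : ℝ → 𝓢'(Space N, Vec N)} {d₀ : 𝓢'(Space N, Vec N)}

theorem aemeasurable_blkSource (h : IsTransportSolution φ s θ b u d M g d₀)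
    (hφ : IsDyadicPartition φ) (k : ℤ) :
    AEMeasurable (fun τ => blkSource φ (u τ) (d τ) (M τ) (g τ) k)
      (volume.restrict (Set.Ioc 0 b)) :=
  ((aemeasurable_eLpNorm_blk h.source_measurable k).add
    (h.aemeasurable_eLpNorm_advComm hφ k)).add
      (((h.aemeasurable_lip.const_mul _).const_mul _).mul
        (aemeasurable_eLpNorm_blk h.measurable k))

/-- The energy inequality for a dyadic block, in extended nonnegative reals. -/
theorem ae_eLpNorm_blk_add_lintegral_le (h : IsTransportSolution φ s θ b u d M g d₀)
    (hφ : IsDyadicPartition φ) (hθ : 0 < θ) {c : ℝ} (hc0 : 0 < c)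
    (hc : ∀ (l : ℤ) (w : Space N → Vec N), IsBlock φ l w →
      ∫ x, inner ℝ (lapBlk φ l w x) (w x) ≤ -(c * ((2 : ℝ) ^ l * (eLpNorm w 2).toReal) ^ 2))
    {C : ℝ≥0∞} (hC : C ≠ ∞) (hadv : ∀ᵐ τ ∂volume.restrict (Set.Ioc 0 b),
      ∑' k : ℤ, pw (k * s) * eLpNorm (advComm φ (fieldOf φ (u τ)) (d τ) (g τ) k) 2 ≤
        C * lip φ (u τ) * besovSum φ s (d τ)) (k : ℤ) :
    ∀ᵐ t ∂volume.restrict (Set.Ioc 0 b),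
      eLpNorm (blk φ k (d t)) 2 + ENNReal.ofReal (θ * (c * ((2 : ℝ) ^ k) ^ 2)) *
          ∫⁻ τ in Set.Ioc 0 t, eLpNorm (blk φ k (d τ)) 2 ≤
        eLpNorm (blk φ k d₀) 2 +
          ∫⁻ τ in Set.Ioc 0 t, blkSource φ (u τ) (d τ) (M τ) (g τ) k := by
  have hd : ∀ᵐ τ ∂volume.restrict (Set.Ioc 0 b), eLpNorm (blk φ k (d τ)) 2 ≠ ∞ :=
    (h.finiteBlocks hφ).mono fun τ hτ => (hτ.isBlock hφ k).memLp.2.ne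
  have hM : ∀ᵐ τ ∂volume.restrict (Set.Ioc 0 b), eLpNorm (blk φ k (M τ)) 2 ≠ ∞ :=
    (h.finiteBlocks_source hφ).mono fun τ hτ => (hτ.isBlock hφ k).memLp.2.ne
  have hsrc : ∀ᵐ τ ∂volume.restrict (Set.Ioc 0 b),
      blkSource φ (u τ) (d τ) (M τ) (g τ) k ≠ ∞ ∧
      (blkSource φ (u τ) (d τ) (M τ) (g τ) k).toReal = (eLpNorm (blk φ k (M τ)) 2).toReal +
          (eLpNorm (advComm φ (fieldOf φ (u τ)) (d τ) (g τ) k) 2).toReal +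
          2 * N * lipConst φ (u τ) * (eLpNorm (blk φ k (d τ)) 2).toReal := by
    filter_upwards [hd, hM, h.velocity, h.memLp_advComm hφ hC hadv k] with τ h1 h2 h3 h4
    have h5 : 2 * (N : ℝ≥0∞) * (gradConst φ * lip φ (u τ)) * eLpNorm (blk φ k (d τ)) 2 ≠ ∞ :=
      ENNReal.mul_ne_top (ENNReal.mul_ne_top
        (ENNReal.mul_ne_top ENNReal.ofNat_ne_top (ENNReal.natCast_ne_top N))
        (ENNReal.mul_ne_top gradConst_ne_top h3.lip_ne_top)) h1
    have h6 := ENNReal.add_ne_top.2 ⟨h2, h4.2.ne⟩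
    refine ⟨ENNReal.add_ne_top.2 ⟨h6, h5⟩, ?_⟩
    rw [blkSource, ENNReal.toReal_add h6 h5, ENNReal.toReal_add h2 h4.2.ne, ENNReal.toReal_mul,
      ENNReal.toReal_mul, ENNReal.toReal_mul, ENNReal.toReal_ofNat, ENNReal.toReal_natCast,
      lipConst]
  have hsi : IntegrableOn (fun τ => (blkSource φ (u τ) (d τ) (M τ) (g τ) k).toReal)
      (Set.Ioc 0 b) := by
    refine (((h.integrableOn_eLpNorm_source k).add
      (h.integrableOn_eLpNorm_advComm hφ hC hadv k)).add (h.integrableOn_mul_eLpNorm k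
        ((h.integrable_lip_mul (gradConst_ne_top (φ := φ))).const_mul (2 * (N : ℝ))))).congr ?_
    filter_upwards [hsrc] with τ hτ
    rw [hτ.2]
    rfl
  filter_upwards [h.ae_eLpNorm_blk_add_integral_le hφ hθ hc hC hadv k, hd,
    ae_restrict_mem measurableSet_Ioc] with t ht hdt htb
  have htb' : t ∈ Set.Icc 0 b := ⟨htb.1.le, htb.2⟩
  have e : ∫ τ in 0..t, ((eLpNorm (blk φ k (M τ)) 2).toReal +
      (eLpNorm (advComm φ (fieldOf φ (u τ)) (d τ) (g τ) k) 2).toReal +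
      2 * N * lipConst φ (u τ) * (eLpNorm (blk φ k (d τ)) 2).toReal) =
      ∫ τ in 0..t, (blkSource φ (u τ) (d τ) (M τ) (g τ) k).toReal :=
    intervalIntegral_congr_of_ae htb (hsrc.mono fun τ hτ => hτ.2.symm)
  rw [e] at ht
  have hI : 0 ≤ ∫ τ in 0..t, (eLpNorm (blk φ k (d τ)) 2).toReal :=
    intervalIntegral.integral_nonneg htb.1.le fun _ _ => ENNReal.toReal_nonneg
  have hκ : 0 ≤ θ * (c * ((2 : ℝ) ^ k) ^ 2) := by positivity
  have h1 := ENNReal.ofReal_le_ofReal ht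
  rw [ENNReal.ofReal_add ENNReal.toReal_nonneg (mul_nonneg hκ hI), ENNReal.ofReal_mul hκ,
    ENNReal.ofReal_toReal hdt, ofReal_intervalIntegral_toReal htb' (h.integrableOn_eLpNorm_blk k) hd,
    ENNReal.ofReal_add ENNReal.toReal_nonneg (intervalIntegral.integral_nonneg htb.1.le
      fun _ _ => ENNReal.toReal_nonneg), ENNReal.ofReal_toReal (h.initial.isBlock hφ k).memLp.2.ne,
    ofReal_intervalIntegral_toReal htb' hsi (hsrc.mono fun _ hτ => hτ.1)] at h1
  exact h1

/-- The commutators and the transport terms sum to at most `‖u‖ ‖d‖` in the Besov norms, up to a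
constant. -/
theorem tsum_blkSource_le {C : ℝ≥0∞} {u d M g : 𝓢'(Space N, Vec N)}
    (hadv : ∑' k : ℤ, pw (k * s) * eLpNorm (advComm φ (fieldOf φ u) d g k) 2 ≤
      C * lip φ u * besovSum φ s d) :
    ∑' k : ℤ, pw (k * s) * blkSource φ u d M g k ≤
      besovSum φ s M + (C + 2 * N * gradConst φ) * lip φ u * besovSum φ s d := by
  simp only [blkSource, mul_add]
  rw [ENNReal.tsum_add, ENNReal.tsum_add, add_mul, add_mul, add_assoc]
  refine add_le_add le_rfl (add_le_add hadv (le_of_eq ?_))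
  rw [besovSum, ← ENNReal.tsum_mul_left]
  exact tsum_congr fun k => by ring

/-- The integral in time of the sum of the right-hand sides of the blocks. -/
theorem tsum_lintegral_blkSource_le (h : IsTransportSolution φ s θ b u d M g d₀)
    (hφ : IsDyadicPartition φ) {C : ℝ≥0∞} (hadv : ∀ᵐ τ ∂volume.restrict (Set.Ioc 0 b),
      ∑' k : ℤ, pw (k * s) * eLpNorm (advComm φ (fieldOf φ (u τ)) (d τ) (g τ) k) 2 ≤
        C * lip φ (u τ) * besovSum φ s (d τ)) {t : ℝ} (ht : t ≤ b) :
    ∑' k : ℤ, pw (k * s) * (eLpNorm (blk φ k d₀) 2 +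
        ∫⁻ τ in Set.Ioc 0 t, blkSource φ (u τ) (d τ) (M τ) (g τ) k) ≤
      (besovSum φ s d₀ + ∫⁻ τ in Set.Ioc 0 b, besovSum φ s (M τ)) +
        ∫⁻ τ in Set.Ioc 0 t, (C + 2 * N * gradConst φ) * lip φ (u τ) * besovSum φ s (d τ) := by
  have hsub : Set.Ioc 0 t ⊆ Set.Ioc 0 b := Set.Ioc_subset_Ioc_right ht
  have hm := Measure.restrict_mono (μ := volume) hsub le_rfl
  simp only [mul_add]
  rw [ENNReal.tsum_add, add_assoc]
  refine add_le_add le_rfl ?_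
  have e : ∀ k : ℤ, pw (k * s) * ∫⁻ τ in Set.Ioc 0 t, blkSource φ (u τ) (d τ) (M τ) (g τ) k =
      ∫⁻ τ in Set.Ioc 0 t, pw (k * s) * blkSource φ (u τ) (d τ) (M τ) (g τ) k := fun k =>
    (lintegral_const_mul'' _ ((h.aemeasurable_blkSource hφ k).mono_measure hm)).symm
  simp only [e]
  rw [← lintegral_tsum fun k => ((h.aemeasurable_blkSource hφ k).mono_measure hm).const_mul _]
  have h1 : ∫⁻ τ in Set.Ioc 0 t, besovSum φ s (M τ) ≤ ∫⁻ τ in Set.Ioc 0 b, besovSum φ s (M τ) :=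
    lintegral_mono' hm le_rfl
  refine le_trans ?_ (add_le_add h1 le_rfl)
  rw [← lintegral_add_left' ((aemeasurable_besovSum h.source_measurable s).mono_measure hm)]
  exact lintegral_mono_ae ((hadv.filter_mono (ae_mono hm)).mono fun τ hτ => tsum_blkSource_le hτ)

/-- The conclusion of Grönwall's inequality for the Besov norm of the solution. -/
theorem add_lintegral_le (h : IsTransportSolution φ s θ b u d M g d₀)
    (hb : 0 ≤ b) {K D : ℝ≥0∞} (hK : K ≠ ∞) (hD : D ≠ ∞)
    (hle : ∀ᵐ t ∂volume.restrict (Set.Ioc 0 b), besovSum φ s (d t) ≤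
      D + ∫⁻ τ in Set.Ioc 0 t, K * lip φ (u τ) * besovSum φ s (d τ)) :
    D + ∫⁻ τ in Set.Ioc 0 b, K * lip φ (u τ) * besovSum φ s (d τ) ≤
      D * ENNReal.ofReal (Real.exp (K.toReal * (∫⁻ τ in Set.Ioc 0 b, lip φ (u τ)).toReal)) := by
  have hXtop : ∀ᵐ τ ∂volume.restrict (Set.Ioc 0 b),
      K * lip φ (u τ) * besovSum φ s (d τ) ≠ ∞ := by
    filter_upwards [h.velocity, h.besovSum_ne_top] with τ hu hd
    exact ENNReal.mul_ne_top (ENNReal.mul_ne_top hK hu.lip_ne_top) hd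
  have hℓ := h.integrable_lip_mul hK
  have hℓy : IntegrableOn (fun τ => (K * lip φ (u τ) * besovSum φ s (d τ)).toReal)
      (Set.Ioc 0 b) := by
    obtain ⟨B, hB, hdB⟩ := h.bounded
    have := hℓ.mul_bdd (c := B.toReal)
      (aemeasurable_besovSum (φ := φ) h.measurable s).ennreal_toReal.aestronglyMeasurable
      (hdB.mono fun t ht => by
        rw [Real.norm_of_nonneg ENNReal.toReal_nonneg]
        exact ENNReal.toReal_mono hB ht)
    refine this.congr (Eventually.of_forall fun τ => ?_)
    simp only [ENNReal.toReal_mul]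
  have key := add_integral_le_mul_exp (A := D.toReal) (y := fun t => (besovSum φ s (d t)).toReal)
    hb hℓ (fun _ => ENNReal.toReal_nonneg) (by simpa only [ENNReal.toReal_mul] using hℓy) (by
      filter_upwards [hle, ae_restrict_mem measurableSet_Ioc] with t ht htb
      have e := ofReal_intervalIntegral_toReal ⟨htb.1.le, htb.2⟩ hℓy hXtop
      rw [← e] at ht
      have h1 := ENNReal.toReal_mono (ENNReal.add_ne_top.2 ⟨hD, ENNReal.ofReal_ne_top⟩) ht
      rw [ENNReal.toReal_add hD ENNReal.ofReal_ne_top, ENNReal.toReal_ofReal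
        (intervalIntegral.integral_nonneg htb.1.le fun _ _ => ENNReal.toReal_nonneg)] at h1
      simpa only [ENNReal.toReal_mul] using h1)
  have e2 : ∫ τ in 0..b, (K * lip φ (u τ)).toReal =
      K.toReal * (∫⁻ τ in Set.Ioc 0 b, lip φ (u τ)).toReal := by
    rw [intervalIntegral.integral_of_le hb, integral_toReal (h.aemeasurable_lip.const_mul K)
      (h.velocity.mono fun τ hu => (ENNReal.mul_ne_top hK hu.lip_ne_top).lt_top),
      lintegral_const_mul'' _ h.aemeasurable_lip, ENNReal.toReal_mul]
  have h2 := ENNReal.ofReal_le_ofReal key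
  simp only [← ENNReal.toReal_mul] at h2
  rw [ENNReal.ofReal_add ENNReal.toReal_nonneg (intervalIntegral.integral_nonneg hb
    fun _ _ => ENNReal.toReal_nonneg), ENNReal.ofReal_toReal hD,
    ofReal_intervalIntegral_toReal ⟨hb, le_rfl⟩ hℓy hXtop, ENNReal.ofReal_mul ENNReal.toReal_nonneg,
    ENNReal.ofReal_toReal hD, e2] at h2
  exact h2

end IsTransportSolution

end Summation

/-! ### The a priori estimate -/

section Estimate

variable {N : ℕ} {φ : 𝓢(Space N, ℝ)}

namespace IsTransportSolution

variable {s θ b : ℝ} {u d M g : ℝ → 𝓢'(Space N, Vec N)} {d₀ : 𝓢'(Space N, Vec N)}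

/-- A bound of `∫₀ᵗ ‖Δ_k d‖` for almost every `t` passes to the end point `t = b`. -/
theorem mul_lintegral_eLpNorm_blk_le (h : IsTransportSolution φ s θ b u d M g d₀)
    (hφ : IsDyadicPartition φ) (hb : 0 < b) {κ R : ℝ≥0∞} (hκ : κ ≠ ∞) (k : ℤ)
    (hle : ∀ᵐ t ∂volume.restrict (Set.Ioc 0 b),
      κ * ∫⁻ τ in Set.Ioc 0 t, eLpNorm (blk φ k (d τ)) 2 ≤ R) :
    κ * ∫⁻ τ in Set.Ioc 0 b, eLpNorm (blk φ k (d τ)) 2 ≤ R := by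
  have hd : ∀ᵐ τ ∂volume.restrict (Set.Ioc 0 b), eLpNorm (blk φ k (d τ)) 2 ≠ ∞ :=
    (h.finiteBlocks hφ).mono fun τ hτ => (hτ.isBlock hφ k).memLp.2.ne
  have hi := h.integrableOn_eLpNorm_blk k
  have hc : ContinuousOn (fun t => ∫ τ in 0..t, (eLpNorm (blk φ k (d τ)) 2).toReal)
      (Set.uIcc 0 b) := (absolutelyContinuousOnInterval_integral
        ((intervalIntegrable_iff_integrableOn_Ioc_of_le hb.le).2 hi)).continuousOn
  rw [Set.uIcc_of_le hb.le] at hc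
  have h1 : Tendsto (fun t => ∫ τ in 0..t, (eLpNorm (blk φ k (d τ)) 2).toReal) (𝓝[<] b)
      (𝓝 (∫ τ in 0..b, (eLpNorm (blk φ k (d τ)) 2).toReal)) :=
    ((hc b (Set.right_mem_Icc.2 hb.le)).mono_left
      (nhdsWithin_le_of_mem (mem_of_superset (Ioo_mem_nhdsLT hb) Set.Ioo_subset_Icc_self)))
  have h2 := ENNReal.Tendsto.const_mul (a := κ) (ENNReal.tendsto_ofReal h1) (Or.inr hκ)
  rw [ofReal_intervalIntegral_toReal ⟨hb.le, le_rfl⟩ hi hd] at h2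
  refine le_of_tendsto_of_frequently h2 (frequently_of_ae_restrict_Ioc hb ?_)
  filter_upwards [hle, ae_restrict_mem measurableSet_Ioc] with t ht htb
  rwa [ofReal_intervalIntegral_toReal ⟨htb.1.le, htb.2⟩ hi hd]

end IsTransportSolution

/-- The a priori estimate on `(0, b]`, in terms of the smooth representatives of the blocks. -/
theorem exists_besovSum_bound (hφ : IsDyadicPartition φ) {s : ℝ} (hs : -(N : ℝ) / 2 < s)
    (hs' : s < 1 + (N : ℝ) / 2) : ∃ C : ℝ, 0 < C ∧ ∀ (θ b : ℝ) (u d M g : ℝ → 𝓢'(Space N, Vec N))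
      (d₀ : 𝓢'(Space N, Vec N)), 0 < θ → 0 < b → besovSum φ s d₀ ≠ ∞ →
      IsTransportSolution φ s θ b u d M g d₀ →
      ∑' k : ℤ, pw (k * s) *
            essSup (fun τ => eLpNorm (blk φ k (d τ)) 2) (volume.restrict (Set.Ioc 0 b)) +
          ENNReal.ofReal θ * ∫⁻ τ in Set.Ioc 0 b, besovSum φ (s + 2) (d τ) ≤
        ENNReal.ofReal (C * Real.exp (C * (∫⁻ τ in Set.Ioc 0 b, lip φ (u τ)).toReal)) *
          (besovSum φ s d₀ + ∫⁻ τ in Set.Ioc 0 b, besovSum φ s (M τ)) := by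
  obtain ⟨c, hc0, hc⟩ := exists_coercive hφ
  obtain ⟨C, hC, hcomm⟩ := exists_advComm_bound hφ hs hs'
  -- `K` is the Grönwall rate: the commutators contribute `C`, the transport of the blocks the rest
  set K : ℝ≥0∞ := C + 2 * N * gradConst φ with hKdef
  have hK : K ≠ ∞ := ENNReal.add_ne_top.2 ⟨hC, ENNReal.mul_ne_top
    (ENNReal.mul_ne_top ENNReal.ofNat_ne_top (ENNReal.natCast_ne_top N)) gradConst_ne_top⟩
  have hK0 : 0 ≤ K.toReal := ENNReal.toReal_nonneg
  -- `1` comes from the supremum in time, `c⁻¹` from the diffusion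
  refine ⟨1 + c⁻¹ + K.toReal, by positivity, fun θ b u d M g d₀ hθ hb hd₀ h => ?_⟩
  have hadv := h.ae_tsum_advComm_le hφ hcomm
  have hblk := h.ae_eLpNorm_blk_add_lintegral_le hφ hθ hc0 hc hC hadv
  set D : ℝ≥0∞ := besovSum φ s d₀ + ∫⁻ τ in Set.Ioc 0 b, besovSum φ s (M τ) with hDdef
  set ℓ : ℝ≥0∞ := ∫⁻ τ in Set.Ioc 0 b, lip φ (u τ) with hℓ
  have hD : D ≠ ∞ := ENNReal.add_ne_top.2 ⟨hd₀, h.source_norm⟩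
  -- the bound of the `k`-th block that does not depend on the time
  set R : ℤ → ℝ≥0∞ := fun k => eLpNorm (blk φ k d₀) 2 +
    ∫⁻ τ in Set.Ioc 0 b, blkSource φ (u τ) (d τ) (M τ) (g τ) k with hRdef
  have hYle : ∀ᵐ t ∂volume.restrict (Set.Ioc 0 b), besovSum φ s (d t) ≤
      D + ∫⁻ τ in Set.Ioc 0 t, K * lip φ (u τ) * besovSum φ s (d τ) := by
    filter_upwards [ae_all_iff.2 hblk, ae_restrict_mem measurableSet_Ioc] with t ht htb
    refine le_trans (ENNReal.tsum_le_tsum fun k => ?_) (h.tsum_lintegral_blkSource_le hφ hadv htb.2)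
    exact mul_le_mul' le_rfl (le_self_add.trans (ht k))
  have hR : ∑' k : ℤ, pw (k * s) * R k ≤ D * ENNReal.ofReal (Real.exp (K.toReal * ℓ.toReal)) :=
    (h.tsum_lintegral_blkSource_le hφ hadv le_rfl).trans (h.add_lintegral_le hb.le hK hD hYle)
  have hRle : ∀ k, ∀ᵐ t ∂volume.restrict (Set.Ioc 0 b),
      eLpNorm (blk φ k (d t)) 2 + ENNReal.ofReal (θ * (c * ((2 : ℝ) ^ k) ^ 2)) *
          ∫⁻ τ in Set.Ioc 0 t, eLpNorm (blk φ k (d τ)) 2 ≤ R k := by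
    intro k
    filter_upwards [hblk k, ae_restrict_mem measurableSet_Ioc] with t ht htb
    exact ht.trans (add_le_add le_rfl (lintegral_mono_set (Set.Ioc_subset_Ioc_right htb.2)))
  have hsup : ∑' k : ℤ, pw (k * s) *
      essSup (fun τ => eLpNorm (blk φ k (d τ)) 2) (volume.restrict (Set.Ioc 0 b)) ≤
      ∑' k : ℤ, pw (k * s) * R k :=
    ENNReal.tsum_le_tsum fun k => mul_le_mul' le_rfl
      (essSup_le_of_ae_le _ ((hRle k).mono fun t ht => le_self_add.trans ht))
  have hdiff : ENNReal.ofReal θ * ∫⁻ τ in Set.Ioc 0 b, besovSum φ (s + 2) (d τ) ≤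
      ENNReal.ofReal c⁻¹ * ∑' k : ℤ, pw (k * s) * R k := by
    have e1 : ∫⁻ τ in Set.Ioc 0 b, besovSum φ (s + 2) (d τ) =
        ∑' k : ℤ, pw (k * (s + 2)) * ∫⁻ τ in Set.Ioc 0 b, eLpNorm (blk φ k (d τ)) 2 := by
      simp only [besovSum]
      rw [lintegral_tsum fun k => (aemeasurable_eLpNorm_blk h.measurable k).const_mul _]
      exact tsum_congr fun k =>
        lintegral_const_mul'' _ (aemeasurable_eLpNorm_blk h.measurable k)
    rw [e1, ← ENNReal.tsum_mul_left, ← ENNReal.tsum_mul_left]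
    refine ENNReal.tsum_le_tsum fun k => ?_
    have h1 := h.mul_lintegral_eLpNorm_blk_le hφ hb
      (κ := ENNReal.ofReal (θ * (c * ((2 : ℝ) ^ k) ^ 2))) ENNReal.ofReal_ne_top k
      ((hRle k).mono fun t ht => le_add_self.trans ht)
    have h2 : ENNReal.ofReal θ * pw (k * (s + 2)) =
        ENNReal.ofReal c⁻¹ * (pw (k * s) * ENNReal.ofReal (θ * (c * ((2 : ℝ) ^ k) ^ 2))) := by
      have h3 : (2 : ℝ) ^ ((k : ℝ) * (s + 2)) = (2 : ℝ) ^ ((k : ℝ) * s) * ((2 : ℝ) ^ k) ^ 2 := by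
        rw [mul_add, Real.rpow_add two_pos, Real.rpow_mul two_pos.le _ 2, Real.rpow_two,
          Real.rpow_intCast]
      rw [pw, pw, ← ENNReal.ofReal_mul hθ.le, ← ENNReal.ofReal_mul (by positivity),
        ← ENNReal.ofReal_mul (by positivity), h3]
      congr 1
      field_simp
    rw [← mul_assoc, h2, mul_assoc, mul_assoc]
    exact mul_le_mul' le_rfl (mul_le_mul' le_rfl h1)
  refine (add_le_add hsup hdiff).trans ?_
  have e : ∑' k : ℤ, pw (k * s) * R k + ENNReal.ofReal c⁻¹ * ∑' k : ℤ, pw (k * s) * R k =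
      ENNReal.ofReal (1 + c⁻¹) * ∑' k : ℤ, pw (k * s) * R k := by
    rw [ENNReal.ofReal_add zero_le_one (by positivity), ENNReal.ofReal_one, add_mul, one_mul]
  rw [e]
  refine (mul_le_mul' le_rfl hR).trans ?_
  rw [mul_comm D, ← mul_assoc, ← ENNReal.ofReal_mul (by positivity)]
  refine mul_le_mul' (ENNReal.ofReal_le_ofReal ?_) le_rfl
  have hc1 : 0 < c⁻¹ := inv_pos.2 hc0
  have hℓ0 : 0 ≤ ℓ.toReal := ENNReal.toReal_nonneg
  exact mul_le_mul (by linarith) (Real.exp_le_exp.2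
    (mul_le_mul_of_nonneg_right (by linarith) hℓ0)) (Real.exp_pos _).le (by positivity)

/-! ### Norms and representatives of the blocks -/

theorem eLpNorm_one_count (f : ℤ → ℝ≥0∞) : eLpNorm f 1 Measure.count = ∑' k, f k := by
  rw [eLpNorm_one_eq_lintegral_enorm, lintegral_count]
  simp

theorem besovNorm_eq_besovSum (hφ : IsDyadicPartition φ) (s : ℝ) (f : 𝓢'(Space N, Vec N)) :
    besovNorm φ s 2 1 f = besovSum φ s f := by
  rw [besovNorm, eLpNorm_one_count]
  exact tsum_congr fun k => by rw [distLpNorm_dyadicBlock hφ, pw]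

theorem timeInterval_ofReal (b : ℝ) : timeInterval (ENNReal.ofReal b) = Set.Ioo 0 b := by
  ext τ
  rw [timeInterval, Set.mem_ofPred_eq, Set.mem_Ioo]
  exact and_congr_right fun h => ENNReal.ofReal_lt_ofReal_iff_of_nonneg h.le

theorem restrict_timeInterval_ofReal (b : ℝ) :
    (volume : Measure ℝ).restrict (timeInterval (ENNReal.ofReal b)) =
      volume.restrict (Set.Ioc 0 b) := by
  rw [timeInterval_ofReal]
  exact Measure.restrict_congr_set Ioo_ae_eq_Ioc

theorem timeInterval_mono {T T' : ℝ≥0∞} (h : T ≤ T') : timeInterval T ⊆ timeInterval T' :=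
  fun _ hτ => ⟨hτ.1, hτ.2.trans_le h⟩

theorem timeBesovNorm_one (hφ : IsDyadicPartition φ) (T : ℝ≥0∞) (s : ℝ)
    (f : ℝ → 𝓢'(Space N, Vec N)) : timeBesovNorm φ T 1 s 2 1 f =
      ∫⁻ τ in timeInterval T, besovSum φ s (f τ) := by
  rw [timeBesovNorm, eLpNorm_one_eq_lintegral_enorm]
  simp only [besovNorm_eq_besovSum hφ, enorm_eq_self]

theorem cheminLernerNorm_top (hφ : IsDyadicPartition φ) (T : ℝ≥0∞) (s : ℝ)
    (f : ℝ → 𝓢'(Space N, Vec N)) : cheminLernerNorm φ T ∞ s 2 1 f =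
      ∑' k : ℤ, pw (k * s) *
        essSup (fun τ => eLpNorm (blk φ k (f τ)) 2) (volume.restrict (timeInterval T)) := by
  rw [cheminLernerNorm, eLpNorm_one_count]
  refine tsum_congr fun k => ?_
  rw [eLpNorm_exponent_top, eLpNormEssSup]
  simp only [distLpNorm_dyadicBlock hφ, enorm_eq_self, pw]

theorem ae_besovSum_le_timeBesovNorm_top (hφ : IsDyadicPartition φ) (T : ℝ≥0∞) (s : ℝ)
    (f : ℝ → 𝓢'(Space N, Vec N)) : ∀ᵐ τ ∂volume.restrict (timeInterval T),
      besovSum φ s (f τ) ≤ timeBesovNorm φ T ∞ s 2 1 f := by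
  rw [timeBesovNorm, eLpNorm_exponent_top, eLpNormEssSup]
  simp only [besovNorm_eq_besovSum hφ, enorm_eq_self]
  exact ENNReal.ae_le_essSup _

/-- A solution on `[0, T)` restricts to the intervals `(0, b]`, `b < T`. -/
theorem IsSolution.exists_isTransportSolution (hφ : IsDyadicPartition φ) {s θ : ℝ} {T : ℝ≥0∞}
    {u d M : ℝ → 𝓢'(Space N, Vec N)} {d₀ : 𝓢'(Space N, Vec N)}
    (hu : ∀ᵐ τ ∂(volume.restrict (timeInterval T)), IsReal (u τ) ∧ HasNormalizedGradient φ (u τ))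
    (hui : WeaklyLocallyIntegrable T u) (hun : timeBesovNorm φ T 1 ((N : ℝ) / 2 + 1) 2 1 u < ∞)
    (hM : WeaklyMeasurable T M) (hMn : timeBesovNorm φ T 1 s 2 1 M < ∞)
    (hd : WeaklyMeasurable T d)
    (hdn : ∀ᵐ τ ∂(volume.restrict (timeInterval T)), HasNormalizedGradient φ (d τ))
    (hdb : ∀ t : ℝ≥0∞, t < T → timeBesovNorm φ t ∞ s 2 1 d < ∞)
    (hsol : IsSolution θ T u d M d₀) (hd₀ : besovSum φ s d₀ ≠ ∞) {b : ℝ}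
    (hb : ENNReal.ofReal b < T) : ∃ g, IsTransportSolution φ s θ b u d M g d₀ := by
  obtain ⟨g, hg, heq⟩ := hsol
  have hle : (volume : Measure ℝ).restrict (Set.Ioc 0 b) ≤ volume.restrict (timeInterval T) := by
    rw [← restrict_timeInterval_ofReal]
    exact Measure.restrict_mono (timeInterval_mono hb.le) le_rfl
  have hae : ∀ {p : ℝ → Prop}, (∀ᵐ τ ∂volume.restrict (timeInterval T), p τ) →
      ∀ᵐ τ ∂volume.restrict (Set.Ioc 0 b), p τ := fun h => h.filter_mono (ae_mono hle)
  have hon : ∀ {F : ℝ → Vec N}, IntegrableOn F (timeInterval (ENNReal.ofReal b)) →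
      IntegrableOn F (Set.Ioc 0 b) := fun h => by
    rwa [IntegrableOn, restrict_timeInterval_ofReal] at h
  have hlip : ∫⁻ τ in Set.Ioc 0 b, lip φ (u τ) ≠ ∞ := by
    rw [timeBesovNorm_one hφ, add_comm] at hun
    exact ((lintegral_mono' hle le_rfl).trans_lt hun).ne
  have hum : ∀ η, IntegrableOn (fun τ => u τ η) (Set.Ioc 0 b) := fun η => hon (hui η _ hb)
  have hlipt : ∀ᵐ τ ∂volume.restrict (Set.Ioc 0 b), lip φ (u τ) < ∞ :=
    ae_lt_top' (aemeasurable_besovSum (fun η => (hum η).1) (1 + N / 2)) hlip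
  refine ⟨g, ?_, hum, hlip, fun η => (hM η).mono_measure hle, ?_, fun η => (hd η).mono_measure hle,
    hae hdn, ⟨_, (hdb _ hb).ne, ?_⟩, finiteBlocks_of_besovSum_ne_top hφ hd₀, hae hg,
    fun η hη => hon ((heq η hη).1 _ hb).1, fun η hη => hon ((heq η hη).1 _ hb).2.1,
    fun η hη => hon ((heq η hη).1 _ hb).2.2, fun η hη => hae (heq η hη).2⟩
  · filter_upwards [hae hu, hlipt] with τ h1 h2
    exact ⟨h1.1, h1.2, finiteBlocks_of_besovSum_ne_top hφ (s := 1 + N / 2) h2.ne, h2.ne⟩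
  · rw [timeBesovNorm_one hφ] at hMn
    exact ((lintegral_mono' hle le_rfl).trans_lt hMn).ne
  · rw [← restrict_timeInterval_ofReal]
    exact ae_besovSum_le_timeBesovNorm_top hφ _ s d

end Estimate

end LiquidCrystal

end

theorem proposition3p2 (N : ℕ) (hN : 2 ≤ N) (s : ℝ) (hs : -(N : ℝ) / 2 < s)
    (hs' : s < 1 + (N : ℝ) / 2)
    (φ : 𝓢(LiquidCrystal.Space N, ℝ)) (hφ : LiquidCrystal.IsDyadicPartition φ) :
    ∃ C : ℝ, 0 < C ∧
      ∀ (θ : ℝ) (T : ℝ≥0∞)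
        (u d M : ℝ → 𝓢'(LiquidCrystal.Space N, LiquidCrystal.Vec N))
        (d₀ : 𝓢'(LiquidCrystal.Space N, LiquidCrystal.Vec N)),
        0 < θ →
        -- the velocity: a real field in `L¹_T(Ḃ^{N/2+1}_{2,1})`
        (∀ᵐ τ ∂(volume.restrict (LiquidCrystal.timeInterval T)),
          LiquidCrystal.IsReal (u τ) ∧ LiquidCrystal.HasNormalizedGradient φ (u τ)) →
        LiquidCrystal.WeaklyLocallyIntegrable T u →
        LiquidCrystal.timeBesovNorm φ T 1 ((N : ℝ) / 2 + 1) 2 1 u < ∞ →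
        -- the source: `M ∈ L¹_T(Ḃ^s_{2,1})`
        LiquidCrystal.WeaklyMeasurable T M →
        LiquidCrystal.timeBesovNorm φ T 1 s 2 1 M < ∞ →
        -- the solution, in the class `L^∞_loc([0,T); Ḃ^s_{2,1})`
        LiquidCrystal.WeaklyMeasurable T d →
        (∀ᵐ τ ∂(volume.restrict (LiquidCrystal.timeInterval T)),
          LiquidCrystal.HasNormalizedGradient φ (d τ)) →
        (∀ t : ℝ≥0∞, t < T → LiquidCrystal.timeBesovNorm φ t ∞ s 2 1 d < ∞) →
        LiquidCrystal.IsSolution θ T u d M d₀ →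
        -- the estimate on `[0,T)`
        ∀ t : ℝ≥0∞, t < T →
          LiquidCrystal.cheminLernerNorm φ t ∞ s 2 1 d
              + ENNReal.ofReal θ * LiquidCrystal.timeBesovNorm φ t 1 (s + 2) 2 1 d
            ≤ ENNReal.ofReal (C * Real.exp (C *
                  (LiquidCrystal.timeBesovNorm φ t 1 ((N : ℝ) / 2 + 1) 2 1 u).toReal))
                * (LiquidCrystal.besovNorm φ s 2 1 d₀
                    + LiquidCrystal.timeBesovNorm φ t 1 s 2 1 M) := by
  obtain ⟨C, hC, hest⟩ := LiquidCrystal.exists_besovSum_bound hφ hs hs'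
  refine ⟨C, hC, fun θ T u d M d₀ hθ hu hui hun hM hMn hd hdn hdb hsol t ht => ?_⟩
  rw [LiquidCrystal.cheminLernerNorm_top hφ, LiquidCrystal.timeBesovNorm_one hφ,
    LiquidCrystal.timeBesovNorm_one hφ, LiquidCrystal.timeBesovNorm_one hφ,
    LiquidCrystal.besovNorm_eq_besovSum hφ, add_comm ((N : ℝ) / 2) 1]
  -- the estimate is trivial for initial data of infinite norm
  by_cases hd₀ : LiquidCrystal.besovSum φ s d₀ = ∞
  · have hpos : ENNReal.ofReal (C * Real.exp (C * (∫⁻ τ in LiquidCrystal.timeInterval t,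
        LiquidCrystal.besovSum φ (1 + (N : ℝ) / 2) (u τ)).toReal)) ≠ 0 := by
      rw [Ne, ENNReal.ofReal_eq_zero, not_le]
      positivity
    rw [hd₀, top_add, ENNReal.mul_top hpos]
    exact le_top
  obtain ⟨b, hb, rfl⟩ : ∃ b : ℝ, 0 ≤ b ∧ ENNReal.ofReal b = t :=
    ⟨t.toReal, ENNReal.toReal_nonneg, ENNReal.ofReal_toReal ht.ne_top⟩
  rw [LiquidCrystal.restrict_timeInterval_ofReal]
  rcases hb.eq_or_lt with rfl | hb
  · simp
  · obtain ⟨g, hg⟩ := LiquidCrystal.IsSolution.exists_isTransportSolution hφ hu hui hun hM hMn hd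
      hdn hdb hsol hd₀ ht
    exact hest θ b u d M g d₀ hθ hb hd₀ hg
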